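/- All graphs are finite and simple. A \emph{Halin graph} is a graph $G=T\cup C$, where $T$ is a tree with at least four vertices and no vertex of degree two, embedded in the plane, and $C$ is the cycle that connects the leaves of $T$ in the cyclic order given by the embedding; $(T,C)$ is then called a \emph{decomposition} of $G$ into a tree and a cycle. \emph{Reductions.} (D3a) If degree-three vertices $u,v,w$ form a triangle and their neighbors $u',v',w'$ outside the triangle are distinct, replace the triangle by a single new vertex $x$ adjacent to $u',v',w'$. (D3b) If degree-three vertices $u,v,w$ induce a path with middle vertex $v$, and a vertex $x$ (the apex) is adjacent to all three, delete $v$ and add the edge $uw$. \emph{Algorithm.} Given $G$, keep a set $K$ of vertices, initially empty, and a collection $\mathcal C$ of vertices, initially all vertices of degree three. While $\mathcal C\neq\emptyset$, select and remove an arbitrary vertex $y$ from $\mathcal C$. \begin{itemize} \item If $y$ belongs to the triangle $uvw$ of a D3a reduction: the reduction is forbidden if $u,v,w\in K$. Otherwise perform it, add $x$ to $K$, add to $K$ the outside neighbor of each of $u,v,w$ that was in $K$, and add $x$ and its degree-three neighbors to $\mathcal C$. \item Otherwise, if $y=v$ is the middle vertex of the path $uvw$ of a D3b reduction with apex $x$: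 the reduction is forbidden if $x\in K$. Otherwise perform it and add $u,w$ to $K$; if the graph has become $K_4$, add its fourth vertex (other than $u,w,x$) to $K$ as well; if $x$ now has degree three, add it to $\mathcal C$. \item If no reduction is performed, just go on to the next vertex of $\mathcal C$. \end{itemize} When $\mathcal C=\emptyset$, accept if and only if the current graph is isomorphic to $K_4$ and has a vertex that is not in $K$. \emph{Reversal.} After an accepting run, choose any vertex $z\notin K$ of the final $K_4$, start with the set $L$ of its three other vertices, and undo the reductions in reverse order: undoing D3b, add $v$ to $L$; undoing D3a, replace $x$ in $L$ by those of $u,v,w$ whose outside neighbor is in $L$. Finally let $C$ consist of the edges of $G$ with both ends in $L$, and $T$ of all other edges. \textbf{Theorem.} Let $G$ be a graph with $n$ vertices and $m$ edges. \begin{enumerate} \item For every choice of the selected vertices, the loop of the algorithm never gets stuck and ends after $O(n)$ iterations, the algorithm accepts $G$ if and only if $G$ is a Halin graph, and, if it accepts, the reversal (for every choice of $z$) yields a decomposition $(T,C)$ of $G$ into a tree and a cycle. \item The algorithm can be carried out in linear time: there is a program for a random access machine (whose registers and arrays hold natural numbers and whose only arithmetic is adding or subtracting one) that, given $n$, $m$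 and a list of the edges of $G$, takes $O(n+m+1)$ steps, decides whether $G$ is a Halin graph, and outputs the sequence of vertices selected in a complete run of the algorithm on $G$ whose result is this decision. \item There is likewise a program that, given a Halin graph $G$, takes $O(n+m+1)$ steps, outputs the sequence of vertices selected in an accepting run, and marks each edge of $G$ as belonging to the tree or to the cycle of the decomposition obtained by reversing that run. \end{enumerate} -/

import Mathlib

/-! ## Halin graphs -/

namespace Halin

variable {V : Type*}

/-- A vertex with exactly one neighbour. -/
def IsLeaf (T : SimpleGraph V) (v : V) : Prop := (T.neighborSet v).ncard = 1

/-- `rot v u` is the neighbour of `v` that follows the neighbour `u` in the (clockwise) order around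
`v`: at every vertex, `rot v` permutes the neighbours of `v` in a single cycle.  For a tree, such a
rotation system is exactly a combinatorial embedding in the plane. -/
def IsRotation (T : SimpleGraph V) (rot : V → V → V) : Prop :=
  ∀ v a, T.Adj v a → T.Adj v (rot v a) ∧ ∀ b, T.Adj v b → ∃ k : ℕ, (rot v)^[k] a = b

/-- One step along the boundary walk of a face: after traversing the edge from `d.1` to `d.2`,
leave `d.2` by the edge that follows it in the rotation at `d.2`. -/
def faceStep (rot : V → V → V) (d : V × V) : V × V := (d.2, rot d.2 d.1)

/-- `b` is the first leaf met after the leaf `a` on the boundary walk of the embedded tree. -/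
def NextLeaf (T : SimpleGraph V) (rot : V → V → V) (a b : V) : Prop :=
  IsLeaf T a ∧ IsLeaf T b ∧ ∃ u, T.Adj a u ∧ ∃ k : ℕ, 0 < k ∧
    ((faceStep rot)^[k] (a, u)).1 = b ∧
    ∀ j : ℕ, 0 < j → j < k → ¬ IsLeaf T ((faceStep rot)^[j] (a, u)).1

/-- The cycle through the leaves, in the cyclic order given by the embedding. -/
def leafCycle (T : SimpleGraph V) (rot : V → V → V) : SimpleGraph V :=
  SimpleGraph.fromRel (NextLeaf T rot)

/-- `T` and `C` are a decomposition of `G` into a tree (with four or more vertices, none of degree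
two) and a cycle through the leaves of the tree in the cyclic order of a plane embedding of it. -/
def IsDecomposition (G T C : SimpleGraph V) : Prop :=
  T.IsTree ∧ 4 ≤ Nat.card V ∧ (∀ v, (T.neighborSet v).ncard ≠ 2) ∧
    ∃ rot, IsRotation T rot ∧ C = leafCycle T rot ∧ G = T ⊔ C

def IsHalin (G : SimpleGraph V) : Prop := ∃ T C, IsDecomposition G T C

/-! ## The D3 reductions -/

/-- The degree-three vertices `p`, `q`, `r` induce a triangle and their neighbours `p'`, `q'`, `r'`
outside the triangle are distinct. -/
structure IsD3a (G : SimpleGraph V) (p q r p' q' r' : V) : Prop where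
  degree_p : (G.neighborSet p).ncard = 3
  degree_q : (G.neighborSet q).ncard = 3
  degree_r : (G.neighborSet r).ncard = 3
  nbr_p : G.neighborSet p = {q, r, p'}
  nbr_q : G.neighborSet q = {p, r, q'}
  nbr_r : G.neighborSet r = {p, q, r'}
  ne_pq : p' ≠ q'
  ne_pr : p' ≠ r'
  ne_qr : q' ≠ r'

/-- The degree-three vertices `p`, `q`, `r` induce a path with middle vertex `q`, and the apex `s`
is adjacent to all three. -/
structure IsD3b (G : SimpleGraph V) (p q r s : V) : Prop where
  degree_p : (G.neighborSet p).ncard = 3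
  degree_q : (G.neighborSet q).ncard = 3
  degree_r : (G.neighborSet r).ncard = 3
  ne_pr : p ≠ r
  adj_pq : G.Adj p q
  adj_qr : G.Adj q r
  not_adj_pr : ¬ G.Adj p r
  adj_sp : G.Adj s p
  adj_sq : G.Adj s q
  adj_sr : G.Adj s r

/-- Remove all edges that meet `S`. -/
def isolate (G : SimpleGraph V) (S : Set V) : SimpleGraph V where
  Adj a b := G.Adj a b ∧ a ∉ S ∧ b ∉ S
  symm := ⟨fun _ _ h => ⟨h.1.symm, h.2.2, h.2.1⟩⟩
  loopless := ⟨fun _ h => h.1.ne rfl⟩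

/-! ## The recognition algorithm

The current graph lives on the set `alive` of vertices.  The vertex that replaces a collapsed
triangle gets the name of that vertex of the triangle that was selected from the collection `C`. -/

structure State (V : Type*) where
  graph : SimpleGraph V
  alive : Set V
  /-- the known outer vertices (and possibly some former vertices) -/
  K : Set V
  /-- the vertices (and possibly former vertices) still to be examined -/
  C : Set V

def State.init (G : SimpleGraph V) : State V where
  graph := G
  alive := Set.univ
  K := ∅
  C := {v | (G.neighborSet v).ncard = 3}

/-- The current graph is isomorphic to the complete graph on four vertices. -/
def State.IsK4 (s : State V) : Prop :=
  Nonempty (s.graph.induce s.alive ≃g (⊤ : SimpleGraph (Fin 4)))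

/-- What one iteration of the loop does with the selected vertex. -/
inductive Move (V : Type*) where
  /-- D3a: collapse the triangle `p q r` with outside neighbours `p' q' r'`; `p` is selected -/
  | collapse (p q r p' q' r' : V)
  /-- D3b: shorten the path `p q r` with apex `x`; the middle vertex `q` is selected -/
  | shorten (p q r x : V)
  /-- no allowed reduction at the selected vertex `v` -/
  | discard (v : V)

/-- The vertex selected from `C`. -/
def Move.vertex : Move V → V
  | .collapse p _ _ _ _ _ => p
  | .shorten _ q _ _ => q
  | .discard v => v

/-- The move can be made in state `s`: the vertex is in `C`, and the reduction applies and is not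
forbidden; a vertex is discarded only if no reduction at it applies without being forbidden.  (A
D3a reduction at `v` and a D3b reduction with middle vertex `v` never apply both, so the order in
which they are tried is immaterial.) -/
def Move.Allowed (s : State V) : Move V → Prop
  | .collapse p q r p' q' r' =>
      p ∈ s.C ∧ IsD3a s.graph p q r p' q' r' ∧ ¬ (p ∈ s.K ∧ q ∈ s.K ∧ r ∈ s.K)
  | .shorten p q r x => q ∈ s.C ∧ IsD3b s.graph p q r x ∧ x ∉ s.K
  | .discard v => v ∈ s.C ∧
      (∀ q r v' q' r', IsD3a s.graph v q r v' q' r' → v ∈ s.K ∧ q ∈ s.K ∧ r ∈ s.K) ∧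
      (∀ p r x, IsD3b s.graph p v r x → x ∈ s.K)

/-- The graph after the move and its vertex set. -/
def Move.reduce (s : State V) : Move V → SimpleGraph V × Set V
  | .collapse p q r p' q' r' =>
      (isolate s.graph {p, q, r} ⊔ SimpleGraph.edge p p' ⊔ SimpleGraph.edge p q' ⊔
        SimpleGraph.edge p r', s.alive \ {q, r})
  | .shorten p q r _ => (isolate s.graph {q} ⊔ SimpleGraph.edge p r, s.alive \ {q})
  | .discard _ => (s.graph, s.alive)

/-- The vertices that the move adds to `K`.  After D3a: the new vertex, and the outside neighbour of
each triangle vertex that was in `K`.  After D3b: the ends of the path, and, if the reduced graph is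
`K₄`, its fourth vertex besides them and the apex. -/
def Move.addK (s : State V) (m : Move V) : Set V :=
  match m with
  | .collapse p q r p' q' r' =>
      {a | a = p ∨ (a = p' ∧ p ∈ s.K) ∨ (a = q' ∧ q ∈ s.K) ∨ (a = r' ∧ r ∈ s.K)}
  | .shorten p _ r x =>
      {a | a = p ∨ a = r ∨ (a ∈ (m.reduce s).2 ∧ a ≠ x ∧
        State.IsK4 { s with graph := (m.reduce s).1, alive := (m.reduce s).2 })}
  | .discard _ => ∅

/-- The vertices that the move adds to `C`.  After D3a: the new vertex and its degree-three
neighbours.  After D3b: the apex, if its degree has become three. -/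
def Move.addC (s : State V) (m : Move V) : Set V :=
  match m with
  | .collapse p _ _ _ _ _ =>
      {a | a = p ∨ ((m.reduce s).1.Adj p a ∧ ((m.reduce s).1.neighborSet a).ncard = 3)}
  | .shorten _ _ _ x => {a | a = x ∧ ((m.reduce s).1.neighborSet x).ncard = 3}
  | .discard _ => ∅

/-- The state after the move. -/
def State.next (s : State V) (m : Move V) : State V where
  graph := (m.reduce s).1
  alive := (m.reduce s).2
  K := s.K ∪ m.addK s
  C := (s.C \ {m.vertex}) ∪ m.addC s

/-- `ms` is a sequence of iterations of the loop that leads from the first state to the second,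
for arbitrary choices of the selected vertices. -/
inductive Run : State V → List (Move V) → State V → Prop
  | nil (s : State V) : Run s [] s
  | cons {s : State V} {m : Move V} {ms : List (Move V)} {s' : State V} :
      m.Allowed s → Run (s.next m) ms s' → Run s (m :: ms) s'

/-- A run of the algorithm on `G` to the end of the loop. -/
def CompleteRun (G : SimpleGraph V) (ms : List (Move V)) (s : State V) : Prop :=
  Run (State.init G) ms s ∧ s.C = ∅

/-- The final test: the graph is `K₄`, and some vertex of it is not in `K`. -/
def State.Accepts (s : State V) : Prop := s.IsK4 ∧ ∃ v ∈ s.alive, v ∉ s.K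

/-! ## The decomposition, by reversing the reductions -/

/-- Update of the set of outer vertices when a move is undone.  Undoing D3a, the outer vertex `p` is
replaced by those vertices of the triangle whose outside neighbour is an outer vertex; undoing D3b,
the middle vertex of the path becomes an outer vertex. -/
def Move.undo : Move V → Set V → Set V
  | .collapse p q r p' q' r', L =>
      (L \ {p}) ∪ {a | (a = p ∧ p' ∈ L) ∨ (a = q ∧ q' ∈ L) ∨ (a = r ∧ r' ∈ L)}
  | .shorten _ q _ _, L => insert q L
  | .discard _, L => L

/-- The outer vertices found by undoing the run `ms` that ended in `s`, from the decomposition of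
the final `K₄` whose only inner vertex is `z`. -/
def outerVertices (ms : List (Move V)) (s : State V) (z : V) : Set V :=
  ms.foldr Move.undo (s.alive \ {z})

/-- The edges of `G` between two outer vertices. -/
def cyclePart (G : SimpleGraph V) (L : Set V) : SimpleGraph V where
  Adj a b := G.Adj a b ∧ a ∈ L ∧ b ∈ L
  symm := ⟨fun _ _ h => ⟨h.1.symm, h.2.2, h.2.1⟩⟩
  loopless := ⟨fun _ h => h.1.ne rfl⟩

/-- The other edges of `G`. -/
def treePart (G : SimpleGraph V) (L : Set V) : SimpleGraph V := G \ cyclePart G L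

end Halin

/-! ## A random access machine

Registers and arrays of natural numbers; the only arithmetic is adding or subtracting one, so that
within `t` steps no number grows by more than `t`. -/

namespace RAM

structure Store where
  reg : ℕ → ℕ
  arr : ℕ → ℕ → ℕ

inductive Expr where
  | const (k : ℕ)
  | reg (r : ℕ)
  | read (a : ℕ) (i : Expr)
  | succ (e : Expr)
  | pred (e : Expr)

def Expr.eval (σ : Store) : Expr → ℕ
  | .const k => k
  | .reg r => σ.reg r
  | .read a i => σ.arr a (i.eval σ)
  | .succ e => e.eval σ + 1
  | .pred e => e.eval σ - 1

def Expr.cost : Expr → ℕ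
  | .const _ => 1
  | .reg _ => 1
  | .read _ i => i.cost + 1
  | .succ e => e.cost + 1
  | .pred e => e.cost + 1

inductive Test where
  | eq (e f : Expr)
  | lt (e f : Expr)
  | and (b c : Test)
  | not (b : Test)

def Test.Holds (σ : Store) : Test → Prop
  | .eq e f => e.eval σ = f.eval σ
  | .lt e f => e.eval σ < f.eval σ
  | .and b c => b.Holds σ ∧ c.Holds σ
  | .not b => ¬ b.Holds σ

def Test.cost : Test → ℕ
  | .eq e f => e.cost + f.cost + 1
  | .lt e f => e.cost + f.cost + 1
  | .and b c => b.cost + c.cost + 1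
  | .not b => b.cost + 1

inductive Cmd where
  | skip
  | assign (r : ℕ) (e : Expr)
  | write (a : ℕ) (i e : Expr)
  | seq (c d : Cmd)
  | ite (b : Test) (c d : Cmd)
  | loop (b : Test) (c : Cmd)

def Store.setReg (σ : Store) (r x : ℕ) : Store :=
  { σ with reg := Function.update σ.reg r x }

def Store.setArr (σ : Store) (a i x : ℕ) : Store :=
  { σ with arr := Function.update σ.arr a (Function.update (σ.arr a) i x) }

/-- `Exec c σ τ t`: started in `σ`, the command `c` halts in `τ` after `t` steps. -/
inductive Exec : Cmd → Store → Store → ℕ → Prop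
  | skip (σ : Store) : Exec .skip σ σ 1
  | assign (σ : Store) (r : ℕ) (e : Expr) :
      Exec (.assign r e) σ (σ.setReg r (e.eval σ)) (e.cost + 1)
  | write (σ : Store) (a : ℕ) (i e : Expr) :
      Exec (.write a i e) σ (σ.setArr a (i.eval σ) (e.eval σ)) (i.cost + e.cost + 1)
  | seq {c d : Cmd} {σ τ υ : Store} {t u : ℕ} :
      Exec c σ τ t → Exec d τ υ u → Exec (.seq c d) σ υ (t + u)
  | ite_true {b : Test} {c d : Cmd} {σ τ : Store} {t : ℕ} :
      b.Holds σ → Exec c σ τ t → Exec (.ite b c d) σ τ (b.cost + t + 1)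
  | ite_false {b : Test} {c d : Cmd} {σ τ : Store} {t : ℕ} :
      ¬ b.Holds σ → Exec d σ τ t → Exec (.ite b c d) σ τ (b.cost + t + 1)
  | loop_true {b : Test} {c : Cmd} {σ τ υ : Store} {t u : ℕ} :
      b.Holds σ → Exec c σ τ t → Exec (.loop b c) τ υ u →
      Exec (.loop b c) σ υ (b.cost + t + u + 1)
  | loop_false {b : Test} {c : Cmd} {σ : Store} :
      ¬ b.Holds σ → Exec (.loop b c) σ σ (b.cost + 1)

/-- The list consists of the edges of `G`, each once, in any order and orientation. -/
def IsEdgeList {n : ℕ} (G : SimpleGraph (Fin n)) (es : List (Fin n × Fin n)) : Prop :=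
  (es.map fun e => s(e.1, e.2)).Nodup ∧
    ∀ u v, G.Adj u v ↔ s(u, v) ∈ es.map fun e => s(e.1, e.2)

/-- The numbers of vertices and edges are in registers `0` and `1`, the two ends of the `i`-th edge
at position `i` of the arrays `0` and `1`; everything else is zero. -/
def input {n : ℕ} (es : List (Fin n × Fin n)) : Store where
  reg r := if r = 0 then n else if r = 1 then es.length else 0
  arr a i := if a = 0 then (es.map fun e => (e.1 : ℕ)).getD i 0
    else if a = 1 then (es.map fun e => (e.2 : ℕ)).getD i 0 else 0

end RAM

/-! A plane tree is a rotation system, and the walk along its single face is followed dart by dart,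
a dart being an ordered pair of adjacent vertices. No topology is needed: in a finite forest a face
walk that enters a branch must leave it by the reversed dart (`PlaneTree.reverse_mem`). Hence all
darts lie on one face, and `NextLeaf` permutes the leaves in a single cycle
(`PlaneTree.mem_of_nextLeaf_closed`).

In a Halin graph every edge at an inner vertex is a tree edge and every edge between leaves is a
cycle edge. So a triangle has at most one inner vertex, and a triangle of three leaves is the whole
cycle, which forces `K₄`. It follows that a D3a triangle has exactly one inner vertex, and that the
path of D3b consists of leaves while its apex is inner. Both reductions and their reversals
therefore delete or insert leaves of the plane tree (`Attach`): `Dec.shorten` and `Dec.collapse` go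
forwards, `Dec.unshorten` and `Dec.expand` go backwards.

The set `K` carries the invariant `State.KLeaf`: current vertices in `K` are leaves. Soundness reads
the run backwards, from the star in the final `K₄` whose centre is a vertex outside `K`. After D3a
the new vertex is in `K`, hence a leaf, and can be expanded. After D3b the ends of the path are
leaves and the apex is inner: otherwise the graph is `K₄` and the fourth vertex, being in `K`, would
be a leaf too. The leaf sets obtained in this way are exactly those computed by `Move.undo`.
Completeness reads the run forwards. On a Halin graph each move preserves the decomposition and
`State.KLeaf`, so a forbidden reduction never occurs and discarding a vertex loses nothing. Thus
`State.Covered` persists: each applicable reduction can be found from a vertex of `C`. When `C` is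
empty no reduction applies, and by `Dec.exists_reduction` the graph is `K₄`, whose centre is not in
`K`. The number of iterations is linear because `State.potential` decreases.

For linear time the graph is kept in arrays of cells with pointers between the two cells of an edge.
A reduction changes boundedly many cells and is found by trying the boundedly many orders of reading
three cells at three vertices, so an iteration is loop-free code (`iteration_spec`). Counting
occurrences builds the arrays, and a record of the moves is replayed backwards to mark the edges. -/

namespace Halin

open Relation

variable {V : Type*}

/-! ### Leaves and rotations -/

theorem IsLeaf.eq {T : SimpleGraph V} {a u w : V} (h : IsLeaf T a) (hu : T.Adj a u)
    (hw : T.Adj a w) : u = w := by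
  obtain ⟨c, hc⟩ := Set.ncard_eq_one.1 h
  have h1 : u ∈ T.neighborSet a := hu
  have h2 : w ∈ T.neighborSet a := hw
  rw [hc] at h1 h2
  rw [Set.mem_singleton_iff.1 h1, Set.mem_singleton_iff.1 h2]

theorem isLeaf_of_forall {T : SimpleGraph V} {a u : V} (hu : T.Adj a u)
    (h : ∀ w, T.Adj a w → w = u) : IsLeaf T a := by
  refine Set.ncard_eq_one.2 ⟨u, ?_⟩
  ext w
  exact ⟨h w, fun hw => by rw [Set.mem_singleton_iff.1 hw]; exact hu⟩

theorem IsLeaf.exists_adj {T : SimpleGraph V} {a : V} (h : IsLeaf T a) : ∃ u, T.Adj a u := by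
  obtain ⟨c, hc⟩ := Set.ncard_eq_one.1 h
  exact ⟨c, by have : c ∈ T.neighborSet a := by simp [hc]
               exact this⟩

theorem exists_adj_ne {T : SimpleGraph V} {a u : V} (h : ¬ IsLeaf T a) (hu : T.Adj a u) :
    ∃ w, T.Adj a w ∧ w ≠ u := by
  by_contra! hc
  exact h (isLeaf_of_forall hu hc)

/-- The neighbours of `v` form one orbit of `rot v`, so a property that holds once and passes to
successors holds everywhere. Together with its converse `isRotation_of_induct` this avoids iterates
whenever a rotation is modified. -/
theorem IsRotation.induct {T : SimpleGraph V} {rot : V → V → V} (h : IsRotation T rot)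
    {v a b : V} (ha : T.Adj v a) (hb : T.Adj v b) (P : V → Prop) (h0 : P a)
    (hs : ∀ c, T.Adj v c → P c → P (rot v c)) : P b := by
  obtain ⟨k, rfl⟩ := (h v a ha).2 b hb
  have : ∀ k, T.Adj v ((rot v)^[k] a) ∧ P ((rot v)^[k] a) := by
    intro k
    induction k with
    | zero => exact ⟨ha, h0⟩
    | succ k ih =>
      rw [Function.iterate_succ_apply']
      exact ⟨(h v _ ih.1).1, hs _ ih.1 ih.2⟩
  exact (this k).2

theorem isRotation_of_induct {T : SimpleGraph V} {rot : V → V → V}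
    (h1 : ∀ v a, T.Adj v a → T.Adj v (rot v a))
    (h2 : ∀ v a b, T.Adj v a → T.Adj v b → ∀ P : V → Prop, P a →
      (∀ c, T.Adj v c → P c → P (rot v c)) → P b) : IsRotation T rot := by
  intro v a ha
  refine ⟨h1 v a ha, fun b hb => ?_⟩
  refine h2 v a b ha hb (fun c => ∃ k : ℕ, (rot v)^[k] a = c) ⟨0, rfl⟩ ?_
  rintro c - ⟨k, rfl⟩
  exact ⟨k + 1, Function.iterate_succ_apply' _ _ _⟩

theorem IsRotation.ne {T : SimpleGraph V} {rot : V → V → V} (h : IsRotation T rot)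
    {v a b : V} (ha : T.Adj v a) (hb : T.Adj v b) (hab : b ≠ a) : rot v a ≠ a := by
  intro hr
  exact hab (h.induct ha hb (fun c => c = a) rfl (by rintro c - rfl; exact hr))

/-- Each neighbour lies on the orbit that starts at its own successor, hence is a value of `rot v`.
A surjection of the finite neighbourhood onto itself is injective. -/
theorem IsRotation.inj [Finite V] {T : SimpleGraph V} {rot : V → V → V} (h : IsRotation T rot)
    {v a b : V} (ha : T.Adj v a) (hb : T.Adj v b) (hab : rot v a = rot v b) : a = b := by
  let f : T.neighborSet v → T.neighborSet v := fun c => ⟨rot v c, (h v c c.2).1⟩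
  have hs : Function.Surjective f := by
    rintro ⟨c, hc⟩
    have h1 := h.induct ((h v c hc).1) hc (fun d => ∃ e, T.Adj v e ∧ rot v e = d) ⟨c, hc, rfl⟩
      (fun d hd _ => ⟨d, hd, rfl⟩)
    obtain ⟨e, he, hr⟩ := h1
    exact ⟨⟨e, he⟩, Subtype.ext hr⟩
  have hi : Function.Injective f := Finite.injective_iff_surjective.2 hs
  have := @hi ⟨a, ha⟩ ⟨b, hb⟩ (Subtype.ext hab)
  exact congrArg Subtype.val this

/-! ### Branches of an acyclic graph -/

@[simp] theorem isolate_adj {G : SimpleGraph V} {S : Set V} {a b : V} :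
    (isolate G S).Adj a b ↔ G.Adj a b ∧ a ∉ S ∧ b ∉ S := Iff.rfl

/-- Every edge of a forest is a bridge. This is the form in which acyclicity is used below:
different neighbours of `x` lie in different branches at `x`. -/
theorem eq_of_reachable_isolate {T : SimpleGraph V} (hT : T.IsAcyclic) {x c d : V}
    (hc : T.Adj x c) (hd : T.Adj x d) (h : (isolate T {x}).Reachable c d) : c = d := by
  by_contra hne
  have hb := (SimpleGraph.isAcyclic_iff_forall_adj_isBridge.1 hT) hc
  rw [SimpleGraph.isBridge_iff] at hb
  refine hb ?_
  have hle : isolate T {x} ≤ T.deleteEdges {s(x, c)} := by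
    intro a b hab
    simp only [SimpleGraph.deleteEdges_adj, Set.mem_singleton_iff]
    refine ⟨hab.1, fun he => ?_⟩
    rcases Sym2.eq_iff.1 he with h | h
    · exact hab.2.1 h.1
    · exact hab.2.2 h.2
  have h1 := (h.mono hle).symm
  refine SimpleGraph.Reachable.trans (SimpleGraph.Adj.reachable ?_) h1
  simp only [SimpleGraph.deleteEdges_adj, Set.mem_singleton_iff]
  refine ⟨hd, fun he => ?_⟩
  rcases Sym2.eq_iff.1 he with h | h
  · exact hne h.2.symm
  · exact hc.ne h.1

theorem not_mem_of_reachable_isolate {T : SimpleGraph V} {S : Set V} {c b : V} (hc : c ∉ S)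
    (h : (isolate T S).Reachable c b) : b ∉ S := by
  rw [SimpleGraph.reachable_iff_reflTransGen] at h
  induction h with
  | refl => exact hc
  | tail _ h _ => exact h.2.2

/-- A walk from `d` that avoids `c` cannot reach `x`, because `x` and `d` are different neighbours
of `c`. So branches are nested along a path. -/
theorem reachable_isolate_trans {T : SimpleGraph V} (hT : T.IsAcyclic) {x c d b : V}
    (hx : T.Adj x c) (hd : T.Adj c d) (hdx : d ≠ x) (h : (isolate T {c}).Reachable d b) :
    (isolate T {x}).Reachable c b := by
  have hne : ∀ b, (isolate T {c}).Reachable d b → b ≠ x := by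
    rintro b hb rfl
    exact hdx (eq_of_reachable_isolate hT hd hx.symm hb)
  have h' := (SimpleGraph.reachable_iff_reflTransGen _ _).1 h
  clear h
  induction h' with
  | refl => exact SimpleGraph.Adj.reachable ⟨hd, by simp [hx.ne'], by simp [hdx]⟩
  | tail h1 h2 ih =>
    refine ih.trans (SimpleGraph.Adj.reachable ⟨h2.1, ?_, ?_⟩)
    · exact hne _ ((SimpleGraph.reachable_iff_reflTransGen _ _).2 h1)
    · exact hne _ ((SimpleGraph.reachable_iff_reflTransGen _ _).2 (h1.tail h2))

/-! ### Steps along a face -/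

/-- A step of the boundary walk that does not pass a leaf. -/
def Step (T : SimpleGraph V) (rot : V → V → V) (d e : V × V) : Prop :=
  ¬ IsLeaf T d.2 ∧ e = faceStep rot d

theorem step_rightUnique (T : SimpleGraph V) (rot : V → V → V) :
    Relator.RightUnique (Step T rot) := fun _ _ _ h h' => h.2.trans h'.2.symm

theorem adj_of_steps {T : SimpleGraph V} {rot : V → V → V} (hr : IsRotation T rot) {d e : V × V}
    (hd : T.Adj d.1 d.2) (h : ReflTransGen (Step T rot) d e) : T.Adj e.1 e.2 := by
  induction h with
  | refl => exact hd
  | tail _ h ih => rw [h.2]; exact (hr _ _ ih.symm).1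

/-- The definition inspects the tail of the current dart, `Step` inspects its head. Hence `k` face
steps become `k - 1` steps, which end at the dart that enters `b`. -/
theorem nextLeaf_iff {T : SimpleGraph V} {rot : V → V → V} {a b : V} :
    NextLeaf T rot a b ↔ IsLeaf T a ∧ IsLeaf T b ∧ ∃ u w, T.Adj a u ∧
      ReflTransGen (Step T rot) (a, u) (w, b) := by
  have key : ∀ k d, (∀ j : ℕ, 0 < j → j ≤ k → ¬ IsLeaf T ((faceStep rot)^[j] d).1) →
      ReflTransGen (Step T rot) d ((faceStep rot)^[k] d) := by
    intro k d
    induction k with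
    | zero => intro _; exact .refl
    | succ k ih =>
      intro h
      refine (ih fun j h0 h1 => h j h0 (by omega)).tail ⟨?_, Function.iterate_succ_apply' _ _ _⟩
      have := h (k + 1) (by omega) le_rfl
      rwa [Function.iterate_succ_apply'] at this
  have key2 : ∀ d e, ReflTransGen (Step T rot) d e → ∃ k : ℕ, (faceStep rot)^[k] d = e ∧
      ∀ j : ℕ, 0 < j → j ≤ k → ¬ IsLeaf T ((faceStep rot)^[j] d).1 := by
    intro d e h
    induction h with
    | refl => exact ⟨0, rfl, fun j h0 h1 => by omega⟩
    | @tail b c _ h ih =>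
      obtain ⟨k, hk, hl⟩ := ih
      refine ⟨k + 1, by rw [Function.iterate_succ_apply', hk, h.2], fun j h0 h1 => ?_⟩
      rcases Nat.lt_or_ge k j with hj | hj
      · obtain rfl : j = k + 1 := by omega
        rw [Function.iterate_succ_apply', hk]
        exact h.1
      · exact hl j h0 hj
  constructor
  · rintro ⟨ha, hb, u, hu, k, hk, hkb, hj⟩
    refine ⟨ha, hb, u, ((faceStep rot)^[k - 1] (a, u)).1, hu, ?_⟩
    obtain ⟨k, rfl⟩ : ∃ k', k = k' + 1 := ⟨k - 1, by omega⟩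
    have := key k (a, u) (fun j h0 h1 => hj j h0 (by omega))
    rw [Function.iterate_succ_apply'] at hkb
    convert this using 1
    exact Prod.ext rfl hkb.symm
  · rintro ⟨ha, hb, u, w, hu, h⟩
    obtain ⟨k, hk, hl⟩ := key2 _ _ h
    refine ⟨ha, hb, u, hu, k + 1, by omega, ?_, fun j h0 h1 => hl j h0 (by omega)⟩
    rw [Function.iterate_succ_apply', hk]
    rfl

theorem steps_leaf_left {T : SimpleGraph V} {rot : V → V → V} {d e : V × V}
    (h : ReflTransGen (Step T rot) d e) (he : IsLeaf T e.1) : d = e := by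
  rcases ReflTransGen.cases_tail h with h | ⟨c, _, hc⟩
  · exact h.symm
  · exact absurd (by rw [hc.2] at he; exact he) hc.1

theorem NextLeaf.right_unique {T : SimpleGraph V} {rot : V → V → V} {a b b' : V}
    (h : NextLeaf T rot a b) (h' : NextLeaf T rot a b') : b = b' := by
  obtain ⟨ha, hb, u, w, hu, hs⟩ := nextLeaf_iff.1 h
  obtain ⟨-, hb', u', w', hu', hs'⟩ := nextLeaf_iff.1 h'
  obtain rfl := ha.eq hu hu'
  rcases ReflTransGen.total_of_right_unique (step_rightUnique T rot) hs hs' with h | h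
  · rcases ReflTransGen.cases_head h with h | ⟨c, hc, _⟩
    · exact congrArg Prod.snd h
    · exact absurd hb hc.1
  · rcases ReflTransGen.cases_head h with h | ⟨c, hc, _⟩
    · exact (congrArg Prod.snd h).symm
    · exact absurd hb' hc.1

/-- Face steps are injective on darts because rotations are. Two walks that enter `b` by its only
edge can be traced back together, and they start together since a dart that leaves a leaf has no
preceding `Step`. -/
theorem NextLeaf.left_unique [Finite V] {T : SimpleGraph V} {rot : V → V → V}
    (hr : IsRotation T rot) {a a' b : V}
    (h : NextLeaf T rot a b) (h' : NextLeaf T rot a' b) : a = a' := by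
  obtain ⟨ha, hb, u, w, hu, hs⟩ := nextLeaf_iff.1 h
  obtain ⟨ha', -, u', w', hu', hs'⟩ := nextLeaf_iff.1 h'
  have hw : T.Adj w b := adj_of_steps (d := (a, u)) hr hu hs
  have hw' : T.Adj w' b := adj_of_steps (d := (a', u')) hr hu' hs'
  obtain rfl := hb.eq hw.symm hw'.symm
  have key : ∀ d d' e, T.Adj d.1 d.2 → T.Adj d'.1 d'.2 → IsLeaf T d.1 → IsLeaf T d'.1 →
      ReflTransGen (Step T rot) d e → ReflTransGen (Step T rot) d' e → d = d' := by
    intro d d' e hd hd' hl hl' h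
    induction h with
    | refl => intro h'; exact (steps_leaf_left h' hl).symm
    | @tail f g hf hg ih =>
      intro h'
      rcases ReflTransGen.cases_tail h' with h | ⟨f', hf', hg'⟩
      · rw [← h, hg.2] at hl'
        exact absurd hl' hg.1
      · have e1 : faceStep rot f = faceStep rot f' := hg.2.symm.trans hg'.2
        have e2 : f.2 = f'.2 := congrArg Prod.fst e1
        have e3 : rot f.2 f.1 = rot f.2 f'.1 := by
          have := congrArg Prod.snd e1
          simp only [faceStep] at this
          rw [this, e2]
        have a1 := adj_of_steps hr hd hf
        have a2 := adj_of_steps hr hd' hf'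
        have e4 : f.1 = f'.1 := hr.inj a1.symm (by rw [e2]; exact a2.symm) e3
        have : f = f' := Prod.ext e4 e2
        subst this
        exact ih hf'
  exact congrArg Prod.fst (key (a, u) (a', u') _ hu hu' ha ha' hs hs')

/-- At a vertex that is not a leaf the walk never turns back, so each step goes deeper into the
branch already entered. -/
theorem reachable_of_steps {T : SimpleGraph V} {rot : V → V → V} (hT : T.IsAcyclic)
    (hr : IsRotation T rot) {d e : V × V} (hd : T.Adj d.1 d.2)
    (h : ReflTransGen (Step T rot) d e) : (isolate T {d.1}).Reachable d.2 e.2 := by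
  induction h using ReflTransGen.head_induction_on with
  | refl => exact SimpleGraph.Reachable.refl _
  | @head d f hf _ ih =>
    obtain ⟨hl, rfl⟩ := hf
    obtain ⟨w, hw, hwd⟩ := exists_adj_ne hl hd.symm
    have h1 : T.Adj d.2 (rot d.2 d.1) := (hr _ _ hd.symm).1
    exact reachable_isolate_trans hT hd h1 (hr.ne hd.symm hw hwd) (ih h1)

/-- From `a` the walk passes `x` and then stays in the branch of `rot x a`, which contains only one
neighbour of `x`. -/
theorem NextLeaf.rot_eq {T : SimpleGraph V} {rot : V → V → V} (hT : T.IsAcyclic)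
    (hr : IsRotation T rot) {a b x : V} (h : NextLeaf T rot a b) (ha : T.Adj x a)
    (hb : T.Adj x b) : rot x a = b := by
  obtain ⟨hla, hlb, u, w, hu, hs⟩ := nextLeaf_iff.1 h
  obtain rfl := hla.eq hu ha.symm
  rcases ReflTransGen.cases_head hs with h | ⟨c, hc, hs⟩
  · exact absurd (congrArg Prod.snd h) hb.ne
  · rw [hc.2] at hs
    have h1 : T.Adj u (rot u a) := (hr _ _ ha).1
    exact eq_of_reachable_isolate hT h1 hb (reachable_of_steps (d := (u, rot u a)) hT hr h1 hs)

theorem nextLeaf_of_rot_eq {T : SimpleGraph V} {rot : V → V → V} {a b x : V} (ha : T.Adj x a)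
    (hla : IsLeaf T a) (hlb : IsLeaf T b) (hx : ¬ IsLeaf T x) (h : rot x a = b) :
    NextLeaf T rot a b :=
  nextLeaf_iff.2 ⟨hla, hlb, x, x, ha.symm, .single ⟨hx, by simp [faceStep, h]⟩⟩

/-! ### Plane trees -/

/-- The edges of `T` form a tree with vertex set `A`, embedded in the plane by `rot`. -/
structure PlaneTree (T : SimpleGraph V) (A : Set V) (rot : V → V → V) : Prop where
  mem : ∀ {a b}, T.Adj a b → a ∈ A
  reach : ∀ {a b}, a ∈ A → b ∈ A → T.Reachable a b
  acyclic : T.IsAcyclic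
  rotation : IsRotation T rot

theorem exists_third {T : SimpleGraph V} {a u w : V} (h2 : (T.neighborSet a).ncard ≠ 2)
    (hu : T.Adj a u) (hw : T.Adj a w) (hne : u ≠ w) : ∃ t, T.Adj a t ∧ t ≠ u ∧ t ≠ w := by
  by_contra! hc
  refine h2 ?_
  have : T.neighborSet a = {u, w} := by
    ext t
    constructor
    · intro ht
      by_cases h : t = u
      · exact Or.inl h
      · exact Or.inr (hc t ht h)
    · rintro (rfl | rfl) <;> assumption
  rw [this, Set.ncard_pair hne]

namespace PlaneTree

variable {T : SimpleGraph V} {A : Set V} {rot : V → V → V}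

theorem subset_of_closed (h : PlaneTree T A rot) {S : Set V} {a : V} (ha : a ∈ A) (haS : a ∈ S)
    (hS : ∀ x y, x ∈ S → T.Adj x y → y ∈ S) : A ⊆ S := by
  intro b hb
  have hr := (SimpleGraph.reachable_iff_reflTransGen _ _).1 (h.reach ha hb)
  clear hb
  induction hr with
  | refl => exact haS
  | tail _ h1 ih => exact hS _ _ ih h1

theorem mem_of_isLeaf (h : PlaneTree T A rot) {a : V} (ha : IsLeaf T a) : a ∈ A := by
  obtain ⟨u, hu⟩ := ha.exists_adj
  exact h.mem hu

theorem exists_adj (h : PlaneTree T A rot) (hA : 4 ≤ A.ncard) {a : V} (ha : a ∈ A) :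
    ∃ u, T.Adj a u := by
  by_contra! hc
  have h1 : A ⊆ {a} := h.subset_of_closed ha rfl (by rintro x y rfl hxy; exact absurd hxy (hc y))
  have h2 := Set.ncard_le_ncard h1
  rw [Set.ncard_singleton] at h2
  omega

theorem not_isLeaf_of_adj (h : PlaneTree T A rot) (hA : 4 ≤ A.ncard) {a u : V} (ha : IsLeaf T a)
    (hu : T.Adj a u) : ¬ IsLeaf T u := by
  intro hlu
  have h1 : A ⊆ {a, u} := by
    refine h.subset_of_closed (h.mem hu) (by simp) ?_
    rintro x y (rfl | rfl) hxy
    · exact Or.inr (ha.eq hxy hu)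
    · exact Or.inl (hlu.eq hxy hu.symm)
  have h2 := Set.ncard_le_ncard h1
  rw [Set.ncard_pair hu.ne] at h2
  omega

/-- The sizes of branches are the measure for all descents into the tree. -/
theorem ncard_branch_lt [Finite V] (h : PlaneTree T A rot) {x c d : V} (hx : T.Adj x c)
    (hd : T.Adj c d) (hdx : d ≠ x) :
    {b | (isolate T {c}).Reachable d b}.ncard < {b | (isolate T {x}).Reachable c b}.ncard := by
  refine Set.ncard_lt_ncard ?_ (Set.toFinite _)
  refine ⟨fun b hb => reachable_isolate_trans h.acyclic hx hd hdx hb, fun hc => ?_⟩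
  have := hc (SimpleGraph.Reachable.refl c)
  exact not_mem_of_reachable_isolate (by simp [hd.ne']) this rfl

theorem exists_steps_leaf [Finite V] (h : PlaneTree T A rot) {d : V × V} (hd : T.Adj d.1 d.2) :
    ∃ e, ReflTransGen (Step T rot) d e ∧ IsLeaf T e.2 := by
  induction hn : {b | (isolate T {d.1}).Reachable d.2 b}.ncard using Nat.strong_induction_on
    generalizing d with
  | _ n ih =>
    by_cases hl : IsLeaf T d.2
    · exact ⟨d, .refl, hl⟩
    · obtain ⟨w, hw, hwd⟩ := exists_adj_ne hl hd.symm
      have h1 : T.Adj d.2 (rot d.2 d.1) := (h.rotation _ _ hd.symm).1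
      have h2 := h.ncard_branch_lt hd h1 (h.rotation.ne hd.symm hw hwd)
      obtain ⟨e, he, hle⟩ := ih _ (hn ▸ h2) (d := faceStep rot d) h1 rfl
      exact ⟨e, .head ⟨hl, rfl⟩ he, hle⟩

theorem exists_leaf_branch [Finite V] (h : PlaneTree T A rot) {x c : V} (hx : T.Adj x c) :
    ∃ b, IsLeaf T b ∧ (isolate T {x}).Reachable c b := by
  obtain ⟨e, he, hl⟩ := h.exists_steps_leaf (d := (x, c)) hx
  exact ⟨e.2, hl, reachable_of_steps (d := (x, c)) h.acyclic h.rotation hx he⟩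

theorem exists_nextLeaf [Finite V] (h : PlaneTree T A rot) {a : V} (ha : IsLeaf T a) :
    ∃ b, NextLeaf T rot a b := by
  obtain ⟨u, hu⟩ := ha.exists_adj
  obtain ⟨⟨w, b⟩, he, hl⟩ := h.exists_steps_leaf (d := (a, u)) hu
  exact ⟨b, nextLeaf_iff.2 ⟨ha, hl, u, w, hu, he⟩⟩

/-- A vertex that is not a leaf and all of whose neighbours but one are leaves. -/
theorem exists_end [Finite V] (h : PlaneTree T A rot) (hA : 4 ≤ A.ncard) :
    ∃ x c, T.Adj x c ∧ ¬ IsLeaf T c ∧ ∀ d, T.Adj c d → d ≠ x → IsLeaf T d := by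
  have key : ∀ n x c, {b | (isolate T {x}).Reachable c b}.ncard = n → T.Adj x c → ¬ IsLeaf T c →
      ∃ x c, T.Adj x c ∧ ¬ IsLeaf T c ∧ ∀ d, T.Adj c d → d ≠ x → IsLeaf T d := by
    intro n
    induction n using Nat.strong_induction_on with
    | _ n ih =>
      intro x c hn hxc hc
      by_cases hd : ∀ d, T.Adj c d → d ≠ x → IsLeaf T d
      · exact ⟨x, c, hxc, hc, hd⟩
      · push Not at hd
        obtain ⟨d, hcd, hdx, hld⟩ := hd
        exact ih _ (hn ▸ h.ncard_branch_lt hxc hcd hdx) c d rfl hcd hld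
  have hne : A.Nonempty := by
    rw [Set.nonempty_iff_ne_empty]
    rintro rfl
    simp at hA
  obtain ⟨a, ha⟩ := hne
  obtain ⟨u, hu⟩ := h.exists_adj hA ha
  by_cases hl : IsLeaf T a
  · exact key _ a u rfl hu (h.not_isLeaf_of_adj hA hl hu)
  · exact key _ u a rfl hu.symm hl

/-! ### The boundary walk is a single cycle -/

/-- Suppose that `O` contains a dart into the branch of `b` but not the dart out of it. Then the
darts of `O` inside the branch are mapped injectively, hence bijectively, to themselves, and none is
left to be the image of the entering dart. -/
theorem reverse_mem [Finite V] (h : PlaneTree T A rot) {O : Set (V × V)}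
    (hO : ∀ d ∈ O, T.Adj d.1 d.2) (hc : ∀ d ∈ O, faceStep rot d ∈ O) {a b : V}
    (hab : (a, b) ∈ O) : (b, a) ∈ O := by
  by_contra hba
  have hadj : T.Adj a b := hO _ hab
  let OB : Set (V × V) := {d | d ∈ O ∧ (isolate T {a}).Reachable b d.1}
  have hcl : ∀ d ∈ OB, faceStep rot d ∈ OB := by
    rintro ⟨x, y⟩ ⟨hd, hx⟩
    refine ⟨hc _ hd, ?_⟩
    have hxy : T.Adj x y := hO _ hd
    have hxa : x ∉ ({a} : Set V) := not_mem_of_reachable_isolate (by simp [hadj.ne']) hx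
    -- The walk can leave the branch only by the dart `(b, a)`, which is missing by assumption.
    by_cases hya : y = a
    · subst hya
      obtain rfl := eq_of_reachable_isolate h.acyclic hadj hxy.symm hx
      exact absurd hd hba
    · exact SimpleGraph.Reachable.trans hx (SimpleGraph.Adj.reachable ⟨hxy, hxa, hya⟩)
  let f : OB → OB := fun d => ⟨faceStep rot d, hcl _ d.2⟩
  have hinj : ∀ d e : V × V, T.Adj d.1 d.2 → T.Adj e.1 e.2 → faceStep rot d = faceStep rot e →
      d = e := by
    intro d e hd he hde
    have e2 : d.2 = e.2 := congrArg Prod.fst hde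
    have e3 : rot d.2 d.1 = rot d.2 e.1 := by
      have := congrArg Prod.snd hde
      simp only [faceStep] at this
      rw [this, e2]
    exact Prod.ext (h.rotation.inj hd.symm (by rw [e2]; exact he.symm) e3) e2
  have hf : Function.Injective f := fun d e hde =>
    Subtype.ext (hinj d e (hO _ d.2.1) (hO _ e.2.1) (congrArg Subtype.val hde))
  have hs : Function.Surjective f := Finite.injective_iff_surjective.1 hf
  -- The dart that follows `(a, b)` must be the image of a dart inside the branch. By injectivity
  -- that dart is `(a, b)` itself, whose tail `a` is outside.
  obtain ⟨d, hd⟩ := hs ⟨faceStep rot (a, b), hc _ hab, SimpleGraph.Reachable.refl _⟩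
  have := hinj d (a, b) (hO _ d.2.1) hadj (congrArg Subtype.val hd)
  have h2 := d.2.2
  rw [this] at h2
  exact not_mem_of_reachable_isolate (by simp [hadj.ne']) h2 rfl

/-- Reversing `(b, c)` and making a face step gives `(b, rot b c)`. So `O` contains all darts at a
vertex as soon as it contains one, and reversal carries this to the adjacent vertices. -/
theorem mem_of_faceStep_closed [Finite V] (h : PlaneTree T A rot) {O : Set (V × V)}
    (hO : ∀ d ∈ O, T.Adj d.1 d.2) (hc : ∀ d ∈ O, faceStep rot d ∈ O) {d e : V × V}
    (hd : d ∈ O) (he : T.Adj e.1 e.2) : e ∈ O := by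
  have h1 : ∀ b c c', (b, c) ∈ O → T.Adj b c' → (b, c') ∈ O := by
    intro b c c' hb hc'
    exact h.rotation.induct (hO _ hb) hc' (fun c => (b, c) ∈ O) hb
      (fun c _ hbc => hc _ (h.reverse_mem hO hc hbc))
  have h2 : A ⊆ {b | ∀ c, T.Adj b c → (b, c) ∈ O} := by
    refine h.subset_of_closed (h.mem (hO _ hd)) (fun c hc' => h1 _ d.2 _ hd hc') ?_
    intro x y hx hxy z hz
    exact h1 y x z (h.reverse_mem hO hc (hx y hxy)) hz
  exact h2 (h.mem he) _ he

/-- The darts on the walks that start at leaves of `S` are closed under face steps, hence are all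
darts. The dart leaving `b` can occur on such a walk only at its beginning. In other words, the
leaves form a single cycle. -/
theorem mem_of_nextLeaf_closed [Finite V] (h : PlaneTree T A rot) {S : Set V} {a : V}
    (haS : a ∈ S) (hS : ∀ a ∈ S, IsLeaf T a)
    (hc : ∀ a b, a ∈ S → NextLeaf T rot a b → b ∈ S) {b : V} (hb : IsLeaf T b) : b ∈ S := by
  let O : Set (V × V) := {e | ∃ l ∈ S, ∃ u, T.Adj l u ∧ ReflTransGen (Step T rot) (l, u) e}
  have hO : ∀ d ∈ O, T.Adj d.1 d.2 := by
    rintro d ⟨l, hl, u, hu, hs⟩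
    exact adj_of_steps (d := (l, u)) h.rotation hu hs
  have hcl : ∀ d ∈ O, faceStep rot d ∈ O := by
    rintro ⟨x, y⟩ hd
    have hxy := hO _ hd
    obtain ⟨l, hl, u, hu, hs⟩ := hd
    by_cases hly : IsLeaf T y
    · refine ⟨y, hc l y hl (nextLeaf_iff.2 ⟨hS l hl, hly, u, x, hu, hs⟩), rot y x, ?_, .refl⟩
      exact (h.rotation _ _ hxy.symm).1
    · exact ⟨l, hl, u, hu, hs.tail ⟨hly, rfl⟩⟩
  obtain ⟨u, hu⟩ := (hS a haS).exists_adj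
  obtain ⟨w, hw⟩ := hb.exists_adj
  obtain ⟨l, hl, v, hv, hs⟩ :=
    h.mem_of_faceStep_closed hO hcl (d := (a, u)) ⟨a, haS, u, hu, .refl⟩ (e := (b, w)) hw
  obtain rfl : l = b := congrArg Prod.fst (steps_leaf_left hs hb)
  exact hl

theorem leafCycle_adj {a b : V} :
    (leafCycle T rot).Adj a b ↔ a ≠ b ∧ (NextLeaf T rot a b ∨ NextLeaf T rot b a) := Iff.rfl

/-- Uniqueness of successors and predecessors orients the triangle cyclically, so its vertices are
closed under `NextLeaf`. -/
theorem eq_of_leafCycle_triangle [Finite V] (h : PlaneTree T A rot) {p q r : V}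
    (hpq : (leafCycle T rot).Adj p q) (hqr : (leafCycle T rot).Adj q r)
    (hpr : (leafCycle T rot).Adj p r) {a : V} (ha : IsLeaf T a) : a = p ∨ a = q ∨ a = r := by
  have key : ∀ x y z : V, NextLeaf T rot x y → NextLeaf T rot y z → NextLeaf T rot z x →
      a = x ∨ a = y ∨ a = z := by
    intro x y z h1 h2 h3
    refine h.mem_of_nextLeaf_closed (S := {x, y, z}) (a := x) (by simp) ?_ ?_ ha
    · rintro b (rfl | rfl | rfl)
      exacts [h1.1, h2.1, h3.1]
    · rintro b c (rfl | rfl | rfl) hbc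
      · exact Or.inr (Or.inl (hbc.right_unique h1))
      · exact Or.inr (Or.inr (hbc.right_unique h2))
      · exact Or.inl (hbc.right_unique h3)
  rcases hpq.2 with h1 | h1
  · have h2 : NextLeaf T rot q r := hqr.2.resolve_right fun h2 =>
      hpr.1 (h1.left_unique h.rotation h2)
    have h3 : NextLeaf T rot r p := hpr.2.resolve_left fun h3 => hqr.1 (h1.right_unique h3)
    exact key _ _ _ h1 h2 h3
  · have h2 : NextLeaf T rot p r := hpr.2.resolve_right fun h2 =>
      hqr.1 (h1.left_unique h.rotation h2)
    have h3 : NextLeaf T rot r q := hqr.2.resolve_left fun h3 => hpr.1 (h1.right_unique h3)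
    have := key _ _ _ h1 h2 h3
    tauto

/-- A plane tree with three leaves and no vertex of degree two is a star. -/
theorem star_of_three_leaves [Finite V] (h : PlaneTree T A rot) (hA : 4 ≤ A.ncard)
    (h2 : ∀ v, (T.neighborSet v).ncard ≠ 2) {p q r : V}
    (hl : ∀ a, IsLeaf T a → a = p ∨ a = q ∨ a = r) :
    ∃ c, ¬ IsLeaf T c ∧ T.Adj c p ∧ T.Adj c q ∧ T.Adj c r ∧ A = {c, p, q, r} := by
  obtain ⟨x, c, hxc, hc, hd⟩ := h.exists_end hA
  obtain ⟨d, hcd, hdx⟩ := exists_adj_ne hc hxc.symm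
  obtain ⟨e, hce, hex, hed⟩ := exists_third (h2 c) hxc.symm hcd hdx.symm
  have ld := hl _ (hd d hcd hdx)
  have le := hl _ (hd e hce hex)
  by_cases hx : IsLeaf T x
  · have lx := hl _ hx
    have hN : ∀ y, T.Adj c y ↔ y = p ∨ y = q ∨ y = r := by
      intro y
      constructor
      · intro hy
        by_cases hyx : y = x
        · rw [hyx]; exact lx
        · exact hl _ (hd y hy hyx)
      · intro hy
        have hy' : y = x ∨ y = d ∨ y = e := by grind
        rcases hy' with rfl | rfl | rfl
        exacts [hxc.symm, hcd, hce]
    have hsub : A ⊆ {c, p, q, r} := by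
      refine h.subset_of_closed (h.mem hxc.symm) (by simp) ?_
      intro y z hy hyz
      by_cases hyc : y = c
      · subst hyc
        exact Or.inr ((hN z).1 hyz)
      · have hy' : y = p ∨ y = q ∨ y = r := hy.resolve_left hyc
        have hcy := (hN y).2 hy'
        have hly : IsLeaf T y := by
          by_cases hyx : y = x
          · rw [hyx]; exact hx
          · exact hd y hcy hyx
        exact Or.inl (hly.eq hyz hcy.symm)
    refine ⟨c, hc, (hN p).2 (by simp), (hN q).2 (by simp), (hN r).2 (by simp),
      hsub.antisymm ?_⟩
    rintro y (rfl | hy)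
    · exact h.mem hxc.symm
    · exact h.mem ((hN y).2 hy).symm
  -- An inner `x` has two branches besides that of `c`. Their leaves `u`, `v` together with the
  -- leaves `d`, `e` at `c` would be four leaves.
  · exfalso
    obtain ⟨f, hxf, hfc⟩ := exists_adj_ne hx hxc
    obtain ⟨g, hxg, hgc, hgf⟩ := exists_third (h2 x) hxc hxf hfc.symm
    obtain ⟨u, hu, hbu⟩ := h.exists_leaf_branch hxf
    obtain ⟨v, hv, hbv⟩ := h.exists_leaf_branch hxg
    have bd : (isolate T {x}).Reachable c d :=
      SimpleGraph.Adj.reachable ⟨hcd, by simp [hxc.ne'], by simp [hdx]⟩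
    have be : (isolate T {x}).Reachable c e :=
      SimpleGraph.Adj.reachable ⟨hce, by simp [hxc.ne'], by simp [hex]⟩
    have key : ∀ {y z s t : V}, T.Adj x y → T.Adj x z → y ≠ z → (isolate T {x}).Reachable y s →
        (isolate T {x}).Reachable z t → s ≠ t := by
      rintro y z s t hy hz hyz hs ht rfl
      exact hyz (eq_of_reachable_isolate h.acyclic hy hz (hs.trans ht.symm))
    have n1 := key hxc hxf hfc.symm bd hbu
    have n2 := key hxc hxf hfc.symm be hbu
    have n3 := key hxc hxg hgc.symm bd hbv
    have n4 := key hxc hxg hgc.symm be hbv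
    have n5 := key hxg hxf hgf hbv hbu
    have lu := hl _ hu
    have lv := hl _ hv
    clear key
    grind

end PlaneTree

/-! ### Attaching a leaf -/

open Classical in
/-- Insert the new leaf `v` after the neighbour `u` of `x`. -/
noncomputable def insertRot (rot : V → V → V) (x u v : V) : V → V → V := fun a b =>
  if a = x ∧ b = u then v else if a = x ∧ b = v then rot x u else
    if a = v ∧ b = x then x else rot a b

/-- The data for attaching a new leaf `v` to the vertex `x`, after its neighbour `u`. -/
structure Attach (T : SimpleGraph V) (A : Set V) (x u v : V) : Prop where
  mem : ∀ {a b}, T.Adj a b → a ∈ A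
  not_mem : v ∉ A
  adj : T.Adj x u

namespace Attach

variable {T : SimpleGraph V} {A : Set V} {rot : V → V → V} {x u v : V}

theorem mem_right (h : Attach T A x u v) {a b : V} (hab : T.Adj a b) : b ∈ A := h.mem hab.symm

theorem x_mem (h : Attach T A x u v) : x ∈ A := h.mem h.adj

theorem xv (h : Attach T A x u v) : x ≠ v := fun e => h.not_mem (e ▸ h.x_mem)

theorem uv (h : Attach T A x u v) : u ≠ v := fun e => h.not_mem (e ▸ h.mem h.adj.symm)

theorem ne_left (h : Attach T A x u v) {a b : V} (hab : T.Adj a b) : a ≠ v :=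
  fun e => h.not_mem (e ▸ h.mem hab)

theorem ne_right (h : Attach T A x u v) {a b : V} (hab : T.Adj a b) : b ≠ v :=
  h.ne_left hab.symm

theorem adj_iff (h : Attach T A x u v) {a b : V} :
    (T ⊔ SimpleGraph.edge x v).Adj a b ↔ T.Adj a b ∨ (a = x ∧ b = v) ∨ (a = v ∧ b = x) := by
  have := h.xv
  simp only [SimpleGraph.sup_adj, SimpleGraph.edge_adj]
  constructor
  · rintro (h | ⟨h, -⟩)
    · exact Or.inl h
    · tauto
  · rintro (h | ⟨rfl, rfl⟩ | ⟨rfl, rfl⟩)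
    · exact Or.inl h
    · exact Or.inr ⟨by simp, this⟩
    · exact Or.inr ⟨by simp, this.symm⟩

theorem rot_xu : insertRot rot x u v x u = v := by simp [insertRot]

theorem rot_xv (h : Attach T A x u v) : insertRot rot x u v x v = rot x u := by
  have := h.uv
  simp [insertRot, this.symm]

theorem rot_vx (h : Attach T A x u v) : insertRot rot x u v v x = x := by
  have := h.xv
  simp [insertRot, this, this.symm]

theorem rot_of_ne {a b : V} (h1 : ¬ (a = x ∧ b = u)) (ha : a ≠ v) (hb : b ≠ v) :
    insertRot rot x u v a b = rot a b := by
  simp only [insertRot]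
  rw [if_neg h1, if_neg (by tauto), if_neg (by tauto)]

theorem isolated (h : Attach T A x u v) {b : V} (hr : T.Reachable v b) : b = v := by
  replace hr := (SimpleGraph.reachable_iff_reflTransGen _ _).1 hr
  induction hr with
  | refl => rfl
  | tail _ h1 ih => exact absurd ih (h.ne_left h1)

/-- The new leaf only lengthens the cycle at `x`: a property closed under the new rotation passes
from `u` through `v` to `rot x u`, so it is closed under the old rotation. -/
theorem isRotation (h : Attach T A x u v) (hr : IsRotation T rot) :
    IsRotation (T ⊔ SimpleGraph.edge x v) (insertRot rot x u v) := by
  refine isRotation_of_induct ?_ ?_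
  · intro a b hab
    rw [h.adj_iff] at hab ⊢
    rcases hab with hab | ⟨rfl, rfl⟩ | ⟨rfl, rfl⟩
    · by_cases h1 : a = x ∧ b = u
      · rw [h1.1, h1.2, rot_xu]; simp
      · rw [rot_of_ne h1 (h.ne_left hab) (h.ne_right hab)]
        exact Or.inl (hr _ _ hab).1
    · rw [h.rot_xv]; exact Or.inl (hr _ _ h.adj).1
    · rw [h.rot_vx]; simp
  · intro w a b ha hb P hP hs
    rw [h.adj_iff] at ha hb
    have hs' : ∀ c, T.Adj w c → P c → P (insertRot rot x u v w c) :=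
      fun c hc => hs c (h.adj_iff.2 (Or.inl hc))
    by_cases hwx : w = x
    · subst hwx
      have sv : P v → P (rot w u) := fun hv => by
        have := hs v (h.adj_iff.2 (by simp)) hv
        rwa [h.rot_xv] at this
      have su : P u → P v := fun hu => by
        have := hs' u h.adj hu
        rwa [rot_xu] at this
      have start : ∃ a0, T.Adj w a0 ∧ P a0 := by
        rcases ha with ha | ⟨-, rfl⟩ | ⟨rfl, rfl⟩
        · exact ⟨a, ha, hP⟩
        · exact ⟨rot w u, (hr _ _ h.adj).1, sv hP⟩
        · exact absurd rfl h.xv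
      obtain ⟨a0, ha0, hP0⟩ := start
      have key : ∀ b, T.Adj w b → P b := by
        intro b hb
        refine hr.induct ha0 hb P hP0 ?_
        intro c hc hPc
        by_cases hcu : c = u
        · subst hcu
          exact sv (su hPc)
        · have := hs' c hc hPc
          rwa [rot_of_ne (by tauto) h.xv (h.ne_right hc)] at this
      rcases hb with hb | ⟨-, rfl⟩ | ⟨rfl, rfl⟩
      · exact key b hb
      · exact su (key u h.adj)
      · exact absurd rfl h.xv
    · rcases ha with ha | ⟨rfl, rfl⟩ | ⟨rfl, rfl⟩
      · have hwv := h.ne_left ha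
        rcases hb with hb | ⟨rfl, rfl⟩ | ⟨rfl, rfl⟩
        · refine hr.induct ha hb P hP ?_
          intro c hc hPc
          have := hs' c hc hPc
          rwa [rot_of_ne (by tauto) hwv (h.ne_right hc)] at this
        · exact absurd rfl hwx
        · exact absurd rfl hwv
      · exact absurd rfl hwx
      · rcases hb with hb | ⟨rfl, rfl⟩ | ⟨-, rfl⟩
        · exact absurd rfl (h.ne_left hb)
        · exact absurd rfl hwx
        · exact hP

theorem isRotation_of [Finite V] (h : Attach T A x u v)
    (hr : IsRotation (T ⊔ SimpleGraph.edge x v) (insertRot rot x u v)) : IsRotation T rot := by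
  have hxu := h.adj_iff.2 (Or.inl h.adj)
  have hxv : (T ⊔ SimpleGraph.edge x v).Adj x v := h.adj_iff.2 (by simp)
  refine isRotation_of_induct ?_ ?_
  · intro a b hab
    have hab' := h.adj_iff.2 (Or.inl hab)
    by_cases h1 : a = x ∧ b = u
    · obtain ⟨rfl, rfl⟩ := h1
      have h2 := (hr _ _ hxv).1
      have h3 := hr.ne hxv hxu h.uv
      rw [h.rot_xv] at h2 h3
      rcases h.adj_iff.1 h2 with h2 | ⟨-, h2⟩ | ⟨h2, -⟩
      · exact h2
      · exact absurd h2 h3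
      · exact absurd h2 h.xv
    · have h2 := (hr _ _ hab').1
      have h3 : insertRot rot x u v a b = rot a b :=
        rot_of_ne h1 (h.ne_left hab) (h.ne_right hab)
      rw [h3] at h2
      rcases h.adj_iff.1 h2 with h2 | ⟨h2, h4⟩ | ⟨h2, -⟩
      · exact h2
      · subst h2
        exact absurd ⟨rfl, hr.inj hab' hxu (h3.trans (h4.trans rot_xu.symm))⟩ h1
      · exact absurd h2 (h.ne_left hab)
  · intro w a b ha hb P hP hs
    have ha' := h.adj_iff.2 (Or.inl ha)
    have hb' := h.adj_iff.2 (Or.inl hb)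
    -- Along the longer cycle the predicate at `v` is taken to be `P u`. Passing over `v` then
    -- amounts to the old step from `u` to `rot x u`.
    have := hr.induct ha' hb' (fun c => (c ≠ v ∧ P c) ∨ (c = v ∧ w = x ∧ P u))
      (Or.inl ⟨h.ne_right ha, hP⟩) ?_
    · rcases this with h | h'
      · exact h.2
      · exact absurd h'.1 (h.ne_right hb)
    · intro c hc hQ
      have hcl : ∀ c, T.Adj w c → rot w c ≠ v ∨ w = x := by
        intro c hc
        by_cases hwx : w = x
        · exact Or.inr hwx
        · refine Or.inl fun hv => ?_
          have := (hr _ _ (h.adj_iff.2 (Or.inl hc))).1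
          rw [rot_of_ne (by tauto) (h.ne_left hc) (h.ne_right hc), hv, h.adj_iff] at this
          rcases this with h3 | h3 | h3
          · exact h.ne_right h3 rfl
          · exact hwx h3.1
          · exact h.ne_left hc h3.1
      rcases hQ with ⟨hcv, hPc⟩ | ⟨rfl, rfl, hPu⟩
      · have hwc : T.Adj w c := by
          rcases h.adj_iff.1 hc with h1 | h1 | h1
          · exact h1
          · exact absurd h1.2 hcv
          · exact absurd h1.1 (h.ne_left ha)
        by_cases h1 : w = x ∧ c = u
        · obtain ⟨rfl, rfl⟩ := h1
          rw [rot_xu]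
          exact Or.inr ⟨rfl, rfl, hPc⟩
        · have e := rot_of_ne (rot := rot) h1 (h.ne_left ha) hcv
          rw [e]
          refine Or.inl ⟨fun hv => ?_, hs c hwc hPc⟩
          by_cases hwx : w = x
          · subst hwx
            exact h1 ⟨rfl, hr.inj hc hxu (e.trans (hv.trans rot_xu.symm))⟩
          · exact (hcl c hwc).elim (fun h => h hv) hwx
      · rw [h.rot_xv]
        refine Or.inl ⟨fun hv => ?_, hs u h.adj hPu⟩
        have h3 := hr.ne hxv hxu h.uv
        rw [h.rot_xv] at h3
        exact h3 hv

theorem planeTree (h : Attach T A x u v) (ht : PlaneTree T A rot) :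
    PlaneTree (T ⊔ SimpleGraph.edge x v) (insert v A) (insertRot rot x u v) where
  mem := by
    intro a b hab
    rcases h.adj_iff.1 hab with hab | ⟨rfl, -⟩ | ⟨rfl, -⟩
    · exact Or.inr (h.mem hab)
    · exact Or.inr h.x_mem
    · exact Or.inl rfl
  reach := by
    have key : ∀ a ∈ insert v A, (T ⊔ SimpleGraph.edge x v).Reachable x a := by
      rintro a (rfl | ha)
      · exact SimpleGraph.Adj.reachable (h.adj_iff.2 (by simp))
      · exact (ht.reach h.x_mem ha).mono le_sup_left
    exact fun {_ _} ha hb => (key _ ha).symm.trans (key _ hb)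
  acyclic := by
    refine ht.acyclic.sup_edge_of_not_reachable fun hr => h.xv (h.isolated hr.symm)
  rotation := h.isRotation ht.rotation

theorem planeTree_of [Finite V] (h : Attach T A x u v)
    (ht : PlaneTree (T ⊔ SimpleGraph.edge x v) (insert v A) (insertRot rot x u v)) :
    PlaneTree T A rot where
  mem := h.mem
  reach := by
    intro a b ha hb
    have hr := (SimpleGraph.reachable_iff_reflTransGen _ _).1
      (ht.reach (Or.inr ha) (Or.inr hb))
    -- A walk enters and leaves `v` only by `x`. While it is at `v`, it is remembered that `x` can
    -- be reached without `v`.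
    have key : ∀ c, ReflTransGen (T ⊔ SimpleGraph.edge x v).Adj a c →
        (c ≠ v → T.Reachable a c) ∧ (c = v → T.Reachable a x) := by
      intro c hc
      induction hc with
      | refl => exact ⟨fun _ => .refl _, fun e => absurd (e ▸ ha) h.not_mem⟩
      | tail _ h1 ih =>
        rcases h.adj_iff.1 h1 with h2 | ⟨rfl, rfl⟩ | ⟨rfl, rfl⟩
        · exact ⟨fun _ => (ih.1 (h.ne_left h2)).trans h2.reachable, fun e =>
            absurd e (h.ne_right h2)⟩
        · exact ⟨fun e => absurd rfl e, fun _ => ih.1 h.xv⟩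
        · exact ⟨fun _ => ih.2 rfl, fun e => absurd e h.xv⟩
    exact (key b hr).1 fun e => h.not_mem (e ▸ hb)
  acyclic := ht.acyclic.anti le_sup_left
  rotation := h.isRotation_of ht.rotation

theorem neighborSet_of_ne (h : Attach T A x u v) {a : V} (hx : a ≠ x) (hv : a ≠ v) :
    (T ⊔ SimpleGraph.edge x v).neighborSet a = T.neighborSet a := by
  ext b
  rw [SimpleGraph.mem_neighborSet, h.adj_iff, SimpleGraph.mem_neighborSet]
  tauto

theorem neighborSet_x (h : Attach T A x u v) :
    (T ⊔ SimpleGraph.edge x v).neighborSet x = insert v (T.neighborSet x) := by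
  ext b
  simp only [SimpleGraph.mem_neighborSet, h.adj_iff, Set.mem_insert_iff]
  have := h.xv
  tauto

theorem ncard_neighborSet_x [Finite V] (h : Attach T A x u v) :
    ((T ⊔ SimpleGraph.edge x v).neighborSet x).ncard = (T.neighborSet x).ncard + 1 := by
  rw [h.neighborSet_x, Set.ncard_insert_of_notMem]
  exact fun hv => h.ne_right (show T.Adj x v from hv) rfl

theorem isLeaf_v (h : Attach T A x u v) : IsLeaf (T ⊔ SimpleGraph.edge x v) v := by
  refine isLeaf_of_forall (u := x) (h.adj_iff.2 (by simp)) ?_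
  intro w hw
  rcases h.adj_iff.1 hw with hw | hw | hw
  · exact absurd rfl (h.ne_left hw)
  · exact absurd hw.1.symm h.xv
  · exact hw.2

theorem not_isLeaf_x (h : Attach T A x u v) : ¬ IsLeaf (T ⊔ SimpleGraph.edge x v) x := fun hl =>
  h.uv (hl.eq (h.adj_iff.2 (Or.inl h.adj)) (h.adj_iff.2 (by simp)))

theorem isLeaf_iff (h : Attach T A x u v) {a : V} :
    IsLeaf (T ⊔ SimpleGraph.edge x v) a ↔ a = v ∨ (a ≠ x ∧ IsLeaf T a) := by
  by_cases hv : a = v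
  · subst hv; simp [h.isLeaf_v]
  · by_cases hx : a = x
    · subst hx; simp [h.not_isLeaf_x, hv]
    · simp only [IsLeaf, h.neighborSet_of_ne hx hv]; tauto

/-- Among the old darts, the rotation has changed only at the one that arrives at `x` from `u`. -/
theorem step (h : Attach T A x u v) {f g : V × V} (hf : T.Adj f.1 f.2) (hs : Step T rot f g)
    (hne : f ≠ (u, x)) : Step (T ⊔ SimpleGraph.edge x v) (insertRot rot x u v) f g := by
  refine ⟨fun hl => ?_, ?_⟩
  · rcases h.isLeaf_iff.1 hl with hl | hl
    · exact h.ne_right hf hl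
    · exact hs.1 hl.2
  · rw [hs.2, faceStep, faceStep, rot_of_ne _ (h.ne_right hf) (h.ne_left hf)]
    rintro ⟨h1, h2⟩
    exact hne (Prod.ext h2 h1)

theorem steps (h : Attach T A x u v) (hr : IsRotation T rot) {d e : V × V}
    (hd : T.Adj d.1 d.2) (hne : ∀ f, ReflTransGen (Step T rot) d f → ¬ IsLeaf T f.2 → f ≠ (u, x))
    (hs : ReflTransGen (Step T rot) d e) :
    ReflTransGen (Step (T ⊔ SimpleGraph.edge x v) (insertRot rot x u v)) d e := by
  induction hs with
  | refl => exact .refl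
  | @tail f g hf hg ih => exact ih.tail (h.step (adj_of_steps hr hd hf) hg (hne f hf hg.1))

/-- Inserting a leaf next to another leaf. -/
theorem nextLeaf_insert [Finite V] (h : Attach T A x u v) (ht : PlaneTree T A rot)
    (hx : ¬ IsLeaf T x) (hu : IsLeaf T u) {a b : V} :
    NextLeaf (T ⊔ SimpleGraph.edge x v) (insertRot rot x u v) a b ↔
      (a = u ∧ b = v) ∨ (a = v ∧ NextLeaf T rot u b) ∨ (a ≠ u ∧ NextLeaf T rot a b) := by
  have hleaf : ∀ {a}, IsLeaf T a → IsLeaf (T ⊔ SimpleGraph.edge x v) a := fun {a} ha =>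
    h.isLeaf_iff.2 (Or.inr ⟨fun e => hx (e ▸ ha), ha⟩)
  have hr := ht.rotation
  have steps : ∀ {d e : V × V}, T.Adj d.1 d.2 → d.1 ≠ u → ReflTransGen (Step T rot) d e →
      ReflTransGen (Step (T ⊔ SimpleGraph.edge x v) (insertRot rot x u v)) d e := by
    intro d e hd hdu hs
    refine h.steps hr hd ?_ hs
    rintro f hf - rfl
    have := steps_leaf_left hf hu
    exact hdu (congrArg Prod.fst this)
  have hxu' : (T ⊔ SimpleGraph.edge x v).Adj x u := h.adj_iff.2 (Or.inl h.adj)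
  have c1 : NextLeaf (T ⊔ SimpleGraph.edge x v) (insertRot rot x u v) u v :=
    nextLeaf_of_rot_eq hxu' (hleaf hu) h.isLeaf_v h.not_isLeaf_x rot_xu
  have c2 : ∀ b, NextLeaf T rot u b →
      NextLeaf (T ⊔ SimpleGraph.edge x v) (insertRot rot x u v) v b := by
    intro b hb
    obtain ⟨-, hlb, s, w, hs, hst⟩ := nextLeaf_iff.1 hb
    obtain rfl := hu.eq hs h.adj.symm
    refine nextLeaf_iff.2 ⟨h.isLeaf_v, hleaf hlb, s, w, h.adj_iff.2 (by simp), ?_⟩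
    rcases ReflTransGen.cases_head hst with he | ⟨c, hc, hst⟩
    · exact absurd (by rw [show s = b from congrArg Prod.snd he]; exact hlb) hx
    · rw [hc.2] at hst
      refine .head ⟨h.not_isLeaf_x, rfl⟩ ?_
      rw [faceStep, h.rot_xv]
      exact steps (d := (s, rot s u)) (hr _ _ h.adj).1 h.adj.ne hst
  have c3 : ∀ a b, a ≠ u → NextLeaf T rot a b →
      NextLeaf (T ⊔ SimpleGraph.edge x v) (insertRot rot x u v) a b := by
    intro a b hau hab
    obtain ⟨hla, hlb, s, w, hs, hst⟩ := nextLeaf_iff.1 hab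
    exact nextLeaf_iff.2 ⟨hleaf hla, hleaf hlb, s, w, h.adj_iff.2 (Or.inl hs),
      steps (d := (a, s)) hs hau hst⟩
  -- The facts `c1`, `c2`, `c3` provide a successor for every leaf of the new tree. Since successors
  -- are unique, there are no other pairs.
  constructor
  · intro hab
    by_cases hau : a = u
    · subst hau
      exact Or.inl ⟨rfl, hab.right_unique c1⟩
    · rcases h.isLeaf_iff.1 hab.1 with rfl | ⟨-, hl⟩
      · obtain ⟨b', hb'⟩ := ht.exists_nextLeaf hu
        rw [hab.right_unique (c2 _ hb')]
        exact Or.inr (Or.inl ⟨rfl, hb'⟩)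
      · obtain ⟨b', hb'⟩ := ht.exists_nextLeaf hl
        rw [hab.right_unique (c3 _ _ hau hb')]
        exact Or.inr (Or.inr ⟨hau, hb'⟩)
  · rintro (⟨rfl, rfl⟩ | ⟨rfl, hb⟩ | ⟨hau, hb⟩)
    exacts [c1, c2 _ hb, c3 _ _ hau hb]

/-- Attaching a leaf to a leaf, which it replaces. -/
theorem nextLeaf_extend [Finite V] [DecidableEq V] (h : Attach T A x u v)
    (ht : PlaneTree T A rot) (hx : IsLeaf T x) {a b : V} :
    NextLeaf (T ⊔ SimpleGraph.edge x v) (insertRot rot x u v) a b ↔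
      ∃ a' b', NextLeaf T rot a' b' ∧ a = (if a' = x then v else a') ∧
        b = (if b' = x then v else b') := by
  have hr := ht.rotation
  have hxu' : (T ⊔ SimpleGraph.edge x v).Adj x u := h.adj_iff.2 (Or.inl h.adj)
  have hleaf : ∀ {a}, IsLeaf T a → IsLeaf (T ⊔ SimpleGraph.edge x v) (if a = x then v else a) := by
    intro a ha
    split_ifs with hax
    · exact h.isLeaf_v
    · exact h.isLeaf_iff.2 (Or.inr ⟨hax, ha⟩)
  have steps : ∀ {d e : V × V}, T.Adj d.1 d.2 → ReflTransGen (Step T rot) d e →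
      ReflTransGen (Step (T ⊔ SimpleGraph.edge x v) (insertRot rot x u v)) d e := by
    intro d e hd hs
    refine h.steps hr hd ?_ hs
    rintro f hf hl rfl
    exact hl hx
  have c : ∀ a' b', NextLeaf T rot a' b' →
      NextLeaf (T ⊔ SimpleGraph.edge x v) (insertRot rot x u v) (if a' = x then v else a')
        (if b' = x then v else b') := by
    intro a' b' hab
    obtain ⟨hla, hlb, s, w, hs, hst⟩ := nextLeaf_iff.1 hab
    have hwb : T.Adj w b' := adj_of_steps (d := (a', s)) hr hs hst
    have h1 : ∃ s', (T ⊔ SimpleGraph.edge x v).Adj (if a' = x then v else a') s' ∧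
        ReflTransGen (Step (T ⊔ SimpleGraph.edge x v) (insertRot rot x u v))
          (if a' = x then v else a', s') (w, b') := by
      split_ifs with hax
      · subst hax
        obtain rfl := hla.eq hs h.adj
        -- The former leaf `a'` had the single neighbour `s`. So the walk from the new leaf through
        -- `a'` continues as the old walk from `a'` did.
        have e1 : rot a' s = s := hla.eq (hr _ _ hs).1 hs
        refine ⟨a', h.adj_iff.2 (by simp), .head ⟨h.not_isLeaf_x, rfl⟩ ?_⟩
        rw [faceStep, h.rot_xv, e1]
        exact steps (d := (a', s)) hs hst
      · exact ⟨s, h.adj_iff.2 (Or.inl hs), steps (d := (a', s)) hs hst⟩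
    have h2 : ∃ w', ReflTransGen (Step (T ⊔ SimpleGraph.edge x v) (insertRot rot x u v))
          (w, b') (w', if b' = x then v else b') := by
      split_ifs with hbx
      · subst hbx
        obtain rfl := hlb.eq hwb.symm h.adj
        exact ⟨b', .single ⟨h.not_isLeaf_x, by rw [faceStep, rot_xu]⟩⟩
      · exact ⟨w, .refl⟩
    obtain ⟨s', hs', hst1⟩ := h1
    obtain ⟨w', hst2⟩ := h2
    exact nextLeaf_iff.2 ⟨hleaf hla, hleaf hlb, s', w', hs', hst1.trans hst2⟩
  constructor
  · intro hab
    have : ∃ a', IsLeaf T a' ∧ a = if a' = x then v else a' := by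
      rcases h.isLeaf_iff.1 hab.1 with rfl | ⟨hax, hl⟩
      · exact ⟨x, hx, by simp⟩
      · exact ⟨a, hl, by simp [hax]⟩
    obtain ⟨a', hla, rfl⟩ := this
    obtain ⟨b', hb'⟩ := ht.exists_nextLeaf hla
    exact ⟨a', b', hb', rfl, hab.right_unique (c _ _ hb')⟩
  · rintro ⟨a', b', hab, rfl, rfl⟩
    exact c _ _ hab

end Attach

/-! ### Detaching a leaf -/

/-- The rotation bypasses `v` by sending `u` directly to the successor of `v`. The equation for
`rot` is one of functions, so the results on `insertRot` can be used by rewriting. -/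
theorem PlaneTree.detach [Finite V] {T : SimpleGraph V} {A : Set V} {rot : V → V → V}
    (h : PlaneTree T A rot) {x u v : V} (hv : IsLeaf T v) (hxv : T.Adj x v) (hxu : T.Adj x u)
    (huv : u ≠ v) (hrot : rot x u = v) :
    ∃ T' rot', Attach T' (A \ {v}) x u v ∧ T = T' ⊔ SimpleGraph.edge x v ∧
      rot = insertRot rot' x u v ∧ PlaneTree T' (A \ {v}) rot' := by
  classical
  let rot' : V → V → V := fun a b => if a = x ∧ b = u then rot x v else rot a b
  have hat : Attach (isolate T {v}) (A \ {v}) x u v :=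
    ⟨fun {a b} hab => ⟨h.mem hab.1, hab.2.1⟩, by simp, ⟨hxu, hxv.ne, huv⟩⟩
  have hT : T = isolate T {v} ⊔ SimpleGraph.edge x v := by
    ext a b
    rw [hat.adj_iff]
    simp only [isolate_adj, Set.mem_singleton_iff]
    constructor
    · intro hab
      by_cases ha : a = v
      · subst ha
        exact Or.inr (Or.inr ⟨rfl, hv.eq hab hxv.symm⟩)
      · by_cases hb : b = v
        · subst hb
          exact Or.inr (Or.inl ⟨hv.eq hab.symm hxv.symm, rfl⟩)
        · exact Or.inl ⟨hab, ha, hb⟩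
    · rintro (hab | ⟨rfl, rfl⟩ | ⟨rfl, rfl⟩)
      exacts [hab.1, hxv, hxv.symm]
  have hrot' : rot = insertRot rot' x u v := by
    funext a b
    by_cases h1 : a = x ∧ b = u
    · rw [h1.1, h1.2, Attach.rot_xu, hrot]
    · by_cases h2 : a = x ∧ b = v
      · rw [h2.1, h2.2, hat.rot_xv]
        simp [rot']
      · by_cases h3 : a = v ∧ b = x
        · rw [h3.1, h3.2, hat.rot_vx]
          exact hv.eq (h.rotation _ _ hxv.symm).1 hxv.symm
        · simp only [insertRot, if_neg h1, if_neg h2, if_neg h3, rot']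
  have hA : insert v (A \ {v}) = A := by
    ext a
    simp only [Set.mem_insert_iff, Set.mem_sdiff, Set.mem_singleton_iff]
    constructor
    · rintro (rfl | ha)
      exacts [h.mem hxv.symm, ha.1]
    · tauto
  refine ⟨_, rot', hat, hT, hrot', hat.planeTree_of ?_⟩
  rw [← hT, ← hrot', hA]
  exact h

/-- A leaf that follows itself would be the only leaf, but the branch beyond its neighbour contains
another one. -/
theorem PlaneTree.nextLeaf_ne [Finite V] {T : SimpleGraph V} {A : Set V} {rot : V → V → V}
    (h : PlaneTree T A rot) {a b : V} (hab : NextLeaf T rot a b) : a ≠ b := by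
  rintro rfl
  obtain ⟨u, hu⟩ := hab.1.exists_adj
  obtain ⟨l, hl, hr⟩ := h.exists_leaf_branch hu
  have := h.mem_of_nextLeaf_closed (S := {a}) (a := a) rfl (by rintro _ rfl; exact hab.1)
    (by rintro _ c rfl hc; exact hc.right_unique hab) hl
  exact not_mem_of_reachable_isolate (by simp [hu.ne']) hr this

/-! ### Decompositions of the current graph -/

/-- `G` is the Halin graph on the vertex set `A` that is given by the embedded tree `T`. -/
structure Dec (G : SimpleGraph V) (A : Set V) (T : SimpleGraph V) (rot : V → V → V) : Prop
    extends PlaneTree T A rot where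
  degree : ∀ v, (T.neighborSet v).ncard ≠ 2
  card : 4 ≤ A.ncard
  eq : G = T ⊔ leafCycle T rot

namespace Dec

variable {G T : SimpleGraph V} {A : Set V} {rot : V → V → V}

theorem adj_iff (h : Dec G A T rot) {a b : V} :
    G.Adj a b ↔ T.Adj a b ∨ (leafCycle T rot).Adj a b := by rw [h.eq]; rfl

theorem isLeaf_of_cycle {a b : V} (hab : (leafCycle T rot).Adj a b) :
    IsLeaf T a ∧ IsLeaf T b := by
  rcases hab.2 with h | h
  exacts [⟨h.1, h.2.1⟩, ⟨h.2.1, h.1⟩]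

theorem tree_of_not_isLeaf (h : Dec G A T rot) {a b : V} (hab : G.Adj a b) (ha : ¬ IsLeaf T a) :
    T.Adj a b :=
  (h.adj_iff.1 hab).resolve_right fun hc => ha (isLeaf_of_cycle hc).1

theorem cycle_of_isLeaf (h : Dec G A T rot) {a b : V} (hab : G.Adj a b) (ha : IsLeaf T a)
    (hb : IsLeaf T b) : (leafCycle T rot).Adj a b :=
  (h.adj_iff.1 hab).resolve_left fun hc => h.not_isLeaf_of_adj h.card ha hc hb

theorem tree_adj (h : Dec G A T rot) {a b : V} (hab : T.Adj a b) : G.Adj a b :=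
  h.adj_iff.2 (Or.inl hab)

theorem mem_of_adj (h : Dec G A T rot) {a b : V} (hab : G.Adj a b) : a ∈ A := by
  rcases h.adj_iff.1 hab with hab | hab
  · exact h.mem hab
  · exact h.mem_of_isLeaf (isLeaf_of_cycle hab).1

/-- With at least four vertices no tree edge joins two leaves, so the set of leaves determines both
parts of the decomposition. -/
theorem cyclePart_eq (h : Dec G A T rot) : cyclePart G {a | IsLeaf T a} = leafCycle T rot := by
  ext a b
  exact ⟨fun hab => h.cycle_of_isLeaf hab.1 hab.2.1 hab.2.2, fun hab =>
    ⟨h.adj_iff.2 (Or.inr hab), isLeaf_of_cycle hab⟩⟩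

theorem treePart_eq (h : Dec G A T rot) : treePart G {a | IsLeaf T a} = T := by
  rw [treePart, h.cyclePart_eq]
  ext a b
  rw [SimpleGraph.sdiff_adj, h.adj_iff]
  constructor
  · tauto
  · intro hab
    refine ⟨Or.inl hab, fun hc => ?_⟩
    have := isLeaf_of_cycle hc
    exact h.not_isLeaf_of_adj h.card this.1 hab this.2

theorem isDecomposition (h : Dec G Set.univ T rot) :
    IsDecomposition G (treePart G {a | IsLeaf T a}) (cyclePart G {a | IsLeaf T a}) := by
  rw [h.treePart_eq, h.cyclePart_eq]
  have hne : Nonempty V := by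
    by_contra hc
    rw [not_nonempty_iff] at hc
    have := h.card
    simp [Set.ncard_univ] at this
  refine ⟨⟨?_, h.acyclic⟩, by simpa [Set.ncard_univ] using h.card, h.degree, rot, h.rotation,
    rfl, h.eq⟩
  rw [SimpleGraph.connected_iff]
  exact ⟨fun a b => h.reach trivial trivial, hne⟩

theorem _root_.Halin.isHalin_iff_dec {G : SimpleGraph V} :
    IsHalin G ↔ ∃ T rot, Dec G Set.univ T rot := by
  constructor
  · rintro ⟨T, C, hT, h4, hd, rot, hr, rfl, hG⟩
    exact ⟨T, rot, ⟨⟨fun _ => trivial, fun {a b} _ _ => hT.1.preconnected a b, hT.2, hr⟩, hd,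
      by rwa [Set.ncard_univ], hG⟩⟩
  · rintro ⟨T, rot, h⟩
    exact ⟨_, _, h.isDecomposition⟩

/-- If `p` and `q` were inner, every edge of the triangle would be at an inner vertex and hence in
the tree. -/
theorem isLeaf_or_of_triangle (h : Dec G A T rot) {p q r : V} (hpq : G.Adj p q)
    (hqr : G.Adj q r) (hpr : G.Adj p r) : IsLeaf T p ∨ IsLeaf T q := by
  by_contra! hc
  have h1 := h.tree_of_not_isLeaf hpq hc.1
  have h2 := h.tree_of_not_isLeaf hpr hc.1
  have h3 := h.tree_of_not_isLeaf hqr hc.2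
  exact hqr.ne (eq_of_reachable_isolate h.acyclic h1 h2
    (SimpleGraph.Adj.reachable ⟨h3, hpq.ne', hpr.ne'⟩))

/-- The triangle is the whole leaf cycle, so the tree has only three leaves. -/
theorem star_of_leaf_triangle [Finite V] (h : Dec G A T rot) {p q r : V} (hpq : G.Adj p q)
    (hqr : G.Adj q r) (hpr : G.Adj p r) (hp : IsLeaf T p) (hq : IsLeaf T q) (hr : IsLeaf T r) :
    ∃ c, ¬ IsLeaf T c ∧ T.Adj c p ∧ T.Adj c q ∧ T.Adj c r ∧ A = {c, p, q, r} :=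
  h.star_of_three_leaves h.card h.degree fun _ ha =>
    h.eq_of_leafCycle_triangle (h.cycle_of_isLeaf hpq hp hq) (h.cycle_of_isLeaf hqr hq hr)
      (h.cycle_of_isLeaf hpr hp hr) ha

/-! ### Renaming vertices -/

theorem isLeaf_comap (e : V ≃ V) {a : V} : IsLeaf (T.comap e) a ↔ IsLeaf T (e a) := by
  have : (T.comap e).neighborSet a = e ⁻¹' T.neighborSet (e a) := rfl
  rw [IsLeaf, IsLeaf, this, Set.ncard_preimage_of_injective_subset_range e.injective
    (by simp)]

theorem nextLeaf_comap (e : V ≃ V) {a b : V} :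
    NextLeaf (T.comap e) (fun v u => e.symm (rot (e v) (e u))) a b ↔
      NextLeaf T rot (e a) (e b) := by
  have key : ∀ k a u, (faceStep fun v u => e.symm (rot (e v) (e u)))^[k] (a, u) =
      (e.symm ((faceStep rot)^[k] (e a, e u)).1, e.symm ((faceStep rot)^[k] (e a, e u)).2) := by
    intro k a u
    induction k with
    | zero => simp
    | succ k ih => rw [Function.iterate_succ_apply', ih, Function.iterate_succ_apply']; simp [faceStep]
  simp only [NextLeaf, isLeaf_comap, key, Equiv.apply_symm_apply, SimpleGraph.comap_adj]
  refine and_congr Iff.rfl (and_congr Iff.rfl ⟨?_, ?_⟩)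
  · rintro ⟨u, hu, k, hk, hb, hj⟩
    exact ⟨e u, hu, k, hk, by rw [← hb]; simp, hj⟩
  · rintro ⟨u, hu, k, hk, hb, hj⟩
    exact ⟨e.symm u, by simpa using hu, k, hk, by simp [hb], by simpa using hj⟩

/-- The algorithm names a collapsed triangle after the selected vertex, while the tree construction
naturally keeps the inner one. A transposition of names makes up the difference. -/
theorem comap (h : Dec G A T rot) (e : V ≃ V) :
    Dec (G.comap e) (e ⁻¹' A) (T.comap e) (fun v u => e.symm (rot (e v) (e u))) where
  mem := fun hab => h.mem hab
  reach := fun {a b} ha hb =>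
    (SimpleGraph.Iso.reachable_iff (φ := SimpleGraph.Iso.comap e T)).1 (h.reach ha hb)
  acyclic := h.acyclic.of_comap e.toEmbedding
  rotation := by
    refine isRotation_of_induct ?_ ?_
    · intro v a ha
      simpa using (h.rotation _ _ ha).1
    · intro v a b ha hb P hP hs
      have := h.rotation.induct (v := e v) ha hb (fun c => P (e.symm c)) (by simpa using hP) ?_
      · simpa using this
      · intro c hc hPc
        have := hs (e.symm c) (by simpa using hc) hPc
        simpa using this
  degree := by
    intro v
    have : (T.comap e).neighborSet v = e ⁻¹' T.neighborSet (e v) := rfl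
    rw [this, Set.ncard_preimage_of_injective_subset_range e.injective (by simp)]
    exact h.degree _
  card := by
    rw [Set.ncard_preimage_of_injective_subset_range e.injective (by simp)]
    exact h.card
  eq := by
    ext a b
    rw [SimpleGraph.comap_adj, h.adj_iff]
    refine or_congr Iff.rfl ?_
    simp only [PlaneTree.leafCycle_adj, nextLeaf_comap, ne_eq, EmbeddingLike.apply_eq_iff_eq]

end Dec

/-! ### Vertices of degree three and the paths of D3b -/

theorem eq_or_of_ncard_three {S : Set V} (hS : S.ncard = 3) {a b c y : V} (ha : a ∈ S) (hb : b ∈ S)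
    (hc : c ∈ S) (hab : a ≠ b) (hac : a ≠ c) (hbc : b ≠ c) (hy : y ∈ S) :
    y = a ∨ y = b ∨ y = c := by
  have hf : S.Finite := Set.finite_of_ncard_ne_zero (by omega)
  have h1 : ({a, b, c} : Set V) ⊆ S := by
    rintro z (rfl | rfl | rfl) <;> assumption
  have h2 : ({a, b, c} : Set V).ncard = 3 := Set.ncard_eq_three.2 ⟨a, b, c, hab, hac, hbc, rfl⟩
  have := Set.eq_of_subset_of_ncard_le h1 (by omega) hf
  rw [← this] at hy
  exact hy

theorem four_le_ncard [Finite V] {S : Set V} {a b c d : V} (ha : a ∈ S) (hb : b ∈ S)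
    (hc : c ∈ S) (hd : d ∈ S) (hab : a ≠ b) (hac : a ≠ c) (had : a ≠ d) (hbc : b ≠ c)
    (hbd : b ≠ d) (hcd : c ≠ d) : 4 ≤ S.ncard := by
  have h1 : ({a, b, c, d} : Set V) ⊆ S := by
    rintro z (rfl | rfl | rfl | rfl) <;> assumption
  have h2 : ({a, b, c, d} : Set V).ncard = 4 := by
    rw [Set.ncard_insert_of_notMem (by simp [hab, hac, had]),
      Set.ncard_insert_of_notMem (by simp [hbc, hbd]), Set.ncard_pair hcd]
  rw [← h2]
  exact Set.ncard_le_ncard h1 (Set.toFinite _)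

theorem IsD3b.symm {G : SimpleGraph V} {p q r x : V} (h : IsD3b G p q r x) : IsD3b G r q p x :=
  ⟨h.degree_r, h.degree_q, h.degree_p, h.ne_pr.symm, h.adj_qr.symm, h.adj_pq.symm,
    fun e => h.not_adj_pr e.symm, h.adj_sr, h.adj_sq, h.adj_sp⟩

theorem IsD3b.exists_outside {G : SimpleGraph V} {p q r x : V} (h : IsD3b G p q r x) :
    ∃ p', G.Adj p p' ∧ p' ≠ q ∧ p' ≠ x ∧ p' ≠ p ∧ p' ≠ r := by
  obtain ⟨t, ht, h1, h2⟩ := exists_third (T := G) (by rw [h.degree_p]; omega) h.adj_pq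
    h.adj_sp.symm h.adj_sq.ne'
  exact ⟨t, ht, h1, h2, ht.ne', fun e => h.not_adj_pr (e ▸ ht)⟩

theorem IsD3b.nbr_q {G : SimpleGraph V} {p q r x : V} (h : IsD3b G p q r x) {y : V} :
    G.Adj q y ↔ y = p ∨ y = r ∨ y = x := by
  constructor
  · intro hy
    exact eq_or_of_ncard_three h.degree_q h.adj_pq.symm h.adj_qr h.adj_sq.symm h.ne_pr
      h.adj_sp.ne' h.adj_sr.ne' hy
  · rintro (rfl | rfl | rfl)
    exacts [h.adj_pq.symm, h.adj_qr, h.adj_sq.symm]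

namespace Dec

variable {G T : SimpleGraph V} {A : Set V} {rot : V → V → V}

/-! ### Shortening a path -/

/-- Once the apex is known to be inner, each vertex of the path is a leaf because it lies in a
triangle with the apex and another vertex of the path. A leaf as apex is excluded by the third
neighbours of the ends and by the non-adjacency of `p` and `r`. -/
theorem isLeaf_of_isD3b [Finite V] (h : Dec G A T rot) {p q r x : V} (hd : IsD3b G p q r x) :
    IsLeaf T p ∧ IsLeaf T q ∧ IsLeaf T r ∧ ¬ IsLeaf T x := by
  have hx : ¬ IsLeaf T x := by
    intro hx
    -- If `p`, `q`, `x` were leaves, the tree would be a star with these leaves. Then `r` could only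
    -- be its centre, which is adjacent to `p`.
    have key : ∀ p r, IsD3b G p q r x → IsLeaf T q → ¬ IsLeaf T p := by
      intro p r hd hq hp
      obtain ⟨c, -, hcp, -, -, hA⟩ :=
        h.star_of_leaf_triangle hd.adj_pq hd.adj_sq.symm hd.adj_sp.symm hp hq hx
      have hr : r ∈ A := h.mem_of_adj hd.adj_sr.symm
      rw [hA] at hr
      rcases hr with rfl | rfl | rfl | hr
      · exact hd.not_adj_pr (h.tree_adj hcp).symm
      · exact hd.ne_pr rfl
      · exact hd.adj_qr.ne rfl
      · exact hd.adj_sr.ne' hr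
    by_cases hq : IsLeaf T q
    · exact hd.ne_pr (hq.eq (h.tree_of_not_isLeaf hd.adj_pq (key p r hd hq)).symm
        (h.tree_of_not_isLeaf hd.adj_qr.symm (key r p hd.symm hq)).symm)
    -- An inner `q` would have the leaves `p`, `r`, `x` as its only neighbours. The tree would
    -- consist of these four vertices, which leaves no room for the third neighbour of `p`.
    · have hp : IsLeaf T p :=
        (h.isLeaf_or_of_triangle hd.adj_pq hd.adj_sq.symm hd.adj_sp.symm).resolve_right hq
      have hr : IsLeaf T r :=
        (h.isLeaf_or_of_triangle hd.adj_qr.symm hd.adj_sq.symm hd.adj_sr.symm).resolve_right hq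
      obtain ⟨p', hp', h1, h2, h3, h4⟩ := hd.exists_outside
      have tq := h.tree_of_not_isLeaf hd.adj_pq.symm hq
      have hsub : A ⊆ {q, p, r, x} := by
        refine h.subset_of_closed (h.mem tq) (by simp) ?_
        rintro y z (rfl | rfl | rfl | rfl) hyz
        · exact Or.inr (hd.nbr_q.1 (h.tree_adj hyz))
        · exact Or.inl (hp.eq hyz tq.symm)
        · exact Or.inl (hr.eq hyz (h.tree_of_not_isLeaf hd.adj_qr hq).symm)
        · exact Or.inl (hx.eq hyz (h.tree_of_not_isLeaf hd.adj_sq.symm hq).symm)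
      rcases hsub (h.mem_of_adj hp'.symm) with e | e | e | e
      exacts [h1 e, h3 e, h4 e, h2 e]
  refine ⟨?_, ?_, ?_, hx⟩
  · exact (h.isLeaf_or_of_triangle hd.adj_sp hd.adj_pq hd.adj_sq).resolve_left hx
  · exact (h.isLeaf_or_of_triangle hd.adj_sq hd.adj_pq.symm hd.adj_sp).resolve_left hx
  · exact (h.isLeaf_or_of_triangle hd.adj_sr hd.adj_qr.symm hd.adj_sq).resolve_left hx

end Dec

/-- The new leaf subdivides the cycle edge from `u` to `w`. The hypothesis `hwu` excludes a cyclic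
order of only two leaves, where that edge would also arise in the opposite direction. -/
theorem Attach.leafCycle_insert [Finite V] {T : SimpleGraph V} {A : Set V} {rot : V → V → V}
    {x u v w : V} (h : Attach T A x u v) (ht : PlaneTree T A rot)
    (hx : ¬ IsLeaf T x) (hu : IsLeaf T u) (hw : NextLeaf T rot u w) (hwu : ¬ NextLeaf T rot w u)
    {a b : V} :
    (leafCycle (T ⊔ SimpleGraph.edge x v) (insertRot rot x u v)).Adj a b ↔
      (a = u ∧ b = v) ∨ (a = v ∧ b = u) ∨ (a = v ∧ b = w) ∨ (a = w ∧ b = v) ∨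
        ((leafCycle T rot).Adj a b ∧ ¬ (a = u ∧ b = w) ∧ ¬ (a = w ∧ b = u)) := by
  have hv : ∀ {c d}, NextLeaf T rot c d → c ≠ v ∧ d ≠ v := fun hcd =>
    ⟨fun e => h.not_mem (e ▸ ht.mem_of_isLeaf hcd.1), fun e =>
      h.not_mem (e ▸ ht.mem_of_isLeaf hcd.2.1)⟩
  have hu' : ∀ {d}, NextLeaf T rot u d ↔ d = w :=
    fun {d} => ⟨fun hd => hd.right_unique hw, fun e => e ▸ hw⟩
  have hw' : ∀ {c}, NextLeaf T rot c w → c = u := fun hc => hc.left_unique ht.rotation hw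
  have huv := h.uv
  have hwv := (hv hw).2
  simp only [PlaneTree.leafCycle_adj, h.nextLeaf_insert ht hx hu, hu']
  constructor
  · rintro ⟨hab, (h1 | h1 | h1) | (h1 | h1 | h1)⟩
    · tauto
    · tauto
    · right; right; right; right
      refine ⟨⟨hab, Or.inl h1.2⟩, fun e => h1.1 e.1, fun e => hwu (by rw [← e.1, ← e.2]; exact h1.2)⟩
    · tauto
    · tauto
    · right; right; right; right
      refine ⟨⟨hab, Or.inr h1.2⟩, fun e => hwu (by rw [← e.1, ← e.2]; exact h1.2), fun e => h1.1 e.2⟩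
  · rintro (⟨rfl, rfl⟩ | ⟨rfl, rfl⟩ | ⟨rfl, rfl⟩ | ⟨rfl, rfl⟩ | ⟨⟨hab, h1 | h1⟩, h2, h3⟩)
    · exact ⟨huv, by tauto⟩
    · exact ⟨huv.symm, by tauto⟩
    · exact ⟨hwv.symm, by tauto⟩
    · exact ⟨hwv, by tauto⟩
    · refine ⟨hab, Or.inl (Or.inr (Or.inr ⟨fun e => ?_, h1⟩))⟩
      subst e
      exact h2 ⟨rfl, hu'.1 h1⟩
    · refine ⟨hab, Or.inr (Or.inr (Or.inr ⟨fun e => ?_, h1⟩))⟩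
      subst e
      exact h3 ⟨hu'.1 h1, rfl⟩

namespace Dec

variable {G T : SimpleGraph V} {A : Set V} {rot : V → V → V}

/-- The leaf `q` is detached from the apex, and the cycle closes up from `p` to `r`. -/
theorem shorten_of_nextLeaf [Finite V] (h : Dec G A T rot) {p q r x : V} (hd : IsD3b G p q r x)
    (hpq : NextLeaf T rot p q) (hqr : NextLeaf T rot q r) :
    ∃ T' rot', Dec (isolate G {q} ⊔ SimpleGraph.edge p r) (A \ {q}) T' rot' ∧
      ∀ a, IsLeaf T a ↔ a = q ∨ IsLeaf T' a := by
  obtain ⟨hp, hq, hr, hx⟩ := h.isLeaf_of_isD3b hd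
  have txp := h.tree_of_not_isLeaf hd.adj_sp hx
  have txq := h.tree_of_not_isLeaf hd.adj_sq hx
  have txr := h.tree_of_not_isLeaf hd.adj_sr hx
  have rxp := hpq.rot_eq h.acyclic h.rotation txp txq
  obtain ⟨p', hp', hpq', hpx', hpp', hpr'⟩ := hd.exists_outside
  have hp'A := h.mem_of_adj hp'.symm
  have hpA := h.mem_of_adj hp'
  have hxA := h.mem_of_adj hd.adj_sp
  have hrA := h.mem_of_adj hd.adj_sr.symm
  obtain ⟨T', rot', hat, hTT, hrr, ht'⟩ := h.detach hq txq txp hd.adj_pq.ne rxp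
  have hleaf : ∀ {a}, IsLeaf T a ↔ a = q ∨ (a ≠ x ∧ IsLeaf T' a) := fun {a} => by
    rw [hTT]; exact hat.isLeaf_iff
  have hadj : ∀ {a b}, T.Adj a b ↔ T'.Adj a b ∨ (a = x ∧ b = q) ∨ (a = q ∧ b = x) :=
    fun {a b} => by rw [hTT]; exact hat.adj_iff
  have hp1 : IsLeaf T' p := ((hleaf.1 hp).resolve_left hd.adj_pq.ne).2
  have hr1 : IsLeaf T' r := ((hleaf.1 hr).resolve_left hd.adj_qr.ne').2
  have txr' : T'.Adj x r := by
    rcases hadj.1 txr with e | e | e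
    · exact e
    · exact absurd e.2 hd.adj_qr.ne'
    · exact absurd e.1 hd.adj_sq.ne
  have hx1 : ¬ IsLeaf T' x := fun hl => hd.ne_pr (hl.eq hat.adj txr')
  have hnext : ∀ {a b}, NextLeaf T rot a b ↔ (a = p ∧ b = q) ∨ (a = q ∧ NextLeaf T' rot' p b) ∨
      (a ≠ p ∧ NextLeaf T' rot' a b) := fun {a b} => by
    rw [hTT, hrr]; exact hat.nextLeaf_insert ht' hx1 hp1
  have hmem : ∀ {a}, IsLeaf T' a → a ≠ q := fun ha e => hat.not_mem (e ▸ ht'.mem_of_isLeaf ha)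
  have n1 : NextLeaf T' rot' p r := by
    rcases hnext.1 hqr with e | e | e
    · exact absurd e.1 hd.adj_pq.ne'
    · exact e.2
    · exact absurd rfl (hmem e.2.1)
  -- Such a step would already be an edge between `r` and `p` before the reduction.
  have n2 : ¬ NextLeaf T' rot' r p := fun hn =>
    hd.not_adj_pr (h.adj_iff.2 (Or.inr ⟨hd.ne_pr, Or.inr (hnext.2 (Or.inr (Or.inr
      ⟨hd.ne_pr.symm, hn⟩)))⟩))
  have hcyc : ∀ {a b}, (leafCycle T rot).Adj a b ↔ (a = p ∧ b = q) ∨ (a = q ∧ b = p) ∨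
      (a = q ∧ b = r) ∨ (a = r ∧ b = q) ∨
        ((leafCycle T' rot').Adj a b ∧ ¬ (a = p ∧ b = r) ∧ ¬ (a = r ∧ b = p)) := fun {a b} => by
    rw [hTT, hrr]; exact hat.leafCycle_insert ht' hx1 hp1 n1 n2
  refine ⟨T', rot', ⟨ht', ?_, ?_, ?_⟩, ?_⟩
  · intro v hv
    by_cases hvq : v = q
    · subst hvq
      have : T'.neighborSet v = ∅ := by
        ext b
        exact ⟨fun hb => hat.ne_left hb rfl, fun hb => hb.elim⟩
      rw [this] at hv
      simp at hv
    · by_cases hvx : v = x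
      · subst hvx
        -- If the apex were left with two tree neighbours, the tree would consist of the apex, `p`
        -- and `r`. But the outside neighbour `p'` of `p` is a fourth vertex.
        have hN : ∀ y, T'.Adj v y → y = p ∨ y = r := by
          intro y hy
          by_contra! hc
          have h3 := Set.ncard_eq_three.2 ⟨p, r, y, hd.ne_pr, hc.1.symm, hc.2.symm, rfl⟩
          have h4 : ({p, r, y} : Set V) ⊆ T'.neighborSet v := by
            rintro z (rfl | rfl | rfl)
            exacts [hat.adj, txr', hy]
          have := Set.ncard_le_ncard h4 (Set.toFinite _)
          omega
        have hsub : A \ {q} ⊆ {v, p, r} := by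
          refine ht'.subset_of_closed hat.x_mem (by simp) ?_
          rintro y z (rfl | rfl | rfl) hyz
          · exact Or.inr (hN z hyz)
          · exact Or.inl (hp1.eq hyz hat.adj.symm)
          · exact Or.inl (hr1.eq hyz txr'.symm)
        rcases hsub ⟨hp'A, hpq'⟩ with e | e | e
        exacts [hpx' e, hpp' e, hpr' e]
      · have := hat.neighborSet_of_ne hvx hvq
        rw [← hTT] at this
        rw [← this] at hv
        exact h.degree v hv
  · exact four_le_ncard (a := p) (b := r) (c := x) (d := p') ⟨hpA, hd.adj_pq.ne⟩
      ⟨hrA, hd.adj_qr.ne'⟩ ⟨hxA, hd.adj_sq.ne⟩ ⟨hp'A, hpq'⟩ hd.ne_pr hd.adj_sp.ne' hpp'.symm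
      hd.adj_sr.ne' hpr'.symm hpx'.symm
  · ext a b
    have c1 : (leafCycle T' rot').Adj p r := ⟨hd.ne_pr, Or.inl n1⟩
    have c2 : ∀ {a b}, (leafCycle T' rot').Adj a b → a ≠ q ∧ b ≠ q := fun hab =>
      ⟨hmem (isLeaf_of_cycle hab).1, hmem (isLeaf_of_cycle hab).2⟩
    have t2 : ∀ {a b}, T'.Adj a b → a ≠ q ∧ b ≠ q := fun hab =>
      ⟨hat.ne_left hab, hat.ne_right hab⟩
    simp only [SimpleGraph.sup_adj, isolate_adj, SimpleGraph.edge_adj, h.adj_iff, hadj, hcyc,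
      Set.mem_singleton_iff]
    constructor
    · rintro (⟨h1, h2, h3⟩ | ⟨⟨rfl, rfl⟩ | ⟨rfl, rfl⟩, -⟩)
      · rcases h1 with (h1 | h1 | h1) | h1 | h1 | h1 | h1 | h1
        exacts [Or.inl h1, absurd h1.2 h3, absurd h1.1 h2, absurd h1.2 h3, absurd h1.1 h2,
          absurd h1.1 h2, absurd h1.2 h3, Or.inr h1.1]
      · exact Or.inr c1
      · exact Or.inr c1.symm
    · rintro (h1 | h1)
      · exact Or.inl ⟨Or.inl (Or.inl h1), t2 h1⟩
      · by_cases e : (a = p ∧ b = r) ∨ (a = r ∧ b = p)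
        · exact Or.inr ⟨e, h1.ne⟩
        · rw [not_or] at e
          exact Or.inl ⟨Or.inr (Or.inr (Or.inr (Or.inr (Or.inr ⟨h1, e⟩)))), c2 h1⟩
  · intro a
    rw [hleaf]
    constructor
    · tauto
    · rintro (e | e)
      · exact Or.inl e
      · exact Or.inr ⟨fun e' => hx1 (e' ▸ e), e⟩

theorem shorten [Finite V] (h : Dec G A T rot) {p q r x : V} (hd : IsD3b G p q r x) :
    ∃ T' rot', Dec (isolate G {q} ⊔ SimpleGraph.edge p r) (A \ {q}) T' rot' ∧
      ∀ a, IsLeaf T a ↔ a = q ∨ IsLeaf T' a := by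
  obtain ⟨hp, hq, hr, hx⟩ := h.isLeaf_of_isD3b hd
  rcases (h.cycle_of_isLeaf hd.adj_pq hp hq).2 with h1 | h1
  · refine h.shorten_of_nextLeaf hd h1 ((h.cycle_of_isLeaf hd.adj_qr hq hr).2.resolve_right ?_)
    exact fun h2 => hd.ne_pr (h1.left_unique h.rotation h2)
  · rw [SimpleGraph.edge_comm]
    refine h.shorten_of_nextLeaf hd.symm
      ((h.cycle_of_isLeaf hd.adj_qr hq hr).2.resolve_left ?_) h1
    exact fun h2 => hd.ne_pr (h1.right_unique h2)

/-- The reversal attaches `q` to the apex immediately after `p`, which subdivides the cycle edge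
from `p` to `r`. -/
theorem unshorten_of_nextLeaf [Finite V] {G' : SimpleGraph V} {p q r x : V}
    (h : Dec G' (A \ {q}) T rot) (hG' : G' = isolate G {q} ⊔ SimpleGraph.edge p r)
    (hd : IsD3b G p q r x) (hq : q ∈ A) (hp : IsLeaf T p)
    (hx : ¬ IsLeaf T x) (hpr : NextLeaf T rot p r) :
    ∃ T₁ rot₁, Dec G A T₁ rot₁ ∧ ∀ a, IsLeaf T₁ a ↔ a = q ∨ IsLeaf T a := by
  have g1 : ∀ {a b}, G'.Adj a b ↔ (G.Adj a b ∧ a ≠ q ∧ b ≠ q) ∨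
      (a = p ∧ b = r) ∨ (a = r ∧ b = p) := by
    intro a b
    have := hd.ne_pr
    simp only [hG', SimpleGraph.sup_adj, isolate_adj, SimpleGraph.edge_adj, Set.mem_singleton_iff]
    grind
  have txp : T.Adj x p :=
    h.tree_of_not_isLeaf (g1.2 (Or.inl ⟨hd.adj_sp, hd.adj_sq.ne, hd.adj_pq.ne⟩)) hx
  have txr : T.Adj x r :=
    h.tree_of_not_isLeaf (g1.2 (Or.inl ⟨hd.adj_sr, hd.adj_sq.ne, hd.adj_qr.ne'⟩)) hx
  have hat : Attach T (A \ {q}) x p q := ⟨h.mem, by simp, txp⟩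
  have hA : insert q (A \ {q}) = A := by
    ext a
    simp only [Set.mem_insert_iff, Set.mem_sdiff, Set.mem_singleton_iff]
    constructor
    · rintro (rfl | ha)
      exacts [hq, ha.1]
    · tauto
  -- Otherwise the rotation at `x` would exchange `p` and `r`, and `x` would have degree two.
  have n2 : ¬ NextLeaf T rot r p := by
    intro hn
    have e1 := hpr.rot_eq h.acyclic h.rotation txp txr
    have e2 := hn.rot_eq h.acyclic h.rotation txr txp
    have hN : T.neighborSet x = {p, r} := by
      ext y
      constructor
      · intro hy
        refine h.rotation.induct txp hy (fun c => c = p ∨ c = r) (Or.inl rfl) ?_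
        rintro c - (rfl | rfl)
        · exact Or.inr e1
        · exact Or.inl e2
      · rintro (rfl | rfl)
        exacts [txp, txr]
    exact h.degree x (by rw [hN, Set.ncard_pair hd.ne_pr])
  have ht := hat.planeTree h.toPlaneTree
  rw [hA] at ht
  refine ⟨_, _, ⟨ht, ?_, ?_, ?_⟩, ?_⟩
  · intro v
    by_cases hvq : v = q
    · subst hvq
      have := hat.isLeaf_v
      unfold IsLeaf at this
      omega
    · by_cases hvx : v = x
      · subst hvx
        rw [hat.ncard_neighborSet_x]
        unfold IsLeaf at hx
        omega
      · rw [hat.neighborSet_of_ne hvx hvq]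
        exact h.degree v
  · exact h.card.trans (Set.ncard_le_ncard Set.sdiff_subset (Set.toFinite _))
  · ext a b
    have c1 := hat.leafCycle_insert h.toPlaneTree hx hp hpr n2 (a := a) (b := b)
    have g2 := g1 (a := a) (b := b)
    rw [h.adj_iff] at g2
    rw [SimpleGraph.sup_adj, hat.adj_iff, c1]
    have k1 := hd.nbr_q (y := a)
    have k2 := hd.nbr_q (y := b)
    have k3 := G.adj_comm q a
    have k4 : T.Adj a b → a ≠ q ∧ b ≠ q := fun hab => ⟨hat.ne_left hab, hat.ne_right hab⟩
    have k5 : (leafCycle T rot).Adj a b → a ≠ q ∧ b ≠ q := fun hab =>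
      ⟨fun e => hat.not_mem (e ▸ h.mem_of_isLeaf (isLeaf_of_cycle hab).1),
        fun e => hat.not_mem (e ▸ h.mem_of_isLeaf (isLeaf_of_cycle hab).2)⟩
    have k6 : T.Adj a b → ¬ (a = p ∧ b = r) ∧ ¬ (a = r ∧ b = p) := by
      refine fun hab => ⟨?_, ?_⟩
      · rintro ⟨rfl, rfl⟩
        exact h.not_isLeaf_of_adj h.card hp hab hpr.2.1
      · rintro ⟨rfl, rfl⟩
        exact h.not_isLeaf_of_adj h.card hp hab.symm hpr.2.1
    have k7 : G.Adj a b → ¬ (a = p ∧ b = r) ∧ ¬ (a = r ∧ b = p) := by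
      refine fun hab => ⟨?_, ?_⟩
      · rintro ⟨rfl, rfl⟩
        exact hd.not_adj_pr hab
      · rintro ⟨rfl, rfl⟩
        exact hd.not_adj_pr hab.symm
    have := hd.adj_pq.ne
    have := hd.adj_qr.ne
    have := hd.adj_sq.ne
    have k8 := G.adj_comm a b
    generalize T.Adj a b = X1 at *
    generalize (leafCycle T rot).Adj a b = X2 at *
    generalize hX3 : G.Adj a b = X3 at *
    clear hd h ht hat c1 hpr n2 txp txr hp hx g1 hG' hA
    grind
  · intro a
    rw [hat.isLeaf_iff]
    constructor
    · tauto
    · rintro (e | e)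
      · exact Or.inl e
      · exact Or.inr ⟨fun e' => hx (e' ▸ e), e⟩

theorem unshorten [Finite V] {G' : SimpleGraph V} {p q r x : V}
    (h : Dec G' (A \ {q}) T rot) (hG' : G' = isolate G {q} ⊔ SimpleGraph.edge p r)
    (hd : IsD3b G p q r x) (hq : q ∈ A) (hp : IsLeaf T p) (hr : IsLeaf T r)
    (hx : ¬ IsLeaf T x) :
    ∃ T₁ rot₁, Dec G A T₁ rot₁ ∧ ∀ a, IsLeaf T₁ a ↔ a = q ∨ IsLeaf T a := by
  have hpr : G'.Adj p r := by
    rw [hG']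
    simp [SimpleGraph.edge_adj, hd.ne_pr]
  rcases (h.cycle_of_isLeaf hpr hp hr).2 with h1 | h1
  · exact h.unshorten_of_nextLeaf hG' hd hq hp hx h1
  · rw [SimpleGraph.edge_comm] at hG'
    exact h.unshorten_of_nextLeaf hG' hd.symm hq hr hx h1

end Dec

/-! ### Collapsing a triangle -/

/-- The triangle `p q r` is replaced by the vertex `o`. -/
def collapseGraph (G : SimpleGraph V) (p q r o p' q' r' : V) : SimpleGraph V :=
  isolate G {p, q, r} ⊔ SimpleGraph.edge o p' ⊔ SimpleGraph.edge o q' ⊔ SimpleGraph.edge o r'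

namespace IsD3a

variable {G : SimpleGraph V} {p q r p' q' r' : V}

theorem rotate (h : IsD3a G p q r p' q' r') : IsD3a G q r p q' r' p' where
  degree_p := h.degree_q
  degree_q := h.degree_r
  degree_r := h.degree_p
  nbr_p := by rw [h.nbr_q, Set.insert_comm]
  nbr_q := by rw [h.nbr_r, Set.insert_comm]
  nbr_r := h.nbr_p
  ne_pq := h.ne_qr
  ne_pr := h.ne_pq.symm
  ne_qr := h.ne_pr.symm

theorem swap (h : IsD3a G p q r p' q' r') : IsD3a G q p r q' p' r' where
  degree_p := h.degree_q
  degree_q := h.degree_p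
  degree_r := h.degree_r
  nbr_p := h.nbr_q
  nbr_q := h.nbr_p
  nbr_r := by rw [h.nbr_r, Set.insert_comm]
  ne_pq := h.ne_pq.symm
  ne_pr := h.ne_qr
  ne_qr := h.ne_pr

theorem adj_p (h : IsD3a G p q r p' q' r') {y : V} : G.Adj p y ↔ y = q ∨ y = r ∨ y = p' := by
  rw [← SimpleGraph.mem_neighborSet, h.nbr_p]
  exact Iff.rfl

theorem adj_q (h : IsD3a G p q r p' q' r') {y : V} : G.Adj q y ↔ y = p ∨ y = r ∨ y = q' := by
  rw [← SimpleGraph.mem_neighborSet, h.nbr_q]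
  exact Iff.rfl

theorem adj_r (h : IsD3a G p q r p' q' r') {y : V} : G.Adj r y ↔ y = p ∨ y = q ∨ y = r' := by
  rw [← SimpleGraph.mem_neighborSet, h.nbr_r]
  exact Iff.rfl

theorem distinct (h : IsD3a G p q r p' q' r') : p ≠ q ∧ p ≠ r ∧ q ≠ r ∧ p' ≠ p ∧ p' ≠ q ∧ p' ≠ r := by
  have h1 : G.Adj p q := h.adj_p.2 (by simp)
  have h2 : G.Adj p r := h.adj_p.2 (by simp)
  have h3 : G.Adj p p' := h.adj_p.2 (by simp)
  have h4 : G.Adj q r := h.adj_q.2 (by simp)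
  have hd := h.degree_p
  rw [h.nbr_p] at hd
  refine ⟨h1.ne, h2.ne, h4.ne, h3.ne', ?_, ?_⟩
  · rintro rfl
    rw [Set.insert_comm, Set.pair_eq_singleton] at hd
    have := Set.ncard_insert_le r {p'}
    rw [Set.ncard_singleton] at this
    omega
  · rintro rfl
    rw [Set.pair_eq_singleton] at hd
    have := Set.ncard_insert_le q {p'}
    rw [Set.ncard_singleton] at this
    omega

theorem collapse_adj (h : IsD3a G p q r p' q' r') {o : V} (ho : o = p ∨ o = q ∨ o = r) {a b : V} :
    (collapseGraph G p q r o p' q' r').Adj a b ↔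
      (G.Adj a b ∧ (a ≠ p ∧ a ≠ q ∧ a ≠ r) ∧ (b ≠ p ∧ b ≠ q ∧ b ≠ r)) ∨
      (a = o ∧ (b = p' ∨ b = q' ∨ b = r')) ∨ (b = o ∧ (a = p' ∨ a = q' ∨ a = r')) := by
  have d1 := h.distinct
  have d2 := h.rotate.distinct
  have d3 := h.rotate.rotate.distinct
  simp only [collapseGraph, SimpleGraph.sup_adj, isolate_adj, SimpleGraph.edge_adj,
    Set.mem_insert_iff, Set.mem_singleton_iff]
  grind

end IsD3a

theorem collapseGraph_rotate (G : SimpleGraph V) (p q r o p' q' r' : V) :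
    collapseGraph G q r p o q' r' p' = collapseGraph G p q r o p' q' r' := by
  unfold collapseGraph
  rw [show ({q, r, p} : Set V) = {p, q, r} by ext; simp; tauto]
  rw [sup_assoc, sup_assoc, sup_assoc, sup_assoc, sup_comm (SimpleGraph.edge o p'), sup_assoc]

theorem collapseGraph_swap (G : SimpleGraph V) (p q r o p' q' r' : V) :
    collapseGraph G q p r o q' p' r' = collapseGraph G p q r o p' q' r' := by
  unfold collapseGraph
  rw [Set.insert_comm, sup_right_comm (isolate G _)]

theorem IsD3a.collapse_comap [DecidableEq V] {G : SimpleGraph V} {p q r p' q' r' o i : V}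
    (h : IsD3a G p q r p' q' r') (ho : o = p ∨ o = q ∨ o = r) (hi : i = p ∨ i = q ∨ i = r) :
    (collapseGraph G p q r i p' q' r').comap (Equiv.swap o i) =
      collapseGraph G p q r o p' q' r' := by
  have d1 := h.distinct
  have d2 := h.rotate.distinct
  have d3 := h.rotate.rotate.distinct
  have key : ∀ a, a ≠ p ∧ a ≠ q ∧ a ≠ r → Equiv.swap o i a = a := fun a ha =>
    Equiv.swap_apply_of_ne_of_ne (by grind) (by grind)
  have key2 : ∀ a, a = p ∨ a = q ∨ a = r →
      (Equiv.swap o i a = p ∨ Equiv.swap o i a = q ∨ Equiv.swap o i a = r) := by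
    intro a ha
    rw [Equiv.swap_apply_def]
    split_ifs <;> assumption
  have key3 : ∀ a, Equiv.swap o i a = i ↔ a = o := by
    intro a
    rw [Equiv.swap_apply_eq_iff, Equiv.swap_apply_right]
  have key4 : ∀ a, a = p ∨ a = q ∨ a = r → ¬ (a = p' ∨ a = q' ∨ a = r') := by grind
  have key5 : ∀ a, a = p ∨ a = q ∨ a = r → ¬ (a ≠ p ∧ a ≠ q ∧ a ≠ r) := by tauto
  ext a b
  rw [SimpleGraph.comap_adj, h.collapse_adj hi, h.collapse_adj ho, key3, key3]
  by_cases ha : a = p ∨ a = q ∨ a = r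
  · have ha' := key2 a ha
    by_cases hb : b = p ∨ b = q ∨ b = r
    · have hb' := key2 b hb
      simp only [key5 _ ha, key5 _ ha', key4 _ ha, key4 _ ha', key4 _ hb, key4 _ hb', and_false,
        false_and]
    · push Not at hb
      rw [key b hb]
      simp only [key5 _ ha, key5 _ ha', key4 _ ha, key4 _ ha', and_false, false_and]
  · push Not at ha
    rw [key a ha]
    by_cases hb : b = p ∨ b = q ∨ b = r
    · have hb' := key2 b hb
      simp only [key5 _ hb, key5 _ hb', key4 _ hb, key4 _ hb', and_false]
    · push Not at hb
      rw [key b hb]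

theorem Attach.nextLeaf_extend' [Finite V] {T : SimpleGraph V} {A : Set V} {rot : V → V → V}
    {i y p s t : V} (h : Attach T A i y p) (ht : PlaneTree T A rot) (hi : IsLeaf T i)
    (hs : NextLeaf T rot s i) (htt : NextLeaf T rot i t) {a b : V} :
    NextLeaf (T ⊔ SimpleGraph.edge i p) (insertRot rot i y p) a b ↔
      (a = p ∧ b = t) ∨ (b = p ∧ a = s) ∨ (a ≠ i ∧ b ≠ i ∧ NextLeaf T rot a b) := by
  classical
  rw [h.nextLeaf_extend ht hi]
  have hsi := ht.nextLeaf_ne hs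
  have hti := ht.nextLeaf_ne htt
  constructor
  · rintro ⟨a', b', hab, rfl, rfl⟩
    split_ifs with h1 h2 h2
    · rw [h1, h2] at hab; exact absurd rfl (ht.nextLeaf_ne hab)
    · rw [h1] at hab
      exact Or.inl ⟨rfl, hab.right_unique htt⟩
    · rw [h2] at hab
      exact Or.inr (Or.inl ⟨rfl, hab.left_unique ht.rotation hs⟩)
    · exact Or.inr (Or.inr ⟨h1, h2, hab⟩)
  · rintro (⟨rfl, rfl⟩ | ⟨rfl, rfl⟩ | ⟨h1, h2, hab⟩)
    · exact ⟨i, b, htt, by simp, by simp [hti.symm]⟩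
    · exact ⟨a, i, hs, by simp [hsi], by simp⟩
    · exact ⟨a, b, hab, by simp [h1], by simp [h2]⟩

/-- The leaf `i` becomes the parent of two new leaves `p` and `q`. -/
theorem Attach.leafCycle_split [Finite V] {T : SimpleGraph V} {A : Set V} {rot : V → V → V}
    {i y p q s t : V} (h : Attach T A i y p)
    (h2 : Attach (T ⊔ SimpleGraph.edge i p) (insert p A) i p q)
    (ht : PlaneTree T A rot) (hi : IsLeaf T i)
    (hs : NextLeaf T rot s i) (htt : NextLeaf T rot i t) {a b : V} :
    (leafCycle (T ⊔ SimpleGraph.edge i p ⊔ SimpleGraph.edge i q)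
      (insertRot (insertRot rot i y p) i p q)).Adj a b ↔
      (a = p ∧ b = q) ∨ (a = q ∧ b = p) ∨ (a = q ∧ b = t) ∨ (a = t ∧ b = q) ∨
      (a = p ∧ b = s) ∨ (a = s ∧ b = p) ∨ (a ≠ i ∧ b ≠ i ∧ (leafCycle T rot).Adj a b) := by
  have hv : ∀ {c d}, NextLeaf T rot c d → (c ≠ p ∧ d ≠ p) ∧ (c ≠ q ∧ d ≠ q) := fun hcd => by
    have m1 := ht.mem_of_isLeaf hcd.1
    have m2 := ht.mem_of_isLeaf hcd.2.1
    exact ⟨⟨fun e => h.not_mem (e ▸ m1), fun e => h.not_mem (e ▸ m2)⟩,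
      ⟨fun e => h2.not_mem (e ▸ Or.inr m1), fun e => h2.not_mem (e ▸ Or.inr m2)⟩⟩
  have hpq : p ≠ q := h2.uv
  have k1 := hv hs
  have k2 := hv htt
  have k3 := hv (c := a) (d := b)
  have k4 := hv (c := b) (d := a)
  have k5 := h.xv
  have k6 : ∀ c, ¬ NextLeaf T rot p c := fun c hc => (hv hc).1.1 rfl
  simp only [PlaneTree.leafCycle_adj,
    h2.nextLeaf_insert (h.planeTree ht) h.not_isLeaf_x h.isLeaf_v, h.nextLeaf_extend' ht hi hs htt, k6]
  generalize NextLeaf T rot a b = X1 at *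
  generalize NextLeaf T rot b a = X2 at *
  clear hv h h2 ht hi hs htt k6
  grind

namespace Dec

variable {G T : SimpleGraph V} {A : Set V} {rot : V → V → V} {p q r p' q' r' : V}

/-- Three leaves would have their common parent as the outside neighbour of each, but the outside
neighbours are distinct. -/
theorem not_isLeaf_of_isD3a [Finite V] (h : Dec G A T rot) (hd : IsD3a G p q r p' q' r') :
    ¬ (IsLeaf T p ∧ IsLeaf T q ∧ IsLeaf T r) := by
  rintro ⟨hp, hq, hr⟩
  have d1 := hd.distinct
  have d2 := hd.rotate.distinct
  obtain ⟨c, -, -, -, -, hA⟩ := h.star_of_leaf_triangle (hd.adj_p.2 (by simp))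
    (hd.adj_q.2 (by simp)) (hd.adj_p.2 (by simp)) hp hq hr
  have h1 : p' ∈ A := h.mem_of_adj (hd.adj_p.2 (by simp) : G.Adj p p').symm
  have h2 : q' ∈ A := h.mem_of_adj (hd.adj_q.2 (by simp) : G.Adj q q').symm
  have h3 := hd.ne_pq
  rw [hA] at h1 h2
  simp only [Set.mem_insert_iff, Set.mem_singleton_iff] at h1 h2
  grind

/-- Acyclicity allows at most one inner vertex in the triangle, and the three vertices are not all
leaves. -/
theorem isLeaf_of_isD3a [Finite V] (h : Dec G A T rot) (hd : IsD3a G p q r p' q' r') :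
    (¬ IsLeaf T p ∧ IsLeaf T q ∧ IsLeaf T r) ∨ (IsLeaf T p ∧ ¬ IsLeaf T q ∧ IsLeaf T r) ∨
      (IsLeaf T p ∧ IsLeaf T q ∧ ¬ IsLeaf T r) := by
  have h0 := h.not_isLeaf_of_isD3a hd
  have hpq : G.Adj p q := hd.adj_p.2 (by simp)
  have hpr : G.Adj p r := hd.adj_p.2 (by simp)
  have hqr : G.Adj q r := hd.adj_q.2 (by simp)
  have h1 := h.isLeaf_or_of_triangle hpq hqr hpr
  have h2 := h.isLeaf_or_of_triangle hqr hpr.symm hpq.symm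
  have h3 := h.isLeaf_or_of_triangle hpr hqr.symm hpq
  tauto

/-- The tree edge at the leaf `p` goes to `r`, so the edge to `p'` belongs to the cycle. -/
theorem isLeaf_outside (h : Dec G A T rot) (hd : IsD3a G p q r p' q' r') (hp : IsLeaf T p)
    (hr : ¬ IsLeaf T r) : IsLeaf T p' := by
  have h1 : T.Adj p r := (h.tree_of_not_isLeaf (hd.adj_r.2 (by simp)) hr).symm
  rcases h.adj_iff.1 (hd.adj_p.2 (by simp) : G.Adj p p') with h2 | h2
  · exact absurd (hp.eq h2 h1) hd.distinct.2.2.2.2.2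
  · exact (isLeaf_of_cycle h2).2

/-- The leaves `p` and `q` are stripped from their parent `r`, which becomes a leaf and takes their
place on the cycle. -/
theorem collapse_of_nextLeaf [Finite V] (h : Dec G A T rot) (hd : IsD3a G p q r p' q' r')
    (hr : ¬ IsLeaf T r) (hpq : NextLeaf T rot p q) :
    ∃ T₁ rot₁, Dec (collapseGraph G p q r r p' q' r') (A \ {p, q}) T₁ rot₁ ∧
      ∀ a, IsLeaf T₁ a ↔ a = r ∨ (a ≠ p ∧ a ≠ q ∧ IsLeaf T a) := by
  have hp := hpq.1
  have hq := hpq.2.1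
  have d1 := hd.distinct
  have d2 := hd.rotate.distinct
  have d3 := hd.rotate.rotate.distinct
  have n1 := hd.ne_pq
  have n2 := hd.ne_pr
  have n3 := hd.ne_qr
  have trp : T.Adj r p := h.tree_of_not_isLeaf (hd.adj_r.2 (by simp)) hr
  have trq : T.Adj r q := h.tree_of_not_isLeaf (hd.adj_r.2 (by simp)) hr
  have trr : T.Adj r r' := h.tree_of_not_isLeaf (hd.adj_r.2 (by simp)) hr
  have hp' := h.isLeaf_outside hd hp hr
  have hq' := h.isLeaf_outside hd.swap hq hr
  have hpA := h.mem trp.symm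
  have hrA := h.mem trp
  have hr'A := h.mem trr.symm
  have np : NextLeaf T rot p' p := by
    refine (h.cycle_of_isLeaf (hd.adj_p.2 (by simp)) hp hp').2.resolve_left fun e => ?_
    exact d1.2.2.2.2.1 (e.right_unique hpq)
  have nq : NextLeaf T rot q q' := by
    refine (h.cycle_of_isLeaf (hd.adj_q.2 (by simp)) hq hq').2.resolve_right fun e => ?_
    exact d2.2.2.2.2.2 (e.left_unique h.rotation hpq)
  have rot1 := hpq.rot_eq h.acyclic h.rotation trp trq
  -- The only neighbours of `r` are `p`, `q`, `r'`, so the order at `r` is `r'`, `p`, `q`. This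
  -- prepares the detachment of `q` after `p`, and then of `p` after `r'`.
  have rot2 : rot r r' = p := by
    have e1 := (h.rotation _ _ trr).1
    have e2 := h.rotation.ne trr trp d3.2.2.2.2.1.symm
    rcases hd.adj_r.1 (h.tree_adj e1) with e | e | e
    · exact e
    · exact absurd (h.rotation.inj trr trp (e.trans rot1.symm)) d3.2.2.2.2.1
    · exact absurd e e2
  obtain ⟨T₂, rot₂, hat₂, hT₂, hr₂, ht₂⟩ := h.detach hq trq trp d1.1 rot1
  have hadj₂ : ∀ {a b}, T.Adj a b ↔ T₂.Adj a b ∨ (a = r ∧ b = q) ∨ (a = q ∧ b = r) :=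
    fun {a b} => by rw [hT₂]; exact hat₂.adj_iff
  have hleaf₂ : ∀ {a}, IsLeaf T a ↔ a = q ∨ (a ≠ r ∧ IsLeaf T₂ a) := fun {a} => by
    rw [hT₂]; exact hat₂.isLeaf_iff
  have trr₂ : T₂.Adj r r' := by
    rcases hadj₂.1 trr with e | e | e
    · exact e
    · exact absurd e.2 d3.2.2.2.2.2
    · exact absurd e.1.symm d1.2.2.1
  have hp₂ : IsLeaf T₂ p := ((hleaf₂.1 hp).resolve_left d1.1).2
  have rot2' : rot₂ r r' = p := by
    rw [← rot2, hr₂, Attach.rot_of_ne (fun e => d3.2.2.2.2.1 e.2) hat₂.xv d3.2.2.2.2.2]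
  obtain ⟨T₁, rot₁, hat₁, hT₁, hr₁, ht₁⟩ :=
    ht₂.detach hp₂ hat₂.adj trr₂ d3.2.2.2.2.1 rot2'
  have hAA : (A \ {q}) \ {p} = A \ {p, q} := by
    ext a; simp only [Set.mem_sdiff, Set.mem_singleton_iff, Set.mem_insert_iff]; tauto
  have hadj₁ : ∀ {a b}, T₂.Adj a b ↔ T₁.Adj a b ∨ (a = r ∧ b = p) ∨ (a = p ∧ b = r) :=
    fun {a b} => by rw [hT₁]; exact hat₁.adj_iff
  have hleaf₁ : ∀ {a}, IsLeaf T₂ a ↔ a = p ∨ (a ≠ r ∧ IsLeaf T₁ a) := fun {a} => by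
    rw [hT₁]; exact hat₁.isLeaf_iff
  have hins : insert p ((A \ {q}) \ {p}) = A \ {q} := by
    ext a
    simp only [Set.mem_sdiff, Set.mem_singleton_iff, Set.mem_insert_iff]
    constructor
    · rintro (rfl | e)
      exacts [⟨hpA, d1.1⟩, e.1]
    · tauto
  have hat₂' : Attach (T₁ ⊔ SimpleGraph.edge r p) (insert p ((A \ {q}) \ {p})) r p q := by
    rw [hins, ← hT₁]; exact hat₂
  have m1 : ∀ {a}, a ∈ (A \ {q}) \ {p} → a ≠ p ∧ a ≠ q := fun ha => ⟨ha.2, ha.1.2⟩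
  have tr1 : ∀ {y}, T₁.Adj r y → y = r' := by
    intro y hy
    have := m1 (hat₁.mem_right hy)
    rcases hd.adj_r.1 (h.tree_adj (hadj₂.2 (Or.inl (hadj₁.2 (Or.inl hy))))) with e | e | e
    exacts [absurd e this.1, absurd e this.2, e]
  have hleafr : IsLeaf T₁ r := isLeaf_of_forall hat₁.adj fun _ => tr1
  have nx2 : ∀ {a b}, NextLeaf T rot a b ↔ (a = p ∧ b = q) ∨ (a = q ∧ NextLeaf T₂ rot₂ p b) ∨
      (a ≠ p ∧ NextLeaf T₂ rot₂ a b) := fun {a b} => by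
    rw [hT₂, hr₂]
    exact hat₂.nextLeaf_insert ht₂ (by rw [hT₁]; exact hat₁.not_isLeaf_x) hp₂
  classical
  have nx1 : ∀ {a b}, NextLeaf T₂ rot₂ a b ↔ ∃ a' b', NextLeaf T₁ rot₁ a' b' ∧
      a = (if a' = r then p else a') ∧ b = (if b' = r then p else b') := fun {a b} => by
    rw [hT₁, hr₁]
    exact hat₁.nextLeaf_extend ht₁ hleafr
  -- Following the cyclic order through both detachments shows that `r` now lies between `p'` and
  -- `q'`.
  have ns : NextLeaf T₁ rot₁ p' r := by
    rcases nx2.1 np with e | e | e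
    · exact absurd e.1 d1.2.2.2.1
    · exact absurd e.1 d1.2.2.2.2.1
    · obtain ⟨a', b', hab, e1, e2⟩ := nx1.1 e.2
      have hb := m1 (ht₁.mem_of_isLeaf hab.2.1)
      split_ifs at e1 e2 with i1 i2 i2
      · exact absurd e1 d1.2.2.2.1
      · exact absurd e1 d1.2.2.2.1
      · rw [e1, ← i2]; exact hab
      · exact absurd e2.symm hb.1
  have nt : NextLeaf T₁ rot₁ r q' := by
    rcases nx2.1 nq with e | e | e
    · exact absurd e.1 d1.1.symm
    · obtain ⟨a', b', hab, e1, e2⟩ := nx1.1 e.2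
      have ha := m1 (ht₁.mem_of_isLeaf hab.1)
      split_ifs at e1 e2 with i1 i2 i2
      · exact absurd e2 d2.2.2.2.2.2
      · rw [e2, ← i1]; exact hab
      · exact absurd e1.symm ha.1
      · exact absurd e1.symm ha.1
    · exact absurd (ht₂.mem_of_isLeaf e.2.1).2 (by simp)
  have hcyc : ∀ {a b}, (leafCycle T rot).Adj a b ↔ (a = p ∧ b = q) ∨ (a = q ∧ b = p) ∨
      (a = q ∧ b = q') ∨ (a = q' ∧ b = q) ∨ (a = p ∧ b = p') ∨ (a = p' ∧ b = p) ∨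
      (a ≠ r ∧ b ≠ r ∧ (leafCycle T₁ rot₁).Adj a b) := fun {a b} => by
    rw [hT₂, hr₂, hT₁, hr₁]
    exact hat₁.leafCycle_split hat₂' ht₁ hleafr ns nt
  have cr : ∀ {b}, (leafCycle T₁ rot₁).Adj r b ↔ b = p' ∨ b = q' := by
    intro b
    constructor
    · rintro ⟨-, e | e⟩
      · exact Or.inr (e.right_unique nt)
      · exact Or.inl (e.left_unique ht₁.rotation ns)
    · rintro (rfl | rfl)
      · exact ⟨(ht₁.nextLeaf_ne ns).symm, Or.inr ns⟩
      · exact ⟨ht₁.nextLeaf_ne nt, Or.inl nt⟩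
  refine ⟨T₁, rot₁, ⟨hAA ▸ ht₁, ?_, ?_, ?_⟩, ?_⟩
  · intro v hv
    by_cases hvr : v = r
    · subst hvr
      unfold IsLeaf at hleafr
      omega
    · by_cases hvpq : v = p ∨ v = q
      · have : T₁.neighborSet v = ∅ := by
          ext b
          refine ⟨fun hb => ?_, fun hb => hb.elim⟩
          have := m1 (hat₁.mem (show T₁.Adj v b from hb))
          tauto
        rw [this] at hv
        simp at hv
      · push Not at hvpq
        have e1 := hat₂.neighborSet_of_ne hvr hvpq.2
        have e2 := hat₁.neighborSet_of_ne hvr hvpq.1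
        rw [← hT₂] at e1
        rw [← hT₁] at e2
        rw [← e2, ← e1] at hv
        exact h.degree v hv
  · exact four_le_ncard (a := r) (b := p') (c := q') (d := r')
      ⟨hrA, by rintro (e | e); exacts [d1.2.1 e.symm, d1.2.2.1 e.symm]⟩
      ⟨h.mem_of_isLeaf hp', by rintro (e | e); exacts [d1.2.2.2.1 e, d1.2.2.2.2.1 e]⟩
      ⟨h.mem_of_isLeaf hq', by rintro (e | e); exacts [d2.2.2.2.2.2 e, d2.2.2.2.1 e]⟩
      ⟨hr'A, by rintro (e | e); exacts [d3.2.2.2.2.1 e, d3.2.2.2.2.2 e]⟩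
      d1.2.2.2.2.2.symm d2.2.2.2.2.1.symm trr.ne n1 n2 n3
  · ext a b
    rw [hd.collapse_adj (by simp), h.adj_iff, hadj₂, hadj₁, hcyc, SimpleGraph.sup_adj]
    have t1 : T₁.Adj a b → (a ≠ p ∧ a ≠ q) ∧ (b ≠ p ∧ b ≠ q) := fun e =>
      ⟨m1 (hat₁.mem e), m1 (hat₁.mem_right e)⟩
    have t2 : (leafCycle T₁ rot₁).Adj a b → (a ≠ p ∧ a ≠ q) ∧ (b ≠ p ∧ b ≠ q) := fun e =>
      ⟨m1 (ht₁.mem_of_isLeaf (isLeaf_of_cycle e).1), m1 (ht₁.mem_of_isLeaf (isLeaf_of_cycle e).2)⟩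
    have t3 : a = r → ((leafCycle T₁ rot₁).Adj a b ↔ b = p' ∨ b = q') := by
      rintro rfl; exact cr
    have t4 : b = r → ((leafCycle T₁ rot₁).Adj a b ↔ a = p' ∨ a = q') := by
      rintro rfl; rw [SimpleGraph.adj_comm]; exact cr
    have t5 : a = r → (T₁.Adj a b ↔ b = r') := by
      rintro rfl; exact ⟨tr1, fun e => e ▸ hat₁.adj⟩
    have t6 : b = r → (T₁.Adj a b ↔ a = r') := by
      rintro rfl; exact ⟨fun e => tr1 e.symm, fun e => e ▸ hat₁.adj.symm⟩
    generalize T₁.Adj a b = X1 at *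
    generalize (leafCycle T₁ rot₁).Adj a b = X2 at *
    clear h hr hpq hp hq trp trq trr hp' hq' hpA hrA hr'A np nq rot1 rot2 hat₂ hT₂ hr₂ ht₂ hadj₂
      hleaf₂ trr₂ hp₂ rot2' hat₁ hT₁ hr₁ ht₁ hAA hadj₁ hleaf₁ hins hat₂' m1 tr1 hleafr nx2 nx1 ns nt
      hcyc cr hd
    grind
  · intro a
    have t1 : IsLeaf T₁ a → a ≠ p ∧ a ≠ q := fun e => m1 (ht₁.mem_of_isLeaf e)
    rw [hleaf₂, hleaf₁]
    by_cases har : a = r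
    · simp [har, hleafr]
    · tauto

theorem collapse_inner [Finite V] (h : Dec G A T rot) (hd : IsD3a G p q r p' q' r')
    (hp : IsLeaf T p) (hq : IsLeaf T q) (hr : ¬ IsLeaf T r) :
    ∃ T₁ rot₁, Dec (collapseGraph G p q r r p' q' r') (A \ {p, q}) T₁ rot₁ ∧
      ∀ a, IsLeaf T₁ a ↔ a = r ∨ (a ≠ p ∧ a ≠ q ∧ IsLeaf T a) := by
  rcases (h.cycle_of_isLeaf (hd.adj_p.2 (by simp)) hp hq).2 with h1 | h1
  · exact h.collapse_of_nextLeaf hd hr h1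
  · obtain ⟨T₁, rot₁, h2, h3⟩ := h.collapse_of_nextLeaf hd.swap hr h1
    rw [collapseGraph_swap, Set.pair_comm] at h2
    exact ⟨T₁, rot₁, h2, fun a => by rw [h3]; tauto⟩

theorem collapse_rename [Finite V] (h : Dec G A T rot) (hd : IsD3a G p q r p' q' r')
    (hp : IsLeaf T p) (hq : IsLeaf T q) (hr : ¬ IsLeaf T r) {o : V}
    (ho : o = p ∨ o = q ∨ o = r) :
    ∃ T₁ rot₁, Dec (collapseGraph G p q r o p' q' r') (insert o (A \ {p, q, r})) T₁ rot₁ ∧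
      ∀ a, IsLeaf T₁ a ↔ a = o ∨ (a ≠ p ∧ a ≠ q ∧ a ≠ r ∧ IsLeaf T a) := by
  classical
  have hrA : r ∈ A := h.mem_of_adj (hd.adj_r.2 (by simp) : G.Adj r p)
  obtain ⟨T₁, rot₁, h2, h3⟩ := h.collapse_inner hd hp hq hr
  have h4 := h2.comap (Equiv.swap o r)
  rw [hd.collapse_comap ho (by simp)] at h4
  have key : ∀ a, a ≠ p → a ≠ q → a ≠ r → Equiv.swap o r a = a := fun a h1 h2 h3 =>
    Equiv.swap_apply_of_ne_of_ne (by grind) h3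
  have key2 : ∀ a, a = p ∨ a = q ∨ a = r → a ≠ o →
      (Equiv.swap o r a = p ∨ Equiv.swap o r a = q) := by
    intro a ha hao
    have d1 := hd.distinct
    rw [Equiv.swap_apply_def]
    split_ifs <;> grind
  have hset : Equiv.swap o r ⁻¹' (A \ {p, q}) = insert o (A \ {p, q, r}) := by
    ext a
    simp only [Set.mem_insert_iff, Set.mem_sdiff, Set.mem_singleton_iff, Set.mem_preimage]
    by_cases hao : a = o
    · subst hao
      have d1 := hd.distinct
      simp only [Equiv.swap_apply_left, true_or, iff_true]
      exact ⟨hrA, by rintro (e | e); exacts [d1.2.1 e.symm, d1.2.2.1 e.symm]⟩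
    · by_cases ha : a = p ∨ a = q ∨ a = r
      · have := key2 a ha hao
        tauto
      · push Not at ha
        rw [key a ha.1 ha.2.1 ha.2.2]
        tauto
  rw [hset] at h4
  refine ⟨_, _, h4, fun a => ?_⟩
  · rw [isLeaf_comap, h3]
    by_cases hao : a = o
    · subst hao
      simp
    · by_cases ha : a = p ∨ a = q ∨ a = r
      · have h5 := key2 a ha hao
        have h6 : Equiv.swap o r a ≠ r := fun e => hao (by
          rwa [Equiv.swap_apply_eq_iff, Equiv.swap_apply_right] at e)
        tauto
      · push Not at ha
        rw [key a ha.1 ha.2.1 ha.2.2]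
        tauto

/-- The last three conclusions serve the rule that membership in `K` is handed on from a triangle
vertex to its outside neighbour. -/
theorem collapse [Finite V] (h : Dec G A T rot) (hd : IsD3a G p q r p' q' r') :
    ∃ T₁ rot₁, Dec (collapseGraph G p q r p p' q' r') (A \ {q, r}) T₁ rot₁ ∧
      (∀ a, IsLeaf T₁ a ↔ a = p ∨ (a ≠ p ∧ a ≠ q ∧ a ≠ r ∧ IsLeaf T a)) ∧
      (IsLeaf T p → IsLeaf T₁ p') ∧ (IsLeaf T q → IsLeaf T₁ q') ∧ (IsLeaf T r → IsLeaf T₁ r') := by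
  have hpA : p ∈ A := h.mem_of_adj (hd.adj_p.2 (by simp) : G.Adj p q)
  have d1 := hd.distinct
  have d2 := hd.rotate.distinct
  have d3 := hd.rotate.rotate.distinct
  have hA : insert p (A \ {p, q, r}) = A \ {q, r} := by
    ext a
    simp only [Set.mem_insert_iff, Set.mem_sdiff, Set.mem_singleton_iff]
    constructor
    · rintro (rfl | e)
      · exact ⟨hpA, by tauto⟩
      · tauto
    · tauto
  rcases h.isLeaf_of_isD3a hd with ⟨hp, hq, hr⟩ | ⟨hp, hq, hr⟩ | ⟨hp, hq, hr⟩
  · obtain ⟨T₁, rot₁, h2, h3⟩ := h.collapse_rename hd.rotate hq hr hp (o := p) (by simp)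
    rw [collapseGraph_rotate, show ({q, r, p} : Set V) = {p, q, r} by ext; simp; tauto, hA] at h2
    refine ⟨T₁, rot₁, h2, fun a => by rw [h3]; tauto, fun e => absurd e hp, fun e => ?_, fun e => ?_⟩
    · exact (h3 _).2 (Or.inr ⟨d2.2.2.2.1, d2.2.2.2.2.1, d2.2.2.2.2.2,
        h.isLeaf_outside hd.rotate hq hp⟩)
    · exact (h3 _).2 (Or.inr ⟨d3.2.2.2.2.2, d3.2.2.2.1, d3.2.2.2.2.1,
        h.isLeaf_outside hd.rotate.swap hr hp⟩)
  · obtain ⟨T₁, rot₁, h2, h3⟩ := h.collapse_rename hd.rotate.rotate hr hp hq (o := p) (by simp)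
    rw [collapseGraph_rotate, collapseGraph_rotate,
      show ({r, p, q} : Set V) = {p, q, r} by ext; simp; tauto, hA] at h2
    refine ⟨T₁, rot₁, h2, fun a => by rw [h3]; tauto, fun e => ?_, fun e => absurd e hq, fun e => ?_⟩
    · exact (h3 _).2 (Or.inr ⟨d1.2.2.2.2.2, d1.2.2.2.1, d1.2.2.2.2.1,
        h.isLeaf_outside hd.rotate.rotate.swap hp hq⟩)
    · exact (h3 _).2 (Or.inr ⟨d3.2.2.2.1, d3.2.2.2.2.1, d3.2.2.2.2.2,
        h.isLeaf_outside hd.rotate.rotate hr hq⟩)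
  · obtain ⟨T₁, rot₁, h2, h3⟩ := h.collapse_rename hd hp hq hr (o := p) (by simp)
    rw [hA] at h2
    refine ⟨T₁, rot₁, h2, fun a => by rw [h3], fun e => ?_, fun e => ?_, fun e => absurd e hr⟩
    · exact (h3 _).2 (Or.inr ⟨d1.2.2.2.1, d1.2.2.2.2.1, d1.2.2.2.2.2,
        h.isLeaf_outside hd hp hr⟩)
    · exact (h3 _).2 (Or.inr ⟨d2.2.2.2.2.2, d2.2.2.2.1, d2.2.2.2.2.1,
        h.isLeaf_outside hd.swap hq hr⟩)

/-! ### Expanding a vertex to a triangle -/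

/-- The leaf `r` receives the children `p` and `q` in the order in which the cycle passes from `p'`
to `q'`. Its degree rises from one to three, so no vertex of degree two arises. -/
theorem expand_of_nextLeaf [Finite V] {G' : SimpleGraph V} (h : Dec G' (A \ {p, q}) T rot)
    (hG' : G' = collapseGraph G p q r r p' q' r') (hd : IsD3a G p q r p' q' r')
    (hpA : p ∈ A) (hqA : q ∈ A) (hr : IsLeaf T r) (htr : T.Adj r r')
    (ns : NextLeaf T rot p' r) (nt : NextLeaf T rot r q') :
    ∃ T₁ rot₁, Dec G A T₁ rot₁ ∧ ∀ a, IsLeaf T₁ a ↔ a = p ∨ a = q ∨ (a ≠ r ∧ IsLeaf T a) := by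
  have d1 := hd.distinct
  have d2 := hd.rotate.distinct
  have d3 := hd.rotate.rotate.distinct
  have n1 := hd.ne_pq
  have n2 := hd.ne_pr
  have n3 := hd.ne_qr
  have hat : Attach T (A \ {p, q}) r r' p := ⟨h.mem, by simp, htr⟩
  have hat₂ : Attach (T ⊔ SimpleGraph.edge r p) (insert p (A \ {p, q})) r p q := by
    refine ⟨(hat.planeTree h.toPlaneTree).mem, ?_, hat.adj_iff.2 (by simp)⟩
    rintro (e | e)
    · exact d1.1 e.symm
    · exact e.2 (by simp)
  have hA : insert q (insert p (A \ {p, q})) = A := by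
    ext a
    simp only [Set.mem_insert_iff, Set.mem_sdiff, Set.mem_singleton_iff]
    constructor
    · rintro (rfl | rfl | e)
      exacts [hqA, hpA, e.1]
    · tauto
  have ht := hat₂.planeTree (hat.planeTree h.toPlaneTree)
  rw [hA] at ht
  refine ⟨_, _, ⟨ht, ?_, ?_, ?_⟩, ?_⟩
  · intro v
    by_cases hvq : v = q
    · subst hvq
      have := hat₂.isLeaf_v
      unfold IsLeaf at this
      omega
    · by_cases hvr : v = r
      · subst hvr
        rw [hat₂.ncard_neighborSet_x, hat.ncard_neighborSet_x]
        unfold IsLeaf at hr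
        omega
      · rw [hat₂.neighborSet_of_ne hvr hvq]
        by_cases hvp : v = p
        · subst hvp
          have := hat.isLeaf_v
          unfold IsLeaf at this
          omega
        · rw [hat.neighborSet_of_ne hvr hvp]
          exact h.degree v
  · exact h.card.trans (Set.ncard_le_ncard Set.sdiff_subset (Set.toFinite _))
  · ext a b
    have g := hd.collapse_adj (o := r) (by simp) (a := a) (b := b)
    rw [← hG', h.adj_iff] at g
    rw [SimpleGraph.sup_adj, hat₂.adj_iff, hat.adj_iff,
      hat.leafCycle_split hat₂ h.toPlaneTree hr ns nt]
    have m1 : ∀ {a}, a ∈ A \ {p, q} → a ≠ p ∧ a ≠ q := fun ha =>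
      ⟨fun e => ha.2 (Or.inl e), fun e => ha.2 (Or.inr e)⟩
    have t1 : T.Adj a b → (a ≠ p ∧ a ≠ q) ∧ (b ≠ p ∧ b ≠ q) := fun e =>
      ⟨m1 (hat.mem e), m1 (hat.mem_right e)⟩
    have t2 : (leafCycle T rot).Adj a b → (a ≠ p ∧ a ≠ q) ∧ (b ≠ p ∧ b ≠ q) := fun e =>
      ⟨m1 (h.mem_of_isLeaf (isLeaf_of_cycle e).1), m1 (h.mem_of_isLeaf (isLeaf_of_cycle e).2)⟩
    have t5 : a = r → (T.Adj a b ↔ b = r') := by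
      rintro rfl; exact ⟨fun e => hr.eq e htr, fun e => e ▸ htr⟩
    have t6 : b = r → (T.Adj a b ↔ a = r') := by
      rintro rfl; exact ⟨fun e => hr.eq e.symm htr, fun e => e ▸ htr.symm⟩
    have k1 : a = p → (G.Adj a b ↔ b = q ∨ b = r ∨ b = p') := by rintro rfl; exact hd.adj_p
    have k2 : a = q → (G.Adj a b ↔ b = p ∨ b = r ∨ b = q') := by rintro rfl; exact hd.adj_q
    have k3 : a = r → (G.Adj a b ↔ b = p ∨ b = q ∨ b = r') := by rintro rfl; exact hd.adj_r
    have k4 : b = p → (G.Adj a b ↔ a = q ∨ a = r ∨ a = p') := by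
      rintro rfl; rw [SimpleGraph.adj_comm]; exact hd.adj_p
    have k5 : b = q → (G.Adj a b ↔ a = p ∨ a = r ∨ a = q') := by
      rintro rfl; rw [SimpleGraph.adj_comm]; exact hd.adj_q
    have k6 : b = r → (G.Adj a b ↔ a = p ∨ a = q ∨ a = r') := by
      rintro rfl; rw [SimpleGraph.adj_comm]; exact hd.adj_r
    generalize T.Adj a b = X1 at *
    generalize (leafCycle T rot).Adj a b = X2 at *
    generalize G.Adj a b = X3 at *
    clear h hG' hd hr htr ns nt hat hat₂ hA ht m1
    grind (splits := 30)
  · intro a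
    have t1 : IsLeaf T a → a ≠ p ∧ a ≠ q := fun e =>
      ⟨fun e' => (h.mem_of_isLeaf e).2 (Or.inl e'), fun e' => (h.mem_of_isLeaf e).2 (Or.inr e')⟩
    rw [hat₂.isLeaf_iff, hat.isLeaf_iff]
    have := d1.2.1
    by_cases hap : a = p
    · simp [hap, this]
    · tauto

theorem expand_inner [Finite V] {G' : SimpleGraph V} (h : Dec G' (A \ {p, q}) T rot)
    (hG' : G' = collapseGraph G p q r r p' q' r') (hd : IsD3a G p q r p' q' r')
    (hpA : p ∈ A) (hqA : q ∈ A) (hr : IsLeaf T r) (htr : T.Adj r r') :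
    ∃ T₁ rot₁, Dec G A T₁ rot₁ ∧ ∀ a, IsLeaf T₁ a ↔ a = p ∨ a = q ∨ (a ≠ r ∧ IsLeaf T a) := by
  have g : ∀ z, z = p' ∨ z = q' ∨ z = r' → G'.Adj r z := fun z hz => by
    rw [hG', hd.collapse_adj (by simp)]
    exact Or.inr (Or.inl ⟨rfl, hz⟩)
  have c1 : (leafCycle T rot).Adj r p' := by
    refine (h.adj_iff.1 (g p' (by simp))).resolve_left fun e => hd.ne_pr (hr.eq e htr)
  have c2 : (leafCycle T rot).Adj r q' := by
    refine (h.adj_iff.1 (g q' (by simp))).resolve_left fun e => hd.ne_qr (hr.eq e htr)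
  rcases c1.2 with e1 | e1
  · have e2 := c2.2.resolve_left fun e2 => hd.ne_pq (e1.right_unique e2)
    rw [Set.pair_comm] at h
    rw [← collapseGraph_swap] at hG'
    obtain ⟨T₁, rot₁, h1, h2⟩ := h.expand_of_nextLeaf hG' hd.swap hqA hpA hr htr e2 e1
    exact ⟨T₁, rot₁, h1, fun a => by rw [h2]; tauto⟩
  · have e2 := c2.2.resolve_right fun e2 => hd.ne_pq (e1.left_unique h.rotation e2)
    exact h.expand_of_nextLeaf hG' hd hpA hqA hr htr e1 e2

theorem expand_rename [Finite V] {o : V}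
    (h : Dec (collapseGraph G p q r o p' q' r') (insert o (A \ {p, q, r})) T rot)
    (hd : IsD3a G p q r p' q' r') (hA : ∀ a, a = p ∨ a = q ∨ a = r → a ∈ A)
    (ho : o = p ∨ o = q ∨ o = r) (hlo : IsLeaf T o) (hto : T.Adj o r') :
    ∃ T₁ rot₁, Dec G A T₁ rot₁ ∧ ∀ a, IsLeaf T₁ a ↔
      a = p ∨ a = q ∨ (a ≠ p ∧ a ≠ q ∧ a ≠ r ∧ IsLeaf T a) := by
  classical
  have d1 := hd.distinct
  have d2 := hd.rotate.distinct
  have d3 := hd.rotate.rotate.distinct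
  have h4 := h.comap (Equiv.swap r o)
  rw [hd.collapse_comap (by simp) ho] at h4
  have key : ∀ a, a ≠ p → a ≠ q → a ≠ r → Equiv.swap r o a = a := fun a h1 h2 h3 =>
    Equiv.swap_apply_of_ne_of_ne h3 (by grind)
  have key2 : ∀ a, a = p ∨ a = q → Equiv.swap r o a ≠ o ∧
      (Equiv.swap r o a = p ∨ Equiv.swap r o a = q ∨ Equiv.swap r o a = r) := by
    intro a ha
    rw [Equiv.swap_apply_def]
    split_ifs <;> grind
  have hset : Equiv.swap r o ⁻¹' (insert o (A \ {p, q, r})) = A \ {p, q} := by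
    ext a
    simp only [Set.mem_insert_iff, Set.mem_sdiff, Set.mem_singleton_iff, Set.mem_preimage]
    by_cases har : a = r
    · subst har
      have := hA a (by simp)
      simp only [Equiv.swap_apply_left, true_or, true_iff]
      exact ⟨this, by rintro (e | e); exacts [d1.2.1 e.symm, d1.2.2.1 e.symm]⟩
    · by_cases ha : a = p ∨ a = q
      · have := key2 a ha
        simp only [this.1, this.2, not_true_eq_false, and_false, or_self, ha]
      · push Not at ha
        rw [key a ha.1 ha.2 har]
        have : a ≠ o := by grind
        simp [this, ha.1, ha.2, har]
  rw [hset] at h4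
  obtain ⟨T₁, rot₁, h5, h6⟩ := h4.expand_inner rfl hd (hA p (by simp)) (hA q (by simp))
    (by rw [isLeaf_comap, Equiv.swap_apply_left]; exact hlo)
    (by rw [SimpleGraph.comap_adj, Equiv.swap_apply_left,
          key r' d3.2.2.2.2.1 d3.2.2.2.2.2 d3.2.2.2.1]; exact hto)
  refine ⟨T₁, rot₁, h5, fun a => ?_⟩
  rw [h6, isLeaf_comap]
  by_cases ha : a = p ∨ a = q
  · tauto
  · push Not at ha
    by_cases har : a = r
    · simp [har, d1.2.1.symm, d1.2.2.1.symm]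
    · rw [key a ha.1 ha.2 har]
      tauto

/-- The tree edge at the leaf `p` leads to exactly one of the outside neighbours, and the triangle
vertex belonging to that neighbour becomes inner. The tree neighbour is inner and the other two
outside neighbours are leaves, so a triangle vertex is a leaf precisely when its outside neighbour
is. -/
theorem expand [Finite V] (h : Dec (collapseGraph G p q r p p' q' r') (A \ {q, r}) T rot)
    (hd : IsD3a G p q r p' q' r') (hqA : q ∈ A) (hrA : r ∈ A) (hlp : IsLeaf T p) :
    ∃ T₁ rot₁, Dec G A T₁ rot₁ ∧ ∀ a, IsLeaf T₁ a ↔ (IsLeaf T a ∧ a ≠ p) ∨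
      (a = p ∧ IsLeaf T p') ∨ (a = q ∧ IsLeaf T q') ∨ (a = r ∧ IsLeaf T r') := by
  have hpA : p ∈ A := (h.mem_of_isLeaf hlp).1
  have hmem : ∀ a, a = p ∨ a = q ∨ a = r → a ∈ A := by
    rintro a (rfl | rfl | rfl) <;> assumption
  have d1 := hd.distinct
  have hA : A \ {q, r} = insert p (A \ {p, q, r}) := by
    ext a
    simp only [Set.mem_insert_iff, Set.mem_sdiff, Set.mem_singleton_iff]
    constructor
    · tauto
    · rintro (rfl | e)
      · exact ⟨hpA, by tauto⟩
      · tauto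
  have hlq : ∀ a, IsLeaf T a → a ≠ q ∧ a ≠ r := fun a ha =>
    ⟨fun e => (h.mem_of_isLeaf ha).2 (Or.inl e), fun e => (h.mem_of_isLeaf ha).2 (Or.inr e)⟩
  obtain ⟨y, hy⟩ := hlp.exists_adj
  have hny := h.not_isLeaf_of_adj h.card hlp hy
  have g : ∀ z, (collapseGraph G p q r p p' q' r').Adj p z ↔ z = p' ∨ z = q' ∨ z = r' := by
    intro z
    have d2 := hd.rotate.distinct
    have d3 := hd.rotate.rotate.distinct
    rw [hd.collapse_adj (by simp)]
    grind
  have hz : ∀ z, z = p' ∨ z = q' ∨ z = r' → z ≠ y → IsLeaf T z := by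
    intro z hz hzy
    refine (isLeaf_of_cycle ((h.adj_iff.1 ((g z).2 hz)).resolve_left fun e => ?_)).2
    exact hzy (hlp.eq e hy)
  have n1 := hd.ne_pq
  have n2 := hd.ne_pr
  have n3 := hd.ne_qr
  have hy' : y = p' ∨ y = q' ∨ y = r' := (g y).1 (h.tree_adj hy)
  rw [hA] at h
  rcases hy' with rfl | rfl | rfl
  · rw [← collapseGraph_rotate, show ({p, q, r} : Set V) = {q, r, p} by ext; simp; tauto] at h
    obtain ⟨T₁, rot₁, h1, h2⟩ :=
      h.expand_rename hd.rotate (fun a ha => hmem a (by tauto)) (by simp) hlp hy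
    refine ⟨T₁, rot₁, h1, fun a => ?_⟩
    have i1 := hz q' (by simp) n1.symm
    have i2 := hz r' (by simp) n2.symm
    have i3 := hlq a
    rw [h2]
    tauto
  · rw [← collapseGraph_rotate, ← collapseGraph_rotate,
      show ({p, q, r} : Set V) = {r, p, q} by ext; simp; tauto] at h
    obtain ⟨T₁, rot₁, h1, h2⟩ :=
      h.expand_rename hd.rotate.rotate (fun a ha => hmem a (by tauto)) (by simp) hlp hy
    refine ⟨T₁, rot₁, h1, fun a => ?_⟩
    have i1 := hz p' (by simp) n1
    have i2 := hz r' (by simp) n3.symm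
    have i3 := hlq a
    rw [h2]
    tauto
  · obtain ⟨T₁, rot₁, h1, h2⟩ := h.expand_rename hd hmem (by simp) hlp hy
    refine ⟨T₁, rot₁, h1, fun a => ?_⟩
    have i1 := hz p' (by simp) n2
    have i2 := hz q' (by simp) n3
    have i3 := hlq a
    rw [h2]
    tauto

end Dec

/-! ### Every Halin graph other than `K₄` can be reduced -/

/-- The leaves that have a predecessor are closed under `NextLeaf`, and there is one. -/
theorem PlaneTree.exists_prevLeaf [Finite V] {T : SimpleGraph V} {A : Set V} {rot : V → V → V}
    (h : PlaneTree T A rot) {b : V} (hb : IsLeaf T b) : ∃ a, NextLeaf T rot a b := by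
  obtain ⟨c, hc⟩ := h.exists_nextLeaf hb
  exact (h.mem_of_nextLeaf_closed (S := {c | IsLeaf T c ∧ ∃ a, NextLeaf T rot a c}) (a := c)
    ⟨hc.2.1, b, hc⟩ (fun _ ha => ha.1) (fun a d _ hd => ⟨hd.2.1, a, hd⟩) hb).2

namespace Dec

variable {G T : SimpleGraph V} {A : Set V} {rot : V → V → V}

/-- Otherwise `a` and `b` are the only leaves. The star lemma, applied with one leaf repeated, then
leaves at most three vertices. -/
theorem not_nextLeaf_symm [Finite V] (h : Dec G A T rot) {a b : V} (hab : NextLeaf T rot a b) :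
    ¬ NextLeaf T rot b a := by
  intro hba
  obtain ⟨c, -, -, -, -, hA⟩ := h.star_of_three_leaves h.card h.degree (p := a) (q := b) (r := b)
    (fun l hl => by
      have := h.mem_of_nextLeaf_closed (S := {a, b}) (a := a) (by simp)
        (by rintro x (rfl | rfl); exacts [hab.1, hba.1])
        (by
          rintro x y (rfl | rfl) hxy
          · exact Or.inr (hxy.right_unique hab)
          · exact Or.inl (hxy.right_unique hba)) hl
      rcases this with e | e
      exacts [Or.inl e, Or.inr (Or.inl e)])
  have h4 := h.card
  have h1 : A.ncard ≤ 3 := by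
    rw [hA, Set.pair_eq_singleton]
    have := Set.ncard_insert_le c {a, b}
    have := Set.ncard_insert_le a {b}
    rw [Set.ncard_singleton] at this
    omega
  omega

/-- A leaf has degree three: its parent and the two neighbours on the cycle. -/
theorem neighborSet_leaf [Finite V] (h : Dec G A T rot) {a b c u : V} (hu : T.Adj u b)
    (hab : NextLeaf T rot a b) (hbc : NextLeaf T rot b c) :
    G.neighborSet b = {a, c, u} ∧ (G.neighborSet b).ncard = 3 := by
  have hul : ¬ IsLeaf T u := h.not_isLeaf_of_adj h.card hbc.1 hu.symm
  have hac : a ≠ c := by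
    rintro rfl
    exact h.not_nextLeaf_symm hab hbc
  have h1 : G.neighborSet b = {a, c, u} := by
    ext y
    rw [SimpleGraph.mem_neighborSet, h.adj_iff]
    constructor
    · rintro (e | ⟨-, e | e⟩)
      · exact Or.inr (Or.inr (hbc.1.eq e hu.symm))
      · exact Or.inr (Or.inl (e.right_unique hbc))
      · exact Or.inl (e.left_unique h.rotation hab)
    · rintro (rfl | rfl | rfl)
      · exact Or.inr ⟨(h.nextLeaf_ne hab).symm, Or.inr hab⟩
      · exact Or.inr ⟨h.nextLeaf_ne hbc, Or.inl hbc⟩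
      · exact Or.inl hu.symm
  refine ⟨h1, ?_⟩
  rw [h1]
  refine Set.ncard_eq_three.2 ⟨a, c, u, hac, ?_, ?_, rfl⟩
  · rintro rfl; exact hul hab.1
  · rintro rfl; exact hul hbc.2.1

theorem degree_leaf [Finite V] (h : Dec G A T rot) {b : V} (hb : IsLeaf T b) :
    (G.neighborSet b).ncard = 3 := by
  obtain ⟨u, hu⟩ := hb.exists_adj
  obtain ⟨a, ha⟩ := h.exists_prevLeaf hb
  obtain ⟨c, hc⟩ := h.exists_nextLeaf hb
  exact (h.neighborSet_leaf hu.symm ha hc).2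

theorem neighborSet_inner (h : Dec G A T rot) {c : V} (hc : ¬ IsLeaf T c) :
    G.neighborSet c = T.neighborSet c := by
  ext y
  exact ⟨fun e => h.tree_of_not_isLeaf e hc, fun e => h.tree_adj e⟩

/-- If the ends of three consecutive leaves with common parent `c` are adjacent, these leaves form
the whole cycle; otherwise they are a path with apex `c`. -/
theorem isD3b_or_star [Finite V] (h : Dec G A T rot) {c u v w : V} (hc : ¬ IsLeaf T c)
    (hu : T.Adj c u) (hv : T.Adj c v) (hw : T.Adj c w) (huv : NextLeaf T rot u v)
    (hvw : NextLeaf T rot v w) : IsD3b G u v w c ∨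
      ∃ c, ¬ IsLeaf T c ∧ T.Adj c u ∧ T.Adj c v ∧ T.Adj c w ∧ A = {c, u, v, w} := by
  have huw : u ≠ w := by
    rintro rfl
    exact h.not_nextLeaf_symm huv hvw
  have a1 : G.Adj u v := h.adj_iff.2 (Or.inr ⟨h.nextLeaf_ne huv, Or.inl huv⟩)
  have a2 : G.Adj v w := h.adj_iff.2 (Or.inr ⟨h.nextLeaf_ne hvw, Or.inl hvw⟩)
  by_cases a3 : G.Adj u w
  · exact Or.inr (h.star_of_leaf_triangle a1 a2 a3 huv.1 hvw.1 hvw.2.1)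
  · exact Or.inl ⟨h.degree_leaf huv.1, h.degree_leaf hvw.1, h.degree_leaf hvw.2.1, huw, a1, a2, a3,
      h.tree_adj hu, h.tree_adj hv, h.tree_adj hw⟩

/-- At an end `c` of the tree all neighbours except possibly `x` are leaves. Three consecutive
leaves around `c` give D3b, unless the graph is `K₄`. If `c` has only two leaves, they form with `c`
the triangle of D3a. -/
theorem exists_reduction [Finite V] (h : Dec G A T rot) :
    (∃ p q r p' q' r', IsD3a G p q r p' q' r') ∨ (∃ p q r x, IsD3b G p q r x) ∨
      ∃ c u v w, ¬ IsLeaf T c ∧ A = {c, u, v, w} ∧ IsLeaf T u ∧ IsLeaf T v ∧ IsLeaf T w ∧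
        G.Adj u v ∧ G.Adj v w ∧ G.Adj u w ∧ G.Adj c u ∧ G.Adj c v ∧ G.Adj c w := by
  obtain ⟨x, c, hxc, hc, hd⟩ := h.exists_end h.card
  obtain ⟨y, hy, hyx⟩ := exists_adj_ne hc hxc.symm
  have hr := h.rotation
  have e0 := hxc.symm
  have e1 : T.Adj c (rot c x) := (hr _ _ e0).1
  have n1 : rot c x ≠ x := hr.ne e0 hy hyx
  have l1 := hd _ e1 n1
  have e2 : T.Adj c (rot c (rot c x)) := (hr _ _ e1).1
  have n2 : rot c (rot c x) ≠ rot c x := hr.ne e1 e0 n1.symm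
  -- The rotation at `c` cannot return after two steps, since `c` does not have degree two.
  have n3 : rot c (rot c x) ≠ x := by
    intro e
    obtain ⟨z, hz, hz1, hz2⟩ := exists_third (h.degree c) e0 e1 n1.symm
    have := hr.induct e0 hz (fun d => d = x ∨ d = rot c x) (Or.inl rfl) (by
      rintro d - (rfl | rfl)
      · exact Or.inr rfl
      · exact Or.inl e)
    tauto
  have l2 := hd _ e2 n3
  have nx1 := nextLeaf_of_rot_eq e1 l1 l2 hc rfl
  have star : ∀ u v w, NextLeaf T rot u v → NextLeaf T rot v w →
      (∃ c, ¬ IsLeaf T c ∧ T.Adj c u ∧ T.Adj c v ∧ T.Adj c w ∧ A = {c, u, v, w}) →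
      ∃ c u v w, ¬ IsLeaf T c ∧ A = {c, u, v, w} ∧ IsLeaf T u ∧ IsLeaf T v ∧ IsLeaf T w ∧
        G.Adj u v ∧ G.Adj v w ∧ G.Adj u w ∧ G.Adj c u ∧ G.Adj c v ∧ G.Adj c w := by
    rintro u v w huv hvw ⟨c, hc, h1, h2, h3, hA⟩
    have a1 : G.Adj u v := h.adj_iff.2 (Or.inr ⟨h.nextLeaf_ne huv, Or.inl huv⟩)
    have a2 : G.Adj v w := h.adj_iff.2 (Or.inr ⟨h.nextLeaf_ne hvw, Or.inl hvw⟩)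
    have a3 : G.Adj u w := by
      obtain ⟨t, ht⟩ := h.exists_nextLeaf hvw.2.1
      have htA := h.mem_of_isLeaf ht.2.1
      have t1 : t ≠ c := by rintro rfl; exact hc ht.2.1
      have t2 : t ≠ v := by
        rintro rfl
        exact h.not_nextLeaf_symm hvw ht
      have t3 : t ≠ w := (h.nextLeaf_ne ht).symm
      rw [hA] at htA
      simp only [Set.mem_insert_iff, Set.mem_singleton_iff, t1, t2, t3, false_or, or_false] at htA
      subst htA
      exact h.adj_iff.2 (Or.inr ⟨(h.nextLeaf_ne ht).symm, Or.inr ht⟩)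
    exact ⟨c, u, v, w, hc, hA, huv.1, hvw.1, hvw.2.1, a1, a2, a3, h.tree_adj h1, h.tree_adj h2,
      h.tree_adj h3⟩
  by_cases hx : IsLeaf T x
  · have nx0 := nextLeaf_of_rot_eq e0 hx l1 hc rfl
    rcases h.isD3b_or_star hc e0 e1 e2 nx0 nx1 with h1 | h1
    · exact Or.inr (Or.inl ⟨_, _, _, _, h1⟩)
    · exact Or.inr (Or.inr (star _ _ _ nx0 nx1 h1))
  · have e3 : T.Adj c (rot c (rot c (rot c x))) := (hr _ _ e2).1
    by_cases n4 : rot c (rot c (rot c x)) = x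
    · left
      obtain ⟨s, hs⟩ := h.exists_prevLeaf l1
      obtain ⟨t, ht⟩ := h.exists_nextLeaf l2
      have k1 := h.neighborSet_leaf e1 hs nx1
      have k2 := h.neighborSet_leaf e2 nx1 ht
      have k3 : G.neighborSet c = {rot c x, rot c (rot c x), x} := by
        rw [h.neighborSet_inner hc]
        ext z
        constructor
        · intro hz
          exact hr.induct e1 hz (fun d => d = rot c x ∨ d = rot c (rot c x) ∨ d = x)
            (Or.inl rfl) (by
              rintro d - (rfl | rfl | rfl)
              · exact Or.inr (Or.inl rfl)
              · exact Or.inr (Or.inr n4)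
              · exact Or.inl rfl)
        · rintro (rfl | rfl | rfl)
          exacts [e1, e2, e0]
      refine ⟨rot c x, rot c (rot c x), c, s, t, x, k1.2, k2.2, ?_, ?_, ?_, k3, ?_, ?_, ?_⟩
      · rw [k3]
        exact Set.ncard_eq_three.2 ⟨_, _, _, n2.symm, n1, n3, rfl⟩
      · rw [k1.1]; ext; simp; tauto
      · rw [k2.1]; ext; simp; tauto
      -- If the outside neighbours of the two leaves coincided, there would be only three leaves and
      -- hence one inner vertex. But `c` and `x` are both inner.
      · rintro rfl
        have a1 : G.Adj (rot c x) (rot c (rot c x)) :=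
          h.adj_iff.2 (Or.inr ⟨n2.symm, Or.inl nx1⟩)
        have a2 : G.Adj (rot c (rot c x)) s :=
          h.adj_iff.2 (Or.inr ⟨h.nextLeaf_ne ht, Or.inl ht⟩)
        have a3 : G.Adj (rot c x) s :=
          h.adj_iff.2 (Or.inr ⟨(h.nextLeaf_ne hs).symm, Or.inr hs⟩)
        obtain ⟨c0, -, -, -, -, hA⟩ := h.star_of_leaf_triangle a1 a2 a3 l1 l2 hs.1
        have hcA := h.mem e0
        have hxA := h.mem hxc
        rw [hA] at hcA hxA
        have : ∀ z, ¬ IsLeaf T z → z ∈ ({c0, rot c x, rot c (rot c x), s} : Set V) → z = c0 := by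
          rintro z hz (e | rfl | rfl | rfl)
          exacts [e, absurd l1 hz, absurd l2 hz, absurd hs.1 hz]
        exact hxc.ne ((this x hx hxA).trans (this c hc hcA).symm)
      · rintro rfl; exact hx hs.1
      · rintro rfl; exact hx ht.2.1
    · have l3 := hd _ e3 n4
      have nx2 := nextLeaf_of_rot_eq e2 l2 l3 hc rfl
      rcases h.isD3b_or_star hc e1 e2 e3 nx1 nx2 with h1 | h1
      · exact Or.inr (Or.inl ⟨_, _, _, _, h1⟩)
      · exact Or.inr (Or.inr (star _ _ _ nx1 nx2 h1))

end Dec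

/-! ### The complete graph on four vertices -/

theorem State.isK4_iff (s : State V) : s.IsK4 ↔ s.alive.ncard = 4 ∧
    ∀ a ∈ s.alive, ∀ b ∈ s.alive, a ≠ b → s.graph.Adj a b := by
  constructor
  · rintro ⟨e⟩
    refine ⟨?_, fun a ha b hb hab => ?_⟩
    · have := Nat.card_congr e.toEquiv
      simpa using this
    · have h1 : (s.graph.induce s.alive).Adj ⟨a, ha⟩ ⟨b, hb⟩ := by
        rw [← e.map_adj_iff, SimpleGraph.top_adj]
        intro h
        exact hab (congrArg Subtype.val (e.injective h))
      exact h1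
  · rintro ⟨h1, h2⟩
    have hf : s.alive.Finite := Set.finite_of_ncard_ne_zero (by omega)
    have : Finite s.alive := hf
    have e : s.alive ≃ Fin 4 := (Finite.equivFin s.alive).trans (finCongr h1)
    refine ⟨⟨e, ?_⟩⟩
    rintro ⟨a, ha⟩ ⟨b, hb⟩
    simp only [SimpleGraph.top_adj, ne_eq, EmbeddingLike.apply_eq_iff_eq, Subtype.mk.injEq,
      SimpleGraph.comap_adj, Function.Embedding.subtype_apply]
    exact ⟨fun hab => h2 a ha b hb hab, fun hab => hab.ne⟩

theorem isK4_of_insert {s : State V} {a b c d : V} (hA : s.alive = {a, b, c, d})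
    (hab : s.graph.Adj a b) (hac : s.graph.Adj a c) (had : s.graph.Adj a d)
    (hbc : s.graph.Adj b c) (hbd : s.graph.Adj b d) (hcd : s.graph.Adj c d) : s.IsK4 := by
  rw [State.isK4_iff]
  constructor
  · rw [hA, Set.ncard_insert_of_notMem (by simp [hab.ne, hac.ne, had.ne]),
      Set.ncard_insert_of_notMem (by simp [hbc.ne, hbd.ne]), Set.ncard_pair hcd.ne]
  · rw [hA]
    rintro x (rfl | rfl | rfl | rfl) y (rfl | rfl | rfl | rfl) hxy <;>
      first | exact absurd rfl hxy | assumption | (apply SimpleGraph.Adj.symm; assumption)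

/-- Any vertex of `K₄` can be the centre of the star. The star is grown from one edge by attaching
two leaves, so the results on `Attach` supply the plane tree. -/
theorem dec_of_isK4 [Finite V] {s : State V} (hs : ∀ a b, s.graph.Adj a b → a ∈ s.alive)
    (h : s.IsK4) {z : V} (hz : z ∈ s.alive) :
    ∃ T rot, Dec s.graph s.alive T rot ∧ ∀ a, IsLeaf T a ↔ a ∈ s.alive \ {z} := by
  classical
  rw [State.isK4_iff] at h
  obtain ⟨hc, hadj⟩ := h
  have h3 : (s.alive \ {z}).ncard = 3 := by
    rw [Set.ncard_sdiff_singleton_of_mem hz, hc]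
  obtain ⟨a, b, c, hab, hac, hbc, hS⟩ := Set.ncard_eq_three.1 h3
  have hmem : ∀ y, y ∈ s.alive ↔ y = z ∨ y = a ∨ y = b ∨ y = c := by
    intro y
    have : y ∈ s.alive \ {z} ↔ y = a ∨ y = b ∨ y = c := by rw [hS]; rfl
    simp only [Set.mem_sdiff, Set.mem_singleton_iff] at this
    by_cases e : y = z
    · simp [e, hz]
    · simp only [e, not_false_eq_true, and_true] at this
      rw [this]
      simp [e]
  have hne : ∀ y, y = a ∨ y = b ∨ y = c → y ≠ z := by
    intro y hy
    have : y ∈ s.alive \ {z} := by rw [hS]; exact hy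
    exact this.2
  have hza := (hne a (by simp)).symm
  have hzb := (hne b (by simp)).symm
  have hzc := (hne c (by simp)).symm
  have hA : s.alive = insert c (insert b {z, a}) := by
    ext y
    rw [hmem]
    simp only [Set.mem_insert_iff, Set.mem_singleton_iff]
    tauto
  -- For a single edge the identity is a rotation, as each end has only one neighbour.
  let T₀ : SimpleGraph V := ⊥ ⊔ SimpleGraph.edge z a
  have adj₀ : ∀ {u v}, T₀.Adj u v ↔ (u = z ∧ v = a) ∨ (u = a ∧ v = z) := by
    intro u v
    simp only [T₀, bot_sup_eq, SimpleGraph.edge_adj]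
    grind
  have p₀ : PlaneTree T₀ {z, a} (fun _ u => u) := by
    refine ⟨?_, ?_, ?_, ?_⟩
    · intro u v huv
      rcases adj₀.1 huv with ⟨rfl, -⟩ | ⟨rfl, -⟩ <;> simp
    · have : T₀.Adj z a := adj₀.2 (by simp)
      rintro u v (rfl | rfl) (rfl | rfl)
      exacts [.refl _, this.reachable, this.symm.reachable, .refl _]
    · refine SimpleGraph.IsAcyclic.sup_edge_of_not_reachable ?_ SimpleGraph.isAcyclic_bot
      rw [SimpleGraph.reachable_bot]
      exact hza
    · refine isRotation_of_induct (fun _ _ h => h) ?_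
      intro v x y hx hy P hP _
      rw [adj₀] at hx hy
      grind
  have at₁ : Attach T₀ {z, a} z a b := ⟨p₀.mem, by simp [hzb.symm, hab.symm], adj₀.2 (by simp)⟩
  have p₁ := at₁.planeTree p₀
  have at₂ : Attach (T₀ ⊔ SimpleGraph.edge z b) (insert b {z, a}) z b c :=
    ⟨p₁.mem, by simp [hbc.symm, hzc.symm, hac.symm], at₁.adj_iff.2 (by simp)⟩
  have p₂ := at₂.planeTree p₁
  rw [← hA] at p₂
  have hl₀ : IsLeaf T₀ a := isLeaf_of_forall (u := z) (adj₀.2 (by simp)) fun w hw => by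
    rw [adj₀] at hw
    grind
  have hleaf : ∀ y, IsLeaf (T₀ ⊔ SimpleGraph.edge z b ⊔ SimpleGraph.edge z c) y ↔
      y = a ∨ y = b ∨ y = c := by
    intro y
    rw [at₂.isLeaf_iff, at₁.isLeaf_iff]
    constructor
    · rintro (e | ⟨e1, e | ⟨-, e⟩⟩)
      · simp [e]
      · simp [e]
      · obtain ⟨w, hw⟩ := e.exists_adj
        rcases adj₀.1 hw with e | e
        · exact absurd e.1 e1
        · exact Or.inl e.1
    · rintro (rfl | rfl | rfl)
      · exact Or.inr ⟨hza.symm, Or.inr ⟨hza.symm, hl₀⟩⟩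
      · exact Or.inr ⟨hzb.symm, Or.inl rfl⟩
      · exact Or.inl rfl
  have adj₂ : ∀ {u v}, (T₀ ⊔ SimpleGraph.edge z b ⊔ SimpleGraph.edge z c).Adj u v ↔
      (u = z ∧ (v = a ∨ v = b ∨ v = c)) ∨ (v = z ∧ (u = a ∨ u = b ∨ u = c)) := by
    intro u v
    rw [at₂.adj_iff, at₁.adj_iff, adj₀]
    tauto
  have hzl : ¬ IsLeaf (T₀ ⊔ SimpleGraph.edge z b ⊔ SimpleGraph.edge z c) z := at₂.not_isLeaf_x
  set T := T₀ ⊔ SimpleGraph.edge z b ⊔ SimpleGraph.edge z c with hT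
  set rot := insertRot (insertRot (fun _ u => u) z a b) z b c with hrot
  have r1 : rot z a = b := by
    rw [hrot, Attach.rot_of_ne (fun e => hab e.2) hzc hac, Attach.rot_xu]
  have r2 : rot z b = c := Attach.rot_xu
  have r3 : rot z c = a := by
    rw [hrot, at₂.rot_xv, at₁.rot_xv]
  have x1 : NextLeaf T rot a b := nextLeaf_of_rot_eq (adj₂.2 (by simp)) ((hleaf a).2 (by simp))
    ((hleaf b).2 (by simp)) hzl r1
  have x2 : NextLeaf T rot b c := nextLeaf_of_rot_eq (adj₂.2 (by simp)) ((hleaf b).2 (by simp))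
    ((hleaf c).2 (by simp)) hzl r2
  have x3 : NextLeaf T rot c a := nextLeaf_of_rot_eq (adj₂.2 (by simp)) ((hleaf c).2 (by simp))
    ((hleaf a).2 (by simp)) hzl r3
  refine ⟨T, rot, ⟨p₂, ?_, by omega, ?_⟩, ?_⟩
  · intro v
    by_cases hvz : v = z
    · have : T.neighborSet v = {a, b, c} := by
        ext y
        rw [SimpleGraph.mem_neighborSet, adj₂]
        simp only [hvz, Set.mem_insert_iff, Set.mem_singleton_iff, true_and]
        grind
      rw [this, Set.ncard_eq_three.2 ⟨a, b, c, hab, hac, hbc, rfl⟩]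
      omega
    · by_cases hv : v = a ∨ v = b ∨ v = c
      · have := (hleaf v).2 hv
        unfold IsLeaf at this
        omega
      · have : T.neighborSet v = ∅ := by
          ext y
          rw [SimpleGraph.mem_neighborSet, adj₂]
          simp [hvz, hv]
        simp [this]
  · ext u v
    rw [SimpleGraph.sup_adj, adj₂, PlaneTree.leafCycle_adj]
    constructor
    · intro huv
      have hu := (hmem u).1 (hs u v huv)
      have hv := (hmem v).1 (hs v u huv.symm)
      have := huv.ne
      rcases hu with hu | hu
      · refine Or.inl (Or.inl ⟨hu, hv.resolve_left fun e => this (hu.trans e.symm)⟩)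
      · rcases hv with hv | hv
        · exact Or.inl (Or.inr ⟨hv, hu⟩)
        · refine Or.inr ⟨this, ?_⟩
          clear_value T rot
          rcases hu with rfl | rfl | rfl <;> rcases hv with rfl | rfl | rfl <;>
            first
              | exact absurd rfl this
              | exact Or.inl x1
              | exact Or.inl x2
              | exact Or.inl x3
              | exact Or.inr x1
              | exact Or.inr x2
              | exact Or.inr x3
    · rintro ((⟨e0, e⟩ | ⟨e0, e⟩) | ⟨hne', e⟩)
      · rw [e0]; exact hadj _ hz _ ((hmem _).2 (Or.inr e)) (hne _ e).symm
      · rw [e0]; exact hadj _ ((hmem _).2 (Or.inr e)) _ hz (hne _ e)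
      · have k : IsLeaf T u ∧ IsLeaf T v := by
          rcases e with e | e
          exacts [⟨e.1, e.2.1⟩, ⟨e.2.1, e.1⟩]
        exact hadj _ ((hmem u).2 (Or.inr ((hleaf u).1 k.1))) _
          ((hmem v).2 (Or.inr ((hleaf v).1 k.2))) hne'
  · intro y
    rw [hleaf, hS]
    rfl

/-! ### Runs of the algorithm -/

/-- The edges of the current graph join current vertices. -/
def State.Supported (s : State V) : Prop := ∀ a b, s.graph.Adj a b → a ∈ s.alive

theorem State.supported_init (G : SimpleGraph V) : (State.init G).Supported := fun _ _ _ => trivial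

theorem next_graph_collapse (s : State V) (p q r p' q' r' : V) :
    (s.next (.collapse p q r p' q' r')).graph = collapseGraph s.graph p q r p p' q' r' := rfl

theorem State.Supported.next {s : State V} (hs : s.Supported) {m : Move V} (hm : m.Allowed s) :
    (s.next m).Supported := by
  cases m with
  | collapse p q r p' q' r' =>
    have hd : IsD3a s.graph p q r p' q' r' := hm.2.1
    intro a b hab
    rw [next_graph_collapse, hd.collapse_adj (by simp)] at hab
    have d1 := hd.distinct
    have d2 := hd.rotate.distinct
    have d3 := hd.rotate.rotate.distinct
    have hp : p ∈ s.alive := hs p q (hd.adj_p.2 (by simp))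
    have h1 : p' ∈ s.alive := hs p' p (hd.adj_p.2 (by simp) : s.graph.Adj p p').symm
    have h2 : q' ∈ s.alive := hs q' q (hd.adj_q.2 (by simp) : s.graph.Adj q q').symm
    have h3 : r' ∈ s.alive := hs r' r (hd.adj_r.2 (by simp) : s.graph.Adj r r').symm
    show a ∈ s.alive \ {q, r}
    simp only [Set.mem_sdiff, Set.mem_insert_iff, Set.mem_singleton_iff]
    rcases hab with ⟨h, ⟨-, h4, h5⟩, -⟩ | ⟨rfl, -⟩ | ⟨-, rfl | rfl | rfl⟩
    · exact ⟨hs _ _ h, by simp [h4, h5]⟩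
    · exact ⟨hp, by simp [d1.1, d1.2.1]⟩
    · exact ⟨h1, by simp [d1.2.2.2.2.1, d1.2.2.2.2.2]⟩
    · exact ⟨h2, by simp [d2.2.2.2.1, d2.2.2.2.2.1]⟩
    · exact ⟨h3, by simp [d3.2.2.2.2.2, d3.2.2.2.1]⟩
  | shorten p q r x =>
    have hd : IsD3b s.graph p q r x := hm.2.1
    have hp : p ∈ s.alive := hs p q hd.adj_pq
    have hr : r ∈ s.alive := hs r q hd.adj_qr.symm
    rintro a b (⟨h, h1, -⟩ | h)
    · exact ⟨hs _ _ h, h1⟩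
    · rw [SimpleGraph.edge_adj] at h
      rcases h.1 with ⟨rfl, -⟩ | ⟨rfl, -⟩
      · exact ⟨hp, hd.adj_pq.ne⟩
      · exact ⟨hr, hd.adj_qr.ne'⟩
  | discard v => exact hs

/-- A vertex may be discarded exactly when no reduction at it is allowed. So the loop cannot get
stuck at any selected vertex. -/
theorem exists_move (s : State V) {v : V} (hv : v ∈ s.C) :
    ∃ m : Move V, m.vertex = v ∧ m.Allowed s := by
  by_cases h1 : ∃ q r v' q' r', IsD3a s.graph v q r v' q' r' ∧ ¬ (v ∈ s.K ∧ q ∈ s.K ∧ r ∈ s.K)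
  · obtain ⟨q, r, v', q', r', h, hk⟩ := h1
    exact ⟨.collapse v q r v' q' r', rfl, hv, h, hk⟩
  · by_cases h2 : ∃ p r x, IsD3b s.graph p v r x ∧ x ∉ s.K
    · obtain ⟨p, r, x, h, hk⟩ := h2
      exact ⟨.shorten p v r x, rfl, hv, h, hk⟩
    · push Not at h1 h2
      exact ⟨.discard v, rfl, hv, h1, h2⟩

/-- Every iteration decreases this number. -/
noncomputable def State.potential (s : State V) : ℕ := s.C.ncard + 2 * s.alive.ncard

/-- D3a removes the selected vertex from `C`, adds at most the four vertices `p`, `p'`, `q'`, `r'`,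
and deletes two vertices: the weight two for a vertex is just enough. D3b adds at most the apex and
deletes one vertex. -/
theorem State.potential_next [Finite V] {s : State V} (hs : s.Supported) {m : Move V}
    (hm : m.Allowed s) : (s.next m).potential + 1 ≤ s.potential := by
  have hC : ∀ v ∈ s.C, (s.C \ {v}).ncard + 1 = s.C.ncard := fun v hv =>
    Set.ncard_sdiff_singleton_add_one hv (Set.toFinite _)
  unfold State.potential
  cases m with
  | collapse p q r p' q' r' =>
    have hd : IsD3a s.graph p q r p' q' r' := hm.2.1
    have d1 := hd.distinct
    have h1 := hC p hm.1
    have h2 : ((s.next (.collapse p q r p' q' r')).C).ncard ≤ (s.C \ {p}).ncard + 4 := by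
      have e1 : (s.next (.collapse p q r p' q' r')).C ⊆ (s.C \ {p}) ∪ {p, p', q', r'} := by
        rintro a (h | h | h)
        · exact Or.inl h
        · exact Or.inr (Or.inl h)
        · have h' : (collapseGraph s.graph p q r p p' q' r').Adj p a := h.1
          rw [hd.collapse_adj (by simp)] at h'
          rcases h' with h' | h' | h'
          · exact absurd rfl h'.2.1.1
          · exact Or.inr (Or.inr h'.2)
          · exact Or.inr (Or.inl h'.1)
      have e2 : ({p, p', q', r'} : Set V).ncard ≤ 4 := by
        have := Set.ncard_insert_le p {p', q', r'}
        have := Set.ncard_insert_le p' {q', r'}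
        have := Set.ncard_insert_le q' {r'}
        rw [Set.ncard_singleton] at this
        omega
      have e3 := Set.ncard_le_ncard e1 (Set.toFinite _)
      have e4 := Set.ncard_union_le (s.C \ {p}) {p, p', q', r'}
      omega
    have h3 : (s.alive \ {q, r}).ncard + 2 = s.alive.ncard := by
      have := Set.ncard_sdiff_add_ncard_of_subset (s := {q, r}) (t := s.alive) (by
        rintro a (rfl | rfl)
        · exact hs a p (hd.adj_q.2 (by simp))
        · exact hs a p (hd.adj_r.2 (by simp))) (Set.toFinite _)
      rwa [Set.ncard_pair d1.2.2.1] at this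
    have h4 : (s.next (.collapse p q r p' q' r')).alive = s.alive \ {q, r} := rfl
    rw [h4]
    omega
  | shorten p q r x =>
    have hd : IsD3b s.graph p q r x := hm.2.1
    have h1 := hC q hm.1
    have h2 : ((s.next (.shorten p q r x)).C).ncard ≤ (s.C \ {q}).ncard + 1 := by
      have e1 : (s.next (.shorten p q r x)).C ⊆ (s.C \ {q}) ∪ {x} := by
        rintro a (h | h)
        · exact Or.inl h
        · exact Or.inr h.1
      have e3 := Set.ncard_le_ncard e1 (Set.toFinite _)
      have e4 := Set.ncard_union_le (s.C \ {q}) {x}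
      rw [Set.ncard_singleton] at e4
      omega
    have h3 : (s.alive \ {q}).ncard + 1 = s.alive.ncard :=
      Set.ncard_sdiff_singleton_add_one (hs q r hd.adj_qr) (Set.toFinite _)
    have h4 : (s.next (.shorten p q r x)).alive = s.alive \ {q} := rfl
    rw [h4]
    omega
  | discard v =>
    have h1 := hC v hm.1
    have h2 : (s.next (.discard v)).C = s.C \ {v} := by
      show s.C \ {v} ∪ ∅ = _
      simp
    have h4 : (s.next (.discard v)).alive = s.alive := rfl
    rw [h2, h4]
    omega

theorem Run.length_le [Finite V] {s s' : State V} {ms : List (Move V)} (h : Run s ms s')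
    (hs : s.Supported) : ms.length ≤ s.potential := by
  induction h with
  | nil => simp
  | cons hm _ ih =>
    have h1 := ih (hs.next hm)
    have h2 := State.potential_next hs hm
    simp only [List.length_cons]
    omega

/-- At the start `C` contributes at most the number of vertices to the potential, and the current
vertices contribute twice that number. -/
theorem Run.length_le_card [Finite V] {G : SimpleGraph V} {s : State V} {ms : List (Move V)}
    (h : Run (State.init G) ms s) : ms.length ≤ 3 * Nat.card V := by
  have h1 := h.length_le (State.supported_init G)
  have h2 : (State.init G).C.ncard ≤ Nat.card V := by
    rw [← Set.ncard_univ]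
    exact Set.ncard_le_ncard (Set.subset_univ _) (Set.toFinite _)
  have h3 : (State.init G).alive.ncard = Nat.card V := Set.ncard_univ V
  unfold State.potential at h1
  omega

/-! ### Undoing a run -/

/-- The current vertices in `K` are leaves. -/
def State.KLeaf (s : State V) (T : SimpleGraph V) : Prop := ∀ a ∈ s.alive, a ∈ s.K → IsLeaf T a

/-- This is soundness of a single move. A decomposition after the move may have been chosen
arbitrarily; `KLeaf` is what makes it reversible, and it is handed back to the earlier state. -/
theorem exists_dec_of_next [Finite V] {s : State V} {m : Move V} (hs : s.Supported)
    (hm : m.Allowed s) {T : SimpleGraph V} {rot : V → V → V}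
    (h : Dec (s.next m).graph (s.next m).alive T rot) (hK : (s.next m).KLeaf T) :
    ∃ T₁ rot₁, Dec s.graph s.alive T₁ rot₁ ∧ s.KLeaf T₁ ∧
      {a | IsLeaf T₁ a} = m.undo {a | IsLeaf T a} := by
  cases m with
  | collapse p q r p' q' r' =>
    have hd : IsD3a s.graph p q r p' q' r' := hm.2.1
    have d1 := hd.distinct
    have d2 := hd.rotate.distinct
    have d3 := hd.rotate.rotate.distinct
    have hqA : q ∈ s.alive := hs q p (hd.adj_q.2 (by simp))
    have hrA : r ∈ s.alive := hs r p (hd.adj_r.2 (by simp))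
    have hpA : p ∈ s.alive := hs p q (hd.adj_p.2 (by simp))
    have h1 : p' ∈ s.alive := hs p' p (hd.adj_p.2 (by simp) : s.graph.Adj p p').symm
    have h2 : q' ∈ s.alive := hs q' q (hd.adj_q.2 (by simp) : s.graph.Adj q q').symm
    have h3 : r' ∈ s.alive := hs r' r (hd.adj_r.2 (by simp) : s.graph.Adj r r').symm
    have mem : ∀ a, a ∈ s.alive → a ≠ q → a ≠ r →
        a ∈ (s.next (.collapse p q r p' q' r')).alive := fun a ha hq hr =>
      ⟨ha, by simp [hq, hr]⟩
    -- The vertex that replaces the triangle is put into `K`, so it is a leaf and can be expanded.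
    have hlp : IsLeaf T p := hK p (mem p hpA d1.1 d1.2.1) (Or.inr (Or.inl rfl))
    obtain ⟨T₁, rot₁, hdec, hl⟩ := Dec.expand h hd hqA hrA hlp
    refine ⟨T₁, rot₁, hdec, ?_, ?_⟩
    · intro a ha hak
      rw [hl]
      by_cases e1 : a = p
      · subst e1
        exact Or.inr (Or.inl ⟨rfl, hK _ (mem _ h1 d1.2.2.2.2.1 d1.2.2.2.2.2)
          (Or.inr (Or.inr (Or.inl ⟨rfl, hak⟩)))⟩)
      · by_cases e2 : a = q
        · subst e2
          exact Or.inr (Or.inr (Or.inl ⟨rfl, hK _ (mem _ h2 d2.2.2.2.1 d2.2.2.2.2.1)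
            (Or.inr (Or.inr (Or.inr (Or.inl ⟨rfl, hak⟩))))⟩))
        · by_cases e3 : a = r
          · subst e3
            exact Or.inr (Or.inr (Or.inr ⟨rfl, hK _ (mem _ h3 d3.2.2.2.2.2 d3.2.2.2.1)
              (Or.inr (Or.inr (Or.inr (Or.inr ⟨rfl, hak⟩))))⟩))
          · exact Or.inl ⟨hK a (mem a ha e2 e3) (Or.inl hak), e1⟩
    · ext a
      exact hl a
  | shorten p q r x =>
    have hd : IsD3b s.graph p q r x := hm.2.1
    have hqA : q ∈ s.alive := hs q r hd.adj_qr
    have mem : ∀ a, a ∈ s.alive → a ≠ q → a ∈ (s.next (.shorten p q r x)).alive :=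
      fun a ha hq => ⟨ha, hq⟩
    have hp : IsLeaf T p := hK p (mem p (hs p q hd.adj_pq) hd.adj_pq.ne) (Or.inr (Or.inl rfl))
    have hr : IsLeaf T r := hK r (mem r (hs r q hd.adj_qr.symm) hd.adj_qr.ne')
      (Or.inr (Or.inr (Or.inl rfl)))
    -- If the apex were a leaf, then `p`, `r`, `x` would be a leaf triangle and the graph would be
    -- `K₄`. In this case the algorithm has also put the fourth vertex into `K`, but that vertex is
    -- the centre of the star.
    have hx : ¬ IsLeaf T x := by
      intro hx
      have apr : (s.next (.shorten p q r x)).graph.Adj p r :=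
        Or.inr (by rw [SimpleGraph.edge_adj]; exact ⟨by simp, hd.ne_pr⟩)
      have axp : (s.next (.shorten p q r x)).graph.Adj x p :=
        Or.inl ⟨hd.adj_sp, hd.adj_sq.ne, hd.adj_pq.ne⟩
      have axr : (s.next (.shorten p q r x)).graph.Adj x r :=
        Or.inl ⟨hd.adj_sr, hd.adj_sq.ne, hd.adj_qr.ne'⟩
      obtain ⟨c, hc, c1, c2, c3, hA⟩ := h.star_of_leaf_triangle apr axr.symm axp.symm hp hr hx
      have hk4 : (s.next (.shorten p q r x)).IsK4 :=
        isK4_of_insert hA (h.tree_adj c1) (h.tree_adj c2) (h.tree_adj c3) apr axp.symm axr.symm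
      have hcA : c ∈ (s.next (.shorten p q r x)).alive := by rw [hA]; simp
      exact hc (hK c hcA (Or.inr (Or.inr (Or.inr ⟨hcA, c3.ne, hk4⟩))))
    obtain ⟨T₁, rot₁, hdec, hl⟩ := Dec.unshorten h rfl hd hqA hp hr hx
    refine ⟨T₁, rot₁, hdec, ?_, ?_⟩
    · intro a ha hak
      rw [hl]
      by_cases e : a = q
      · exact Or.inl e
      · exact Or.inr (hK a (mem a ha e) (Or.inl hak))
    · ext a
      exact hl a
  | discard v =>
    exact ⟨T, rot, h, fun a ha hak => hK a ha (Or.inl hak), rfl⟩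

theorem Run.exists_dec [Finite V] {s s' : State V} {ms : List (Move V)} (hr : Run s ms s')
    (hs : s.Supported) {T : SimpleGraph V} {rot : V → V → V}
    (h : Dec s'.graph s'.alive T rot) (hK : s'.KLeaf T) :
    ∃ T₁ rot₁, Dec s.graph s.alive T₁ rot₁ ∧ s.KLeaf T₁ ∧
      {a | IsLeaf T₁ a} = ms.foldr Move.undo {a | IsLeaf T a} := by
  induction hr with
  | nil => exact ⟨T, rot, h, hK, rfl⟩
  | @cons s m ms s' hm _ ih =>
    obtain ⟨T₁, rot₁, h1, h2, h3⟩ := ih (hs.next hm) h hK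
    obtain ⟨T₂, rot₂, h4, h5, h6⟩ := exists_dec_of_next hs hm h1 h2
    exact ⟨T₂, rot₂, h4, h5, by rw [h6, h3]; rfl⟩

theorem Run.supported {s s' : State V} {ms : List (Move V)} (hr : Run s ms s')
    (hs : s.Supported) : s'.Supported := by
  induction hr with
  | nil => exact hs
  | cons hm _ ih => exact ih (hs.next hm)

/-- Choosing `z` outside `K` as centre makes every other vertex of the final `K₄` a leaf, which
establishes `KLeaf` at the end of the run. -/
theorem Run.isDecomposition [Finite V] {G : SimpleGraph V} {s : State V} {ms : List (Move V)}
    (hr : Run (State.init G) ms s) (hk : s.IsK4) {z : V} (hz : z ∈ s.alive) (hzK : z ∉ s.K) :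
    IsDecomposition G (treePart G (outerVertices ms s z)) (cyclePart G (outerVertices ms s z)) := by
  obtain ⟨T, rot, h, hl⟩ := dec_of_isK4 (hr.supported (State.supported_init G)) hk hz
  have hK : s.KLeaf T := by
    intro a ha hak
    rw [hl]
    exact ⟨ha, fun e => hzK (e ▸ hak)⟩
  obtain ⟨T₁, rot₁, h1, -, h3⟩ := hr.exists_dec (State.supported_init G) h hK
  have e : outerVertices ms s z = {a | IsLeaf T₁ a} := by
    rw [h3, outerVertices]
    congr 1
    ext a
    exact (hl a).symm
  rw [e]
  exact Dec.isDecomposition h1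

/-! ### Runs on a Halin graph -/

/-- This is the forward counterpart of `exists_dec_of_next`: in a Halin graph everything that a move
adds to `K` is a leaf of the tree after the move. -/
theorem Dec.next [Finite V] {s : State V} {T : SimpleGraph V} {rot : V → V → V}
    (h : Dec s.graph s.alive T rot) (hK : s.KLeaf T) {m : Move V} (hm : m.Allowed s) :
    ∃ T₁ rot₁, Dec (s.next m).graph (s.next m).alive T₁ rot₁ ∧ (s.next m).KLeaf T₁ := by
  cases m with
  | collapse p q r p' q' r' =>
    have hd : IsD3a s.graph p q r p' q' r' := hm.2.1
    have hpA : p ∈ s.alive := h.mem_of_adj (hd.adj_p.2 (by simp) : s.graph.Adj p q)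
    have hqA : q ∈ s.alive := h.mem_of_adj (hd.adj_q.2 (by simp) : s.graph.Adj q p)
    have hrA : r ∈ s.alive := h.mem_of_adj (hd.adj_r.2 (by simp) : s.graph.Adj r p)
    obtain ⟨T₁, rot₁, h1, hl, k1, k2, k3⟩ := h.collapse hd
    refine ⟨T₁, rot₁, h1, ?_⟩
    rintro a ⟨ha, ha'⟩ (hak | rfl | ⟨rfl, hk⟩ | ⟨rfl, hk⟩ | ⟨rfl, hk⟩)
    · rw [hl]
      by_cases e : a = p
      · exact Or.inl e
      · exact Or.inr ⟨e, fun e => ha' (Or.inl e), fun e => ha' (Or.inr e), hK a ha hak⟩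
    · exact (hl a).2 (Or.inl rfl)
    · exact k1 (hK p hpA hk)
    · exact k2 (hK q hqA hk)
    · exact k3 (hK r hrA hk)
  | shorten p q r x =>
    have hd : IsD3b s.graph p q r x := hm.2.1
    obtain ⟨lp, lq, lr, lx⟩ := h.isLeaf_of_isD3b hd
    obtain ⟨T₁, rot₁, h1, hl⟩ := h.shorten hd
    have hlp : IsLeaf T₁ p := ((hl p).1 lp).resolve_left hd.adj_pq.ne
    refine ⟨T₁, rot₁, h1, ?_⟩
    rintro a ⟨ha, ha'⟩ (hak | rfl | rfl | ⟨-, hax, hk4⟩)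
    · exact ((hl a).1 (hK a ha hak)).resolve_left ha'
    · exact hlp
    · exact ((hl a).1 lr).resolve_left hd.adj_qr.ne'
    -- In `K₄` the fourth vertex forms a triangle with the apex and `p`. The apex is inner, so the
    -- fourth vertex is a leaf.
    · by_cases hap : a = p
      · rw [hap]; exact hlp
      · have hk := ((State.isK4_iff _).1 hk4).2
        have hxA : x ∈ s.alive \ {q} := ⟨h.mem_of_adj hd.adj_sp, hd.adj_sq.ne⟩
        have hpA : p ∈ s.alive \ {q} := ⟨h.mem_of_adj hd.adj_pq, hd.adj_pq.ne⟩
        have a1 := hk a ⟨ha, ha'⟩ x hxA hax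
        have a2 := hk x hxA p hpA hd.adj_sp.ne
        have a3 := hk a ⟨ha, ha'⟩ p hpA hap
        exact (Dec.isLeaf_or_of_triangle h1 a1 a2 a3).resolve_right
          fun e => lx ((hl x).2 (Or.inr e))
  | discard v =>
    refine ⟨T, rot, h, fun a ha hak => hK a ha ?_⟩
    rcases hak with e | e
    exacts [e, e.elim]

/-! ### The reductions that are still to be examined -/

/-- Every reduction that applies can be found from a vertex of `C`. -/
def State.Covered (s : State V) : Prop :=
  (∀ p q r p' q' r', IsD3a s.graph p q r p' q' r' → p ∈ s.C ∨ q ∈ s.C ∨ r ∈ s.C) ∧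
    ∀ p q r x, IsD3b s.graph p q r x → q ∈ s.C

theorem State.covered_init (G : SimpleGraph V) : (State.init G).Covered :=
  ⟨fun _ _ _ _ _ _ h => Or.inl h.degree_p, fun _ _ _ _ h => h.degree_q⟩

section Collapse

variable {G : SimpleGraph V} {p q r p' q' r' : V}

/-- Outside the triangle, the collapse renames neighbours, but does not change their number. -/
theorem IsD3a.collapse_swap [DecidableEq V] (h : IsD3a G p q r p' q' r') {a : V} (hp : a ≠ p)
    (hq : a ≠ q) (hr : a ≠ r) : ∃ e : V ≃ V, (∀ y, y ≠ p → y ≠ q → y ≠ r → e y = y) ∧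
      ∀ y, G.Adj a y ↔ (collapseGraph G p q r p p' q' r').Adj a (e y) := by
  have d1 := h.distinct
  have d2 := h.rotate.distinct
  have d3 := h.rotate.rotate.distinct
  have k1 := h.ne_pq
  have k2 := h.ne_pr
  have k3 := h.ne_qr
  have a1 : ∀ y, G.Adj y p ↔ _ := fun y => (G.adj_comm y p).trans h.adj_p
  have a2 : ∀ y, G.Adj y q ↔ _ := fun y => (G.adj_comm y q).trans h.adj_q
  have a3 : ∀ y, G.Adj y r ↔ _ := fun y => (G.adj_comm y r).trans h.adj_r
  -- A vertex outside the triangle is adjacent to at most one of its vertices. The name of that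
  -- vertex is exchanged with the name of the new one.
  refine ⟨Equiv.swap p (if a = q' then q else if a = r' then r else p), ?_, ?_⟩
  · intro y h1 h2 h3
    apply Equiv.swap_apply_of_ne_of_ne h1
    split_ifs <;> assumption
  · intro y
    rw [h.collapse_adj (by simp)]
    have b1 := a1 a
    have b2 := a2 a
    have b3 := a3 a
    by_cases y1 : y = p
    · subst y1
      rw [Equiv.swap_apply_left]
      split_ifs <;> grind
    · by_cases y2 : y = q
      · subst y2
        by_cases e : a = q'
        · rw [if_pos e, Equiv.swap_apply_right]; grind
        · rw [Equiv.swap_apply_of_ne_of_ne y1 (by split_ifs <;> grind)]; grind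
      · by_cases y3 : y = r
        · subst y3
          by_cases e : a = r'
          · rw [if_neg (by grind), if_pos e, Equiv.swap_apply_right]; grind
          · rw [Equiv.swap_apply_of_ne_of_ne y1 (by split_ifs <;> grind)]; grind
        · rw [Equiv.swap_apply_of_ne_of_ne y1 (by split_ifs <;> assumption)]
          grind

theorem ncard_neighborSet_of_equiv {G H : SimpleGraph V} {a b : V} (e : V ≃ V)
    (h : ∀ y, G.Adj a y ↔ H.Adj b (e y)) :
    (G.neighborSet a).ncard = (H.neighborSet b).ncard := by
  have : G.neighborSet a = e.symm '' H.neighborSet b := by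
    ext y
    simp [h]
  rw [this, Set.ncard_image_of_injective _ e.symm.injective]

theorem collapse_isolated (h : IsD3a G p q r p' q' r') {y : V} :
    ¬ (collapseGraph G p q r p p' q' r').Adj q y ∧
      ¬ (collapseGraph G p q r p p' q' r').Adj r y := by
  have d1 := h.distinct
  have d2 := h.rotate.distinct
  have d3 := h.rotate.rotate.distinct
  rw [h.collapse_adj (by simp), h.collapse_adj (by simp)]
  grind

/-- A triangle of the collapsed graph without the new vertex is a triangle of the graph. -/
theorem IsD3a.of_collapse (h : IsD3a G p q r p' q' r') {a b c a' b' c' : V}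
    (hd : IsD3a (collapseGraph G p q r p p' q' r') a b c a' b' c') (ha : a ≠ p) (hb : b ≠ p)
    (hc : c ≠ p) : ∃ a' b' c', IsD3a G a b c a' b' c' := by
  classical
  have nq : ∀ x y, (collapseGraph G p q r p p' q' r').Adj x y → x ≠ q ∧ x ≠ r := by
    rintro x y hxy
    constructor <;> rintro rfl
    exacts [(collapse_isolated h).1 hxy, (collapse_isolated h).2 hxy]
  have ab := nq a b (hd.adj_p.2 (by simp))
  have bc := nq b c (hd.adj_q.2 (by simp))
  have ca := nq c a (hd.adj_r.2 (by simp))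
  obtain ⟨ea, fa, ga⟩ := h.collapse_swap ha ab.1 ab.2
  obtain ⟨eb, fb, gb⟩ := h.collapse_swap hb bc.1 bc.2
  obtain ⟨ec, fc, gc⟩ := h.collapse_swap hc ca.1 ca.2
  -- Each vertex of the collapsed triangle has a single neighbour outside it. So the outside
  -- neighbours of `a`, `b`, `c` remain distinct when they are renamed.
  have out : ∀ x ∈ ({p, q, r} : Set V), ∀ u v, u ∉ ({p, q, r} : Set V) →
      v ∉ ({p, q, r} : Set V) → G.Adj u x → G.Adj v x → u = v := by
    simp only [Set.mem_insert_iff, Set.mem_singleton_iff, not_or]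
    rintro x (rfl | rfl | rfl) u v hu hv h1 h2
    · have := h.adj_p.1 h1.symm
      have := h.adj_p.1 h2.symm
      grind
    · have := h.adj_q.1 h1.symm
      have := h.adj_q.1 h2.symm
      grind
    · have := h.adj_r.1 h1.symm
      have := h.adj_r.1 h2.symm
      grind
  have sa : a ∉ ({p, q, r} : Set V) := by simp [ha, ab]
  have sb : b ∉ ({p, q, r} : Set V) := by simp [hb, bc]
  have sc : c ∉ ({p, q, r} : Set V) := by simp [hc, ca]
  have key : ∀ (e : V ≃ V) (x u : V), (∀ y, y ≠ p → y ≠ q → y ≠ r → e y = y) →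
      (∀ y, G.Adj x y ↔ (collapseGraph G p q r p p' q' r').Adj x (e y)) →
      e.symm u ∈ ({p, q, r} : Set V) ∨ e.symm u = u := by
    intro e x u he _
    by_cases hu : e.symm u ∈ ({p, q, r} : Set V)
    · exact Or.inl hu
    · simp only [Set.mem_insert_iff, Set.mem_singleton_iff, not_or] at hu
      have := he _ hu.1 hu.2.1 hu.2.2
      rw [e.apply_symm_apply] at this
      exact Or.inr this.symm
  have aa : G.Adj a (ea.symm a') := (ga _).2 (by rw [ea.apply_symm_apply]; exact hd.adj_p.2 (by simp))
  have bb : G.Adj b (eb.symm b') := (gb _).2 (by rw [eb.apply_symm_apply]; exact hd.adj_q.2 (by simp))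
  have cc : G.Adj c (ec.symm c') := (gc _).2 (by rw [ec.apply_symm_apply]; exact hd.adj_r.2 (by simp))
  have d1 := hd.distinct
  have ne : ∀ (e f : V ≃ V) (x y u v : V), (e.symm u ∈ ({p, q, r} : Set V) ∨ e.symm u = u) →
      (f.symm v ∈ ({p, q, r} : Set V) ∨ f.symm v = v) → x ∉ ({p, q, r} : Set V) →
      y ∉ ({p, q, r} : Set V) → G.Adj x (e.symm u) → G.Adj y (f.symm v) → x ≠ y → u ≠ v →
      e.symm u ≠ f.symm v := by
    intro e f x y u v h1 h2 hx hy h3 h4 hxy huv e1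
    rcases h1 with h1 | h1
    · exact hxy (out _ h1 x y hx hy h3 (by rw [e1]; exact h4))
    · rcases h2 with h2 | h2
      · exact hxy (out _ h2 x y hx hy (by rw [← e1]; exact h3) h4)
      · exact huv (by rw [← h1, ← h2, e1])
  refine ⟨ea.symm a', eb.symm b', ec.symm c', ?_, ?_, ?_, ?_, ?_, ?_, ?_, ?_, ?_⟩
  · rw [ncard_neighborSet_of_equiv ea ga]; exact hd.degree_p
  · rw [ncard_neighborSet_of_equiv eb gb]; exact hd.degree_q
  · rw [ncard_neighborSet_of_equiv ec gc]; exact hd.degree_r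
  · ext y
    rw [SimpleGraph.mem_neighborSet, ga, hd.adj_p]
    simp only [Set.mem_insert_iff, Set.mem_singleton_iff, Equiv.eq_symm_apply]
    rw [← fa b hb bc.1 bc.2, ← fa c hc ca.1 ca.2, ea.injective.eq_iff, ea.injective.eq_iff,
      fa b hb bc.1 bc.2, fa c hc ca.1 ca.2]
  · ext y
    rw [SimpleGraph.mem_neighborSet, gb, hd.adj_q]
    simp only [Set.mem_insert_iff, Set.mem_singleton_iff, Equiv.eq_symm_apply]
    rw [← fb a ha ab.1 ab.2, ← fb c hc ca.1 ca.2, eb.injective.eq_iff, eb.injective.eq_iff,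
      fb a ha ab.1 ab.2, fb c hc ca.1 ca.2]
  · ext y
    rw [SimpleGraph.mem_neighborSet, gc, hd.adj_r]
    simp only [Set.mem_insert_iff, Set.mem_singleton_iff, Equiv.eq_symm_apply]
    rw [← fc a ha ab.1 ab.2, ← fc b hb bc.1 bc.2, ec.injective.eq_iff, ec.injective.eq_iff,
      fc a ha ab.1 ab.2, fc b hb bc.1 bc.2]
  · exact ne _ _ a b _ _ (key ea a a' fa ga) (key eb b b' fb gb) sa sb aa bb d1.1 hd.ne_pq
  · exact ne _ _ a c _ _ (key ea a a' fa ga) (key ec c c' fc gc) sa sc aa cc d1.2.1 hd.ne_pr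
  · exact ne _ _ b c _ _ (key eb b b' fb gb) (key ec c c' fc gc) sb sc bb cc d1.2.2.1 hd.ne_qr

/-- Every other vertex of the reduction is adjacent to the middle vertex `b`, so none of them is the
new vertex. The excluded cases need no lifting: the collapse puts the new vertex and its neighbours
of degree three into `C`. -/
theorem IsD3b.of_collapse (h : IsD3a G p q r p' q' r') {a b c y : V}
    (hd : IsD3b (collapseGraph G p q r p p' q' r') a b c y) (hb : b ≠ p)
    (hpb : ¬ (collapseGraph G p q r p p' q' r').Adj p b) : IsD3b G a b c y := by
  classical
  have nq : ∀ x y, (collapseGraph G p q r p p' q' r').Adj x y → x ≠ q ∧ x ≠ r := by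
    rintro x y hxy
    constructor <;> rintro rfl
    exacts [(collapse_isolated h).1 hxy, (collapse_isolated h).2 hxy]
  have na := nq a b hd.adj_pq
  have nb := nq b c hd.adj_qr
  have nc := nq c b hd.adj_qr.symm
  have ny := nq y b hd.adj_sq
  have ha : a ≠ p := by rintro rfl; exact hpb hd.adj_pq
  have hc : c ≠ p := by rintro rfl; exact hpb hd.adj_qr.symm
  have hy : y ≠ p := by rintro rfl; exact hpb hd.adj_sq
  obtain ⟨ea, fa, ga⟩ := h.collapse_swap ha na.1 na.2
  obtain ⟨eb, fb, gb⟩ := h.collapse_swap hb nb.1 nb.2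
  obtain ⟨ec, fc, gc⟩ := h.collapse_swap hc nc.1 nc.2
  obtain ⟨ey, fy, gy⟩ := h.collapse_swap hy ny.1 ny.2
  have k1 := fa b hb nb.1 nb.2
  have k2 := fb c hc nc.1 nc.2
  have k3 := fa c hc nc.1 nc.2
  have k4 := fy a ha na.1 na.2
  have k5 := fy b hb nb.1 nb.2
  have k6 := fy c hc nc.1 nc.2
  constructor
  · rw [ncard_neighborSet_of_equiv ea ga]; exact hd.degree_p
  · rw [ncard_neighborSet_of_equiv eb gb]; exact hd.degree_q
  · rw [ncard_neighborSet_of_equiv ec gc]; exact hd.degree_r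
  · exact hd.ne_pr
  · rw [ga, k1]; exact hd.adj_pq
  · rw [gb, k2]; exact hd.adj_qr
  · rw [ga, k3]; exact hd.not_adj_pr
  · rw [gy, k4]; exact hd.adj_sp
  · rw [gy, k5]; exact hd.adj_sq
  · rw [gy, k6]; exact hd.adj_sr

end Collapse

section Shorten

variable {G : SimpleGraph V} {p q r x : V}

theorem shorten_adj (h : IsD3b G p q r x) {a b : V} :
    (isolate G {q} ⊔ SimpleGraph.edge p r).Adj a b ↔
      (G.Adj a b ∧ a ≠ q ∧ b ≠ q) ∨ (a = p ∧ b = r) ∨ (a = r ∧ b = p) := by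
  have := h.ne_pr
  rw [SimpleGraph.sup_adj, isolate_adj, SimpleGraph.edge_adj]
  simp only [Set.mem_singleton_iff]
  grind

theorem shorten_neighborSet (h : IsD3b G p q r x) {a : V} (hp : a ≠ p) (hq : a ≠ q) (hr : a ≠ r)
    (hx : a ≠ x) : (isolate G {q} ⊔ SimpleGraph.edge p r).neighborSet a = G.neighborSet a := by
  ext y
  rw [SimpleGraph.mem_neighborSet, SimpleGraph.mem_neighborSet, shorten_adj h]
  have := h.nbr_q (y := a)
  have := G.adj_comm q a
  grind

/-- If the triangle contained `p` but not the apex, the apex would be the outside neighbour of `p`.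
Then `r` would belong to the triangle as well, with the same outside neighbour. By symmetry `r` is
excluded too, and away from `p`, `q`, `r`, `x` neighbourhoods do not change. -/
theorem IsD3a.of_shorten (h : IsD3b G p q r x) {a b c a' b' c' : V}
    (hd : IsD3a (isolate G {q} ⊔ SimpleGraph.edge p r) a b c a' b' c') (ha : a ≠ x) (hb : b ≠ x)
    (hc : c ≠ x) : IsD3a G a b c a' b' c' := by
  have e1 : ∀ y, _ ↔ _ := fun y => hd.adj_p (y := y)
  have e2 : ∀ y, _ ↔ _ := fun y => hd.adj_q (y := y)
  have e3 : ∀ y, _ ↔ _ := fun y => hd.adj_r (y := y)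
  have d1 := hd.distinct
  have k1 := hd.ne_pq
  have k2 := hd.ne_pr
  have k3 := hd.ne_qr
  have n1 := h.adj_sp.ne
  have n2 := h.adj_sq.ne
  have n3 := h.adj_sr.ne
  have n4 := h.adj_pq.ne
  have n5 := h.adj_qr.ne
  have n6 := h.ne_pr
  have px : (isolate G {q} ⊔ SimpleGraph.edge p r).Adj p x :=
    (shorten_adj h).2 (Or.inl ⟨h.adj_sp.symm, n4, n2⟩)
  have rx : (isolate G {q} ⊔ SimpleGraph.edge p r).Adj r x :=
    (shorten_adj h).2 (Or.inl ⟨h.adj_sr.symm, n5.symm, n2⟩)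
  have pr : (isolate G {q} ⊔ SimpleGraph.edge p r).Adj p r :=
    (shorten_adj h).2 (Or.inr (Or.inl ⟨rfl, rfl⟩))
  have rp := pr.symm
  have nq : ∀ y, ¬ (isolate G {q} ⊔ SimpleGraph.edge p r).Adj q y := by
    intro y hy
    rw [shorten_adj h] at hy
    grind
  have q1 : a ≠ q := by rintro rfl; exact nq b ((e1 b).2 (by simp))
  have q2 : b ≠ q := by rintro rfl; exact nq a ((e2 a).2 (by simp))
  have q3 : c ≠ q := by rintro rfl; exact nq a ((e3 a).2 (by simp))
  have p1 : a ≠ p ∧ b ≠ p ∧ c ≠ p ∧ a ≠ r ∧ b ≠ r ∧ c ≠ r := by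
    generalize (isolate G {q} ⊔ SimpleGraph.edge p r) = H at *
    have f1 := e1 x
    have f2 := e2 x
    have f3 := e3 x
    have g1 := e1 r
    have g2 := e2 r
    have g3 := e3 r
    have g4 := e1 p
    have g5 := e2 p
    have g6 := e3 p
    clear e1 e2 e3 h hd nq
    refine ⟨?_, ?_, ?_, ?_, ?_, ?_⟩ <;> rintro rfl <;> grind
  have s1 := shorten_neighborSet h p1.1 q1 p1.2.2.2.1 ha
  have s2 := shorten_neighborSet h p1.2.1 q2 p1.2.2.2.2.1 hb
  have s3 := shorten_neighborSet h p1.2.2.1 q3 p1.2.2.2.2.2 hc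
  exact ⟨s1 ▸ hd.degree_p, s2 ▸ hd.degree_q, s3 ▸ hd.degree_r, s1 ▸ hd.nbr_p, s2 ▸ hd.nbr_q,
    s3 ▸ hd.nbr_r, k1, k2, k3⟩

/-- A path of the shortened graph centred at an end of the path that was shortened. -/
theorem IsD3b.of_shorten_end (h : IsD3b G p q r x) {a c : V}
    (hd : IsD3b (isolate G {q} ⊔ SimpleGraph.edge p r) a p c x) (ha : a ≠ r) :
    IsD3b G a p q x := by
  have n1 := h.adj_sp.ne
  have n2 := h.adj_sq.ne
  have n4 := h.adj_pq.ne
  have n6 := h.adj_sr.ne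
  have h1 : G.Adj a p ∧ a ≠ q ∧ p ≠ q := by
    have := (shorten_adj h).1 hd.adj_pq
    have := h.ne_pr
    grind
  have h2 : G.Adj x a := by
    have := (shorten_adj h).1 hd.adj_sp
    grind
  have h3 := shorten_neighborSet h h1.1.ne h1.2.1 ha h2.ne'
  refine ⟨h3 ▸ hd.degree_p, h.degree_p, h.degree_q, h1.2.1, h1.1, h.adj_pq, ?_, h2, h.adj_sp,
    h.adj_sq⟩
  intro e
  rcases h.nbr_q.1 e.symm with e | e | e
  · exact h1.1.ne e
  · exact ha e
  · exact h2.ne' e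

/-- A path that is new is centred at `p` or `r`. Before the shortening there was a path with the
same middle vertex and with `q` as an end, so that middle vertex was already covered. -/
theorem IsD3b.of_shorten (h : IsD3b G p q r x) {a b c y : V}
    (hd : IsD3b (isolate G {q} ⊔ SimpleGraph.edge p r) a b c y) (ha : a ≠ x) (hb : b ≠ x)
    (hc : c ≠ x) (hp : y ≠ p) (hr : y ≠ r) :
    IsD3b G a b c y ∨ (b = p ∨ b = r) ∧ ∃ u w, IsD3b G u b w x := by
  have n2 := h.adj_sq.ne
  have n4 := h.adj_pq.ne
  have n5 := h.adj_qr.ne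
  by_cases hbp : b = p
  · subst hbp
    right
    have hyx : y = x := ((hd.nbr_q (y := x)).1 ((shorten_adj h).2
      (Or.inl ⟨h.adj_sp.symm, n4, n2⟩))).resolve_left ha.symm |>.resolve_left hc.symm |>.symm
    subst hyx
    by_cases har : a = r
    · exact ⟨Or.inl rfl, c, q, IsD3b.of_shorten_end h hd.symm (by rw [← har]; exact hd.ne_pr.symm)⟩
    · exact ⟨Or.inl rfl, a, q, IsD3b.of_shorten_end h hd har⟩
  · by_cases hbr : b = r
    · subst hbr
      right
      have hyx : y = x := ((hd.nbr_q (y := x)).1 ((shorten_adj h).2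
        (Or.inl ⟨h.adj_sr.symm, n5.symm, n2⟩))).resolve_left ha.symm
          |>.resolve_left hc.symm |>.symm
      subst hyx
      have hd' := hd
      rw [SimpleGraph.edge_comm] at hd'
      by_cases hap : a = p
      · exact ⟨Or.inr rfl, c, q,
          IsD3b.of_shorten_end h.symm hd'.symm (by rw [← hap]; exact hd.ne_pr.symm)⟩
      · exact ⟨Or.inr rfl, a, q, IsD3b.of_shorten_end h.symm hd' hap⟩
    · left
      have adj : ∀ u v, (u ≠ p ∧ u ≠ r) ∨ (v ≠ p ∧ v ≠ r) →
          (isolate G {q} ⊔ SimpleGraph.edge p r).Adj u v → G.Adj u v ∧ u ≠ q ∧ v ≠ q := by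
        intro u v huv hadj
        rw [shorten_adj h] at hadj
        grind
      have k1 := adj _ _ (Or.inr ⟨hbp, hbr⟩) hd.adj_pq
      have k2 := adj _ _ (Or.inl ⟨hbp, hbr⟩) hd.adj_qr
      have k3 := adj _ _ (Or.inl ⟨hp, hr⟩) hd.adj_sp
      have k4 := adj _ _ (Or.inl ⟨hp, hr⟩) hd.adj_sq
      have k5 := adj _ _ (Or.inl ⟨hp, hr⟩) hd.adj_sr
      have deg : ∀ u, ((isolate G {q} ⊔ SimpleGraph.edge p r).neighborSet u).ncard = 3 → u ≠ q →
          u ≠ x → (G.neighborSet u).ncard = 3 := by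
        intro u h1 h2 h3
        by_cases e1 : u = p
        · rw [e1]; exact h.degree_p
        · by_cases e2 : u = r
          · rw [e2]; exact h.degree_r
          · rw [← shorten_neighborSet h e1 h2 e2 h3]; exact h1
      exact ⟨deg a hd.degree_p k1.2.1 ha, deg b hd.degree_q k1.2.2 hb, deg c hd.degree_r k2.2.2 hc,
        hd.ne_pr, k1.1, k2.1, fun e => hd.not_adj_pr ((shorten_adj h).2
          (Or.inl ⟨e, k1.2.1, k2.2.2⟩)), k3.1, k4.1, k5.1⟩

end Shorten

/-- Each reduction after the move either existed before at the same vertices, or at least had the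
same middle vertex, or involves a vertex that the move adds to `C`. That the graph is Halin is used
for shortening and for discarding. -/
theorem State.Covered.next [Finite V] {s : State V} {T : SimpleGraph V} {rot : V → V → V}
    (h : Dec s.graph s.alive T rot) (hK : s.KLeaf T) (hc : s.Covered) {m : Move V}
    (hm : m.Allowed s) : (s.next m).Covered := by
  have keep : ∀ v, v ∈ s.C → v ≠ m.vertex → v ∈ (s.next m).C := fun v h1 h2 => Or.inl ⟨h1, h2⟩
  cases m with
  | collapse p q r p' q' r' =>
    have hd : IsD3a s.graph p q r p' q' r' := hm.2.1
    have new : p ∈ (s.next (.collapse p q r p' q' r')).C := Or.inr (Or.inl rfl)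
    constructor
    · intro a b c a' b' c' h1
      by_cases ha : a = p
      · exact Or.inl (ha ▸ new)
      · by_cases hb : b = p
        · exact Or.inr (Or.inl (hb ▸ new))
        · by_cases hc' : c = p
          · exact Or.inr (Or.inr (hc' ▸ new))
          · obtain ⟨_, _, _, h2⟩ := hd.of_collapse h1 ha hb hc'
            rcases hc.1 _ _ _ _ _ _ h2 with e | e | e
            · exact Or.inl (keep _ e ha)
            · exact Or.inr (Or.inl (keep _ e hb))
            · exact Or.inr (Or.inr (keep _ e hc'))
    · intro a b c y h1
      by_cases hb : b = p
      · exact hb ▸ new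
      · by_cases hpb : (s.next (.collapse p q r p' q' r')).graph.Adj p b
        · exact Or.inr (Or.inr ⟨hpb, h1.degree_q⟩)
        · exact keep _ (hc.2 _ _ _ _ (IsD3b.of_collapse hd h1 hb hpb)) hb
  | shorten p q r x =>
    have hd : IsD3b s.graph p q r x := hm.2.1
    have iso : ∀ u v, (s.next (.shorten p q r x)).graph.Adj u v → u ≠ q := by
      intro u v huv
      have := (shorten_adj hd).1 huv
      have := hd.adj_pq.ne
      have := hd.adj_qr.ne
      grind
    constructor
    · intro a b c a' b' c' h1
      by_cases ha : a = x
      · exact Or.inl (Or.inr ⟨ha, ha ▸ h1.degree_p⟩)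
      · by_cases hb : b = x
        · exact Or.inr (Or.inl (Or.inr ⟨hb, hb ▸ h1.degree_q⟩))
        · by_cases hc' : c = x
          · exact Or.inr (Or.inr (Or.inr ⟨hc', hc' ▸ h1.degree_r⟩))
          · have h2 := IsD3a.of_shorten hd h1 ha hb hc'
            rcases hc.1 _ _ _ _ _ _ h2 with e | e | e
            · exact Or.inl (keep _ e (iso a b (h1.adj_p.2 (by simp))))
            · exact Or.inr (Or.inl (keep _ e (iso b a (h1.adj_q.2 (by simp)))))
            · exact Or.inr (Or.inr (keep _ e (iso c a (h1.adj_r.2 (by simp)))))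
    · intro a b c y h1
      obtain ⟨lp, lq, lr, lx⟩ := h.isLeaf_of_isD3b hd
      obtain ⟨T₁, rot₁, h2, hl⟩ := h.shorten hd
      -- In the shortened Halin graph the new path consists of leaves and its apex is inner. So the
      -- old apex is not on the path, and neither `p` nor `r` is the new apex.
      obtain ⟨ka, kb, kc, ky⟩ := Dec.isLeaf_of_isD3b h2 h1
      have nx : ∀ u, IsLeaf T₁ u → u ≠ x := by
        rintro u hu rfl
        exact lx ((hl u).2 (Or.inr hu))
      have yp : y ≠ p := by
        rintro rfl
        exact ky (((hl y).1 lp).resolve_left hd.adj_pq.ne)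
      have yr : y ≠ r := by
        rintro rfl
        exact ky (((hl y).1 lr).resolve_left hd.adj_qr.ne')
      have hbq := iso b c h1.adj_qr
      rcases IsD3b.of_shorten hd h1 (nx a ka) (nx b kb) (nx c kc) yp yr with e | ⟨-, u, w, e⟩
      · exact keep _ (hc.2 _ _ _ _ e) hbq
      · exact keep _ (hc.2 _ _ _ _ e) hbq
  | discard v =>
    obtain ⟨-, h1, h2⟩ := hm
    -- A forbidden triangle would consist of three leaves. Hence none exists, and discarding loses
    -- no D3a reduction.
    have no : ∀ q r p' q' r', ¬ IsD3a s.graph v q r p' q' r' := by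
      intro q r p' q' r' hd
      obtain ⟨k1, k2, k3⟩ := h1 _ _ _ _ _ hd
      exact h.not_isLeaf_of_isD3a hd
        ⟨hK _ (h.mem_of_adj (hd.adj_p.2 (by simp) : s.graph.Adj v q)) k1,
        hK _ (h.mem_of_adj (hd.adj_q.2 (by simp) : s.graph.Adj q v)) k2,
        hK _ (h.mem_of_adj (hd.adj_r.2 (by simp) : s.graph.Adj r v)) k3⟩
    constructor
    · intro a b c a' b' c' hd
      have e1 : a ≠ v := by rintro rfl; exact no _ _ _ _ _ hd
      have e2 : b ≠ v := by rintro rfl; exact no _ _ _ _ _ hd.rotate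
      have e3 : c ≠ v := by rintro rfl; exact no _ _ _ _ _ hd.rotate.rotate
      rcases hc.1 _ _ _ _ _ _ hd with e | e | e
      · exact Or.inl (keep _ e e1)
      · exact Or.inr (Or.inl (keep _ e e2))
      · exact Or.inr (Or.inr (keep _ e e3))
    · intro a b c y hd
      refine keep _ (hc.2 _ _ _ _ hd) ?_
      rintro rfl
      exact (h.isLeaf_of_isD3b hd).2.2.2 (hK _ (h.mem_of_adj hd.adj_sp) (h2 _ _ _ hd))

theorem Run.dec_covered [Finite V] {s s' : State V} {ms : List (Move V)} (hr : Run s ms s')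
    {T : SimpleGraph V} {rot : V → V → V} (h : Dec s.graph s.alive T rot) (hK : s.KLeaf T)
    (hc : s.Covered) : ∃ T₁ rot₁, Dec s'.graph s'.alive T₁ rot₁ ∧ s'.KLeaf T₁ ∧ s'.Covered := by
  induction hr generalizing T rot with
  | nil => exact ⟨T, rot, h, hK, hc⟩
  | cons hm _ ih =>
    obtain ⟨T₁, rot₁, h1, h2⟩ := h.next hK hm
    exact ih h1 h2 (hc.next h hK hm)

/-- Acceptance yields a decomposition by reversal. Conversely, with `C` empty no reduction is left,
so the tree of a Halin graph has shrunk to a star, and its centre is not in `K` because it is not a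
leaf. -/
theorem CompleteRun.accepts_iff [Finite V] {G : SimpleGraph V} {ms : List (Move V)} {s : State V}
    (h : CompleteRun G ms s) : s.Accepts ↔ IsHalin G := by
  constructor
  · rintro ⟨hk, z, hz, hzK⟩
    exact ⟨_, _, h.1.isDecomposition hk hz hzK⟩
  · intro hG
    obtain ⟨T, rot, hd⟩ := isHalin_iff_dec.1 hG
    obtain ⟨T₁, rot₁, h1, h2, h3⟩ := h.1.dec_covered (s := State.init G) hd
      (fun _ _ h => h.elim) (State.covered_init G)
    have hC := h.2
    rcases h1.exists_reduction with ⟨_, _, _, _, _, _, e⟩ | ⟨_, _, _, _, e⟩ |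
      ⟨c, u, v, w, hc, hA, -, -, -, uv, vw, uw, cu, cv, cw⟩
    · have := h3.1 _ _ _ _ _ _ e
      simp [hC] at this
    · have := h3.2 _ _ _ _ e
      simp [hC] at this
    · have hcA : c ∈ s.alive := by rw [hA]; simp
      exact ⟨isK4_of_insert hA cu cv cw uv uw vw, c, hcA, fun e => hc (h2 c hcA e)⟩

/-! ### Adjacency lists

The cells of the vertex `v` are the numbers from `st v` to `en v - 1`.  Each belongs to an edge at
`v`; `nb` gives the other end of the edge and `tw` its cell there. -/

/-- `pos v w` is the cell of `v` that belongs to the edge from `v` to `w`. -/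
structure Cells (G : SimpleGraph V) (e : V → ℕ) (st en nb tw : ℕ → ℕ) (pos : V → V → ℕ) :
    Prop where
  le : ∀ {v w}, G.Adj v w → st (e v) ≤ pos v w
  lt : ∀ {v w}, G.Adj v w → pos v w < en (e v)
  nbr : ∀ {v w}, G.Adj v w → nb (pos v w) = e w
  twin : ∀ {v w}, G.Adj v w → tw (pos v w) = pos w v
  surj : ∀ {v i}, st (e v) ≤ i → i < en (e v) → ∃ w, G.Adj v w ∧ pos v w = i

namespace Cells

variable {G : SimpleGraph V} {e : V → ℕ} {st en nb tw : ℕ → ℕ} {pos : V → V → ℕ}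

/-- A cell determines the far end of its edge, and its twin determines the near end. -/
theorem pos_inj (h : Cells G e st en nb tw pos) (he : Function.Injective e) {v w v' w' : V}
    (h1 : G.Adj v w) (h2 : G.Adj v' w') (h3 : pos v w = pos v' w') : v = v' ∧ w = w' := by
  have e1 : w = w' := he (by rw [← h.nbr h1, ← h.nbr h2, h3])
  have e2 : pos w v = pos w' v' := by rw [← h.twin h1, ← h.twin h2, h3]
  exact ⟨he (by rw [← h.nbr h1.symm, ← h.nbr h2.symm, e2]), e1⟩

theorem ncard_neighborSet (h : Cells G e st en nb tw pos) (he : Function.Injective e) (v : V) :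
    (G.neighborSet v).ncard = en (e v) - st (e v) := by
  have h1 : pos v '' G.neighborSet v = ↑(Finset.Ico (st (e v)) (en (e v))) := by
    ext i
    simp only [Set.mem_image, SimpleGraph.mem_neighborSet, Finset.coe_Ico, Set.mem_Ico]
    constructor
    · rintro ⟨w, hw, rfl⟩
      exact ⟨h.le hw, h.lt hw⟩
    · rintro ⟨h1, h2⟩
      exact h.surj h1 h2
  have h2 : Set.InjOn (pos v) (G.neighborSet v) := fun a ha b hb hab =>
    (h.pos_inj he ha hb hab).2
  rw [← Set.ncard_image_of_injOn h2, h1, Set.ncard_coe_finset, Nat.card_Ico]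

/-- The edge takes the cell at the current end of the segment of each of its vertices. These two
cells must be different and not yet in use. -/
theorem addEdge (h : Cells G e st en nb tw pos) (he : Function.Injective e) {u v : V}
    (huv : u ≠ v) (hn : ¬ G.Adj u v) (hu : st (e u) ≤ en (e u)) (hv : st (e v) ≤ en (e v))
    (fu : ∀ x y, G.Adj x y → pos x y ≠ en (e u)) (fv : ∀ x y, G.Adj x y → pos x y ≠ en (e v))
    (hab : en (e u) ≠ en (e v)) :
    ∃ pos', Cells (G ⊔ SimpleGraph.edge u v) e st
      (Function.update (Function.update en (e u) (en (e u) + 1)) (e v) (en (e v) + 1))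
      (Function.update (Function.update nb (en (e u)) (e v)) (en (e v)) (e u))
      (Function.update (Function.update tw (en (e u)) (en (e v))) (en (e v)) (en (e u))) pos' := by
  classical
  have adj : ∀ x y, (G ⊔ SimpleGraph.edge u v).Adj x y ↔
      G.Adj x y ∨ (x = u ∧ y = v) ∨ (x = v ∧ y = u) := by
    intro x y
    rw [SimpleGraph.sup_adj, SimpleGraph.edge_adj]
    grind
  have hn' : ¬ G.Adj v u := fun e => hn e.symm
  set pos' : V → V → ℕ := fun x y =>
    if x = u ∧ y = v then en (e u) else if x = v ∧ y = u then en (e v) else pos x y with hpos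
  have p1 : pos' u v = en (e u) := by simp [hpos]
  have p2 : pos' v u = en (e v) := by simp [hpos, huv, huv.symm]
  have p3 : ∀ x y, G.Adj x y → pos' x y = pos x y := by
    intro x y hxy
    have : ¬ (x = u ∧ y = v) := by rintro ⟨rfl, rfl⟩; exact hn hxy
    have : ¬ (x = v ∧ y = u) := by rintro ⟨rfl, rfl⟩; exact hn' hxy
    simp [hpos, *]
  have hen : ∀ x, en (e x) ≤ (Function.update (Function.update en (e u) (en (e u) + 1)) (e v)
      (en (e v) + 1)) (e x) := by
    intro x
    by_cases h1 : x = v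
    · subst h1; simp
    · by_cases h2 : x = u
      · subst h2; simp [he.ne h1]
      · simp [he.ne h1, he.ne h2]
  refine ⟨pos', ?_, ?_, ?_, ?_, ?_⟩
  · intro x y hxy
    rcases (adj x y).1 hxy with h1 | ⟨rfl, rfl⟩ | ⟨rfl, rfl⟩
    · rw [p3 _ _ h1]; exact h.le h1
    · rw [p1]; exact hu
    · rw [p2]; exact hv
  · intro x y hxy
    rcases (adj x y).1 hxy with h1 | ⟨rfl, rfl⟩ | ⟨rfl, rfl⟩
    · rw [p3 _ _ h1]; exact (h.lt h1).trans_le (hen x)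
    · rw [p1]; simp [he.ne huv]
    · rw [p2]; simp
  · intro x y hxy
    rcases (adj x y).1 hxy with h1 | ⟨rfl, rfl⟩ | ⟨rfl, rfl⟩
    · rw [p3 _ _ h1]; simp [fu _ _ h1, fv _ _ h1, h.nbr h1]
    · rw [p1]; simp [hab]
    · rw [p2]; simp
  · intro x y hxy
    rcases (adj x y).1 hxy with h1 | ⟨rfl, rfl⟩ | ⟨rfl, rfl⟩
    · rw [p3 _ _ h1, p3 _ _ h1.symm]; simp [fu _ _ h1, fv _ _ h1, h.twin h1]
    · rw [p1, p2]; simp [hab]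
    · rw [p2, p1]; simp
  · intro x i h1 h2
    by_cases hx : x = v
    · subst hx
      simp only [Function.update_self] at h2
      by_cases hi : i = en (e x)
      · exact ⟨u, (adj _ _).2 (by simp), by rw [p2, hi]⟩
      · obtain ⟨w, hw, hw'⟩ := h.surj h1 (by omega)
        exact ⟨w, (adj _ _).2 (Or.inl hw), by rw [p3 _ _ hw, hw']⟩
    · rw [Function.update_of_ne (he.ne hx)] at h2
      by_cases hx2 : x = u
      · subst hx2
        simp only [Function.update_self] at h2
        by_cases hi : i = en (e x)
        · exact ⟨v, (adj _ _).2 (by simp), by rw [p1, hi]⟩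
        · obtain ⟨w, hw, hw'⟩ := h.surj h1 (by omega)
          exact ⟨w, (adj _ _).2 (Or.inl hw), by rw [p3 _ _ hw, hw']⟩
      · rw [Function.update_of_ne (he.ne hx2)] at h2
        obtain ⟨w, hw, hw'⟩ := h.surj h1 h2
        exact ⟨w, (adj _ _).2 (Or.inl hw), by rw [p3 _ _ hw, hw']⟩

/-- The new vertex keeps the segment of `p`. The two cells of `p` that led to `q` and `r` are paired
with the cells of `q'` and `r'` that led into the triangle, and the segments of `q` and `r` are
emptied. No neighbour list has to be scanned. -/
theorem collapse (h : Cells G e st en nb tw pos) (he : Function.Injective e)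
    {p q r p' q' r' : V} (hd : IsD3a G p q r p' q' r') :
    ∃ pos', Cells (collapseGraph G p q r p p' q' r') e st
      (Function.update (Function.update en (e q) (st (e q))) (e r) (st (e r)))
      (Function.update (Function.update (Function.update (Function.update nb
        (pos p q) (e q')) (pos p r) (e r')) (pos q' q) (e p)) (pos r' r) (e p))
      (Function.update (Function.update (Function.update (Function.update tw
        (pos p q) (pos q' q)) (pos q' q) (pos p q)) (pos p r) (pos r' r)) (pos r' r) (pos p r))
      pos' := by
  classical
  have d1 := hd.distinct
  have d2 := hd.rotate.distinct
  have d3 := hd.rotate.rotate.distinct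
  have k1 := hd.ne_pq
  have k2 := hd.ne_pr
  have k3 := hd.ne_qr
  have apq : G.Adj p q := hd.adj_p.2 (by simp)
  have apr : G.Adj p r := hd.adj_p.2 (by simp)
  have app : G.Adj p p' := hd.adj_p.2 (by simp)
  have aqq : G.Adj q' q := (hd.adj_q.2 (by simp) : G.Adj q q').symm
  have arr : G.Adj r' r := (hd.adj_r.2 (by simp) : G.Adj r r').symm
  have ne : ∀ {x y x' y'}, G.Adj x y → G.Adj x' y' → ¬ (x = x' ∧ y = y') → pos x y ≠ pos x' y' :=
    fun h1 h2 h3 h4 => h3 (h.pos_inj he h1 h2 h4)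
  have n1 : pos p q ≠ pos p r := ne apq apr (by grind)
  have n2 : pos p q ≠ pos q' q := ne apq aqq (by grind)
  have n3 : pos p q ≠ pos r' r := ne apq arr (by grind)
  have n4 : pos p r ≠ pos q' q := ne apr aqq (by grind)
  have n5 : pos p r ≠ pos r' r := ne apr arr (by grind)
  have n6 : pos q' q ≠ pos r' r := ne aqq arr (by grind)
  set en' := Function.update (Function.update en (e q) (st (e q))) (e r) (st (e r)) with hen
  set nb' := Function.update (Function.update (Function.update (Function.update nb
        (pos p q) (e q')) (pos p r) (e r')) (pos q' q) (e p)) (pos r' r) (e p) with hnb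
  set tw' := Function.update (Function.update (Function.update (Function.update tw
        (pos p q) (pos q' q)) (pos q' q) (pos p q)) (pos p r) (pos r' r)) (pos r' r) (pos p r)
    with htw
  have keep : ∀ x y, G.Adj x y → ¬ (x = p ∧ y = q) → ¬ (x = p ∧ y = r) → ¬ (x = q' ∧ y = q) →
      ¬ (x = r' ∧ y = r) → nb' (pos x y) = e y ∧ tw' (pos x y) = pos y x := by
    intro x y h0 h1 h2 h3 h4
    have m1 := ne h0 apq h1
    have m2 := ne h0 apr h2
    have m3 := ne h0 aqq h3
    have m4 := ne h0 arr h4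
    simp [hnb, htw, m1, m2, m3, m4, h.nbr h0, h.twin h0]
  have b1 : nb' (pos p q) = e q' ∧ tw' (pos p q) = pos q' q := by simp [hnb, htw, n1, n2, n3]
  have b2 : nb' (pos p r) = e r' ∧ tw' (pos p r) = pos r' r := by simp [hnb, htw, n4, n5]
  have b3 : nb' (pos q' q) = e p ∧ tw' (pos q' q) = pos p q := by
    simp [hnb, htw, n4.symm, n6]
  have b4 : nb' (pos r' r) = e p ∧ tw' (pos r' r) = pos p r := by simp [hnb, htw]
  have en1 : ∀ x, x ≠ q → x ≠ r → en' (e x) = en (e x) := by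
    intro x h1 h2
    simp [hen, he.ne h1, he.ne h2]
  have en2 : en' (e q) = st (e q) := by simp [hen, he.ne d1.2.2.1]
  have en3 : en' (e r) = st (e r) := by simp [hen]
  clear_value en' nb' tw'
  set pos' : V → V → ℕ := fun x y =>
    if x = p ∧ y = q' then pos p q else if x = p ∧ y = r' then pos p r else
      if x = q' ∧ y = p then pos q' q else if x = r' ∧ y = p then pos r' r else pos x y with hpos
  have q1 : pos' p q' = pos p q := by simp [hpos]
  have q2 : pos' p r' = pos p r := by simp [hpos, k3.symm]
  have q3 : pos' q' p = pos q' q := by grind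
  have q4 : pos' r' p = pos r' r := by grind
  have q5 : ∀ x y, ¬ (x = p ∧ (y = q' ∨ y = r')) → ¬ (y = p ∧ (x = q' ∨ x = r')) →
      pos' x y = pos x y := by grind
  have q6 : pos' p p' = pos p p' := q5 _ _ (by grind) (by grind)
  have q7 : pos' p' p = pos p' p := q5 _ _ (by grind) (by grind)
  clear_value pos'
  have cases : ∀ x y, (collapseGraph G p q r p p' q' r').Adj x y →
      (x ≠ q ∧ x ≠ r) ∧ (
      (G.Adj x y ∧ pos' x y = pos x y ∧ pos' y x = pos y x ∧ nb' (pos x y) = e y ∧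
        tw' (pos x y) = pos y x) ∨
      (x = p ∧ y = q') ∨ (x = p ∧ y = r') ∨ (x = q' ∧ y = p) ∨ (x = r' ∧ y = p)) := by
    intro x y hxy
    have hxy' := (hd.collapse_adj (by simp)).1 hxy
    refine ⟨by grind, ?_⟩
    rcases hxy' with ⟨h1, h2, h3⟩ | ⟨rfl, rfl | rfl | rfl⟩ | ⟨rfl, rfl | rfl | rfl⟩
    · exact Or.inl ⟨h1, q5 _ _ (by grind) (by grind), q5 _ _ (by grind) (by grind),
        keep _ _ h1 (by grind) (by grind) (by grind) (by grind)⟩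
    · exact Or.inl ⟨app, q6, q7, keep _ _ app (by grind) (by grind) (by grind) (by grind)⟩
    · simp
    · simp
    · exact Or.inl ⟨app.symm, q7, q6,
        keep _ _ app.symm (by grind) (by grind) (by grind) (by grind)⟩
    · simp
    · simp
  refine ⟨pos', ?_, ?_, ?_, ?_, ?_⟩
  · intro x y hxy
    rcases (cases x y hxy).2 with ⟨h1, h2, -⟩ | ⟨rfl, rfl⟩ | ⟨rfl, rfl⟩ | ⟨rfl, rfl⟩ | ⟨rfl, rfl⟩
    · rw [h2]; exact h.le h1
    · rw [q1]; exact h.le apq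
    · rw [q2]; exact h.le apr
    · rw [q3]; exact h.le aqq
    · rw [q4]; exact h.le arr
  · intro x y hxy
    obtain ⟨⟨m1, m2⟩, m3⟩ := cases x y hxy
    rw [en1 x m1 m2]
    rcases m3 with ⟨h1, h2, -⟩ | ⟨rfl, rfl⟩ | ⟨rfl, rfl⟩ | ⟨rfl, rfl⟩ | ⟨rfl, rfl⟩
    · rw [h2]; exact h.lt h1
    · rw [q1]; exact h.lt apq
    · rw [q2]; exact h.lt apr
    · rw [q3]; exact h.lt aqq
    · rw [q4]; exact h.lt arr
  · intro x y hxy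
    rcases (cases x y hxy).2 with ⟨h1, h2, h3, h4, h5⟩ | ⟨rfl, rfl⟩ | ⟨rfl, rfl⟩ | ⟨rfl, rfl⟩ |
      ⟨rfl, rfl⟩
    · rw [h2]; exact h4
    · rw [q1]; exact b1.1
    · rw [q2]; exact b2.1
    · rw [q3]; exact b3.1
    · rw [q4]; exact b4.1
  · intro x y hxy
    rcases (cases x y hxy).2 with ⟨h1, h2, h3, h4, h5⟩ | ⟨rfl, rfl⟩ | ⟨rfl, rfl⟩ | ⟨rfl, rfl⟩ |
      ⟨rfl, rfl⟩
    · rw [h2, h3]; exact h5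
    · rw [q1, q3]; exact b1.2
    · rw [q2, q4]; exact b2.2
    · rw [q3, q1]; exact b3.2
    · rw [q4, q2]; exact b4.2
  · intro v i h1 h2
    by_cases vq : v = q
    · subst vq; omega
    by_cases vr : v = r
    · subst vr; omega
    rw [en1 v vq vr] at h2
    obtain ⟨w, hw, rfl⟩ := h.surj h1 h2
    have adj : ∀ x y, _ → (collapseGraph G p q r p p' q' r').Adj x y :=
      fun x y hxy => (hd.collapse_adj (by simp)).2 hxy
    by_cases vp : v = p
    · subst vp
      rcases hd.adj_p.1 hw with rfl | rfl | rfl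
      · exact ⟨q', adj _ _ (by simp), q1⟩
      · exact ⟨r', adj _ _ (by simp), q2⟩
      · exact ⟨w, adj _ _ (by simp), q6⟩
    · by_cases wp : w = p
      · subst wp
        obtain rfl : v = p' := by have := hd.adj_p.1 hw.symm; grind
        exact ⟨w, adj _ _ (by simp), q7⟩
      · by_cases wq : w = q
        · subst wq
          obtain rfl : v = q' := by have := hd.adj_q.1 hw.symm; grind
          exact ⟨p, adj _ _ (by simp), q3⟩
        · by_cases wr : w = r
          · subst wr
            obtain rfl : v = r' := by have := hd.adj_r.1 hw.symm; grind
            exact ⟨p, adj _ _ (by simp), q4⟩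
          · exact ⟨w, adj _ _ (Or.inl ⟨hw, ⟨vp, vq, vr⟩, ⟨wp, wq, wr⟩⟩),
              q5 _ _ (by grind) (by grind)⟩

end Cells

namespace Cells

variable {G : SimpleGraph V} {e : V → ℕ} {st en nb tw : ℕ → ℕ} {pos : V → V → ℕ}

/-- The cells of `p` and `r` that led to `q` become the two cells of the edge between `p` and `r`.
At the apex, whose degree is unbounded, the cell of `q` is overwritten by the last cell, so deletion
takes constant time. -/
theorem shorten (h : Cells G e st en nb tw pos) (he : Function.Injective e) {p q r x : V}
    (hd : IsD3b G p q r x) {nb₁ tw₁ : ℕ → ℕ}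
    (hnb : nb₁ = Function.update (Function.update nb (pos p q) (e r)) (pos r q) (e p))
    (htw : tw₁ = Function.update (Function.update tw (pos p q) (pos r q)) (pos r q) (pos p q)) :
    ∃ pos', Cells (isolate G {q} ⊔ SimpleGraph.edge p r) e st
      (Function.update (Function.update en (e q) (st (e q))) (e x) (en (e x) - 1))
      (Function.update nb₁ (pos x q) (nb₁ (en (e x) - 1)))
      (Function.update (Function.update tw₁ (pos x q) (tw₁ (en (e x) - 1)))
        (tw₁ (en (e x) - 1)) (pos x q)) pos' := by
  classical
  have apq := hd.adj_pq
  have arq := hd.adj_qr.symm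
  have axq := hd.adj_sq
  have npr := hd.ne_pr
  have npq := apq.ne
  have nrq := arq.ne
  have nxq := axq.ne
  have nxp := hd.adj_sp.ne
  have nxr := hd.adj_sr.ne
  have ne : ∀ {x y x' y'}, G.Adj x y → G.Adj x' y' → ¬ (x = x' ∧ y = y') → pos x y ≠ pos x' y' :=
    fun h1 h2 h3 h4 => h3 (h.pos_inj he h1 h2 h4)
  have n1 : pos p q ≠ pos r q := ne apq arq (by grind)
  have n2 : pos p q ≠ pos x q := ne apq axq (by grind)
  have n3 : pos r q ≠ pos x q := ne arq axq (by grind)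
  have hx1 := h.le axq
  have hx2 := h.lt axq
  -- `u` is the neighbour of the apex in its last cell. It may be `q` itself, in which case only the
  -- discarded cells are affected by the move.
  obtain ⟨u, hu, hl⟩ := h.surj (v := x) (i := en (e x) - 1) (by omega) (by omega)
  rw [← hl]
  have c1 : nb₁ (pos x u) = e u := by
    simp [hnb, ne hu apq (by grind), ne hu arq (by grind), h.nbr hu]
  have c2 : tw₁ (pos x u) = pos u x := by
    simp [htw, ne hu apq (by grind), ne hu arq (by grind), h.twin hu]
  rw [c1, c2]
  have nux := hu.ne
  have nu : pos x q ≠ pos u x := ne axq hu.symm (by grind)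
  set en' := Function.update (Function.update en (e q) (st (e q))) (e x) (pos x u) with hen
  set nb' := Function.update nb₁ (pos x q) (e u) with hnb'
  set tw' := Function.update (Function.update tw₁ (pos x q) (pos u x)) (pos u x) (pos x q) with htw'
  have keep : ∀ a b, G.Adj a b → a ≠ q → b ≠ q → ¬ (a = u ∧ b = x) →
      nb' (pos a b) = e b ∧ tw' (pos a b) = pos b a := by
    intro a b hab ha hb h1
    have m1 := ne hab apq (by grind)
    have m2 := ne hab arq (by grind)
    have m3 := ne hab axq (by grind)
    have m4 := ne hab hu.symm h1
    simp [hnb', htw', hnb, htw, m1, m2, m3, m4, h.nbr hab, h.twin hab]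
  have b1 : nb' (pos p q) = e r ∧ tw' (pos p q) = pos r q := by
    have m := ne apq hu.symm (by grind)
    simp [hnb', htw', hnb, htw, n1, n2, m]
  have b2 : nb' (pos r q) = e p ∧ tw' (pos r q) = pos p q := by
    have m := ne arq hu.symm (by grind)
    simp [hnb', htw', hnb, htw, n3, m]
  have b3 : nb' (pos x q) = e u ∧ tw' (pos x q) = pos u x := by
    simp [hnb', htw', nu]
  have b4 : u ≠ q → nb' (pos u x) = e x ∧ tw' (pos u x) = pos x q := by
    intro huq
    have m1 := ne hu.symm apq (by grind)
    have m2 := ne hu.symm arq (by grind)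
    simp [hnb', htw', hnb, m1, m2, nu.symm, h.nbr hu.symm]
  have en1 : ∀ y, y ≠ q → y ≠ x → en' (e y) = en (e y) := by
    intro y h1 h2
    simp [hen, he.ne h1, he.ne h2]
  have en2 : en' (e q) = st (e q) := by simp [hen, he.ne nxq.symm]
  have en3 : en' (e x) = pos x u := by simp [hen]
  clear_value en' nb' tw'
  set pos' : V → V → ℕ := fun a b =>
    if a = p ∧ b = r then pos p q else if a = r ∧ b = p then pos r q else
      if a = x ∧ b = u then pos x q else pos a b with hpos
  have q1 : pos' p r = pos p q := by simp [hpos]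
  have q2 : pos' r p = pos r q := by simp [hpos, npr, npr.symm]
  have q3 : pos' x u = pos x q := by simp [hpos, nxp, nxr]
  have q4 : ∀ a b, G.Adj a b → ¬ (a = x ∧ b = u) → pos' a b = pos a b := by
    intro a b hab h1
    have h2 : ¬ (a = p ∧ b = r) := by rintro ⟨rfl, rfl⟩; exact hd.not_adj_pr hab
    have h3 : ¬ (a = r ∧ b = p) := by rintro ⟨rfl, rfl⟩; exact hd.not_adj_pr hab.symm
    simp [hpos, h1, h2, h3]
  clear_value pos'
  have q5 : pos' u x = pos u x := q4 _ _ hu.symm (by grind)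
  have cases : ∀ a b, (isolate G {q} ⊔ SimpleGraph.edge p r).Adj a b →
      (G.Adj a b ∧ a ≠ q ∧ b ≠ q ∧ ¬ (a = x ∧ b = u) ∧ ¬ (a = u ∧ b = x) ∧
        pos' a b = pos a b ∧ pos' b a = pos b a) ∨
      (a = p ∧ b = r) ∨ (a = r ∧ b = p) ∨ (u ≠ q ∧ a = x ∧ b = u) ∨ (u ≠ q ∧ a = u ∧ b = x) := by
    intro a b hab
    rcases (shorten_adj hd).1 hab with ⟨h1, h2, h3⟩ | h1 | h1
    · by_cases h4 : a = x ∧ b = u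
      · exact Or.inr (Or.inr (Or.inr (Or.inl ⟨h4.2 ▸ h3, h4⟩)))
      · by_cases h5 : a = u ∧ b = x
        · exact Or.inr (Or.inr (Or.inr (Or.inr ⟨h5.1 ▸ h2, h5⟩)))
        · exact Or.inl ⟨h1, h2, h3, h4, h5, q4 _ _ h1 h4, q4 _ _ h1.symm (by grind)⟩
    · exact Or.inr (Or.inl h1)
    · exact Or.inr (Or.inr (Or.inl h1))
  refine ⟨pos', ?_, ?_, ?_, ?_, ?_⟩
  · intro a b hab
    rcases cases a b hab with ⟨h1, -, -, -, -, h2, -⟩ | ⟨rfl, rfl⟩ | ⟨rfl, rfl⟩ | ⟨-, rfl, rfl⟩ |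
      ⟨-, rfl, rfl⟩
    · rw [h2]; exact h.le h1
    · rw [q1]; exact h.le apq
    · rw [q2]; exact h.le arq
    · rw [q3]; exact h.le axq
    · rw [q5]; exact h.le hu.symm
  · intro a b hab
    rcases cases a b hab with ⟨h1, k1, k2, k3, k4, h2, -⟩ | ⟨rfl, rfl⟩ | ⟨rfl, rfl⟩ |
      ⟨k, rfl, rfl⟩ | ⟨k, rfl, rfl⟩
    · rw [h2]
      by_cases hax : a = x
      · subst hax
        have := h.lt h1
        have := ne h1 hu k3
        rw [en3]
        omega
      · rw [en1 a k1 hax]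
        exact h.lt h1
    · rw [q1, en1 _ npq nxp.symm]; exact h.lt apq
    · rw [q2, en1 _ nrq nxr.symm]; exact h.lt arq
    · rw [q3, en3]
      have := ne axq hu (by grind)
      omega
    · rw [q5, en1 _ k nux.symm]; exact h.lt hu.symm
  · intro a b hab
    rcases cases a b hab with ⟨h1, k1, k2, k3, k4, h2, -⟩ | ⟨rfl, rfl⟩ | ⟨rfl, rfl⟩ |
      ⟨k, rfl, rfl⟩ | ⟨k, rfl, rfl⟩
    · rw [h2]; exact (keep _ _ h1 k1 k2 k4).1
    · rw [q1]; exact b1.1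
    · rw [q2]; exact b2.1
    · rw [q3]; exact b3.1
    · rw [q5]; exact (b4 k).1
  · intro a b hab
    rcases cases a b hab with ⟨h1, k1, k2, k3, k4, h2, h3⟩ | ⟨rfl, rfl⟩ | ⟨rfl, rfl⟩ |
      ⟨k, rfl, rfl⟩ | ⟨k, rfl, rfl⟩
    · rw [h2, h3]; exact (keep _ _ h1 k1 k2 k4).2
    · rw [q1, q2]; exact b1.2
    · rw [q2, q1]; exact b2.2
    · rw [q3, q5]; exact b3.2
    · rw [q5, q3]; exact (b4 k).2
  · intro v i h1 h2
    have adj : ∀ a b, _ → (isolate G {q} ⊔ SimpleGraph.edge p r).Adj a b :=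
      fun a b hab => (shorten_adj hd).2 hab
    by_cases vq : v = q
    · subst vq; omega
    by_cases vx : v = x
    · subst vx
      obtain ⟨w, hw, rfl⟩ := h.surj h1 (by omega)
      have hwu : w ≠ u := by rintro rfl; omega
      by_cases wq : w = q
      · subst wq
        exact ⟨u, adj _ _ (Or.inl ⟨hu, vq, hwu.symm⟩), q3⟩
      · exact ⟨w, adj _ _ (Or.inl ⟨hw, vq, wq⟩), q4 _ _ hw (by grind)⟩
    · rw [en1 v vq vx] at h2
      obtain ⟨w, hw, rfl⟩ := h.surj h1 h2
      by_cases wq : w = q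
      · subst wq
        rcases hd.nbr_q.1 hw.symm with rfl | rfl | rfl
        · exact ⟨r, adj _ _ (by simp), q1⟩
        · exact ⟨p, adj _ _ (by simp), q2⟩
        · exact absurd rfl vx
      · exact ⟨w, adj _ _ (Or.inl ⟨hw, vq, wq⟩), q4 _ _ hw (by grind)⟩

/-- The neighbour in the `i`-th cell of a vertex. -/
theorem exists_nbr (h : Cells G e st en nb tw pos) {v : V} {i : ℕ}
    (hi : st (e v) + i < en (e v)) :
    ∃ w, G.Adj v w ∧ pos v w = st (e v) + i ∧ nb (st (e v) + i) = e w := by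
  obtain ⟨w, h1, h2⟩ := h.surj (v := v) (i := st (e v) + i) (by omega) hi
  exact ⟨w, h1, h2, by rw [← h2, h.nbr h1]⟩

end Cells

/-! ### Reading the cells of a vertex of degree three -/

/-- The orders in which three cells can be read. -/
def orders : List (ℕ × ℕ × ℕ) :=
  [(0, 1, 2), (0, 2, 1), (1, 0, 2), (1, 2, 0), (2, 0, 1), (2, 1, 0)]

theorem mem_orders {i j k : ℕ} :
    (i, j, k) ∈ orders ↔ i < 3 ∧ j < 3 ∧ k < 3 ∧ i ≠ j ∧ i ≠ k ∧ j ≠ k := by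
  simp only [orders, List.mem_cons, Prod.mk.injEq, List.not_mem_nil, or_false]
  omega

namespace Cells

variable {G : SimpleGraph V} {e : V → ℕ} {st en nb tw : ℕ → ℕ} {pos : V → V → ℕ}

theorem degree_three_iff (h : Cells G e st en nb tw pos) (he : Function.Injective e) {v : V} :
    (G.neighborSet v).ncard = 3 ↔ en (e v) = st (e v) + 3 := by
  rw [h.ncard_neighborSet he]
  omega

/-- The neighbours of a vertex of degree three, read in some order. -/
theorem read_three (h : Cells G e st en nb tw pos) (he : Function.Injective e) {v : V}
    (hv : en (e v) = st (e v) + 3) {o : ℕ × ℕ × ℕ} (ho : o ∈ orders) :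
    ∃ a b c, G.neighborSet v = {a, b, c} ∧ pos v a = st (e v) + o.1 ∧
      pos v b = st (e v) + o.2.1 ∧ pos v c = st (e v) + o.2.2 ∧ a ≠ b ∧ a ≠ c ∧ b ≠ c := by
  obtain ⟨i, j, k⟩ := o
  rw [mem_orders] at ho
  obtain ⟨a, ha, ha', -⟩ := h.exists_nbr (v := v) (i := i) (by omega)
  obtain ⟨b, hb, hb', -⟩ := h.exists_nbr (v := v) (i := j) (by omega)
  obtain ⟨c, hc, hc', -⟩ := h.exists_nbr (v := v) (i := k) (by omega)
  have hab : a ≠ b := by rintro rfl; omega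
  have hac : a ≠ c := by rintro rfl; omega
  have hbc : b ≠ c := by rintro rfl; omega
  refine ⟨a, b, c, ?_, ha', hb', hc', hab, hac, hbc⟩
  ext y
  constructor
  · intro hy
    exact eq_or_of_ncard_three ((h.degree_three_iff he).2 hv) ha hb hc hab hac hbc hy
  · rintro (rfl | rfl | rfl)
    exacts [ha, hb, hc]

/-- Any distribution of roles among the three neighbours is met by one of the six orders, so trying
all orders overlooks no reduction. -/
theorem exists_order (h : Cells G e st en nb tw pos) (he : Function.Injective e) {v a b c : V}
    (hv : (G.neighborSet v).ncard = 3) (ha : G.Adj v a) (hb : G.Adj v b) (hc : G.Adj v c)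
    (hab : a ≠ b) (hac : a ≠ c) (hbc : b ≠ c) : ∃ o ∈ orders,
      nb (st (e v) + o.1) = e a ∧ nb (st (e v) + o.2.1) = e b ∧ nb (st (e v) + o.2.2) = e c := by
  rw [h.degree_three_iff he] at hv
  have n1 : pos v a ≠ pos v b := fun e1 => hab (h.pos_inj he ha hb e1).2
  have n2 : pos v a ≠ pos v c := fun e1 => hac (h.pos_inj he ha hc e1).2
  have n3 : pos v b ≠ pos v c := fun e1 => hbc (h.pos_inj he hb hc e1).2
  have l1 := h.le ha
  have l2 := h.le hb
  have l3 := h.le hc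
  have m1 := h.lt ha
  have m2 := h.lt hb
  have m3 := h.lt hc
  refine ⟨(pos v a - st (e v), pos v b - st (e v), pos v c - st (e v)), ?_, ?_, ?_, ?_⟩
  · rw [mem_orders]; omega
  · rw [Nat.add_sub_cancel' l1, h.nbr ha]
  · rw [Nat.add_sub_cancel' l2, h.nbr hb]
  · rw [Nat.add_sub_cancel' l3, h.nbr hc]

end Cells

/-! ### A stack with an indicator array -/

/-- The first `top` entries of `stk` are the elements of `C`, each once, and `mem` is its indicator
function. -/
structure Stack {n : ℕ} (C : Set (Fin n)) (top : ℕ) (stk mem : ℕ → ℕ) : Prop where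
  entry : ∀ i < top, ∃ v ∈ C, stk i = v
  exists_entry : ∀ v ∈ C, ∃ i < top, stk i = v
  inj : ∀ i < top, ∀ j < top, stk i = stk j → i = j
  mem_iff : ∀ v : Fin n, mem v ≠ 0 ↔ v ∈ C

namespace Stack

variable {n : ℕ} {C : Set (Fin n)} {top : ℕ} {stk mem : ℕ → ℕ}

theorem push (h : Stack C top stk mem) {v : Fin n} (hv : v ∉ C) :
    Stack (insert v C) (top + 1) (Function.update stk top v) (Function.update mem v 1) := by
  have e : ∀ i < top, Function.update stk top (v : ℕ) i = stk i := fun i hi =>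
    Function.update_of_ne (by omega) _ _
  have ne : ∀ i < top, stk i ≠ v := by
    intro i hi e
    obtain ⟨w, hw, hw'⟩ := h.entry i hi
    exact hv (by rwa [show v = w from Fin.ext (by rw [← e, hw'])])
  constructor
  · intro i hi
    by_cases h1 : i = top
    · exact ⟨v, by simp, by simp [h1]⟩
    · obtain ⟨w, hw, hw'⟩ := h.entry i (by omega)
      exact ⟨w, by simp [hw], by rw [e i (by omega), hw']⟩
  · rintro w (rfl | hw)
    · exact ⟨top, by omega, by simp⟩
    · obtain ⟨i, hi, hi'⟩ := h.exists_entry w hw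
      exact ⟨i, by omega, by rw [e i hi, hi']⟩
  · intro i hi j hj hij
    by_cases h1 : i = top
    · by_cases h2 : j = top
      · rw [h1, h2]
      · subst h1
        rw [e j (by omega), Function.update_self] at hij
        exact absurd hij.symm (ne j (by omega))
    · by_cases h2 : j = top
      · subst h2
        rw [e i (by omega), Function.update_self] at hij
        exact absurd hij (ne i (by omega))
      · rw [e i (by omega), e j (by omega)] at hij
        exact h.inj i (by omega) j (by omega) hij
  · intro w
    by_cases h1 : w = v
    · simp [h1]
    · rw [Function.update_of_ne (fun e => h1 (Fin.ext e)), h.mem_iff]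
      simp [h1]

theorem pop (h : Stack C top stk mem) (ht : 0 < top) : ∃ v ∈ C, stk (top - 1) = v ∧
    Stack (C \ {v}) (top - 1) stk (Function.update mem v 0) := by
  obtain ⟨v, hv, hv'⟩ := h.entry (top - 1) (by omega)
  refine ⟨v, hv, hv', ?_, ?_, ?_, ?_⟩
  · intro i hi
    obtain ⟨w, hw, hw'⟩ := h.entry i (by omega)
    refine ⟨w, ⟨hw, ?_⟩, hw'⟩
    rintro rfl
    have := h.inj i (by omega) (top - 1) (by omega) (by rw [hw', hv'])
    omega
  · rintro w ⟨hw, hwv⟩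
    obtain ⟨i, hi, hi'⟩ := h.exists_entry w hw
    refine ⟨i, ?_, hi'⟩
    by_contra hlt
    obtain rfl : i = top - 1 := by omega
    exact hwv (Fin.ext (by rw [← hi', hv']))
  · intro i hi j hj hij
    exact h.inj i (by omega) j (by omega) hij
  · intro w
    by_cases h1 : w = v
    · simp [h1]
    · rw [Function.update_of_ne (fun e => h1 (Fin.ext e)), h.mem_iff]
      simp [h1]

theorem eq_empty (h : Stack C top stk mem) (ht : top = 0) : C = ∅ := by
  subst ht
  ext v
  simp only [Set.mem_empty_iff_false, iff_false]
  intro hv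
  obtain ⟨i, hi, -⟩ := h.exists_entry v hv
  omega

end Stack

end Halin

/-! ## Running programs -/

namespace RAM

@[simp] theorem Store.setReg_reg (σ : Store) (r x r' : ℕ) :
    (σ.setReg r x).reg r' = if r' = r then x else σ.reg r' := by
  simp [Store.setReg, Function.update_apply]

@[simp] theorem Store.setReg_arr (σ : Store) (r x : ℕ) : (σ.setReg r x).arr = σ.arr := rfl

@[simp] theorem Store.setArr_reg (σ : Store) (a i x : ℕ) : (σ.setArr a i x).reg = σ.reg := rfl

@[simp] theorem Store.setArr_arr (σ : Store) (a i x a' : ℕ) :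
    (σ.setArr a i x).arr a' = if a' = a then Function.update (σ.arr a) i x else σ.arr a' := by
  by_cases h : a' = a
  · subst h; simp [Store.setArr]
  · simp [Store.setArr, h]

def Cmd.LoopFree : Cmd → Prop
  | .skip => True
  | .assign _ _ => True
  | .write _ _ _ => True
  | .seq c d => c.LoopFree ∧ d.LoopFree
  | .ite _ c d => c.LoopFree ∧ d.LoopFree
  | .loop _ _ => False

/-- The number of steps of a loop-free command is at most this. -/
def Cmd.bound : Cmd → ℕ
  | .skip => 1
  | .assign _ e => e.cost + 1
  | .write _ i e => i.cost + e.cost + 1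
  | .seq c d => c.bound + d.bound
  | .ite b c d => b.cost + (c.bound + d.bound) + 1
  | .loop _ _ => 0

open Classical in
/-- The effect of a loop-free command. -/
noncomputable def Cmd.exec : Cmd → Store → Store
  | .skip, σ => σ
  | .assign r e, σ => σ.setReg r (e.eval σ)
  | .write a i e, σ => σ.setArr a (i.eval σ) (e.eval σ)
  | .seq c d, σ => d.exec (c.exec σ)
  | .ite b c d, σ => if b.Holds σ then c.exec σ else d.exec σ
  | .loop _ _, σ => σ

theorem Cmd.LoopFree.exec {c : Cmd} (h : c.LoopFree) (σ : Store) :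
    ∃ t, Exec c σ (c.exec σ) t ∧ t ≤ c.bound := by
  induction c generalizing σ with
  | skip => exact ⟨_, .skip σ, le_rfl⟩
  | assign r e => exact ⟨_, .assign σ r e, le_rfl⟩
  | write a i e => exact ⟨_, .write σ a i e, le_rfl⟩
  | seq c d hc hd =>
    obtain ⟨t, h1, h2⟩ := hc h.1 σ
    obtain ⟨u, h3, h4⟩ := hd h.2 (c.exec σ)
    exact ⟨_, .seq h1 h3, add_le_add h2 h4⟩
  | ite b c d hc hd =>
    by_cases hb : b.Holds σ
    · obtain ⟨t, h1, h2⟩ := hc h.1 σ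
      refine ⟨_, .ite_true (t := t) hb ?_, ?_⟩
      · rw [Cmd.exec, if_pos hb]; exact h1
      · simp only [Cmd.bound]; omega
    · obtain ⟨t, h1, h2⟩ := hd h.2 σ
      refine ⟨_, .ite_false (t := t) hb ?_, ?_⟩
      · rw [Cmd.exec, if_neg hb]; exact h1
      · simp only [Cmd.bound]; omega
  | loop b c _ => exact h.elim

/-- From every store with `P`, the command halts in a store with `Q` within `k` steps. -/
def Total (P : Store → Prop) (c : Cmd) (Q : Store → Prop) (k : ℕ) : Prop :=
  ∀ σ, P σ → ∃ τ t, Exec c σ τ t ∧ t ≤ k ∧ Q τ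

theorem Cmd.LoopFree.total {c : Cmd} (h : c.LoopFree) {P Q : Store → Prop}
    (hQ : ∀ σ, P σ → Q (c.exec σ)) : Total P c Q c.bound := by
  intro σ hσ
  obtain ⟨t, h1, h2⟩ := h.exec σ
  exact ⟨_, t, h1, h2, hQ σ hσ⟩

theorem Total.seq {P Q R : Store → Prop} {c d : Cmd} {k l : ℕ} (h1 : Total P c Q k)
    (h2 : Total Q d R l) : Total P (.seq c d) R (k + l) := by
  intro σ hσ
  obtain ⟨τ, t, h3, h4, h5⟩ := h1 σ hσ
  obtain ⟨υ, u, h6, h7, h8⟩ := h2 τ h5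
  exact ⟨υ, _, .seq h3 h6, add_le_add h4 h7, h8⟩

/-- The measure bounds the number of iterations by `k`. Each costs at most the test, the body and
one more step, and the final failing test accounts for the `+ 1`. -/
theorem Cmd.LoopFree.total_loop {c : Cmd} (h : c.LoopFree) {b : Test} {I : Store → Prop}
    {μ : Store → ℕ} (k : ℕ) (step : ∀ σ, I σ → b.Holds σ → I (c.exec σ) ∧ μ (c.exec σ) < μ σ)
    (hk : ∀ σ, I σ → μ σ ≤ k) :
    Total I (.loop b c) (fun σ => I σ ∧ ¬ b.Holds σ) ((b.cost + c.bound + 1) * (k + 1)) := by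
  have key : ∀ j σ, I σ → μ σ ≤ j → ∃ τ t, Exec (.loop b c) σ τ t ∧
      t ≤ (b.cost + c.bound + 1) * (j + 1) ∧ I τ ∧ ¬ b.Holds τ := by
    intro j
    induction j with
    | zero =>
      intro σ hσ hj
      have hb : ¬ b.Holds σ := fun hb => by
        have := (step σ hσ hb).2
        omega
      exact ⟨σ, _, .loop_false hb, by simp, hσ, hb⟩
    | succ j ih =>
      intro σ hσ hj
      by_cases hb : b.Holds σ
      · obtain ⟨h1, h2⟩ := step σ hσ hb
        obtain ⟨t, h3, h4⟩ := h.exec σ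
        obtain ⟨τ, u, h5, h6, h7, h8⟩ := ih _ h1 (by omega)
        refine ⟨τ, _, .loop_true hb h3 h5, ?_, h7, h8⟩
        have : (b.cost + c.bound + 1) * (j + 1 + 1) =
          (b.cost + c.bound + 1) * (j + 1) + (b.cost + c.bound + 1) := by ring
        omega
      · refine ⟨σ, _, .loop_false hb, ?_, hσ, hb⟩
        have : (b.cost + c.bound + 1) * (j + 1 + 1) =
          (b.cost + c.bound + 1) * (j + 1) + (b.cost + c.bound + 1) := by ring
        omega
  intro σ hσ
  exact key k σ hσ (hk σ hσ)

/-- Execute the action of the first option whose test holds, or else `d`. -/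
def firstOf {α : Type} (test : α → Test) (act : α → Cmd) (d : Cmd) (l : List α) : Cmd :=
  l.foldr (fun o c => .ite (test o) (act o) c) d

theorem firstOf_loopFree {α : Type} {test : α → Test} {act : α → Cmd} {d : Cmd} {l : List α}
    (h : ∀ o, (act o).LoopFree) (hd : d.LoopFree) : (firstOf test act d l).LoopFree := by
  induction l with
  | nil => exact hd
  | cons o l ih => exact ⟨h o, ih⟩

theorem firstOf_exec {α : Type} (test : α → Test) (act : α → Cmd) (d : Cmd) (l : List α)
    (σ : Store) : (∃ o ∈ l, (test o).Holds σ ∧ (firstOf test act d l).exec σ = (act o).exec σ) ∨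
      (∀ o ∈ l, ¬ (test o).Holds σ) ∧ (firstOf test act d l).exec σ = d.exec σ := by
  induction l with
  | nil => exact Or.inr ⟨by simp, rfl⟩
  | cons o l ih =>
    by_cases h : (test o).Holds σ
    · exact Or.inl ⟨o, by simp, h, if_pos h⟩
    · have e : (firstOf test act d (o :: l)).exec σ = (firstOf test act d l).exec σ := if_neg h
      rw [e]
      rcases ih with ⟨o', h1, h2⟩ | ⟨h1, h2⟩
      · exact Or.inl ⟨o', by simp [h1], h2⟩
      · refine Or.inr ⟨?_, h2⟩
        rintro o' ho'
        rcases List.mem_cons.1 ho' with rfl | e'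
        exacts [h, h1 _ e']

/-- The list `l` of commands, one after the other. -/
def block (l : List Cmd) : Cmd := l.foldr .seq .skip

end RAM

/-! ### Frame rules and the memory layout -/

namespace RAM

/-- The registers that a command can change. -/
def Cmd.regs : Cmd → List ℕ
  | .skip => []
  | .assign r _ => [r]
  | .write _ _ _ => []
  | .seq c d => c.regs ++ d.regs
  | .ite _ c d => c.regs ++ d.regs
  | .loop _ c => c.regs

/-- The arrays that a command can change. -/
def Cmd.arrs : Cmd → List ℕ
  | .skip => []
  | .assign _ _ => []
  | .write a _ _ => [a]
  | .seq c d => c.arrs ++ d.arrs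
  | .ite _ c d => c.arrs ++ d.arrs
  | .loop _ c => c.arrs

theorem Cmd.exec_reg (c : Cmd) (σ : Store) {r : ℕ} (h : r ∉ c.regs) :
    (c.exec σ).reg r = σ.reg r := by
  induction c generalizing σ with
  | skip => rfl
  | assign r' e => simp_all [Cmd.exec, Cmd.regs]
  | write a i e => rfl
  | seq c d hc hd =>
    simp only [Cmd.regs, List.mem_append, not_or] at h
    rw [Cmd.exec, hd _ h.2, hc _ h.1]
  | ite b c d hc hd =>
    simp only [Cmd.regs, List.mem_append, not_or] at h
    rw [Cmd.exec]
    split_ifs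
    · exact hc σ h.1
    · exact hd σ h.2
  | loop b c _ => rfl

theorem Cmd.exec_arr (c : Cmd) (σ : Store) {a : ℕ} (h : a ∉ c.arrs) :
    (c.exec σ).arr a = σ.arr a := by
  induction c generalizing σ with
  | skip => rfl
  | assign r' e => rfl
  | write a' i e => simp_all [Cmd.exec, Cmd.arrs]
  | seq c d hc hd =>
    simp only [Cmd.arrs, List.mem_append, not_or] at h
    rw [Cmd.exec, hd _ h.2, hc _ h.1]
  | ite b c d hc hd =>
    simp only [Cmd.arrs, List.mem_append, not_or] at h
    rw [Cmd.exec]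
    split_ifs
    · exact hc σ h.1
    · exact hd σ h.2
  | loop b c _ => rfl

/-! ### The registers and arrays of the programs -/

notation "rLen" => (1 : ℕ)
notation "rEdges" => (2 : ℕ)
notation "rVerts" => (3 : ℕ)
notation "rI" => (4 : ℕ)
notation "rJ" => (5 : ℕ)
notation "rAcc" => (6 : ℕ)
notation "rTop" => (7 : ℕ)
notation "rAlive" => (8 : ℕ)
notation "rY" => (9 : ℕ)
notation "rA" => (10 : ℕ)
notation "rB" => (11 : ℕ)
notation "rX" => (12 : ℕ)
notation "rYout" => (13 : ℕ)
notation "rAout" => (14 : ℕ)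
notation "rBout" => (15 : ℕ)
notation "rCellA" => (16 : ℕ)
notation "rCellB" => (17 : ℕ)
notation "rTwinA" => (18 : ℕ)
notation "rTwinB" => (19 : ℕ)
notation "rLast" => (20 : ℕ)
notation "rTwinLast" => (21 : ℕ)
notation "rCubic" => (22 : ℕ)
notation "rFound" => (23 : ℕ)
notation "rZ" => (24 : ℕ)

notation "aSelected" => (2 : ℕ)
notation "aMark" => (3 : ℕ)
notation "aStart" => (4 : ℕ)
notation "aEnd" => (5 : ℕ)
notation "aNbr" => (6 : ℕ)
notation "aTwin" => (7 : ℕ)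
notation "aDeg" => (8 : ℕ)
notation "aK" => (9 : ℕ)
notation "aIn" => (10 : ℕ)
notation "aStack" => (11 : ℕ)
notation "aKind" => (12 : ℕ)
notation "aLogA" => (13 : ℕ)
notation "aLogB" => (14 : ℕ)
notation "aLogYout" => (15 : ℕ)
notation "aLogAout" => (16 : ℕ)
notation "aLogBout" => (17 : ℕ)
notation "aOuter" => (18 : ℕ)

/-- The `i`-th cell of the vertex `v`. -/
def cell (v : Expr) : ℕ → Expr
  | 0 => .read aStart v
  | i + 1 => .succ (cell v i)

@[simp] theorem cell_eval (v : Expr) (i : ℕ) (σ : Store) :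
    (cell v i).eval σ = σ.arr aStart (v.eval σ) + i := by
  induction i with
  | zero => rfl
  | succ i ih => simp only [cell, Expr.eval, ih]; omega

/-- The neighbour in the `i`-th cell of `v`. -/
def nbr (v : Expr) (i : ℕ) : Expr := .read aNbr (cell v i)

@[simp] theorem nbr_eval (v : Expr) (i : ℕ) (σ : Store) :
    (nbr v i).eval σ = σ.arr aNbr (σ.arr aStart (v.eval σ) + i) := by
  simp [nbr, Expr.eval]

/-- `v` has degree three. -/
def cubic (v : Expr) : Test := .eq (.read aEnd v) (cell v 3)

@[simp] theorem cubic_holds (v : Expr) (σ : Store) :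
    (cubic v).Holds σ ↔ σ.arr aEnd (v.eval σ) = σ.arr aStart (v.eval σ) + 3 := by
  simp [cubic, Test.Holds, Expr.eval]

/-- Push the vertex in register `r`, unless it is in the stack. -/
def push (r : ℕ) : Cmd :=
  .ite (.eq (.read aIn (.reg r)) (.const 0)) (block [.write aStack (.reg rTop) (.reg r),
    .write aIn (.reg r) (.const 1), .assign rTop (.succ (.reg rTop))]) .skip

def pushCubic (r : ℕ) : Cmd := .ite (cubic (.reg r)) (push r) .skip

/-- Put the vertex in register `r'` into `K` if the vertex in register `r` is in `K`. -/
def copyK (r r' : ℕ) : Cmd :=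
  .ite (.eq (.read aK (.reg r)) (.const 0)) .skip (.write aK (.reg r') (.const 1))

open Halin

theorem push_spec {n r : ℕ} {C : Set (Fin n)} {σ : Store} {v : Fin n}
    (h : Stack C (σ.reg rTop) (σ.arr aStack) (σ.arr aIn)) (hr : σ.reg r = v) :
    Stack (insert v C) (((push r).exec σ).reg rTop) (((push r).exec σ).arr aStack)
      (((push r).exec σ).arr aIn) := by
  by_cases hv : v ∈ C
  · have : σ.arr aIn v ≠ 0 := (h.mem_iff v).2 hv
    rw [Set.insert_eq_of_mem hv]
    simpa [push, Cmd.exec, Test.Holds, Expr.eval, hr, this] using h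
  · have : σ.arr aIn v = 0 := by
      by_contra e
      exact hv ((h.mem_iff v).1 e)
    simpa [push, Cmd.exec, Test.Holds, Expr.eval, hr, this, block] using h.push hv

theorem pushCubic_spec {n r : ℕ} {C : Set (Fin n)} {σ : Store} {v : Fin n}
    (h : Stack C (σ.reg rTop) (σ.arr aStack) (σ.arr aIn)) (hr : σ.reg r = v) :
    Stack (C ∪ {w | w = v ∧ σ.arr aEnd v = σ.arr aStart v + 3})
      (((pushCubic r).exec σ).reg rTop) (((pushCubic r).exec σ).arr aStack)
      (((pushCubic r).exec σ).arr aIn) := by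
  by_cases hv : σ.arr aEnd v = σ.arr aStart v + 3
  · have e : (pushCubic r).exec σ = (push r).exec σ := if_pos (by simpa [Expr.eval, hr] using hv)
    rw [e]
    convert push_spec h hr using 1
    ext w
    simp [hv]
  · have e : (pushCubic r).exec σ = σ := if_neg (by simpa [Expr.eval, hr] using hv)
    rw [e]
    convert h using 1
    simp [hv]

theorem copyK_spec {n r r' : ℕ} {K : Set (Fin n)} {σ : Store} {v w : Fin n}
    (h : ∀ u : Fin n, σ.arr aK u ≠ 0 ↔ u ∈ K) (hr : σ.reg r = v) (hr' : σ.reg r' = w) (u : Fin n) :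
    ((copyK r r').exec σ).arr aK u ≠ 0 ↔ u ∈ K ∨ (u = w ∧ v ∈ K) := by
  by_cases hv : σ.arr aK v = 0
  · have hv' : v ∉ K := fun e => (h v).2 e hv
    simp [copyK, Cmd.exec, Test.Holds, Expr.eval, hr, hv, hv', ← h]
  · have hv' : v ∈ K := (h v).1 hv
    simp only [copyK, Cmd.exec, Test.Holds, Expr.eval, hr, hv, hv', hr']
    by_cases e : u = w
    · simp [e]
    · have : (u : ℕ) ≠ w := fun e' => e (Fin.ext e')
      simp [this, e, h]

end RAM

/-! ### Evaluation of loop-free code -/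

namespace RAM

open Halin

def Test.all (l : List Test) : Test := l.foldr .and (.eq (.const 0) (.const 0))

@[simp] theorem Test.all_nil_holds (σ : Store) : (Test.all []).Holds σ ↔ True := by
  simp [Test.all, Test.Holds]

@[simp] theorem Test.all_cons_holds (b : Test) (l : List Test) (σ : Store) :
    (Test.all (b :: l)).Holds σ ↔ b.Holds σ ∧ (Test.all l).Holds σ := Iff.rfl

@[simp] theorem Test.eq_holds (e f : Expr) (σ : Store) :
    (Test.eq e f).Holds σ ↔ e.eval σ = f.eval σ := Iff.rfl

@[simp] theorem Test.lt_holds (e f : Expr) (σ : Store) :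
    (Test.lt e f).Holds σ ↔ e.eval σ < f.eval σ := Iff.rfl

@[simp] theorem Test.not_holds (b : Test) (σ : Store) :
    (Test.not b).Holds σ ↔ ¬ b.Holds σ := Iff.rfl

@[simp] theorem Expr.eval_const (k : ℕ) (σ : Store) : (Expr.const k).eval σ = k := rfl
@[simp] theorem Expr.eval_reg (r : ℕ) (σ : Store) : (Expr.reg r).eval σ = σ.reg r := rfl
@[simp] theorem Expr.eval_read (a : ℕ) (i : Expr) (σ : Store) :
    (Expr.read a i).eval σ = σ.arr a (i.eval σ) := rfl
@[simp] theorem Expr.eval_succ (e : Expr) (σ : Store) : (Expr.succ e).eval σ = e.eval σ + 1 := rfl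
@[simp] theorem Expr.eval_pred (e : Expr) (σ : Store) : (Expr.pred e).eval σ = e.eval σ - 1 := rfl

@[simp] theorem Cmd.exec_skip (σ : Store) : Cmd.skip.exec σ = σ := rfl
@[simp] theorem Cmd.exec_assign (r : ℕ) (e : Expr) (σ : Store) :
    (Cmd.assign r e).exec σ = σ.setReg r (e.eval σ) := rfl
@[simp] theorem Cmd.exec_write (a : ℕ) (i e : Expr) (σ : Store) :
    (Cmd.write a i e).exec σ = σ.setArr a (i.eval σ) (e.eval σ) := rfl
@[simp] theorem exec_block_nil (σ : Store) : (block []).exec σ = σ := rfl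
@[simp] theorem exec_block_cons (c : Cmd) (l : List Cmd) (σ : Store) :
    (block (c :: l)).exec σ = (block l).exec (c.exec σ) := rfl

/-! ### One iteration of the algorithm -/

abbrev Option3 : Type := (ℕ × ℕ × ℕ) × (ℕ × ℕ × ℕ) × (ℕ × ℕ × ℕ)

/-- The orders in which the cells of three vertices can be read. -/
def options : List Option3 := orders ×ˢ (orders ×ˢ orders)

theorem mem_options {o : Option3} :
    o ∈ options ↔ o.1 ∈ orders ∧ o.2.1 ∈ orders ∧ o.2.2 ∈ orders := by
  obtain ⟨a, b, c⟩ := o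
  simp [options]

/-- The selected vertex. -/
def selected : Expr := .reg rY

/-- The triangle of `y` and the neighbours of `y` in its second and third cells can be collapsed. -/
def collapseTest (o : Option3) : Test := .all [
  cubic selected, cubic (nbr selected o.1.2.1), cubic (nbr selected o.1.2.2),
  .eq (nbr (nbr selected o.1.2.1) o.2.1.2.1) selected,
  .eq (nbr (nbr selected o.1.2.1) o.2.1.2.2) (nbr selected o.1.2.2),
  .eq (nbr (nbr selected o.1.2.2) o.2.2.2.1) selected,
  .eq (nbr (nbr selected o.1.2.2) o.2.2.2.2) (nbr selected o.1.2.1),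
  .not (.eq (nbr selected o.1.1) (nbr (nbr selected o.1.2.1) o.2.1.1)),
  .not (.eq (nbr selected o.1.1) (nbr (nbr selected o.1.2.2) o.2.2.1)),
  .not (.eq (nbr (nbr selected o.1.2.1) o.2.1.1) (nbr (nbr selected o.1.2.2) o.2.2.1)),
  .not (.all [.not (.eq (.read aK selected) (.const 0)),
    .not (.eq (.read aK (nbr selected o.1.2.1)) (.const 0)),
    .not (.eq (.read aK (nbr selected o.1.2.2)) (.const 0))])]

/-- Everything is read into registers before any array is changed, since the cells concerned are
about to be overwritten. -/
def collapseLoad (o : Option3) : Cmd := block [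
  .assign rA (nbr selected o.1.2.1), .assign rB (nbr selected o.1.2.2),
  .assign rYout (nbr selected o.1.1),
  .assign rAout (nbr (.reg rA) o.2.1.1), .assign rBout (nbr (.reg rB) o.2.2.1),
  .assign rCellA (cell selected o.1.2.1), .assign rCellB (cell selected o.1.2.2),
  .assign rTwinA (.read aTwin (cell (.reg rA) o.2.1.1)),
  .assign rTwinB (.read aTwin (cell (.reg rB) o.2.2.1))]

/-- The vertices `q` and `r` are removed by making their segments empty, so that they have degree
zero from now on. -/
def collapseLink : Cmd := block [
  .write aNbr (.reg rCellA) (.reg rAout), .write aNbr (.reg rCellB) (.reg rBout),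
  .write aNbr (.reg rTwinA) selected, .write aNbr (.reg rTwinB) selected,
  .write aTwin (.reg rCellA) (.reg rTwinA), .write aTwin (.reg rTwinA) (.reg rCellA),
  .write aTwin (.reg rCellB) (.reg rTwinB), .write aTwin (.reg rTwinB) (.reg rCellB),
  .write aEnd (.reg rA) (.read aStart (.reg rA)), .write aEnd (.reg rB) (.read aStart (.reg rB)),
  .assign rAlive (.pred (.pred (.reg rAlive)))]

/-- The selected vertex is put into `K` last, because its former membership decides about its
outside neighbour. -/
def collapseK : Cmd := block [
  copyK rY rYout, copyK rA rAout, copyK rB rBout, .write aK selected (.const 1)]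

def collapseC : Cmd := block [push rY, pushCubic rYout, pushCubic rAout, pushCubic rBout]

/-- Record the move for the output and for the reversal. -/
def record (kind : ℕ) : Cmd := block [
  .write aSelected (.reg rLen) selected, .write aKind (.reg rLen) (.const kind),
  .write aLogA (.reg rLen) (.reg rA), .write aLogB (.reg rLen) (.reg rB),
  .write aLogYout (.reg rLen) (.reg rYout), .write aLogAout (.reg rLen) (.reg rAout),
  .write aLogBout (.reg rLen) (.reg rBout), .assign rLen (.succ (.reg rLen))]

/-- The path whose middle vertex is `y` can be shortened. -/
def shortenTest (o : Option3) : Test := .all [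
  cubic selected, cubic (nbr selected o.1.1), cubic (nbr selected o.1.2.1),
  .eq (nbr (nbr selected o.1.1) o.2.1.2.1) selected,
  .eq (nbr (nbr selected o.1.1) o.2.1.2.2) (nbr selected o.1.2.2),
  .eq (nbr (nbr selected o.1.2.1) o.2.2.2.1) selected,
  .eq (nbr (nbr selected o.1.2.1) o.2.2.2.2) (nbr selected o.1.2.2),
  .not (.eq (nbr (nbr selected o.1.1) o.2.1.1) (nbr selected o.1.2.1)),
  .eq (.read aK (nbr selected o.1.2.2)) (.const 0)]

def shortenLoad (o : Option3) : Cmd := block [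
  .assign rA (nbr selected o.1.1), .assign rB (nbr selected o.1.2.1),
  .assign rX (nbr selected o.1.2.2),
  .assign rAout (nbr (.reg rA) o.2.1.1),
  .assign rCellA (.read aTwin (cell selected o.1.1)),
  .assign rCellB (.read aTwin (cell selected o.1.2.1)),
  .assign rTwinA (.read aTwin (cell selected o.1.2.2))]

/-- If the cell of `q` at the apex is itself the last one, the transfer copies it to itself and
touches only cells that are no longer used. -/
def shortenLink : Cmd := block [
  .write aNbr (.reg rCellA) (.reg rB), .write aNbr (.reg rCellB) (.reg rA),
  .write aTwin (.reg rCellA) (.reg rCellB), .write aTwin (.reg rCellB) (.reg rCellA),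
  .write aEnd selected (.read aStart selected), .assign rLast (.pred (.read aEnd (.reg rX))),
  .assign rTwinLast (.read aTwin (.reg rLast)),
  .write aNbr (.reg rTwinA) (.read aNbr (.reg rLast)),
  .write aTwin (.reg rTwinA) (.reg rTwinLast), .write aTwin (.reg rTwinLast) (.reg rTwinA),
  .write aEnd (.reg rX) (.reg rLast), .assign rAlive (.pred (.reg rAlive))]

/-- The ends of the path keep degree three. So among four current vertices only the apex and the
outside neighbour of `p` have to be tested for `K₄`. -/
def shortenK : Cmd := block [
  .write aK (.reg rA) (.const 1), .write aK (.reg rB) (.const 1),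
  .ite (.all [.eq (.reg rAlive) (.const 4), cubic (.reg rX), cubic (.reg rAout)])
    (.write aK (.reg rAout) (.const 1)) .skip]

def shortenC : Cmd := pushCubic rX

def pop : Cmd := block [.assign rTop (.pred (.reg rTop)), .assign rY (.read aStack (.reg rTop)),
  .write aIn selected (.const 0)]

def shortenAct (o : Option3) : Cmd :=
  block [shortenLoad o, shortenLink, shortenK, shortenC, record 2]

def collapseAct (o : Option3) : Cmd :=
  block [collapseLoad o, collapseLink, collapseK, collapseC, record 1]

/-- There are six orders at each of three vertices, a fixed number of options. Hence the body is
loop-free and its cost is a constant. -/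
def iteration : Cmd := .seq pop (firstOf collapseTest collapseAct
  (firstOf shortenTest shortenAct (record 0) options) options)

theorem iteration_loopFree : iteration.LoopFree := by
  refine ⟨?_, firstOf_loopFree (fun o => ?_) (firstOf_loopFree (fun o => ?_) ?_)⟩
  all_goals simp [pop, collapseAct, collapseLoad, collapseLink, collapseK, collapseC, record,
    shortenAct, shortenLoad, shortenLink, shortenK, shortenC, block, Cmd.LoopFree, copyK, push,
    pushCubic]

section

variable {n : ℕ} {G : SimpleGraph (Fin n)} {pos : Fin n → Fin n → ℕ} {σ : Store}

theorem collapseLoad_spec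
    (h : Cells G Fin.val (σ.arr aStart) (σ.arr aEnd) (σ.arr aNbr) (σ.arr aTwin) pos)
    {p : Fin n} (hp : σ.reg rY = p) {o : Option3} (ho : o ∈ options)
    (ht : (collapseTest o).Holds σ) : ∃ q r p' q' r' : Fin n, IsD3a G p q r p' q' r' ∧
      ¬ (σ.arr aK p ≠ 0 ∧ σ.arr aK q ≠ 0 ∧ σ.arr aK r ≠ 0) ∧
      ((collapseLoad o).exec σ).reg rA = q ∧ ((collapseLoad o).exec σ).reg rB = r ∧
      ((collapseLoad o).exec σ).reg rYout = p' ∧ ((collapseLoad o).exec σ).reg rAout = q' ∧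
      ((collapseLoad o).exec σ).reg rBout = r' ∧
      ((collapseLoad o).exec σ).reg rCellA = pos p q ∧
      ((collapseLoad o).exec σ).reg rCellB = pos p r ∧
      ((collapseLoad o).exec σ).reg rTwinA = pos q' q ∧
      ((collapseLoad o).exec σ).reg rTwinB = pos r' r := by
  have he : Function.Injective (Fin.val : Fin n → ℕ) := Fin.val_injective
  rw [mem_options] at ho
  simp only [collapseTest, Test.all_cons_holds, cubic_holds, Test.eq_holds, Test.not_holds,
    nbr_eval, Expr.eval_read, Expr.eval_const, selected, Expr.eval_reg, hp, Test.all_nil_holds,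
    and_true] at ht
  obtain ⟨c1, c2, c3, t1, t2, t3, t4, t5, t6, t7, t8⟩ := ht
  obtain ⟨p', q, r, s1, s2, s3, s4, s5, s6, s7⟩ := h.read_three he c1 ho.1
  have aq : G.Adj p q := by rw [← SimpleGraph.mem_neighborSet, s1]; simp
  have ar : G.Adj p r := by rw [← SimpleGraph.mem_neighborSet, s1]; simp
  have ap : G.Adj p p' := by rw [← SimpleGraph.mem_neighborSet, s1]; simp
  rw [← s2] at t5 t6
  rw [← s3] at c2 t1 t2 t4 t5 t7 t8
  rw [← s4] at c3 t2 t3 t4 t6 t7 t8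
  rw [h.nbr ap] at t5 t6
  rw [h.nbr aq] at c2 t1 t2 t4 t5 t7 t8
  rw [h.nbr ar] at c3 t2 t3 t4 t6 t7 t8
  obtain ⟨q', u, v, u1, u2, u3, u4, u5, u6, u7⟩ := h.read_three he c2 ho.2.1
  have bq : G.Adj q q' := by rw [← SimpleGraph.mem_neighborSet, u1]; simp
  have bu : G.Adj q u := by rw [← SimpleGraph.mem_neighborSet, u1]; simp
  have bv : G.Adj q v := by rw [← SimpleGraph.mem_neighborSet, u1]; simp
  rw [← u2, h.nbr bq] at t5 t7
  rw [← u3, h.nbr bu] at t1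
  rw [← u4, h.nbr bv] at t2
  obtain rfl := Fin.ext t1
  obtain rfl := Fin.ext t2
  obtain ⟨r', u', v', v1, v2, v3, v4, v5, v6, v7⟩ := h.read_three he c3 ho.2.2
  have er : G.Adj v r' := by rw [← SimpleGraph.mem_neighborSet, v1]; simp
  have eu : G.Adj v u' := by rw [← SimpleGraph.mem_neighborSet, v1]; simp
  have ev : G.Adj v v' := by rw [← SimpleGraph.mem_neighborSet, v1]; simp
  rw [← v2, h.nbr er] at t6 t7
  rw [← v3, h.nbr eu] at t3
  rw [← v4, h.nbr ev] at t4
  obtain rfl := Fin.ext t3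
  obtain rfl := Fin.ext t4
  refine ⟨v', v, p', q', r', ⟨(h.degree_three_iff he).2 c1, (h.degree_three_iff he).2 c2,
    (h.degree_three_iff he).2 c3, ?_, ?_, ?_, ?_, ?_, ?_⟩, t8, ?_⟩
  · rw [s1]; ext; simp; tauto
  · rw [u1]; ext; simp; tauto
  · rw [v1]; ext; simp; tauto
  · rintro rfl; exact t5 rfl
  · rintro rfl; exact t6 rfl
  · rintro rfl; exact t7 rfl
  · simp [collapseLoad, selected, hp, ← s2, ← s3, ← s4, h.nbr ap, h.nbr aq, h.nbr ar, ← u2, ← v2,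
      h.nbr bq, h.nbr er, h.twin bq, h.twin er]

/-- The search is complete. Together with `exists_shortenTest` this justifies discarding a vertex
after all tests have failed. -/
theorem exists_collapseTest
    (h : Cells G Fin.val (σ.arr aStart) (σ.arr aEnd) (σ.arr aNbr) (σ.arr aTwin) pos)
    {p : Fin n} (hp : σ.reg rY = p) {q r p' q' r' : Fin n} (hd : IsD3a G p q r p' q' r')
    (hK : ¬ (σ.arr aK p ≠ 0 ∧ σ.arr aK q ≠ 0 ∧ σ.arr aK r ≠ 0)) :
    ∃ o ∈ options, (collapseTest o).Holds σ := by
  have he : Function.Injective (Fin.val : Fin n → ℕ) := Fin.val_injective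
  have d1 := hd.distinct
  have d2 := hd.rotate.distinct
  have d3 := hd.rotate.rotate.distinct
  obtain ⟨o1, h1, a1, a2, a3⟩ := h.exists_order he (a := p') (b := q) (c := r) hd.degree_p
    (hd.adj_p.2 (by simp)) (hd.adj_p.2 (by simp)) (hd.adj_p.2 (by simp)) d1.2.2.2.2.1
    d1.2.2.2.2.2 d1.2.2.1
  obtain ⟨o2, h2, b1, b2, b3⟩ := h.exists_order he (a := q') (b := p) (c := r) hd.degree_q
    (hd.adj_q.2 (by simp)) (hd.adj_q.2 (by simp)) (hd.adj_q.2 (by simp)) d2.2.2.2.2.2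
    d2.2.2.2.2.1 d1.2.1
  obtain ⟨o3, h3, c1, c2, c3⟩ := h.exists_order he (a := r') (b := p) (c := q) hd.degree_r
    (hd.adj_r.2 (by simp)) (hd.adj_r.2 (by simp)) (hd.adj_r.2 (by simp)) d3.2.2.2.2.1
    d3.2.2.2.2.2 d1.1
  refine ⟨(o1, o2, o3), mem_options.2 ⟨h1, h2, h3⟩, ?_⟩
  simp only [collapseTest, Test.all_cons_holds, cubic_holds, Test.eq_holds, Test.not_holds,
    nbr_eval, Expr.eval_read, Expr.eval_const, selected, Expr.eval_reg, hp, Test.all_nil_holds,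
    and_true, a1, a2, a3, b1, b2, b3, c1, c2, c3, true_and]
  refine ⟨(h.degree_three_iff he).1 hd.degree_p, (h.degree_three_iff he).1 hd.degree_q,
    (h.degree_three_iff he).1 hd.degree_r, he.ne hd.ne_pq, he.ne hd.ne_pr, he.ne hd.ne_qr, hK⟩

theorem shortenLoad_spec
    (h : Cells G Fin.val (σ.arr aStart) (σ.arr aEnd) (σ.arr aNbr) (σ.arr aTwin) pos)
    {q : Fin n} (hq : σ.reg rY = q) {o : Option3} (ho : o ∈ options)
    (ht : (shortenTest o).Holds σ) : ∃ p r x p' : Fin n, IsD3b G p q r x ∧ σ.arr aK x = 0 ∧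
      G.Adj p p' ∧ p' ≠ q ∧ p' ≠ x ∧ p' ≠ r ∧
      ((shortenLoad o).exec σ).reg rA = p ∧ ((shortenLoad o).exec σ).reg rB = r ∧
      ((shortenLoad o).exec σ).reg rX = x ∧ ((shortenLoad o).exec σ).reg rAout = p' ∧
      ((shortenLoad o).exec σ).reg rCellA = pos p q ∧
      ((shortenLoad o).exec σ).reg rCellB = pos r q ∧
      ((shortenLoad o).exec σ).reg rTwinA = pos x q := by
  have he : Function.Injective (Fin.val : Fin n → ℕ) := Fin.val_injective
  rw [mem_options] at ho
  simp only [shortenTest, Test.all_cons_holds, cubic_holds, Test.eq_holds, Test.not_holds,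
    nbr_eval, Expr.eval_read, Expr.eval_const, selected, Expr.eval_reg, hq, Test.all_nil_holds,
    and_true] at ht
  obtain ⟨c1, c2, c3, t1, t2, t3, t4, t5, t6⟩ := ht
  obtain ⟨p, r, x, s1, s2, s3, s4, s5, s6, s7⟩ := h.read_three he c1 ho.1
  have ap : G.Adj q p := by rw [← SimpleGraph.mem_neighborSet, s1]; simp
  have ar : G.Adj q r := by rw [← SimpleGraph.mem_neighborSet, s1]; simp
  have ax : G.Adj q x := by rw [← SimpleGraph.mem_neighborSet, s1]; simp
  rw [← s2, h.nbr ap] at c2 t1 t2 t5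
  rw [← s3, h.nbr ar] at c3 t3 t4 t5
  rw [← s4, h.nbr ax] at t2 t4 t6
  obtain ⟨p', u, v, u1, u2, u3, u4, u5, u6, u7⟩ := h.read_three he c2 ho.2.1
  have bp : G.Adj p p' := by rw [← SimpleGraph.mem_neighborSet, u1]; simp
  have bu : G.Adj p u := by rw [← SimpleGraph.mem_neighborSet, u1]; simp
  have bv : G.Adj p v := by rw [← SimpleGraph.mem_neighborSet, u1]; simp
  rw [← u2, h.nbr bp] at t5
  rw [← u3, h.nbr bu] at t1
  rw [← u4, h.nbr bv] at t2
  obtain rfl := Fin.ext t1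
  obtain rfl := Fin.ext t2
  obtain ⟨r', u', v', v1, v2, v3, v4, v5, v6, v7⟩ := h.read_three he c3 ho.2.2
  have eu : G.Adj r u' := by rw [← SimpleGraph.mem_neighborSet, v1]; simp
  have ev : G.Adj r v' := by rw [← SimpleGraph.mem_neighborSet, v1]; simp
  rw [← v3, h.nbr eu] at t3
  rw [← v4, h.nbr ev] at t4
  obtain rfl := Fin.ext t3
  obtain rfl := Fin.ext t4
  have hpr : ¬ G.Adj p r := by
    rw [← SimpleGraph.mem_neighborSet, u1]
    rintro (e | e | e)
    · exact t5 (by rw [e])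
    · exact ar.ne' e
    · exact s7 e
  refine ⟨p, r, v', p', ⟨(h.degree_three_iff he).2 c2, (h.degree_three_iff he).2 c1,
    (h.degree_three_iff he).2 c3, s5, ap.symm, ar, hpr, bv.symm, ax.symm, ev.symm⟩, t6, bp, u5, u6,
    fun e => t5 (by rw [e]), ?_⟩
  simp [shortenLoad, selected, hq, ← s2, ← s3, ← s4, h.nbr ap, h.nbr ar, h.nbr ax, ← u2, h.nbr bp,
    h.twin ap, h.twin ar, h.twin ax]

theorem exists_shortenTest
    (h : Cells G Fin.val (σ.arr aStart) (σ.arr aEnd) (σ.arr aNbr) (σ.arr aTwin) pos)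
    {p q r x : Fin n} (hq : σ.reg rY = q) (hd : IsD3b G p q r x) (hK : σ.arr aK x = 0) :
    ∃ o ∈ options, (shortenTest o).Holds σ := by
  have he : Function.Injective (Fin.val : Fin n → ℕ) := Fin.val_injective
  obtain ⟨p', k1, k2, k3, k4, k5⟩ := hd.exists_outside
  obtain ⟨r', l1, l2, l3, l4, l5⟩ := hd.symm.exists_outside
  obtain ⟨o1, h1, a1, a2, a3⟩ := h.exists_order he (a := p) (b := r) (c := x) hd.degree_q
    hd.adj_pq.symm hd.adj_qr hd.adj_sq.symm hd.ne_pr hd.adj_sp.ne' hd.adj_sr.ne'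
  obtain ⟨o2, h2, b1, b2, b3⟩ := h.exists_order he (a := p') (b := q) (c := x) hd.degree_p
    k1 hd.adj_pq hd.adj_sp.symm k2 k3 hd.adj_sq.ne'
  obtain ⟨o3, h3, c1, c2, c3⟩ := h.exists_order he (a := r') (b := q) (c := x) hd.degree_r
    l1 hd.adj_qr.symm hd.adj_sr.symm l2 l3 hd.adj_sq.ne'
  refine ⟨(o1, o2, o3), mem_options.2 ⟨h1, h2, h3⟩, ?_⟩
  simp only [shortenTest, Test.all_cons_holds, cubic_holds, Test.eq_holds, Test.not_holds,
    nbr_eval, Expr.eval_read, Expr.eval_const, selected, Expr.eval_reg, hq, Test.all_nil_holds,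
    and_true, a1, a2, a3, b1, b2, b3, c2, c3, true_and]
  exact ⟨(h.degree_three_iff he).1 hd.degree_q, (h.degree_three_iff he).1 hd.degree_p,
    (h.degree_three_iff he).1 hd.degree_r, he.ne k5, hK⟩

end

end RAM

namespace Halin

/-- The current graph is `K₄` if and only if it has four vertices, all of degree three. -/
theorem State.isK4_iff_degree {V : Type*} [Finite V] {s : State V} (hs : s.Supported) :
    s.IsK4 ↔ s.alive.ncard = 4 ∧ ∀ a ∈ s.alive, (s.graph.neighborSet a).ncard = 3 := by
  rw [State.isK4_iff]
  refine and_congr_right fun h4 => ?_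
  have sub : ∀ a, s.graph.neighborSet a ⊆ s.alive \ {a} := fun a b hb =>
    ⟨hs b a hb.symm, hb.ne'⟩
  have card : ∀ a ∈ s.alive, (s.alive \ {a}).ncard = 3 := by
    intro a ha
    have := Set.ncard_sdiff_singleton_add_one ha (Set.toFinite _)
    omega
  constructor
  · intro h a ha
    rw [← card a ha]
    congr 1
    exact (sub a).antisymm fun b hb => h a ha b hb.1 fun e => hb.2 e.symm
  · intro h a ha b hb hab
    have : s.graph.neighborSet a = s.alive \ {a} :=
      Set.eq_of_subset_of_ncard_le (sub a) (by rw [card a ha, h a ha]) (Set.toFinite _)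
    rw [← SimpleGraph.mem_neighborSet, this]
    exact ⟨hb, fun e => hab e.symm⟩

end Halin

/-! ### The store represents the state before and after a reduction -/

namespace RAM

open Halin

/-- The store represents the state. -/
structure Rep {n : ℕ} (s : State (Fin n)) (σ : Store) : Prop where
  cells : ∃ pos, Cells s.graph Fin.val (σ.arr aStart) (σ.arr aEnd) (σ.arr aNbr) (σ.arr aTwin) pos
  alive : s.alive.ncard = σ.reg rAlive
  K : ∀ u : Fin n, σ.arr aK u ≠ 0 ↔ u ∈ s.K
  C : Stack s.C (σ.reg rTop) (σ.arr aStack) (σ.arr aIn)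

variable {n : ℕ} {s : State (Fin n)} {σ : Store} {pos : Fin n → Fin n → ℕ}
  {p q r p' q' r' x : Fin n}

theorem collapseLink_spec {G : SimpleGraph (Fin n)}
    (h : Cells G Fin.val (σ.arr aStart) (σ.arr aEnd) (σ.arr aNbr) (σ.arr aTwin) pos)
    (hd : IsD3a G p q r p' q' r') (h1 : σ.reg rY = p) (h2 : σ.reg rA = q) (h3 : σ.reg rB = r)
    (h5 : σ.reg rAout = q') (h6 : σ.reg rBout = r')
    (h7 : σ.reg rCellA = pos p q) (h8 : σ.reg rCellB = pos p r) (h9 : σ.reg rTwinA = pos q' q)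
    (h10 : σ.reg rTwinB = pos r' r) :
    (∃ pos', Cells (collapseGraph G p q r p p' q' r') Fin.val ((collapseLink.exec σ).arr aStart)
      ((collapseLink.exec σ).arr aEnd) ((collapseLink.exec σ).arr aNbr)
      ((collapseLink.exec σ).arr aTwin) pos') ∧
    (collapseLink.exec σ).reg rAlive = σ.reg rAlive - 2 := by
  obtain ⟨pos', h'⟩ := h.collapse Fin.val_injective hd
  refine ⟨⟨pos', ?_⟩, ?_⟩
  · simpa [collapseLink, selected, h1, h2, h3, h5, h6, h7, h8, h9, h10] using h'
  · simp [collapseLink, Nat.sub_sub]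

/-- The outside neighbours are not in the triangle, so a copy does not disturb the values that the
later copies read. -/
theorem collapseK_spec {K : Set (Fin n)} {G : SimpleGraph (Fin n)} (hd : IsD3a G p q r p' q' r')
    (hK : ∀ u : Fin n, σ.arr aK u ≠ 0 ↔ u ∈ K) (h1 : σ.reg rY = p)
    (h2 : σ.reg rA = q) (h3 : σ.reg rB = r) (h4 : σ.reg rYout = p') (h5 : σ.reg rAout = q')
    (h6 : σ.reg rBout = r') (u : Fin n) : (collapseK.exec σ).arr aK u ≠ 0 ↔
      u ∈ K ∪ {a | a = p ∨ (a = p' ∧ p ∈ K) ∨ (a = q' ∧ q ∈ K) ∨ (a = r' ∧ r ∈ K)} := by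
  have d1 := hd.distinct
  have d2 := hd.rotate.distinct
  have d3 := hd.rotate.rotate.distinct
  have k1 := copyK_spec (r := rY) (r' := rYout) hK h1 h4
  set σ1 := (copyK rY rYout).exec σ with e1
  have f1 : ∀ a, σ1.reg a = σ.reg a := fun a => Cmd.exec_reg _ _ (by simp [copyK, Cmd.regs])
  have k2 := copyK_spec (σ := σ1) (K := {u | u ∈ K ∨ (u = p' ∧ p ∈ K)}) (r := rA) (r' := rAout)
    k1 (by rw [f1, h2]) (by rw [f1, h5])
  set σ2 := (copyK rA rAout).exec σ1 with e2
  have f2 : ∀ a, σ2.reg a = σ.reg a := fun a =>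
    (Cmd.exec_reg _ _ (by simp [copyK, Cmd.regs])).trans (f1 a)
  have k3 := copyK_spec (σ := σ2) (r := rB) (r' := rBout) (K := {u | _}) k2 (by rw [f2, h3])
    (by rw [f2, h6])
  set σ3 := (copyK rB rBout).exec σ2 with e3
  have f3 : ∀ a, σ3.reg a = σ.reg a := fun a =>
    (Cmd.exec_reg _ _ (by simp [copyK, Cmd.regs])).trans (f2 a)
  have e4 : collapseK.exec σ = σ3.setArr aK p 1 := by
    simp [collapseK, ← e1, ← e2, ← e3, selected, f3, h1]
  rw [e4]
  simp only [Store.setArr_arr, if_true]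
  by_cases hu : u = p
  · simp [hu]
  · rw [Function.update_of_ne (fun e => hu (Fin.ext e)), k3]
    simp only [Set.mem_ofPred_eq, Set.mem_union, hu, false_or]
    grind

theorem collapseC_spec {C : Set (Fin n)}
    (hC : Stack C (σ.reg rTop) (σ.arr aStack) (σ.arr aIn)) (h1 : σ.reg rY = p)
    (h4 : σ.reg rYout = p') (h5 : σ.reg rAout = q') (h6 : σ.reg rBout = r') :
    Stack (C ∪ {a | a = p ∨ ((a = p' ∨ a = q' ∨ a = r') ∧ σ.arr aEnd a = σ.arr aStart a + 3)})
      ((collapseC.exec σ).reg rTop) ((collapseC.exec σ).arr aStack)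
      ((collapseC.exec σ).arr aIn) := by
  have k1 := push_spec (r := rY) hC h1
  set σ1 := (push rY).exec σ with e1
  have f1 : ∀ a, a ≠ rTop → σ1.reg a = σ.reg a := fun a ha =>
    Cmd.exec_reg _ _ (by simp [push, Cmd.regs, block, ha])
  have g1 : ∀ a, a ≠ aStack → a ≠ aIn → σ1.arr a = σ.arr a := fun a ha hb =>
    Cmd.exec_arr _ _ (by simp [push, Cmd.arrs, block, ha, hb])
  have k2 := pushCubic_spec (r := rYout) k1 (by rw [f1 _ (by simp), h4])
  set σ2 := (pushCubic rYout).exec σ1 with e2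
  have f2 : ∀ a, a ≠ rTop → σ2.reg a = σ.reg a := fun a ha =>
    (Cmd.exec_reg _ _ (by simp [push, pushCubic, Cmd.regs, block, ha])).trans (f1 a ha)
  have g2 : ∀ a, a ≠ aStack → a ≠ aIn → σ2.arr a = σ.arr a := fun a ha hb =>
    (Cmd.exec_arr _ _ (by simp [push, pushCubic, Cmd.arrs, block, ha, hb])).trans (g1 a ha hb)
  have k3 := pushCubic_spec (r := rAout) k2 (by rw [f2 _ (by simp), h5])
  set σ3 := (pushCubic rAout).exec σ2 with e3
  have f3 : ∀ a, a ≠ rTop → σ3.reg a = σ.reg a := fun a ha =>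
    (Cmd.exec_reg _ _ (by simp [push, pushCubic, Cmd.regs, block, ha])).trans (f2 a ha)
  have g3 : ∀ a, a ≠ aStack → a ≠ aIn → σ3.arr a = σ.arr a := fun a ha hb =>
    (Cmd.exec_arr _ _ (by simp [push, pushCubic, Cmd.arrs, block, ha, hb])).trans (g2 a ha hb)
  have k4 := pushCubic_spec (r := rBout) k3 (by rw [f3 _ (by simp), h6])
  have e4 : collapseC.exec σ = (pushCubic rBout).exec σ3 := rfl
  rw [e4]
  convert k4 using 1
  rw [g1 aEnd (by simp) (by simp), g1 aStart (by simp) (by simp), g2 aEnd (by simp) (by simp),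
    g2 aStart (by simp) (by simp), g3 aEnd (by simp) (by simp), g3 aStart (by simp) (by simp)]
  ext a
  simp only [Set.mem_union, Set.mem_ofPred_eq, Set.mem_insert_iff]
  grind

theorem collapse_rep (hs : s.Supported)
    (h : Cells s.graph Fin.val (σ.arr aStart) (σ.arr aEnd) (σ.arr aNbr) (σ.arr aTwin) pos)
    (hA : s.alive.ncard = σ.reg rAlive) (hK : ∀ u : Fin n, σ.arr aK u ≠ 0 ↔ u ∈ s.K)
    (hC : Stack (s.C \ {p}) (σ.reg rTop) (σ.arr aStack) (σ.arr aIn))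
    (hd : IsD3a s.graph p q r p' q' r') (h1 : σ.reg rY = p) (h2 : σ.reg rA = q)
    (h3 : σ.reg rB = r) (h4 : σ.reg rYout = p') (h5 : σ.reg rAout = q') (h6 : σ.reg rBout = r')
    (h7 : σ.reg rCellA = pos p q) (h8 : σ.reg rCellB = pos p r) (h9 : σ.reg rTwinA = pos q' q)
    (h10 : σ.reg rTwinB = pos r' r) :
    Rep (s.next (.collapse p q r p' q' r')) (collapseC.exec (collapseK.exec (collapseLink.exec σ)))
      := by
  obtain ⟨⟨pos', c1⟩, c2⟩ := collapseLink_spec h hd h1 h2 h3 h5 h6 h7 h8 h9 h10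
  have d1 := hd.distinct
  set σ1 := collapseLink.exec σ with e1
  have f1 : ∀ a, a ≠ rAlive → σ1.reg a = σ.reg a := fun a ha =>
    Cmd.exec_reg _ _ (by simp [collapseLink, Cmd.regs, block, ha])
  have g1 : ∀ a, a ≠ aNbr → a ≠ aTwin → a ≠ aEnd → σ1.arr a = σ.arr a := fun a ha hb hc =>
    Cmd.exec_arr _ _ (by simp [collapseLink, Cmd.arrs, block, ha, hb, hc])
  have k := collapseK_spec (σ := σ1) (K := s.K) hd
    (by rw [g1 _ (by simp) (by simp) (by simp)]; exact hK) (by rw [f1 _ (by simp), h1])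
    (by rw [f1 _ (by simp), h2]) (by rw [f1 _ (by simp), h3]) (by rw [f1 _ (by simp), h4])
    (by rw [f1 _ (by simp), h5]) (by rw [f1 _ (by simp), h6])
  set σ2 := collapseK.exec σ1 with e2
  have f2 : ∀ a, σ2.reg a = σ1.reg a := fun a =>
    Cmd.exec_reg _ _ (by simp [collapseK, copyK, Cmd.regs, block])
  have g2 : ∀ a, a ≠ aK → σ2.arr a = σ1.arr a := fun a ha =>
    Cmd.exec_arr _ _ (by simp [collapseK, copyK, Cmd.arrs, block, ha])
  have t := collapseC_spec (σ := σ2) (C := s.C \ {p}) (p := p) (p' := p') (q' := q') (r' := r')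
    (by
      rw [f2, f1 _ (by simp), g2 _ (by simp), g1 _ (by simp) (by simp) (by simp), g2 _ (by simp),
        g1 _ (by simp) (by simp) (by simp)]
      exact hC)
    (by rw [f2, f1 _ (by simp), h1]) (by rw [f2, f1 _ (by simp), h4])
    (by rw [f2, f1 _ (by simp), h5]) (by rw [f2, f1 _ (by simp), h6])
  set σ3 := collapseC.exec σ2 with e3
  have f3 : ∀ a, a ≠ rTop → σ3.reg a = σ2.reg a := fun a ha =>
    Cmd.exec_reg _ _ (by simp [collapseC, push, pushCubic, Cmd.regs, block, ha])
  have g3 : ∀ a, a ≠ aStack → a ≠ aIn → σ3.arr a = σ2.arr a := fun a ha hb =>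
    Cmd.exec_arr _ _ (by simp [collapseC, push, pushCubic, Cmd.arrs, block, ha, hb])
  constructor
  · refine ⟨pos', ?_⟩
    rw [g3 _ (by simp) (by simp), g3 _ (by simp) (by simp), g3 _ (by simp) (by simp),
      g3 _ (by simp) (by simp), g2 _ (by simp), g2 _ (by simp), g2 _ (by simp), g2 _ (by simp)]
    exact c1
  · rw [f3 _ (by simp), f2, c2, ← hA]
    have := Set.ncard_sdiff_add_ncard_of_subset (s := {q, r}) (t := s.alive) (by
        rintro a (rfl | rfl)
        · exact hs a p (hd.adj_q.2 (by simp))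
        · exact hs a p (hd.adj_r.2 (by simp))) (Set.toFinite _)
    rw [Set.ncard_pair d1.2.2.1] at this
    show (s.alive \ {q, r}).ncard = _
    omega
  · intro u
    rw [g3 _ (by simp) (by simp)]
    exact k u
  · convert t using 1
    show (s.C \ {p}) ∪ _ = _
    congr 1
    ext a
    show (a = p ∨ ((collapseGraph s.graph p q r p p' q' r').Adj p a ∧
      ((collapseGraph s.graph p q r p p' q' r').neighborSet a).ncard = 3)) ↔ _
    rw [c1.degree_three_iff Fin.val_injective, g2 aEnd (by simp), g2 aStart (by simp),
      hd.collapse_adj (by simp)]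
    have := hd.rotate.distinct
    have := hd.rotate.rotate.distinct
    simp only [Set.mem_ofPred_eq]
    grind

theorem shortenLink_spec {G : SimpleGraph (Fin n)}
    (h : Cells G Fin.val (σ.arr aStart) (σ.arr aEnd) (σ.arr aNbr) (σ.arr aTwin) pos)
    (hd : IsD3b G p q r x) (h1 : σ.reg rY = q) (h2 : σ.reg rA = p) (h3 : σ.reg rB = r)
    (h4 : σ.reg rX = x) (h5 : σ.reg rCellA = pos p q) (h6 : σ.reg rCellB = pos r q)
    (h7 : σ.reg rTwinA = pos x q) :
    (∃ pos', Cells (isolate G {q} ⊔ SimpleGraph.edge p r) Fin.val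
      ((shortenLink.exec σ).arr aStart) ((shortenLink.exec σ).arr aEnd)
      ((shortenLink.exec σ).arr aNbr) ((shortenLink.exec σ).arr aTwin) pos') ∧
    (shortenLink.exec σ).reg rAlive = σ.reg rAlive - 1 := by
  obtain ⟨pos', h'⟩ := h.shorten Fin.val_injective hd rfl rfl
  have : (x : ℕ) ≠ q := fun e => hd.adj_sq.ne (Fin.ext e)
  refine ⟨⟨pos', ?_⟩, ?_⟩
  · simpa [shortenLink, selected, h1, h2, h3, h4, h5, h6, h7, this] using h'
  · simp [shortenLink]

theorem shorten_rep (hs : s.Supported)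
    (h : Cells s.graph Fin.val (σ.arr aStart) (σ.arr aEnd) (σ.arr aNbr) (σ.arr aTwin) pos)
    (hA : s.alive.ncard = σ.reg rAlive) (hK : ∀ u : Fin n, σ.arr aK u ≠ 0 ↔ u ∈ s.K)
    (hC : Stack (s.C \ {q}) (σ.reg rTop) (σ.arr aStack) (σ.arr aIn)) (hq : q ∈ s.C)
    (hd : IsD3b s.graph p q r x) (hx : x ∉ s.K) (hp : s.graph.Adj p p') (n1 : p' ≠ q)
    (n2 : p' ≠ x) (n3 : p' ≠ r)
    (h1 : σ.reg rY = q) (h2 : σ.reg rA = p) (h3 : σ.reg rB = r) (h4 : σ.reg rX = x)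
    (h5 : σ.reg rAout = p') (h6 : σ.reg rCellA = pos p q) (h7 : σ.reg rCellB = pos r q)
    (h8 : σ.reg rTwinA = pos x q) :
    Rep (s.next (.shorten p q r x)) (shortenC.exec (shortenK.exec (shortenLink.exec σ))) := by
  have hm : (Move.shorten p q r x).Allowed s := ⟨hq, hd, hx⟩
  have hs' := hs.next hm
  obtain ⟨⟨pos', c1⟩, c2⟩ := shortenLink_spec h hd h1 h2 h3 h4 h6 h7 h8
  have hcard : (s.alive \ {q}).ncard = σ.reg rAlive - 1 := by
    have := Set.ncard_sdiff_singleton_add_one (hs q r hd.adj_qr) (Set.toFinite s.alive)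
    omega
  set σ1 := shortenLink.exec σ with e1
  have f1 : ∀ a, a ≠ rAlive → a ≠ rLast → a ≠ rTwinLast → σ1.reg a = σ.reg a := fun a ha hb hc =>
    Cmd.exec_reg _ _ (by simp [shortenLink, Cmd.regs, block, ha, hb, hc])
  have g1 : ∀ a, a ≠ aNbr → a ≠ aTwin → a ≠ aEnd → σ1.arr a = σ.arr a := fun a ha hb hc =>
    Cmd.exec_arr _ _ (by simp [shortenLink, Cmd.arrs, block, ha, hb, hc])
  have k4 : (s.next (.shorten p q r x)).IsK4 ↔ σ1.reg rAlive = 4 ∧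
      σ1.arr aEnd x = σ1.arr aStart x + 3 ∧ σ1.arr aEnd p' = σ1.arr aStart p' + 3 := by
    have he : Function.Injective (Fin.val : Fin n → ℕ) := Fin.val_injective
    rw [State.isK4_iff_degree hs', ← c1.degree_three_iff he, ← c1.degree_three_iff he, c2]
    have mp : p ∈ (s.next (.shorten p q r x)).alive := ⟨hs p q hd.adj_pq, hd.adj_pq.ne⟩
    have mr : r ∈ (s.next (.shorten p q r x)).alive := ⟨hs r q hd.adj_qr.symm, hd.adj_qr.ne'⟩
    have mx : x ∈ (s.next (.shorten p q r x)).alive := ⟨hs x q hd.adj_sq, hd.adj_sq.ne⟩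
    have mp' : p' ∈ (s.next (.shorten p q r x)).alive := ⟨hs p' p hp.symm, n1⟩
    have hcard' : (s.next (.shorten p q r x)).alive.ncard = σ.reg rAlive - 1 := hcard
    rw [hcard']
    refine and_congr_right fun h4 => ⟨fun H => ⟨H x mx, H p' mp'⟩, fun H a ha => ?_⟩
    have deg : ∀ a, a ≠ q → a ≠ x → σ1.arr aEnd a = σ.arr aEnd a ∧
        σ1.arr aStart a = σ.arr aStart a := by
      intro a haq hax
      have m1 : (a : ℕ) ≠ q := fun e => haq (Fin.ext e)
      have m2 : (a : ℕ) ≠ x := fun e => hax (Fin.ext e)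
      refine ⟨?_, by rw [g1 _ (by simp) (by simp) (by simp)]⟩
      simp [e1, shortenLink, selected, h1, h4, m1, m2, ‹σ.reg rX = x›]
    have dp : ((s.next (.shorten p q r x)).graph.neighborSet p).ncard = 3 := by
      refine (c1.degree_three_iff he).2 ?_
      rw [(deg p hd.adj_pq.ne hd.adj_sp.ne').1,
        (deg p hd.adj_pq.ne hd.adj_sp.ne').2]
      exact (h.degree_three_iff he).1 hd.degree_p
    have dr : ((s.next (.shorten p q r x)).graph.neighborSet r).ncard = 3 := by
      refine (c1.degree_three_iff he).2 ?_
      rw [(deg r hd.adj_qr.ne' hd.adj_sr.ne').1,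
        (deg r hd.adj_qr.ne' hd.adj_sr.ne').2]
      exact (h.degree_three_iff he).1 hd.degree_r
    -- The vertices `p`, `r`, `x`, `p'` are distinct and current, so when four vertices are left
    -- there are no others.
    have all : ({p, r, x, p'} : Set (Fin n)) = (s.next (.shorten p q r x)).alive := by
      refine Set.eq_of_subset_of_ncard_le ?_ ?_ (Set.toFinite _)
      · rintro a (rfl | rfl | rfl | rfl) <;> assumption
      · rw [hcard', h4]
        exact four_le_ncard (a := p) (b := r) (c := x) (d := p') (by simp) (by simp) (by simp)
          (by simp) hd.ne_pr hd.adj_sp.ne' hp.ne hd.adj_sr.ne' n3.symm n2.symm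
    rw [← all] at ha
    rcases ha with rfl | rfl | rfl | rfl
    exacts [dp, dr, H.1, H.2]
  have kK : ∀ u : Fin n, (shortenK.exec σ1).arr aK u ≠ 0 ↔ u ∈ s.K ∨ u = p ∨ u = r ∨
      (u = p' ∧ (s.next (.shorten p q r x)).IsK4) := by
    intro u
    have r1 := f1 rA (by simp) (by simp) (by simp)
    have r2 := f1 rB (by simp) (by simp) (by simp)
    have r3 := f1 rX (by simp) (by simp) (by simp)
    have r4 := f1 rAout (by simp) (by simp) (by simp)
    have r5 := g1 aK (by simp) (by simp) (by simp)
    rw [k4, ← hK]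
    simp only [shortenK, exec_block_cons, Cmd.exec_write, Expr.eval_reg, Expr.eval_const,
      Store.setArr_reg, exec_block_nil, r1, r2, h2, h3]
    rw [Cmd.exec]
    simp only [Test.all_cons_holds, Test.eq_holds, Expr.eval_reg, Expr.eval_const, cubic_holds,
      Store.setArr_reg, Store.setArr_arr, r3, r4, h4, h5, Test.all_nil_holds, and_true,
      show ((5 : ℕ) = 9) = False by simp, show ((4 : ℕ) = 9) = False by simp, if_false]
    have ne : ∀ v : Fin n, u ≠ v → (u : ℕ) ≠ v := fun v e e' => e (Fin.ext e')
    by_cases up : u = p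
    · subst up
      split_ifs <;> simp [Function.update_apply, r5]
    · by_cases ur : u = r
      · subst ur
        split_ifs <;> simp [Function.update_apply, r5]
      · by_cases up' : u = p'
        · subst up'
          split_ifs with hif
          · simp [hif, r4, h5]
          · simp [hif, r5, up, ur, ne]
        · split_ifs <;> simp [r5, up, ur, up', ne, r4, h5]
  set σ2 := shortenK.exec σ1 with e2
  have f2 : ∀ a, σ2.reg a = σ1.reg a := fun a =>
    Cmd.exec_reg _ _ (by simp [shortenK, Cmd.regs, block])
  have g2 : ∀ a, a ≠ aK → σ2.arr a = σ1.arr a := fun a ha =>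
    Cmd.exec_arr _ _ (by simp [shortenK, Cmd.arrs, block, ha])
  have t := pushCubic_spec (σ := σ2) (r := rX) (v := x) (C := s.C \ {q})
    (by
      rw [f2, f1 _ (by simp) (by simp) (by simp), g2 _ (by simp),
        g1 _ (by simp) (by simp) (by simp), g2 _ (by simp), g1 _ (by simp) (by simp) (by simp)]
      exact hC)
    (by rw [f2, f1 _ (by simp) (by simp) (by simp), h4])
  set σ3 := shortenC.exec σ2 with e3
  have f3 : ∀ a, a ≠ rTop → σ3.reg a = σ2.reg a := fun a ha =>
    Cmd.exec_reg _ _ (by simp [shortenC, push, pushCubic, Cmd.regs, block, ha])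
  have g3 : ∀ a, a ≠ aStack → a ≠ aIn → σ3.arr a = σ2.arr a := fun a ha hb =>
    Cmd.exec_arr _ _ (by simp [shortenC, push, pushCubic, Cmd.arrs, block, ha, hb])
  constructor
  · refine ⟨pos', ?_⟩
    rw [g3 _ (by simp) (by simp), g3 _ (by simp) (by simp), g3 _ (by simp) (by simp),
      g3 _ (by simp) (by simp), g2 _ (by simp), g2 _ (by simp), g2 _ (by simp), g2 _ (by simp)]
    exact c1
  · rw [f3 _ (by simp), f2, c2]
    exact hcard
  · intro u
    rw [g3 _ (by simp) (by simp), kK]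
    show _ ↔ u ∈ s.K ∨ u = p ∨ u = r ∨
      (u ∈ (s.next (.shorten p q r x)).alive ∧ u ≠ x ∧ (s.next (.shorten p q r x)).IsK4)
    constructor
    · rintro (e | e | e | ⟨rfl, e⟩)
      · exact Or.inl e
      · exact Or.inr (Or.inl e)
      · exact Or.inr (Or.inr (Or.inl e))
      · exact Or.inr (Or.inr (Or.inr ⟨⟨hs u p hp.symm, n1⟩, n2, e⟩))
    · rintro (e | e | e | ⟨e1, e2, e⟩)
      · exact Or.inl e
      · exact Or.inr (Or.inl e)
      · exact Or.inr (Or.inr (Or.inl e))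
      · by_cases up : u = p
        · exact Or.inr (Or.inl up)
        by_cases ur : u = r
        · exact Or.inr (Or.inr (Or.inl ur))
        refine Or.inr (Or.inr (Or.inr ⟨?_, e⟩))
        -- In `K₄` the remaining vertex is adjacent to `p`, and it was so before the shortening. Of
        -- the three neighbours of `p` then, only `p'` is possible.
        have hc := ((State.isK4_iff _).1 e)
        have adj := hc.2 p ⟨hs p q hd.adj_pq, hd.adj_pq.ne⟩ u e1 (fun e => up e.symm)
        have adj' : (isolate s.graph {q} ⊔ SimpleGraph.edge p r).Adj p u := adj
        rw [shorten_adj hd] at adj'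
        have hu : s.graph.Adj p u := by grind
        have := eq_or_of_ncard_three hd.degree_p hd.adj_pq hd.adj_sp.symm hp hd.adj_sq.ne'
          n1.symm n2.symm hu
        have : u ≠ q := e1.2
        grind
  · rw [show (pushCubic rX).exec σ2 = σ3 from rfl] at t
    convert t using 1
    show (s.C \ {q}) ∪ _ = _
    congr 1
    ext a
    show (a = x ∧ ((isolate s.graph {q} ⊔ SimpleGraph.edge p r).neighborSet x).ncard = 3) ↔ _
    rw [c1.degree_three_iff Fin.val_injective, g2 aEnd (by simp), g2 aStart (by simp)]
    rfl

end RAM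

namespace Halin

theorem Run.snoc {V : Type*} {s s' : State V} {ms : List (Move V)} (h : Run s ms s') {m : Move V}
    (hm : m.Allowed s') : Run s (ms ++ [m]) (s'.next m) := by
  induction h with
  | nil => exact .cons hm (.nil _)
  | cons h1 _ ih => exact .cons h1 (ih hm)

end Halin

/-! ### The record of the run and the correctness of one iteration -/

namespace RAM

open Halin

/-- The `i`-th entry of the record is the move. -/
def Recorded {n : ℕ} (σ : Store) (i : ℕ) : Move (Fin n) → Prop
  | .collapse p q r p' q' r' => σ.arr aSelected i = p ∧ σ.arr aKind i = 1 ∧ σ.arr aLogA i = q ∧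
      σ.arr aLogB i = r ∧ σ.arr aLogYout i = p' ∧ σ.arr aLogAout i = q' ∧ σ.arr aLogBout i = r'
  | .shorten _ q _ _ => σ.arr aSelected i = q ∧ σ.arr aKind i = 2
  | .discard v => σ.arr aSelected i = v ∧ σ.arr aKind i = 0

/-- The list of moves is recorded in the store. -/
def RunRecorded {n : ℕ} (σ : Store) (ms : List (Move (Fin n))) : Prop :=
  σ.reg rLen = ms.length ∧ ∀ i (hi : i < ms.length), Recorded σ i ms[i]

variable {n : ℕ} {s : State (Fin n)} {σ : Store}

theorem Recorded.congr {τ : Store} {i : ℕ} {m : Move (Fin n)} (h : Recorded σ i m)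
    (ha : ∀ a ∈ [aSelected, aKind, aLogA, aLogB, aLogYout, aLogAout, aLogBout],
      τ.arr a i = σ.arr a i) : Recorded τ i m := by
  simp only [List.mem_cons, List.not_mem_nil, or_false, forall_eq_or_imp, forall_eq] at ha
  obtain ⟨h1, h2, h3, h4, h5, h6, h7⟩ := ha
  cases m <;> simp_all [Recorded]

theorem RunRecorded.congr {τ : Store} {ms : List (Move (Fin n))} (h : RunRecorded σ ms)
    (hr : τ.reg rLen = σ.reg rLen)
    (ha : ∀ a ∈ [aSelected, aKind, aLogA, aLogB, aLogYout, aLogAout, aLogBout],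
      τ.arr a = σ.arr a) : RunRecorded τ ms :=
  ⟨hr.trans h.1, fun i hi => (h.2 i hi).congr fun a h' => by rw [ha a h']⟩

theorem record_spec {ms : List (Move (Fin n))} (h : RunRecorded σ ms) {m : Move (Fin n)} {k : ℕ}
    (hm : Recorded ((record k).exec σ) ms.length m) :
    RunRecorded ((record k).exec σ) (ms ++ [m]) := by
  constructor
  · simp [record, h.1]
  · intro i hi
    by_cases e : i = ms.length
    · subst e
      simpa using hm
    · have hi' : i < ms.length := by simp at hi; omega
      rw [List.getElem_append_left hi']
      refine (h.2 i hi').congr ?_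
      simp [record, Function.update_apply, h.1, e]

theorem pop_spec (h : Rep s σ) (ht : 0 < σ.reg rTop) : ∃ v ∈ s.C, (pop.exec σ).reg rY = v ∧
    Stack (s.C \ {v}) ((pop.exec σ).reg rTop) ((pop.exec σ).arr aStack) ((pop.exec σ).arr aIn) := by
  obtain ⟨v, h1, h2, h3⟩ := h.C.pop ht
  refine ⟨v, h1, ?_, ?_⟩
  · simp [pop, h2]
  · simpa [pop, h2, selected] using h3

theorem record_rep {k : ℕ} (h : Rep s σ) : Rep s ((record k).exec σ) := by
  have f : ∀ r, r ≠ rLen → ((record k).exec σ).reg r = σ.reg r := fun r hr =>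
    Cmd.exec_reg _ _ (by simp [record, Cmd.regs, block, hr])
  have g : ∀ a, a < 12 → a ≠ aSelected → ((record k).exec σ).arr a = σ.arr a := fun a ha hb =>
    Cmd.exec_arr _ _ (by simp [record, Cmd.arrs, block]; omega)
  constructor
  · rw [g aStart (by simp) (by simp), g aEnd (by simp) (by simp), g aNbr (by simp) (by simp),
      g aTwin (by simp) (by simp)]
    exact h.cells
  · rw [f _ (by simp)]; exact h.alive
  · rw [g _ (by simp) (by simp)]; exact h.K
  · rw [f _ (by simp), g _ (by simp) (by simp), g _ (by simp) (by simp)]; exact h.C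

/-- A successful test yields an allowed reduction. If all tests fail, their completeness makes
discarding the vertex an allowed move. In each case exactly one move is appended to the record. -/
theorem iteration_spec (hs : s.Supported) (h : Rep s σ) (ht : 0 < σ.reg rTop)
    {ms : List (Move (Fin n))} (hr : RunRecorded σ ms) :
    ∃ m, m.Allowed s ∧ Rep (s.next m) (iteration.exec σ) ∧
      RunRecorded (iteration.exec σ) (ms ++ [m]) := by
  obtain ⟨v, hvC, hv, hC⟩ := pop_spec h ht
  obtain ⟨pos, hc⟩ := h.cells
  have hA := h.alive
  have hK := h.K
  have e0 : iteration.exec σ = (firstOf collapseTest collapseAct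
    (firstOf shortenTest shortenAct (record 0) options) options).exec (pop.exec σ) := rfl
  rw [e0]
  have f0 : ∀ a, a ≠ rTop → a ≠ rY → (pop.exec σ).reg a = σ.reg a := fun a ha hb =>
    Cmd.exec_reg _ _ (by simp [pop, Cmd.regs, block, ha, hb])
  have g0 : ∀ a, a ≠ aIn → (pop.exec σ).arr a = σ.arr a := fun a ha =>
    Cmd.exec_arr _ _ (by simp [pop, Cmd.arrs, block, ha])
  rw [← g0 aStart (by simp), ← g0 aEnd (by simp), ← g0 aNbr (by simp), ← g0 aTwin (by simp)] at hc
  rw [← f0 rAlive (by simp) (by simp)] at hA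
  rw [← g0 aK (by simp)] at hK
  replace hr : RunRecorded (pop.exec σ) ms := hr.congr (f0 _ (by simp) (by simp))
    (by simp only [List.mem_cons, List.not_mem_nil, or_false]; intro a ha; apply g0; omega)
  generalize pop.exec σ = τ at *
  rcases firstOf_exec collapseTest collapseAct (firstOf shortenTest shortenAct (record 0) options)
    options τ with ⟨o, ho, h1, h2⟩ | ⟨h1, h2⟩
  · rw [h2]
    obtain ⟨q, r, p', q', r', hd, hk, a1, a2, a3, a4, a5, a6, a7, a8, a9⟩ :=
      collapseLoad_spec hc hv ho h1
    have e1 : (collapseAct o).exec τ = (record 1).exec (collapseC.exec (collapseK.exec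
      (collapseLink.exec ((collapseLoad o).exec τ)))) := rfl
    rw [e1]
    have f1 : ∀ a, a < 10 → ((collapseLoad o).exec τ).reg a = τ.reg a := fun a ha =>
      Cmd.exec_reg _ _ (by simp [collapseLoad, Cmd.regs, block]; omega)
    have g1 : ∀ a, ((collapseLoad o).exec τ).arr a = τ.arr a := fun a =>
      Cmd.exec_arr _ _ (by simp [collapseLoad, Cmd.arrs, block])
    simp only [← g1] at hc hK hC
    rw [← f1 _ (by norm_num)] at hA hv
    rw [← f1 rTop (by norm_num)] at hC
    replace hr : RunRecorded ((collapseLoad o).exec τ) ms :=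
      hr.congr (f1 _ (by simp)) (fun a _ => g1 a)
    rw [← g1] at hk
    generalize (collapseLoad o).exec τ = υ at *
    refine ⟨.collapse v q r p' q' r', ⟨hvC, hd, by rwa [hK, hK, hK] at hk⟩,
      record_rep (collapse_rep hs hc hA hK hC hd hv a1 a2 a3 a4 a5 a6 a7 a8 a9), ?_⟩
    have f2 : ∀ a, a ≠ rAlive → a ≠ rTop → (collapseC.exec (collapseK.exec
        (collapseLink.exec υ))).reg a = υ.reg a := by
      intro a ha hb
      rw [Cmd.exec_reg _ _ (by simp [collapseC, push, pushCubic, Cmd.regs, block, hb]),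
        Cmd.exec_reg _ _ (by simp [collapseK, copyK, Cmd.regs, block]),
        Cmd.exec_reg _ _ (by simp [collapseLink, Cmd.regs, block, ha])]
    have g2 : ∀ a, a = aSelected ∨ 12 ≤ a → (collapseC.exec (collapseK.exec
        (collapseLink.exec υ))).arr a = υ.arr a := by
      intro a ha
      rw [Cmd.exec_arr _ _ (by simp [collapseC, push, pushCubic, Cmd.arrs, block]; omega),
        Cmd.exec_arr _ _ (by simp [collapseK, copyK, Cmd.arrs, block]; omega),
        Cmd.exec_arr _ _ (by simp [collapseLink, Cmd.arrs, block]; omega)]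
    have hr' : RunRecorded (collapseC.exec (collapseK.exec (collapseLink.exec υ))) ms :=
      hr.congr (f2 _ (by simp) (by simp))
        (by simp only [List.mem_cons, List.not_mem_nil, or_false]; intro a ha; apply g2; omega)
    refine record_spec hr' ?_
    simp [Recorded, record, selected, f2, hv, a1, a2, a3, a4, a5, hr.1]
  · rw [h2]
    rcases firstOf_exec shortenTest shortenAct (record 0) options τ with ⟨o, ho, h3, h4⟩ | ⟨h3, h4⟩
    · rw [h4]
      obtain ⟨p, r, x, p', hd, hk, hp, n1, n2, n3, a1, a2, a3, a4, a5, a6, a7⟩ :=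
        shortenLoad_spec hc hv ho h3
      have e1 : (shortenAct o).exec τ = (record 2).exec (shortenC.exec (shortenK.exec
        (shortenLink.exec ((shortenLoad o).exec τ)))) := rfl
      rw [e1]
      have f1 : ∀ a, a < 10 → ((shortenLoad o).exec τ).reg a = τ.reg a := fun a ha =>
        Cmd.exec_reg _ _ (by simp [shortenLoad, Cmd.regs, block]; omega)
      have g1 : ∀ a, ((shortenLoad o).exec τ).arr a = τ.arr a := fun a =>
        Cmd.exec_arr _ _ (by simp [shortenLoad, Cmd.arrs, block])
      simp only [← g1] at hc hK hC
      rw [← f1 _ (by norm_num)] at hA hv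
      rw [← f1 rTop (by norm_num)] at hC
      replace hr : RunRecorded ((shortenLoad o).exec τ) ms :=
        hr.congr (f1 _ (by simp)) (fun a _ => g1 a)
      rw [← g1] at hk
      generalize (shortenLoad o).exec τ = υ at *
      have hx : x ∉ s.K := fun e => (hK x).2 e hk
      refine ⟨.shorten p v r x, ⟨hvC, hd, hx⟩,
        record_rep (shorten_rep hs hc hA hK hC hvC hd hx hp n1 n2 n3 hv a1 a2 a3 a4 a5 a6 a7), ?_⟩
      have f2 : ∀ a, a ≠ rAlive → a ≠ rTop → a < 20 → (shortenC.exec (shortenK.exec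
          (shortenLink.exec υ))).reg a = υ.reg a := by
        intro a ha hb hc
        rw [Cmd.exec_reg _ _ (by simp [shortenC, push, pushCubic, Cmd.regs, block, hb]),
          Cmd.exec_reg _ _ (by simp [shortenK, Cmd.regs, block]),
          Cmd.exec_reg _ _ (by simp [shortenLink, Cmd.regs, block, ha]; omega)]
      have g2 : ∀ a, a = aSelected ∨ 12 ≤ a → (shortenC.exec (shortenK.exec
          (shortenLink.exec υ))).arr a = υ.arr a := by
        intro a ha
        rw [Cmd.exec_arr _ _ (by simp [shortenC, push, pushCubic, Cmd.arrs, block]; omega),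
          Cmd.exec_arr _ _ (by simp [shortenK, Cmd.arrs, block]; omega),
          Cmd.exec_arr _ _ (by simp [shortenLink, Cmd.arrs, block]; omega)]
      have hr' : RunRecorded (shortenC.exec (shortenK.exec (shortenLink.exec υ))) ms :=
        hr.congr (f2 _ (by simp) (by simp) (by simp))
          (by simp only [List.mem_cons, List.not_mem_nil, or_false]; intro a ha; apply g2; omega)
      refine record_spec hr' ?_
      simp [Recorded, record, selected, f2, hv, hr.1]
    · rw [h4]
      refine ⟨.discard v, ⟨hvC, ?_, ?_⟩, record_rep ⟨⟨pos, hc⟩, hA, ?_, ?_⟩, ?_⟩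
      · intro q r v' q' r' hd
        by_contra hk
        obtain ⟨o, ho, ho'⟩ := exists_collapseTest hc hv hd (by rwa [hK, hK, hK])
        exact h1 o ho ho'
      · intro p r x hd
        by_contra hk
        obtain ⟨o, ho, ho'⟩ := exists_shortenTest hc hv hd (by
          by_contra e
          exact hk ((hK x).1 e))
        exact h3 o ho ho'
      · intro u
        rw [hK]
        show _ ↔ u ∈ s.K ∪ ∅
        simp
      · show Stack (s.C \ {v} ∪ ∅) _ _ _
        simpa using hC
      · refine record_spec hr ?_
        simp [Recorded, record, selected, hv, hr.1]

theorem firstOf_regs {α : Type} {test : α → Test} {act : α → Cmd} {d : Cmd} {l : List α} {r : ℕ}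
    (h : ∀ o, r ∉ (act o).regs) (hd : r ∉ d.regs) : r ∉ (firstOf test act d l).regs := by
  induction l with
  | nil => exact hd
  | cons o l ih =>
    simp only [firstOf, List.foldr_cons, Cmd.regs, List.mem_append, not_or]
    exact ⟨h o, ih⟩

theorem firstOf_arrs {α : Type} {test : α → Test} {act : α → Cmd} {d : Cmd} {l : List α} {a : ℕ}
    (h : ∀ o, a ∉ (act o).arrs) (hd : a ∉ d.arrs) : a ∉ (firstOf test act d l).arrs := by
  induction l with
  | nil => exact hd
  | cons o l ih =>
    simp only [firstOf, List.foldr_cons, Cmd.arrs, List.mem_append, not_or]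
    exact ⟨h o, ih⟩

theorem iteration_reg {r : ℕ} (hr : r = 0 ∨ r = rEdges ∨ r = rVerts) :
    (iteration.exec σ).reg r = σ.reg r := by
  apply Cmd.exec_reg
  have h1 : r ≠ rLen := by omega
  have h2 : r < 4 := by omega
  simp only [iteration, Cmd.regs, List.mem_append, not_or]
  refine ⟨?_, firstOf_regs (fun o => ?_) (firstOf_regs (fun o => ?_) ?_)⟩
  all_goals
    simp [pop, collapseAct, collapseLoad, collapseLink, collapseK, collapseC, record,
      shortenAct, shortenLoad, shortenLink, shortenK, shortenC, block, Cmd.regs, copyK, push,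
      pushCubic]
    omega

theorem iteration_arr {a : ℕ} (ha : a < 2) : (iteration.exec σ).arr a = σ.arr a := by
  apply Cmd.exec_arr
  simp only [iteration, Cmd.arrs, List.mem_append, not_or]
  refine ⟨?_, firstOf_arrs (fun o => ?_) (firstOf_arrs (fun o => ?_) ?_)⟩
  all_goals
    simp [pop, collapseAct, collapseLoad, collapseLink, collapseK, collapseC, record,
      shortenAct, shortenLoad, shortenLink, shortenK, shortenC, block, Cmd.arrs, copyK, push,
      pushCubic]
    omega

end RAM

namespace RAM

open Halin

/-! ### Building the adjacency lists -/

section EdgeList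

variable {n : ℕ}

/-- The number of times that `v` occurs in the list of edges. -/
def occ (l : List (Fin n × Fin n)) (v : Fin n) : ℕ :=
  l.countP (fun e => e.1 = v) + l.countP (fun e => e.2 = v)

theorem occ_snoc (l : List (Fin n × Fin n)) (e : Fin n × Fin n) (v : Fin n) :
    occ (l ++ [e]) v = occ l v + (if e.1 = v then 1 else 0) + (if e.2 = v then 1 else 0) := by
  simp only [occ, List.countP_append, List.countP_singleton, decide_eq_true_eq]
  omega

theorem occ_take_le (l : List (Fin n × Fin n)) (i : ℕ) (v : Fin n) : occ (l.take i) v ≤ occ l v :=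
  add_le_add (List.take_sublist _ _).countP_le (List.take_sublist _ _).countP_le

theorem sum_occ (l : List (Fin n × Fin n)) : ∑ v, occ l v = 2 * l.length := by
  induction l with
  | nil => simp [occ]
  | cons e l ih =>
    have : ∀ v, occ (e :: l) v =
        occ l v + (if e.1 = v then 1 else 0) + (if e.2 = v then 1 else 0) := by
      intro v
      simp only [occ, List.countP_cons, decide_eq_true_eq]
      omega
    simp only [this, Finset.sum_add_distrib, ih, Finset.sum_ite_eq, Finset.mem_univ, if_true,
      List.length_cons]
    omega

/-- The occurrences of the vertices before `i`. -/
def start (es : List (Fin n × Fin n)) (i : ℕ) : ℕ :=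
  ∑ j ∈ Finset.range i, if h : j < n then occ es ⟨j, h⟩ else 0

theorem start_succ (es : List (Fin n × Fin n)) {i : ℕ} (hi : i < n) :
    start es (i + 1) = start es i + occ es ⟨i, hi⟩ := by
  rw [start, Finset.sum_range_succ, dif_pos hi]
  rfl

theorem start_mono (es : List (Fin n × Fin n)) {i j : ℕ} (h : i ≤ j) : start es i ≤ start es j :=
  Finset.sum_le_sum_of_subset (Finset.range_mono h)

theorem start_add_occ_le (es : List (Fin n × Fin n)) {u v : Fin n} (h : u < v) :
    start es u + occ es u ≤ start es v := by
  rw [← start_succ es u.2]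
  exact start_mono es h

theorem start_last (es : List (Fin n × Fin n)) : start es n = 2 * es.length := by
  rw [← sum_occ, start, Finset.sum_range]
  simp

/-- The graph with the given edges. -/
def edgeGraph (l : List (Fin n × Fin n)) : SimpleGraph (Fin n) :=
  SimpleGraph.fromEdgeSet {e | e ∈ l.map fun e => s(e.1, e.2)}

theorem edgeGraph_adj {l : List (Fin n × Fin n)} {u v : Fin n} :
    (edgeGraph l).Adj u v ↔ s(u, v) ∈ (l.map fun e => s(e.1, e.2)) ∧ u ≠ v := by
  rw [edgeGraph, SimpleGraph.fromEdgeSet_adj]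
  rfl

theorem edgeGraph_snoc (l : List (Fin n × Fin n)) (e : Fin n × Fin n) :
    edgeGraph (l ++ [e]) = edgeGraph l ⊔ SimpleGraph.edge e.1 e.2 := by
  ext u v
  rw [SimpleGraph.sup_adj, edgeGraph_adj, edgeGraph_adj, SimpleGraph.edge_adj]
  simp only [List.map_append, List.mem_append, List.map_cons, List.map_nil, List.mem_singleton,
    Sym2.eq_iff]
  grind

variable {G : SimpleGraph (Fin n)} {es : List (Fin n × Fin n)}

theorem IsEdgeList.edgeGraph_eq (h : IsEdgeList G es) : edgeGraph es = G := by
  ext u v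
  rw [edgeGraph_adj, ← h.2]
  exact ⟨fun e => e.1, fun e => ⟨e, e.ne⟩⟩

theorem IsEdgeList.adj (h : IsEdgeList G es) {i : ℕ} (hi : i < es.length) :
    G.Adj es[i].1 es[i].2 := by
  rw [h.2]
  exact List.mem_map.2 ⟨es[i], List.getElem_mem hi, rfl⟩

theorem IsEdgeList.not_adj_take (h : IsEdgeList G es) {i : ℕ} (hi : i < es.length) :
    ¬ (edgeGraph (es.take i)).Adj es[i].1 es[i].2 := by
  rw [edgeGraph_adj]
  rintro ⟨h1, -⟩
  obtain ⟨e, he, he'⟩ := List.mem_map.1 h1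
  obtain ⟨j, hj, hje⟩ := List.getElem_of_mem he
  simp only [List.length_take] at hj
  rw [List.getElem_take] at hje
  have hnd := h.1
  rw [List.nodup_iff_injective_get] at hnd
  have := @hnd ⟨j, by simp; omega⟩ ⟨i, by simpa using hi⟩ (by simp [hje, he'])
  simp at this
  omega

end EdgeList

/-- The input is still there. -/
structure Base {n : ℕ} (es : List (Fin n × Fin n)) (σ : Store) : Prop where
  edges : σ.reg rEdges = es.length
  verts : σ.reg rVerts = n
  fst : ∀ (i : ℕ) (hi : i < es.length), σ.arr 0 i = es[i].1
  snd : ∀ (i : ℕ) (hi : i < es.length), σ.arr 1 i = es[i].2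

/-- Nothing has been recorded, and no vertex is in `K` or in the stack. -/
structure Fresh {n : ℕ} (es : List (Fin n × Fin n)) (σ : Store) : Prop extends Base es σ where
  len : σ.reg rLen = 0
  noK : ∀ i, σ.arr aK i = 0
  notIn : ∀ i, σ.arr aIn i = 0

variable {n : ℕ} {es : List (Fin n × Fin n)} {G : SimpleGraph (Fin n)} {σ : Store}

theorem Base.frame (h : Base es σ) {c : Cmd} (hr : rEdges ∉ c.regs ∧ rVerts ∉ c.regs)
    (ha : 0 ∉ c.arrs ∧ 1 ∉ c.arrs) : Base es (c.exec σ) := by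
  constructor
  · rw [c.exec_reg _ hr.1, h.edges]
  · rw [c.exec_reg _ hr.2, h.verts]
  · rw [c.exec_arr _ ha.1]; exact h.fst
  · rw [c.exec_arr _ ha.2]; exact h.snd

theorem Fresh.frame (h : Fresh es σ) {c : Cmd}
    (hr : (rEdges ∉ c.regs ∧ rVerts ∉ c.regs) ∧ rLen ∉ c.regs)
    (ha : (0 ∉ c.arrs ∧ 1 ∉ c.arrs) ∧ aK ∉ c.arrs ∧ aIn ∉ c.arrs) : Fresh es (c.exec σ) := by
  refine ⟨h.toBase.frame hr.1 ha.1, ?_, ?_, ?_⟩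
  · rw [c.exec_reg _ hr.2, h.len]
  · rw [c.exec_arr _ ha.2.1]; exact h.noK
  · rw [c.exec_arr _ ha.2.2]; exact h.notIn

/-- The numbers of vertices and edges are moved away because registers `0` and `1` receive the
output. -/
def setup : Cmd := block [.assign rEdges (.reg 1), .assign rVerts (.reg 0), .assign rLen (.const 0),
  .assign rI (.const 0)]

theorem setup_total : Total (fun σ => σ = input es) setup
    (fun σ => Fresh es σ ∧ σ.reg rI = 0 ∧ ∀ i, σ.arr aDeg i = 0) setup.bound := by
  refine Cmd.LoopFree.total (by simp [setup, block, Cmd.LoopFree]) ?_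
  rintro σ rfl
  refine ⟨⟨⟨?_, ?_, ?_, ?_⟩, ?_, ?_, ?_⟩, ?_, ?_⟩
  · simp [setup, input]
  · simp [setup, input]
  · intro i hi
    simp [setup, input, hi]
  · intro i hi
    simp [setup, input, hi]
  all_goals simp [setup, input]

def countBody : Cmd := block [
  .write aDeg (.read 0 (.reg rI)) (.succ (.read aDeg (.read 0 (.reg rI)))),
  .write aDeg (.read 1 (.reg rI)) (.succ (.read aDeg (.read 1 (.reg rI)))),
  .assign rI (.succ (.reg rI))]

def countLoop : Cmd := .loop (.lt (.reg rI) (.reg rEdges)) countBody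

theorem countLoop_total : ∃ k, ∀ {n : ℕ} {es : List (Fin n × Fin n)},
    Total (fun σ => Fresh es σ ∧ σ.reg rI = 0 ∧ ∀ i, σ.arr aDeg i = 0) countLoop
      (fun σ => Fresh es σ ∧ ∀ v : Fin n, σ.arr aDeg v = occ es v) (k * (es.length + 1)) := by
  refine ⟨(Test.lt (.reg rI) (.reg rEdges)).cost + countBody.bound + 1, fun {n es} => ?_⟩
  have key := Cmd.LoopFree.total_loop (c := countBody) (b := .lt (.reg rI) (.reg rEdges))
    (I := fun σ => Fresh es σ ∧ σ.reg rI ≤ es.length ∧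
      ∀ v : Fin n, σ.arr aDeg v = occ (es.take (σ.reg rI)) v)
    (μ := fun σ => es.length - σ.reg rI) (by simp [countBody, block, Cmd.LoopFree]) es.length
    (by
      rintro σ ⟨h1, h2, h3⟩ hb
      simp only [Test.lt_holds, Expr.eval_reg, h1.edges] at hb
      have hI : (countBody.exec σ).reg rI = σ.reg rI + 1 := by simp [countBody]
      refine ⟨⟨h1.frame (by decide) (by decide), by omega, ?_⟩, by omega⟩
      intro v
      rw [hI, List.take_succ_eq_append_getElem hb, occ_snoc]
      simp only [countBody, exec_block_cons, Cmd.exec_write, Expr.eval_read, Expr.eval_reg,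
        h1.fst _ hb, Expr.eval_succ, h3, Store.setArr_arr, Store.setArr_reg, h1.snd _ hb,
        Cmd.exec_assign, exec_block_nil, Store.setReg_arr, OfNat.one_ne_ofNat, if_true, if_false]
      have ne : ∀ {a b : Fin n}, a ≠ b → (a : ℕ) ≠ b := fun h e => h (Fin.ext e)
      by_cases e1 : es[σ.reg rI].1 = v <;> by_cases e2 : es[σ.reg rI].2 = v
      · simp [e1, e2, h3]
      · simp [e1, e2, h3, ne (Ne.symm e2)]
      · simp [e1, e2, h3, ne e1, ne (Ne.symm e1), Function.update_apply]
      · simp [e1, e2, h3, ne (Ne.symm e1), ne (Ne.symm e2)])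
    (by intro σ _; omega)
  intro σ hσ
  obtain ⟨τ, t, h1, h2, ⟨h3, h4, h5⟩, h6⟩ := key σ ⟨hσ.1, by omega, by
    intro v
    rw [hσ.2.1, hσ.2.2]
    simp [occ]⟩
  refine ⟨τ, t, h1, h2, h3, fun v => ?_⟩
  simp only [Test.lt_holds, Expr.eval_reg, h3.edges] at h6
  rw [h5, List.take_of_length_le (by omega)]

def startInit : Cmd := block [.assign rI (.const 0), .assign rJ (.const 0), .assign rAcc (.const 0),
  .write aStart (.const 0) (.const 0), .write aEnd (.const 0) (.const 0)]

/-- Since only adding one is available, the prefix sums are counted in unary: the accumulator grows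
by one for each occurrence of the current vertex, and its value is stored on passing to the next
vertex. -/
def startBody : Cmd := .ite (.lt (.reg rJ) (.read aDeg (.reg rI)))
  (block [.assign rJ (.succ (.reg rJ)), .assign rAcc (.succ (.reg rAcc))])
  (block [.assign rI (.succ (.reg rI)), .assign rJ (.const 0), .write aStart (.reg rI) (.reg rAcc),
    .write aEnd (.reg rI) (.reg rAcc)])

def startLoop : Cmd := .seq startInit (.loop (.lt (.reg rI) (.reg rVerts)) startBody)

theorem startLoop_total : ∃ k, ∀ {n : ℕ} {es : List (Fin n × Fin n)},
    Total (fun σ => Fresh es σ ∧ ∀ v : Fin n, σ.arr aDeg v = occ es v) startLoop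
      (fun σ => Fresh es σ ∧ ∀ v : Fin n, σ.arr aStart v = start es v ∧
        σ.arr aEnd v = start es v) (startInit.bound + k * (n + 2 * es.length + 1)) := by
  refine ⟨(Test.lt (.reg rI) (.reg rVerts)).cost + startBody.bound + 1, fun {n es} => ?_⟩
  have key := Cmd.LoopFree.total_loop (c := startBody) (b := .lt (.reg rI) (.reg rVerts))
    (I := fun σ => Fresh es σ ∧ (∀ v : Fin n, σ.arr aDeg v = occ es v) ∧ σ.reg rI ≤ n ∧
      σ.reg rJ ≤ σ.arr aDeg (σ.reg rI) ∧ σ.reg rAcc = start es (σ.reg rI) + σ.reg rJ ∧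
      ∀ i ≤ σ.reg rI, σ.arr aStart i = start es i ∧ σ.arr aEnd i = start es i)
    -- Each iteration either advances the vertex or increases the accumulator, which never exceeds
    -- the total number `2 * es.length` of occurrences.
    (μ := fun σ => (n - σ.reg rI) + (2 * es.length - σ.reg rAcc))
    (by simp [startBody, block, Cmd.LoopFree]) (n + 2 * es.length)
    (by
      rintro σ ⟨h1, h2, h3, h4, h5, h6⟩ hb
      simp only [Test.lt_holds, Expr.eval_reg, h1.verts] at hb
      have hf : Fresh es (startBody.exec σ) := h1.frame (by decide) (by decide)
      have hd : σ.arr aDeg (σ.reg rI) = occ es ⟨σ.reg rI, hb⟩ := h2 ⟨σ.reg rI, hb⟩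
      have hs := start_succ es hb
      have hm : start es (σ.reg rI + 1) ≤ 2 * es.length := by
        rw [← start_last]; exact start_mono es hb
      by_cases hJ : σ.reg rJ < σ.arr aDeg (σ.reg rI)
      · have e : startBody.exec σ = (block [.assign rJ (.succ (.reg rJ)),
          .assign rAcc (.succ (.reg rAcc))]).exec σ := if_pos hJ
        refine ⟨⟨hf, ?_, ?_, ?_, ?_, ?_⟩, ?_⟩ <;> rw [e]
        · exact h2
        · simpa using h3
        · simpa using hJ
        · simp [h5]; omega
        · simpa using h6
        · simp; omega
      · have e : startBody.exec σ = (block [.assign rI (.succ (.reg rI)), .assign rJ (.const 0),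
          .write aStart (.reg rI) (.reg rAcc), .write aEnd (.reg rI) (.reg rAcc)]).exec σ :=
            if_neg hJ
        refine ⟨⟨hf, ?_, ?_, ?_, ?_, ?_⟩, ?_⟩ <;> rw [e]
        · exact h2
        · simpa using hb
        · simp
        · simp [h5, hs, ← hd]; omega
        · intro i hi
          simp only [exec_block_cons, Cmd.exec_assign, Expr.eval_succ, Expr.eval_reg,
            Expr.eval_const, Cmd.exec_write, Store.setReg_reg, exec_block_nil, Store.setArr_reg,
            Store.setArr_arr, Store.setReg_arr, if_true] at hi ⊢
          norm_num at hi ⊢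
          by_cases ei : i = σ.reg rI + 1
          · subst ei
            simp only [Function.update_self]
            omega
          · rw [Function.update_of_ne ei, Function.update_of_ne ei]
            exact h6 i (by omega)
        · simp; omega)
    (by rintro σ ⟨-, -, h3, -⟩; omega)
  refine Total.seq (Q := fun σ => Fresh es σ ∧ (∀ v : Fin n, σ.arr aDeg v = occ es v) ∧
      σ.reg rI ≤ n ∧ σ.reg rJ ≤ σ.arr aDeg (σ.reg rI) ∧
      σ.reg rAcc = start es (σ.reg rI) + σ.reg rJ ∧
      ∀ i ≤ σ.reg rI, σ.arr aStart i = start es i ∧ σ.arr aEnd i = start es i)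
    (Cmd.LoopFree.total (by simp [startInit, block, Cmd.LoopFree]) ?_) ?_
  · rintro σ ⟨h1, h2⟩
    refine ⟨h1.frame (by decide) (by decide), h2, ?_, ?_, ?_, ?_⟩
    · simp [startInit]
    · simp [startInit]
    · simp [startInit, start]
    · simp [startInit, start]
  · intro σ hσ
    obtain ⟨τ, t, h1, h2, ⟨h3, h4, h5, h6, h7, h8⟩, h9⟩ := key σ hσ
    refine ⟨τ, t, h1, h2, h3, fun v => ?_⟩
    simp only [Test.lt_holds, Expr.eval_reg, h3.verts] at h9
    exact h8 v (by omega)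

/-- While the edges are inserted, `aEnd` serves as the pointer to the next free cell of each vertex.
-/
def fillBody : Cmd := block [
  .assign rA (.read 0 (.reg rI)), .assign rB (.read 1 (.reg rI)),
  .assign rCellA (.read aEnd (.reg rA)), .assign rCellB (.read aEnd (.reg rB)),
  .write aNbr (.reg rCellA) (.reg rB), .write aNbr (.reg rCellB) (.reg rA),
  .write aTwin (.reg rCellA) (.reg rCellB), .write aTwin (.reg rCellB) (.reg rCellA),
  .write aEnd (.reg rA) (.succ (.reg rCellA)), .write aEnd (.reg rB) (.succ (.reg rCellB)),
  .assign rI (.succ (.reg rI))]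

def fillLoop : Cmd := .seq (.assign rI (.const 0)) (.loop (.lt (.reg rI) (.reg rEdges)) fillBody)

theorem fillLoop_total : ∃ k, ∀ {n : ℕ} {es : List (Fin n × Fin n)} {G : SimpleGraph (Fin n)},
    IsEdgeList G es → Total (fun σ => Fresh es σ ∧ ∀ v : Fin n, σ.arr aStart v = start es v ∧
        σ.arr aEnd v = start es v) fillLoop
      (fun σ => Fresh es σ ∧ ∃ pos, Cells G Fin.val (σ.arr aStart) (σ.arr aEnd) (σ.arr aNbr)
        (σ.arr aTwin) pos) (2 + k * (es.length + 1)) := by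
  refine ⟨(Test.lt (.reg rI) (.reg rEdges)).cost + fillBody.bound + 1, fun {n es G} hG => ?_⟩
  have key := Cmd.LoopFree.total_loop (c := fillBody) (b := .lt (.reg rI) (.reg rEdges))
    (I := fun σ => Fresh es σ ∧ σ.reg rI ≤ es.length ∧
      (∃ pos, Cells (edgeGraph (es.take (σ.reg rI))) Fin.val (σ.arr aStart) (σ.arr aEnd)
        (σ.arr aNbr) (σ.arr aTwin) pos) ∧
      ∀ v : Fin n, σ.arr aStart v = start es v ∧
        σ.arr aEnd v = start es v + occ (es.take (σ.reg rI)) v)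
    (μ := fun σ => es.length - σ.reg rI) (by simp [fillBody, block, Cmd.LoopFree]) es.length
    (by
      rintro σ ⟨h1, h2, ⟨pos, h3⟩, h4⟩ hb
      simp only [Test.lt_holds, Expr.eval_reg, h1.edges] at hb
      have hI : (fillBody.exec σ).reg rI = σ.reg rI + 1 := by simp [fillBody]
      have ne : ∀ {a b : Fin n}, a ≠ b → (a : ℕ) ≠ b := fun h e => h (Fin.ext e)
      have htake := List.take_succ_eq_append_getElem hb
      have huv := (hG.adj hb).ne
      have hn := hG.not_adj_take hb
      have e1 := h1.fst _ hb
      have e2 := h1.snd _ hb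
      generalize hu : es[σ.reg rI].1 = u at *
      generalize hv : es[σ.reg rI].2 = v at *
      have hocc : ∀ w, occ (es.take (σ.reg rI + 1)) w = occ (es.take (σ.reg rI)) w +
          (if u = w then 1 else 0) + (if v = w then 1 else 0) := by
        intro w
        rw [htake, occ_snoc, hu, hv]
      have ou := hocc u
      have ov := hocc v
      rw [if_pos rfl] at ou ov
      have lu := occ_take_le es (σ.reg rI + 1) u
      have lv := occ_take_le es (σ.reg rI + 1) v
      -- The segments of different vertices are disjoint, and as long as an occurrence of `w` is
      -- outstanding, the free cell of `w` lies strictly inside its own segment.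
      have fresh : ∀ w : Fin n, σ.arr aEnd w < start es w + occ es w → ∀ x : Fin n, x ≠ w → ∀ i,
          σ.arr aStart x ≤ i → i ≤ σ.arr aEnd x → (σ.arr aEnd x < start es x + occ es x ∨
            i < σ.arr aEnd x) → i ≠ σ.arr aEnd w := by
        intro w hw x hxw i hi hi' hx
        have sw := h4 w
        have sx := h4 x
        have := occ_take_le es (σ.reg rI) x
        rcases lt_or_gt_of_ne hxw with hlt | hlt
        · have := start_add_occ_le es hlt
          omega
        · have := start_add_occ_le es hlt
          omega
      have fu : ∀ x y, (edgeGraph (es.take (σ.reg rI))).Adj x y → pos x y ≠ σ.arr aEnd u := by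
        intro x y hxy
        have p1 := h3.le hxy
        have p2 := h3.lt hxy
        by_cases hx : x = u
        · subst hx; omega
        · exact fresh u (by rw [(h4 u).2]; omega) x hx _ p1 p2.le (Or.inr p2)
      have fv : ∀ x y, (edgeGraph (es.take (σ.reg rI))).Adj x y → pos x y ≠ σ.arr aEnd v := by
        intro x y hxy
        have p1 := h3.le hxy
        have p2 := h3.lt hxy
        by_cases hx : x = v
        · subst hx; omega
        · exact fresh v (by rw [(h4 v).2]; omega) x hx _ p1 p2.le (Or.inr p2)
      have huv' : σ.arr aEnd u ≠ σ.arr aEnd v :=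
        fresh v (by rw [(h4 v).2]; omega) u huv _ (by rw [(h4 u).1, (h4 u).2]; omega) le_rfl
          (Or.inl (by rw [(h4 u).2]; omega))
      obtain ⟨pos', h5⟩ := h3.addEdge Fin.val_injective huv hn (by rw [(h4 u).1, (h4 u).2]; omega)
        (by rw [(h4 v).1, (h4 v).2]; omega) fu fv huv'
      refine ⟨⟨h1.frame (by decide) (by decide), by omega, ⟨pos', ?_⟩, ?_⟩, by omega⟩
      · rw [hI, htake, edgeGraph_snoc, hu, hv]
        simpa [fillBody, e1, e2] using h5
      · intro w
        rw [hI, hocc]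
        simp only [fillBody, exec_block_cons, Cmd.exec_assign, Cmd.exec_write, Expr.eval_read,
          Expr.eval_reg, Expr.eval_succ, exec_block_nil, Store.setReg_reg, Store.setReg_arr,
          Store.setArr_reg, Store.setArr_arr, e1, e2]
        norm_num
        simp only [e2]
        refine ⟨(h4 w).1, ?_⟩
        have e3 := (h4 w).2
        by_cases hwv : v = w
        · subst hwv
          simp [huv, e3]; omega
        · by_cases hwu : u = w
          · subst hwu
            simp [hwv, ne (Ne.symm hwv), e3]; omega
          · simp [hwu, hwv, ne (Ne.symm hwv), ne (Ne.symm hwu), e3])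
    (by intro σ _; omega)
  refine Total.seq (Q := fun σ => Fresh es σ ∧ σ.reg rI = 0 ∧ ∀ v : Fin n,
    σ.arr aStart v = start es v ∧ σ.arr aEnd v = start es v)
    (Cmd.LoopFree.total (c := .assign rI (.const 0)) (by simp [Cmd.LoopFree]) ?_) ?_
  · rintro σ ⟨h1, h2⟩
    exact ⟨h1.frame (by decide) (by decide), by simp, h2⟩
  · intro σ hσ
    obtain ⟨τ, t, h1, h2, ⟨h3, h4, ⟨pos, h5⟩, -⟩, h9⟩ := key σ ⟨hσ.1, by omega, by
      refine ⟨fun _ _ => 0, ?_⟩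
      have none : ∀ {u v : Fin n}, ¬ (edgeGraph (es.take (σ.reg rI))).Adj u v := by
        intro u v
        rw [edgeGraph_adj, hσ.2.1]
        simp
      refine ⟨fun h => (none h).elim, fun h => (none h).elim, fun h => (none h).elim,
        fun h => (none h).elim, ?_⟩
      intro v i h1 h2
      rw [(hσ.2.2 v).1] at h1
      rw [(hσ.2.2 v).2] at h2
      omega, by
      intro v
      rw [(hσ.2.2 v).1, (hσ.2.2 v).2, hσ.2.1]
      simp [occ]⟩
    refine ⟨τ, t, h1, h2, h3, pos, ?_⟩
    simp only [Test.lt_holds, Expr.eval_reg, h3.edges] at h9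
    rwa [List.take_of_length_le (by omega), hG.edgeGraph_eq] at h5

end RAM

namespace RAM

open Halin

theorem Total.weaken {P Q : Store → Prop} {c : Cmd} {k l : ℕ} (h : Total P c Q k) (hkl : k ≤ l) :
    Total P c Q l := fun σ hσ =>
  have ⟨τ, t, h1, h2, h3⟩ := h σ hσ
  ⟨τ, t, h1, h2.trans hkl, h3⟩

theorem Total.exists {ι : Sort*} {P Q : ι → Store → Prop} {c : Cmd} {k : ℕ}
    (h : ∀ i, Total (P i) c (Q i) k) :
    Total (fun σ => ∃ i, P i σ) c (fun σ => ∃ i, Q i σ) k := by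
  rintro σ ⟨i, hi⟩
  obtain ⟨τ, t, h1, h2, h3⟩ := h i σ hi
  exact ⟨τ, t, h1, h2, i, h3⟩

/-! ### The recognition program -/

def stackInit : Cmd := block [.assign rI (.const 0), .assign rTop (.const 0),
  .assign rAlive (.reg rVerts)]

def stackBody : Cmd := block [pushCubic rI, .assign rI (.succ (.reg rI))]

def stackLoop : Cmd := .seq stackInit (.loop (.lt (.reg rI) (.reg rVerts)) stackBody)

theorem stackLoop_total : ∃ k, ∀ {n : ℕ} {es : List (Fin n × Fin n)} {G : SimpleGraph (Fin n)},
    Total (fun σ => Fresh es σ ∧ ∃ pos, Cells G Fin.val (σ.arr aStart) (σ.arr aEnd) (σ.arr aNbr)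
        (σ.arr aTwin) pos) stackLoop
      (fun σ => Base es σ ∧ Rep (State.init G) σ ∧ RunRecorded (n := n) σ [])
      (stackInit.bound + k * (n + 1)) := by
  refine ⟨(Test.lt (.reg rI) (.reg rVerts)).cost + stackBody.bound + 1, fun {n es G} => ?_⟩
  have key := Cmd.LoopFree.total_loop (c := stackBody) (b := .lt (.reg rI) (.reg rVerts))
    (I := fun σ => Base es σ ∧ σ.reg rI ≤ n ∧ σ.reg rLen = 0 ∧ σ.reg rAlive = n ∧
      (∀ i, σ.arr aK i = 0) ∧ (∃ pos, Cells G Fin.val (σ.arr aStart) (σ.arr aEnd) (σ.arr aNbr)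
        (σ.arr aTwin) pos) ∧
      Stack {v : Fin n | v < σ.reg rI ∧ (G.neighborSet v).ncard = 3} (σ.reg rTop) (σ.arr aStack)
        (σ.arr aIn))
    (μ := fun σ => n - σ.reg rI)
    (by simp [stackBody, block, Cmd.LoopFree, pushCubic, push]) n
    (by
      rintro σ ⟨h1, h2, h3, h4, h5, ⟨pos, h6⟩, h7⟩ hb
      simp only [Test.lt_holds, Expr.eval_reg, h1.verts] at hb
      have e : stackBody.exec σ =
        ((pushCubic rI).exec σ).setReg rI (((pushCubic rI).exec σ).reg rI + 1) := rfl
      have f : ∀ r, r ≠ rTop → ((pushCubic rI).exec σ).reg r = σ.reg r := fun r hr =>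
        Cmd.exec_reg _ _ (by simp [push, pushCubic, Cmd.regs, block, hr])
      have g : ∀ a, a ≠ aStack → a ≠ aIn → (stackBody.exec σ).arr a = σ.arr a := fun a ha hb =>
        Cmd.exec_arr _ _ (by simp [stackBody, push, pushCubic, Cmd.arrs, block, ha, hb])
      have hI : (stackBody.exec σ).reg rI = σ.reg rI + 1 := by simp [e, f]
      refine ⟨⟨h1.frame (by decide) (by decide), by omega, ?_, ?_, ?_, ⟨pos, ?_⟩, ?_⟩, by omega⟩
      · simp [e, f, h3]
      · simp [e, f, h4]
      · rw [g _ (by simp) (by simp)]; exact h5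
      · rw [g _ (by simp) (by simp), g _ (by simp) (by simp), g _ (by simp) (by simp),
          g _ (by simp) (by simp)]
        exact h6
      · have := pushCubic_spec (r := rI) (v := ⟨σ.reg rI, hb⟩) h7 rfl
        rw [hI, e]
        simp only [Store.setReg_reg, Store.setReg_arr]
        norm_num
        convert this using 1
        ext v
        simp only [Set.mem_ofPred_eq, Set.mem_union]
        have hd := h6.degree_three_iff Fin.val_injective (v := v)
        rw [hd]
        constructor
        · rintro ⟨k1, k2⟩
          by_cases hv : (v : ℕ) = σ.reg rI
          · refine Or.inr ⟨Fin.ext hv, ?_⟩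
            rwa [← hv]
          · exact Or.inl ⟨by omega, k2⟩
        · rintro (⟨k1, k2⟩ | ⟨rfl, k2⟩)
          · exact ⟨by omega, k2⟩
          · exact ⟨by simp, k2⟩)
    (by intro σ _; omega)
  refine Total.seq (Q := fun σ => Base es σ ∧ σ.reg rI ≤ n ∧ σ.reg rLen = 0 ∧ σ.reg rAlive = n ∧
      (∀ i, σ.arr aK i = 0) ∧ (∃ pos, Cells G Fin.val (σ.arr aStart) (σ.arr aEnd) (σ.arr aNbr)
        (σ.arr aTwin) pos) ∧
      Stack {v : Fin n | v < σ.reg rI ∧ (G.neighborSet v).ncard = 3} (σ.reg rTop) (σ.arr aStack)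
        (σ.arr aIn))
    (Cmd.LoopFree.total (by simp [stackInit, block, Cmd.LoopFree]) ?_) ?_
  · rintro σ ⟨h1, h2⟩
    refine ⟨h1.toBase.frame (by decide) (by decide), ?_, ?_, ?_, h1.noK, h2, ?_⟩
    · simp [stackInit]
    · simp [stackInit, h1.len]
    · simp [stackInit, h1.verts]
    · constructor
      · simp [stackInit]
      · simp [stackInit]
      · simp [stackInit]
      · simp [stackInit, h1.notIn]
  · intro σ hσ
    obtain ⟨τ, t, h1, h2, ⟨h3, h4, h5, h6, h7, h8, h9⟩, h10⟩ := key σ hσ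
    simp only [Test.lt_holds, Expr.eval_reg, h3.verts] at h10
    refine ⟨τ, t, h1, h2, h3, ⟨h8, ?_, ?_, ?_⟩, ?_⟩
    · rw [h6, show (State.init G).alive = Set.univ from rfl, Set.ncard_univ, Nat.card_fin]
    · intro u
      rw [h7]
      simp [State.init]
    · convert h9 using 1
      ext v
      have := v.2
      simp only [State.init, Set.mem_ofPred_eq]
      exact ⟨fun h => ⟨by omega, h⟩, fun h => h.2⟩
    · exact ⟨by simp [h5], by simp⟩

def mainLoop : Cmd := .loop (.lt (.const 0) (.reg rTop)) iteration

/-- A run of the algorithm from the beginning has led to the state in the store. -/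
def Reached {n : ℕ} (es : List (Fin n × Fin n)) (G : SimpleGraph (Fin n)) (ms : List (Move (Fin n)))
    (s : State (Fin n)) (σ : Store) : Prop :=
  Base es σ ∧ Run (State.init G) ms s ∧ Rep s σ ∧ RunRecorded σ ms

/-- Every iteration records one move, and a run has at most `3 * n` moves. So the length of the
record is a clock for the loop. -/
theorem mainLoop_total : ∃ k, ∀ {n : ℕ} {es : List (Fin n × Fin n)} {G : SimpleGraph (Fin n)},
    Total (fun σ => Base es σ ∧ Rep (State.init G) σ ∧ RunRecorded (n := n) σ []) mainLoop
      (fun σ => ∃ x : List (Move (Fin n)) × State (Fin n), Reached es G x.1 x.2 σ ∧ x.2.C = ∅)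
      (k * (3 * n + 1)) := by
  refine ⟨(Test.lt (.const 0) (.reg rTop)).cost + iteration.bound + 1, fun {n es G} => ?_⟩
  have key := iteration_loopFree.total_loop (b := .lt (.const 0) (.reg rTop))
    (I := fun σ => ∃ x : List (Move (Fin n)) × State (Fin n), Reached es G x.1 x.2 σ)
    (μ := fun σ => 3 * n - σ.reg rLen) (3 * n)
    (by
      rintro σ ⟨⟨ms, s⟩, h1, h2, h3, h4⟩ hb
      simp only [Test.lt_holds, Expr.eval_reg, Expr.eval_const] at hb h2 h3 h4
      obtain ⟨m, hm, h5, h6⟩ := iteration_spec (h2.supported (State.supported_init G)) h3 hb h4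
      have h7 := h2.snoc hm
      refine ⟨⟨(ms ++ [m], s.next m), ⟨?_, ?_, ?_, ?_⟩, h7, h5, h6⟩, ?_⟩
      · rw [iteration_reg (by simp), h1.edges]
      · rw [iteration_reg (by simp), h1.verts]
      · rw [iteration_arr (by simp)]; exact h1.fst
      · rw [iteration_arr (by simp)]; exact h1.snd
      · have h8 := h7.length_le_card
        rw [Nat.card_fin] at h8
        have h9 := h4.1
        have h10 := h6.1
        simp only [List.length_append, List.length_singleton] at h8 h10
        omega)
    (by intro σ _; omega)
  rintro σ ⟨h1, h2, h3⟩
  obtain ⟨τ, t, h4, h5, ⟨x, h6⟩, h7⟩ := key σ ⟨([], State.init G), h1, .nil _, h2, h3⟩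
  refine ⟨τ, t, h4, h5, x, h6, h6.2.2.1.C.eq_empty ?_⟩
  simp only [Test.lt_holds, Expr.eval_reg, Expr.eval_const] at h7
  omega

def verdictInit : Cmd := block [.assign rI (.const 0), .assign rCubic (.const 0),
  .assign rFound (.const 0)]

/-- Deleted vertices have empty lists, so every vertex of degree three is current and no array of
current vertices is needed. -/
def verdictBody : Cmd := block [
  .ite (cubic (.reg rI)) (block [.assign rCubic (.succ (.reg rCubic)),
    .ite (.eq (.read aK (.reg rI)) (.const 0))
      (block [.assign rFound (.const 1), .assign rZ (.reg rI)]) .skip]) .skip,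
  .assign rI (.succ (.reg rI))]

def verdict : Cmd :=
  .ite (.all [.eq (.reg rAlive) (.const 4), .eq (.reg rCubic) (.const 4),
    .eq (.reg rFound) (.const 1)]) (.assign 0 (.const 1)) (.assign 0 (.const 0))

def verdictLoop : Cmd :=
  .seq verdictInit (.seq (.loop (.lt (.reg rI) (.reg rVerts)) verdictBody) verdict)

variable {n : ℕ} {es : List (Fin n × Fin n)} {G : SimpleGraph (Fin n)} {σ τ : Store}

theorem Rep.congr {s : State (Fin n)} (h : Rep s σ) (hr : ∀ r, r = rTop ∨ r = rAlive →
    τ.reg r = σ.reg r) (ha : ∀ a, 4 ≤ a → a < 12 → τ.arr a = σ.arr a) : Rep s τ := by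
  constructor
  · rw [ha aStart (by simp) (by simp), ha aEnd (by simp) (by simp), ha aNbr (by simp) (by simp),
      ha aTwin (by simp) (by simp)]
    exact h.cells
  · rw [hr _ (by simp)]; exact h.alive
  · rw [ha _ (by simp) (by simp)]; exact h.K
  · rw [hr _ (by simp), ha aStack (by simp) (by simp), ha aIn (by simp) (by simp)]; exact h.C

theorem Reached.congr {ms : List (Move (Fin n))} {s : State (Fin n)} (h : Reached es G ms s σ)
    (hr : ∀ r, 1 ≤ r → r ≤ 3 ∨ r = rTop ∨ r = rAlive → τ.reg r = σ.reg r)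
    (ha : ∀ a, a ≠ aMark → a < 18 → τ.arr a = σ.arr a) : Reached es G ms s τ := by
  obtain ⟨h1, h2, h3, h4⟩ := h
  refine ⟨⟨?_, ?_, ?_, ?_⟩, h2, h3.congr ?_ ?_, h4.congr ?_ ?_⟩
  · rw [hr _ (by simp) (by simp), h1.edges]
  · rw [hr _ (by simp) (by simp), h1.verts]
  · rw [ha _ (by simp) (by simp)]; exact h1.fst
  · rw [ha _ (by simp) (by simp)]; exact h1.snd
  · intro r h
    exact hr r (by omega) (by omega)
  · intro a h h'
    exact ha a (by omega) (by omega)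
  · exact hr _ (by simp) (by simp)
  · simp only [List.mem_cons, List.not_mem_nil, or_false]
    intro a h
    exact ha a (by omega) (by omega)

theorem Reached.frame {ms : List (Move (Fin n))} {s : State (Fin n)} (h : Reached es G ms s σ)
    {c : Cmd} (hr : rLen ∉ c.regs ∧ rEdges ∉ c.regs ∧ rVerts ∉ c.regs ∧ rTop ∉ c.regs ∧
      rAlive ∉ c.regs) (ha : ∀ a ∈ c.arrs, a = aMark ∨ 18 ≤ a) :
    Reached es G ms s (c.exec σ) := by
  refine h.congr (fun r h1 h2 => c.exec_reg _ ?_) (fun a h1 h2 => c.exec_arr _ fun h3 => ?_)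
  · obtain rfl | rfl | rfl | rfl | rfl : r = 1 ∨ r = 2 ∨ r = 3 ∨ r = 7 ∨ r = 8 := by omega
    exacts [hr.1, hr.2.1, hr.2.2.1, hr.2.2.2.1, hr.2.2.2.2]
  · have := ha a h3
    omega

theorem Rep.cubic_iff {s : State (Fin n)} (h : Rep s σ) (v : Fin n) :
    σ.arr aEnd v = σ.arr aStart v + 3 ↔ (s.graph.neighborSet v).ncard = 3 := by
  obtain ⟨pos, h⟩ := h.cells
  exact (h.degree_three_iff Fin.val_injective).symm

/-- The verdict agrees with the state, and in the case of acceptance a vertex that can be chosen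
for the reversal is known. -/
def Judged {n : ℕ} (s : State (Fin n)) (σ : Store) : Prop :=
  (σ.reg 0 = 1 ∧ s.IsK4 ∧ ∃ z : Fin n, σ.reg rZ = z ∧ z ∈ s.alive ∧ z ∉ s.K) ∨
    (σ.reg 0 = 0 ∧ ¬ s.Accepts)

/-- Vertices of degree three are current. So if both sets have four elements, they are equal. -/
theorem isK4_iff_card {s : State (Fin n)} (hs : s.Supported) :
    s.IsK4 ↔ s.alive.ncard = 4 ∧ {v | (s.graph.neighborSet v).ncard = 3}.ncard = 4 := by
  rw [State.isK4_iff_degree hs]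
  refine and_congr_right fun h4 => ?_
  have sub : {v | (s.graph.neighborSet v).ncard = 3} ⊆ s.alive := by
    intro v (hv : _ = 3)
    obtain ⟨w, hw⟩ := Set.nonempty_of_ncard_ne_zero (by rw [hv]; simp)
    exact hs v w hw
  constructor
  · intro h
    rw [← h4]
    congr 1
    exact sub.antisymm h
  · intro h a ha
    rw [← Set.eq_of_subset_of_ncard_le sub (by rw [h, h4]) (Set.toFinite _)] at ha
    exact ha

theorem verdictLoop_total : ∃ k, ∀ {n : ℕ} {es : List (Fin n × Fin n)} {G : SimpleGraph (Fin n)}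
    (x : List (Move (Fin n)) × State (Fin n)),
    Total (fun σ => Reached es G x.1 x.2 σ ∧ x.2.C = ∅) verdictLoop
      (fun σ => (Reached es G x.1 x.2 σ ∧ x.2.C = ∅) ∧ Judged x.2 σ)
      (verdictInit.bound + (k * (n + 1) + verdict.bound)) := by
  refine ⟨(Test.lt (.reg rI) (.reg rVerts)).cost + verdictBody.bound + 1, fun {n es G} x => ?_⟩
  obtain ⟨ms, s⟩ := x
  let I : Store → Prop := fun σ => (Reached es G ms s σ ∧ s.C = ∅) ∧ σ.reg rI ≤ n ∧
      {v : Fin n | v < σ.reg rI ∧ (s.graph.neighborSet v).ncard = 3}.ncard = σ.reg rCubic ∧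
      ((σ.reg rFound = 1 ∧ ∃ z : Fin n, σ.reg rZ = z ∧ (s.graph.neighborSet z).ncard = 3 ∧ z ∉ s.K) ∨
        (σ.reg rFound = 0 ∧ ∀ v : Fin n, v < σ.reg rI → (s.graph.neighborSet v).ncard = 3 → v ∈ s.K))
  have key := Cmd.LoopFree.total_loop (c := verdictBody) (b := .lt (.reg rI) (.reg rVerts))
    (I := I) (μ := fun σ => n - σ.reg rI) (by simp [verdictBody, block, Cmd.LoopFree]) n
    (by
      rintro σ ⟨⟨h1, hC⟩, h2, h3, h4⟩ hb
      simp only [Test.lt_holds, Expr.eval_reg, h1.1.verts] at hb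
      have hf : Reached es G ms s (verdictBody.exec σ) := h1.frame (by decide) (by decide)
      have hI : (verdictBody.exec σ).reg rI = σ.reg rI + 1 := by
        simp only [verdictBody, exec_block_cons, Cmd.exec_assign, exec_block_nil, Store.setReg_reg,
          if_true, Expr.eval_succ, Expr.eval_reg]
        rw [Cmd.exec_reg _ _ (by decide)]
      have hcub := h1.2.2.1.cubic_iff ⟨σ.reg rI, hb⟩
      have hKK := h1.2.2.1.K ⟨σ.reg rI, hb⟩
      simp only at hcub hKK
      have split : ∀ v : Fin n, v < σ.reg rI + 1 ↔ v < σ.reg rI ∨ v = ⟨σ.reg rI, hb⟩ := by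
        intro v
        rw [Fin.ext_iff]
        simp only
        omega
      by_cases hc : σ.arr aEnd (σ.reg rI) = σ.arr aStart (σ.reg rI) + 3
      · have hc' := hcub.1 hc
        have hcard : {v : Fin n | v < σ.reg rI + 1 ∧ (s.graph.neighborSet v).ncard = 3}.ncard =
            σ.reg rCubic + 1 := by
          rw [← h3, ← Set.ncard_insert_of_notMem (a := (⟨σ.reg rI, hb⟩ : Fin n)) (by simp)
            (Set.toFinite _)]
          congr 1
          ext v
          simp only [Set.mem_ofPred_eq, Set.mem_insert_iff, split]
          constructor
          · rintro ⟨h | h, h'⟩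
            exacts [Or.inr ⟨h, h'⟩, Or.inl h]
          · rintro (rfl | ⟨h, h'⟩)
            exacts [⟨Or.inr rfl, hc'⟩, ⟨Or.inl h, h'⟩]
        by_cases hk : σ.arr aK (σ.reg rI) = 0
        · have e : verdictBody.exec σ = (((σ.setReg rCubic (σ.reg rCubic + 1)).setReg rFound 1).setReg
              rZ (σ.reg rI)).setReg rI (σ.reg rI + 1) := by
            simp [verdictBody, Cmd.exec, hc, hk]
          refine ⟨⟨⟨hf, hC⟩, by omega, by rw [hI, hcard, e]; simp, Or.inl ⟨by rw [e]; simp,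
            ⟨σ.reg rI, hb⟩, by rw [e]; simp, hc', fun h => hKK.2 h hk⟩⟩, by omega⟩
        · have e : verdictBody.exec σ = (σ.setReg rCubic (σ.reg rCubic + 1)).setReg
              rI (σ.reg rI + 1) := by
            simp [verdictBody, Cmd.exec, hc, hk]
          refine ⟨⟨⟨hf, hC⟩, by omega, by rw [hI, hcard, e]; simp, ?_⟩, by omega⟩
          rcases h4 with ⟨k1, k2⟩ | ⟨k1, k2⟩
          · exact Or.inl ⟨by rw [e]; simpa using k1, by rw [e]; simpa using k2⟩
          · refine Or.inr ⟨by rw [e]; simpa using k1, fun v hv hv' => ?_⟩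
            rw [hI, split] at hv
            rcases hv with hv | rfl
            exacts [k2 v hv hv', hKK.1 hk]
      · have hc' := mt hcub.2 hc
        have e : verdictBody.exec σ = σ.setReg rI (σ.reg rI + 1) := by
          simp [verdictBody, Cmd.exec, hc]
        have hcard : {v : Fin n | v < σ.reg rI + 1 ∧ (s.graph.neighborSet v).ncard = 3} =
            {v : Fin n | v < σ.reg rI ∧ (s.graph.neighborSet v).ncard = 3} := by
          ext v
          simp only [Set.mem_ofPred_eq, split]
          constructor
          · rintro ⟨h | rfl, h'⟩
            exacts [⟨h, h'⟩, absurd h' hc']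
          · exact fun h => ⟨Or.inl h.1, h.2⟩
        refine ⟨⟨⟨hf, hC⟩, by omega, by rw [hI, hcard, e]; simpa using h3, ?_⟩, by omega⟩
        rcases h4 with ⟨k1, k2⟩ | ⟨k1, k2⟩
        · exact Or.inl ⟨by rw [e]; simpa using k1, by rw [e]; simpa using k2⟩
        · refine Or.inr ⟨by rw [e]; simpa using k1, fun v hv hv' => ?_⟩
          rw [hI, split] at hv
          rcases hv with hv | rfl
          exacts [k2 v hv hv', absurd hv' hc'])
    (by intro σ _; omega)
  refine Total.seq (Q := I) (Cmd.LoopFree.total (by simp [verdictInit, block, Cmd.LoopFree]) ?_)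
    (Total.seq key (Cmd.LoopFree.total (by simp [verdict, Cmd.LoopFree]) ?_))
  · rintro σ ⟨h1, h2⟩
    refine ⟨⟨h1.frame (by decide) (by decide), h2⟩, by simp [verdictInit], by simp [verdictInit],
      Or.inr ⟨by simp [verdictInit], by simp [verdictInit]⟩⟩
  · rintro σ ⟨⟨⟨h1, h2⟩, h3, h4, h5⟩, h6⟩
    simp only [Test.lt_holds, Expr.eval_reg, h1.1.verts] at h6
    refine ⟨⟨h1.frame (by decide) (by decide), h2⟩, ?_⟩
    have hs := h1.2.1.supported (State.supported_init G)
    have hcard : {v : Fin n | v < σ.reg rI ∧ (s.graph.neighborSet v).ncard = 3} =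
        {v | (s.graph.neighborSet v).ncard = 3} := by
      ext v
      have := v.2
      simp only [Set.mem_ofPred_eq]
      exact ⟨fun h => h.2, fun h => ⟨by omega, h⟩⟩
    rw [hcard] at h4
    have hA := h1.2.2.1.alive
    have hk4 := isK4_iff_card hs
    rw [hA, h4] at hk4
    have deg : s.IsK4 → ∀ a ∈ s.alive, (s.graph.neighborSet a).ncard = 3 := fun h =>
      ((State.isK4_iff_degree hs).1 h).2
    by_cases ht : σ.reg rAlive = 4 ∧ σ.reg rCubic = 4 ∧ σ.reg rFound = 1
    · have e : verdict.exec σ = σ.setReg 0 1 := if_pos (by simpa using ht)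
      rw [e]
      rcases h5 with ⟨k1, z, k2, k3, k4⟩ | ⟨k1, -⟩
      · refine Or.inl ⟨by simp, hk4.2 ⟨ht.1, ht.2.1⟩, z, by simpa using k2, ?_, k4⟩
        obtain ⟨w, hw⟩ := Set.nonempty_of_ncard_ne_zero (by rw [k3]; simp)
        exact hs z w hw
      · omega
    · have e : verdict.exec σ = σ.setReg 0 0 := if_neg (by simpa using ht)
      rw [e]
      refine Or.inr ⟨by simp, ?_⟩
      rintro ⟨k1, v, hv, hvK⟩
      rcases h5 with ⟨k2, -⟩ | ⟨k2, k3⟩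
      · exact ht ⟨(hk4.1 k1).1, (hk4.1 k1).2, k2⟩
      · exact hvK (k3 v (by have := v.2; omega) (deg k1 v hv))

def recognize : Cmd :=
  .seq setup (.seq countLoop (.seq startLoop (.seq fillLoop (.seq stackLoop (.seq mainLoop
    verdictLoop)))))

theorem recognize_total : ∃ k, ∀ {n : ℕ} {es : List (Fin n × Fin n)} {G : SimpleGraph (Fin n)},
    IsEdgeList G es → Total (fun σ => σ = input es) recognize
      (fun σ => ∃ x : List (Move (Fin n)) × State (Fin n),
        (Reached es G x.1 x.2 σ ∧ x.2.C = ∅) ∧ Judged x.2 σ) (k * (n + es.length + 1)) := by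
  obtain ⟨k1, h1⟩ := countLoop_total
  obtain ⟨k2, h2⟩ := startLoop_total
  obtain ⟨k3, h3⟩ := fillLoop_total
  obtain ⟨k4, h4⟩ := stackLoop_total
  obtain ⟨k5, h5⟩ := mainLoop_total
  obtain ⟨k6, h6⟩ := verdictLoop_total
  refine ⟨setup.bound + (k1 + ((startInit.bound + k2 * 2) + ((2 + k3) + ((stackInit.bound + k4) +
    (k5 * 3 + (verdictInit.bound + (k6 + verdict.bound))))))), fun {n es G} hG => ?_⟩
  refine (setup_total.seq (h1.seq (h2.seq ((h3 hG).seq (h4.seq (h5.seq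
    (Total.exists h6))))))).weaken ?_
  have e : ∀ k a : ℕ, a ≤ n + es.length + 1 → k * a ≤ k * (n + es.length + 1) :=
    fun k a h => Nat.mul_le_mul_left k h
  -- The costs that do not depend on the input are absorbed because the linear factor is at least
  -- one.
  have u : ∀ k : ℕ, k ≤ k * (n + es.length + 1) := fun k => Nat.le_mul_of_pos_right k (by omega)
  have e1 := e k1 (es.length + 1) (by omega)
  have e2 : k2 * (n + 2 * es.length + 1) ≤ (k2 * 2) * (n + es.length + 1) := by
    rw [mul_assoc]
    exact Nat.mul_le_mul_left k2 (by omega)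
  have e3 := e k3 (es.length + 1) (by omega)
  have e4 := e k4 (n + 1) (by omega)
  have e5 : k5 * (3 * n + 1) ≤ (k5 * 3) * (n + es.length + 1) := by
    rw [mul_assoc]
    exact Nat.mul_le_mul_left k5 (by omega)
  have e6 := e k6 (n + 1) (by omega)
  have u1 := u setup.bound
  have u2 := u startInit.bound
  have u3 := u 2
  have u4 := u stackInit.bound
  have u5 := u verdictInit.bound
  have u6 := u verdict.bound
  simp only [add_mul]
  omega

end RAM

namespace RAM

open Halin

/-! ### The decomposition program -/

/-- In the final `K₄` the vertices of degree three are exactly the current ones, so this marks all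
of them except the centre. -/
def outerBody : Cmd := block [
  .ite (.all [cubic (.reg rI), .not (.eq (.reg rI) (.reg rZ))]) (.write aOuter (.reg rI) (.const 1))
    (.write aOuter (.reg rI) (.const 0)),
  .assign rI (.succ (.reg rI))]

def outerLoop : Cmd :=
  .seq (.assign rI (.const 0)) (.loop (.lt (.reg rI) (.reg rVerts)) outerBody)

/-- Put the vertex in register `r` into the set of outer vertices if the vertex in register `r'` is
in it. -/
def copyOuter (r r' : ℕ) : Cmd :=
  .ite (.eq (.read aOuter (.reg r')) (.const 0)) .skip (.write aOuter (.reg r) (.const 1))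

/-- The mark of `p` is overwritten by that of `p'`, which both removes `p` and puts it back if its
outside neighbour is outer. The other two vertices can only be added. -/
def undoCollapse : Cmd := block [
  .assign rY (.read aSelected (.reg rI)), .assign rA (.read aLogA (.reg rI)),
  .assign rB (.read aLogB (.reg rI)), .assign rYout (.read aLogYout (.reg rI)),
  .assign rAout (.read aLogAout (.reg rI)), .assign rBout (.read aLogBout (.reg rI)),
  .write aOuter (.reg rY) (.read aOuter (.reg rYout)), copyOuter rA rAout, copyOuter rB rBout]

def undoBody : Cmd := block [
  .assign rI (.pred (.reg rI)),
  .ite (.eq (.read aKind (.reg rI)) (.const 1)) undoCollapse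
    (.ite (.eq (.read aKind (.reg rI)) (.const 2))
      (.write aOuter (.read aSelected (.reg rI)) (.const 1)) .skip)]

def undoLoop : Cmd :=
  .seq (.assign rI (.reg rLen)) (.loop (.lt (.const 0) (.reg rI)) undoBody)

def markBody : Cmd := block [
  .ite (.all [.not (.eq (.read aOuter (.read 0 (.reg rI))) (.const 0)),
    .not (.eq (.read aOuter (.read 1 (.reg rI))) (.const 0))]) (.write aMark (.reg rI) (.const 1))
    (.write aMark (.reg rI) (.const 0)),
  .assign rI (.succ (.reg rI))]

def markLoop : Cmd :=
  .seq (.assign rI (.const 0)) (.loop (.lt (.reg rI) (.reg rEdges)) markBody)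

/-- The set of outer vertices in the store. -/
def Outer {n : ℕ} (L : Set (Fin n)) (σ : Store) : Prop := ∀ v : Fin n, σ.arr aOuter v ≠ 0 ↔ v ∈ L

theorem outerLoop_total : ∃ k, ∀ {n : ℕ} {es : List (Fin n × Fin n)} {G : SimpleGraph (Fin n)}
    {ms : List (Move (Fin n))} {s : State (Fin n)} {z : Fin n}, s.IsK4 →
    Total (fun σ => Reached es G ms s σ ∧ σ.reg rZ = z) outerLoop
      (fun σ => Reached es G ms s σ ∧ Outer (s.alive \ {z}) σ) (2 + k * (n + 1)) := by
  refine ⟨(Test.lt (.reg rI) (.reg rVerts)).cost + outerBody.bound + 1,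
    fun {n es G ms s z} hk => ?_⟩
  have key := Cmd.LoopFree.total_loop (c := outerBody) (b := .lt (.reg rI) (.reg rVerts))
    (I := fun σ => Reached es G ms s σ ∧ σ.reg rZ = z ∧ σ.reg rI ≤ n ∧
      ∀ v : Fin n, v < σ.reg rI → (σ.arr aOuter v ≠ 0 ↔ v ∈ s.alive \ {z}))
    (μ := fun σ => n - σ.reg rI) (by simp [outerBody, block, Cmd.LoopFree]) n
    (by
      rintro σ ⟨h1, h2, h3, h4⟩ hb
      simp only [Test.lt_holds, Expr.eval_reg, h1.1.verts] at hb
      have hI : (outerBody.exec σ).reg rI = σ.reg rI + 1 := by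
        simp only [outerBody, exec_block_cons, Cmd.exec_assign, exec_block_nil, Store.setReg_reg,
          if_true, Expr.eval_succ, Expr.eval_reg]
        rw [Cmd.exec_reg _ _ (by decide)]
      have hs := h1.2.1.supported (State.supported_init G)
      have hdeg : ∀ v : Fin n, σ.arr aEnd v = σ.arr aStart v + 3 ↔ v ∈ s.alive := by
        intro v
        rw [h1.2.2.1.cubic_iff]
        constructor
        · intro hv
          obtain ⟨w, hw⟩ := Set.nonempty_of_ncard_ne_zero (by rw [hv]; simp)
          exact hs v w hw
        · exact ((State.isK4_iff_degree hs).1 hk).2 v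
      have hcub := hdeg ⟨σ.reg rI, hb⟩
      simp only at hcub
      refine ⟨⟨h1.frame (by decide) (by decide), ?_, by omega, ?_⟩, by omega⟩
      · rw [Cmd.exec_reg _ _ (by decide), h2]
      · intro v hv
        rw [hI] at hv
        by_cases e : (v : ℕ) = σ.reg rI
        · obtain rfl : v = ⟨σ.reg rI, hb⟩ := Fin.ext e
          by_cases ht : σ.arr aEnd (σ.reg rI) = σ.arr aStart (σ.reg rI) + 3 ∧ σ.reg rI ≠ z
          · have e1 : outerBody.exec σ = (σ.setArr aOuter (σ.reg rI) 1).setReg rI (σ.reg rI + 1) := by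
              simp [outerBody, Cmd.exec, ht, h2]
            rw [e1]
            simp [hcub.1 ht.1, Fin.ext_iff, ht.2]
          · have e1 : outerBody.exec σ = (σ.setArr aOuter (σ.reg rI) 0).setReg rI (σ.reg rI + 1) := by
              simp only [outerBody, exec_block_cons, exec_block_nil, Cmd.exec, Test.all_cons_holds,
                cubic_holds, Expr.eval_reg, Test.not_holds, Test.eq_holds, h2, Test.all_nil_holds,
                and_true, if_neg ht]
              simp
            rw [e1]
            simp only [Store.setReg_arr, Store.setArr_arr, if_true, Function.update_self, ne_eq,
              not_true, false_iff]
            rintro ⟨k1, k2⟩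
            exact ht ⟨hcub.2 k1, fun e => k2 (Fin.ext e)⟩
        · rw [← h4 v (by omega)]
          suffices (outerBody.exec σ).arr aOuter v = σ.arr aOuter v by rw [this]
          simp only [outerBody, exec_block_cons, exec_block_nil, Cmd.exec]
          split_ifs <;> simp [e])
    (by intro σ _; omega)
  refine Total.seq (Q := fun σ => Reached es G ms s σ ∧ σ.reg rZ = z ∧ σ.reg rI = 0)
    (Cmd.LoopFree.total (c := .assign rI (.const 0)) (by simp [Cmd.LoopFree]) ?_) ?_
  · rintro σ ⟨h1, h2⟩
    exact ⟨h1.frame (by decide) (by decide), by simpa using h2, by simp⟩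
  · rintro σ ⟨h1, h2, h3⟩
    obtain ⟨τ, t, k1, k2, ⟨k3, k4, k5, k6⟩, k7⟩ := key σ ⟨h1, h2, by omega, by
      intro v hv
      omega⟩
    simp only [Test.lt_holds, Expr.eval_reg, k3.1.verts] at k7
    exact ⟨τ, t, k1, k2, k3, fun v => k6 v (by have := v.2; omega)⟩

variable {n : ℕ} {σ : Store}

theorem copyOuter_spec {r r' : ℕ} {L : Set (Fin n)} {v w : Fin n} (h : Outer L σ)
    (hr : σ.reg r = v) (hr' : σ.reg r' = w) :
    Outer (L ∪ {a | a = v ∧ w ∈ L}) ((copyOuter r r').exec σ) := by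
  intro u
  by_cases hw : σ.arr aOuter w = 0
  · have hw' : w ∉ L := fun e => (h w).2 e hw
    have e : (copyOuter r r').exec σ = σ := if_pos (by simpa [hr'] using hw)
    rw [e, h]
    simp [hw']
  · have hw' : w ∈ L := (h w).1 hw
    have e : (copyOuter r r').exec σ = σ.setArr aOuter v 1 := by
      rw [copyOuter, Cmd.exec, if_neg (by simpa [hr'] using hw)]
      simp [hr]
    rw [e]
    simp only [Store.setArr_arr, if_true, Set.mem_union, Set.mem_ofPred_eq, hw', and_true]
    by_cases e : u = v
    · simp [e]
    · rw [Function.update_of_ne (fun e' => e (Fin.ext e')), h]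
      simp [e]

/-- The writes are made one after another, while `Move.undo` refers to the old set throughout. The
three inequalities ensure that the marks of `q'` and `r'` are read before they could change. -/
theorem undoCollapse_spec {L : Set (Fin n)} {p q r p' q' r' : Fin n} (h : Outer L σ)
    (hm : Recorded σ (σ.reg rI) (.collapse p q r p' q' r')) (d1 : q' ≠ p) (d2 : r' ≠ p)
    (d3 : r' ≠ q) :
    Outer (Move.undo (.collapse p q r p' q' r') L) (undoCollapse.exec σ) := by
  obtain ⟨m1, m2, m3, m4, m5, m6, m7⟩ := hm
  let c : Cmd := block [
    .assign rY (.read aSelected (.reg rI)), .assign rA (.read aLogA (.reg rI)),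
    .assign rB (.read aLogB (.reg rI)), .assign rYout (.read aLogYout (.reg rI)),
    .assign rAout (.read aLogAout (.reg rI)), .assign rBout (.read aLogBout (.reg rI)),
    .write aOuter (.reg rY) (.read aOuter (.reg rYout))]
  have e : undoCollapse.exec σ = (copyOuter rB rBout).exec ((copyOuter rA rAout).exec (c.exec σ)) :=
    rfl
  have r1 : (c.exec σ).reg rA = q := by simp [c, m3]
  have r2 : (c.exec σ).reg rAout = q' := by simp [c, m6]
  have r3 : (c.exec σ).reg rB = r := by simp [c, m4]
  have r4 : (c.exec σ).reg rBout = r' := by simp [c, m7]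
  have k1 : Outer ((L \ {p}) ∪ {a | a = p ∧ p' ∈ L}) (c.exec σ) := by
    intro u
    have : (c.exec σ).arr aOuter = Function.update (σ.arr aOuter) p (σ.arr aOuter p') := by
      simp [c, m1, m5]
    rw [this]
    by_cases e : u = p
    · simp [e, h p']
    · rw [Function.update_of_ne (fun e' => e (Fin.ext e')), h]
      simp [e]
  clear_value c
  have k2 := copyOuter_spec k1 r1 r2
  have k3 := copyOuter_spec (r := rB) (r' := rBout) (v := r) (w := r') k2
    (by rw [Cmd.exec_reg _ _ (by decide), r3]) (by rw [Cmd.exec_reg _ _ (by decide), r4])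
  rw [e]
  convert k3 using 1
  ext a
  simp only [Move.undo, Set.mem_union, Set.mem_sdiff, Set.mem_singleton_iff, Set.mem_ofPred_eq, d1,
    d2, d3, not_false_iff, and_true, false_and, or_false]
  tauto

theorem undoBody_spec {L : Set (Fin n)} {m : Move (Fin n)} (h : Outer L σ)
    (hm : Recorded σ (σ.reg rI - 1) m)
    (hd : ∀ p q r p' q' r', m = .collapse p q r p' q' r' → q' ≠ p ∧ r' ≠ p ∧ r' ≠ q) :
    Outer (m.undo L) (undoBody.exec σ) := by
  set τ := σ.setReg rI (σ.reg rI - 1) with hτ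
  have h' : Outer L τ := h
  have hI : τ.reg rI = σ.reg rI - 1 := by simp [hτ]
  have hm' : Recorded τ (τ.reg rI) m := by rw [hI]; exact hm.congr fun _ _ => rfl
  have e : undoBody.exec σ = (Cmd.ite (.eq (.read aKind (.reg rI)) (.const 1)) undoCollapse
    (.ite (.eq (.read aKind (.reg rI)) (.const 2))
      (.write aOuter (.read aSelected (.reg rI)) (.const 1)) .skip)).exec τ := rfl
  rw [e]
  clear_value τ
  cases m with
  | collapse p q r p' q' r' =>
    obtain ⟨d1, d2, d3⟩ := hd _ _ _ _ _ _ rfl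
    rw [Cmd.exec, if_pos (by simpa using hm'.2.1)]
    exact undoCollapse_spec h' hm' d1 d2 d3
  | shorten p q r x =>
    obtain ⟨m1, m2⟩ := hm'
    rw [Cmd.exec, if_neg (by simp [m2]), Cmd.exec, if_pos (by simp [m2])]
    intro u
    simp only [Cmd.exec_write, Expr.eval_read, Expr.eval_reg, m1, Expr.eval_const, Store.setArr_arr,
      if_true, Move.undo, Set.mem_insert_iff]
    by_cases e : u = q
    · simp [e]
    · rw [Function.update_of_ne (fun e' => e (Fin.ext e')), h']
      simp [e]
  | discard v =>
    obtain ⟨m1, m2⟩ := hm'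
    rw [Cmd.exec, if_neg (by simp [m2]), Cmd.exec, if_neg (by simp [m2])]
    exact h'

theorem distinct_of_mem_run {V : Type*} {s s' : State V} {ms : List (Move V)}
    (h : Run s ms s') {p q r p' q' r' : V} (hm : .collapse p q r p' q' r' ∈ ms) :
    q' ≠ p ∧ r' ≠ p ∧ r' ≠ q := by
  induction h with
  | nil => simp at hm
  | cons h1 _ ih =>
    rcases List.mem_cons.1 hm with rfl | hm
    · have hd : IsD3a _ p q r p' q' r' := h1.2.1
      exact ⟨hd.rotate.distinct.2.2.2.2.2, hd.rotate.rotate.distinct.2.2.2.2.1,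
        hd.rotate.rotate.distinct.2.2.2.2.2⟩
    · exact ih hm

/-- The invariant is the fold over the moves from position `rI` on. The loop starts at the end of
the record, where nothing is undone yet, and stops at zero, where the fold is over the whole run. -/
theorem undoLoop_total : ∃ k, ∀ {n : ℕ} {es : List (Fin n × Fin n)} {G : SimpleGraph (Fin n)}
    {ms : List (Move (Fin n))} {s : State (Fin n)} {z : Fin n},
    Total (fun σ => Reached es G ms s σ ∧ Outer (s.alive \ {z}) σ) undoLoop
      (fun σ => Reached es G ms s σ ∧ Outer (outerVertices ms s z) σ) (2 + k * (3 * n + 1)) := by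
  refine ⟨(Test.lt (.const 0) (.reg rI)).cost + undoBody.bound + 1,
    fun {n es G ms s z} => ?_⟩
  have key := Cmd.LoopFree.total_loop (c := undoBody) (b := .lt (.const 0) (.reg rI))
    (I := fun σ => Reached es G ms s σ ∧ σ.reg rI ≤ ms.length ∧
      Outer ((ms.drop (σ.reg rI)).foldr Move.undo (s.alive \ {z})) σ)
    (μ := fun σ => σ.reg rI)
    (by simp [undoBody, undoCollapse, copyOuter, block, Cmd.LoopFree]) (3 * n)
    (by
      rintro σ ⟨h1, h2, h3⟩ hb
      simp only [Test.lt_holds, Expr.eval_reg, Expr.eval_const] at hb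
      have hI : (undoBody.exec σ).reg rI = σ.reg rI - 1 := by
        simp only [undoBody, exec_block_cons, exec_block_nil]
        rw [Cmd.exec_reg _ _ (by decide)]
        simp
      have hlt : σ.reg rI - 1 < ms.length := by omega
      refine ⟨⟨h1.frame (by decide) (by decide), by omega, ?_⟩, by omega⟩
      rw [hI, List.drop_eq_getElem_cons hlt, show σ.reg rI - 1 + 1 = σ.reg rI by omega,
        List.foldr_cons]
      refine undoBody_spec h3 (h1.2.2.2.2 _ hlt) ?_
      intro p q r p' q' r' e
      exact distinct_of_mem_run h1.2.1 (e ▸ List.getElem_mem hlt))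
    (by
      rintro σ ⟨h1, h2, -⟩
      have := h1.2.1.length_le_card
      rw [Nat.card_fin] at this
      omega)
  refine Total.seq (Q := fun σ => (Reached es G ms s σ ∧ Outer (s.alive \ {z}) σ) ∧
      σ.reg rI = σ.reg rLen)
    (Cmd.LoopFree.total (c := .assign rI (.reg rLen)) (by simp [Cmd.LoopFree]) ?_) ?_
  · rintro σ ⟨h1, h2⟩
    exact ⟨⟨h1.frame (by decide) (by decide), h2⟩, by simp⟩
  · rintro σ ⟨⟨h1, h2⟩, h3⟩
    have hl := h1.2.2.2.1
    obtain ⟨τ, t, k1, k2, ⟨k3, k4, k5⟩, k6⟩ := key σ ⟨h1, by omega, by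
      rw [h3, hl, List.drop_length]
      exact h2⟩
    simp only [Test.lt_holds, Expr.eval_reg, Expr.eval_const, not_lt, Nat.le_zero] at k6
    refine ⟨τ, t, k1, k2, k3, ?_⟩
    rw [k6] at k5
    exact k5

theorem markLoop_total : ∃ k, ∀ {n : ℕ} {es : List (Fin n × Fin n)} {G : SimpleGraph (Fin n)}
    {ms : List (Move (Fin n))} {s : State (Fin n)} {L : Set (Fin n)},
    Total (fun σ => Reached es G ms s σ ∧ Outer L σ) markLoop
      (fun σ => Reached es G ms s σ ∧ ∀ (i : ℕ) (hi : i < es.length),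
        (es[i].1 ∈ L ∧ es[i].2 ∈ L → σ.arr aMark i = 1) ∧
        (¬ (es[i].1 ∈ L ∧ es[i].2 ∈ L) → σ.arr aMark i = 0)) (2 + k * (es.length + 1)) := by
  refine ⟨(Test.lt (.reg rI) (.reg rEdges)).cost + markBody.bound + 1,
    fun {n es G ms s L} => ?_⟩
  have key := Cmd.LoopFree.total_loop (c := markBody) (b := .lt (.reg rI) (.reg rEdges))
    (I := fun σ => (Reached es G ms s σ ∧ Outer L σ) ∧ σ.reg rI ≤ es.length ∧
      ∀ (i : ℕ) (hi : i < es.length), i < σ.reg rI →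
        (es[i].1 ∈ L ∧ es[i].2 ∈ L → σ.arr aMark i = 1) ∧
        (¬ (es[i].1 ∈ L ∧ es[i].2 ∈ L) → σ.arr aMark i = 0))
    (μ := fun σ => es.length - σ.reg rI) (by simp [markBody, block, Cmd.LoopFree]) es.length
    (by
      rintro σ ⟨⟨h1, h2⟩, h3, h4⟩ hb
      simp only [Test.lt_holds, Expr.eval_reg, h1.1.edges] at hb
      have hI : (markBody.exec σ).reg rI = σ.reg rI + 1 := by
        simp only [markBody, exec_block_cons, Cmd.exec_assign, exec_block_nil, Store.setReg_reg,
          if_true, Expr.eval_succ, Expr.eval_reg]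
        rw [Cmd.exec_reg _ _ (by decide)]
      refine ⟨⟨⟨h1.frame (by decide) (by decide), ?_⟩, by omega, ?_⟩, by omega⟩
      · intro v
        rw [Cmd.exec_arr _ _ (by decide)]
        exact h2 v
      · intro i hi hiI
        rw [hI] at hiI
        have ht : (Test.all [.not (.eq (.read aOuter (.read 0 (.reg rI))) (.const 0)),
            .not (.eq (.read aOuter (.read 1 (.reg rI))) (.const 0))]).Holds σ ↔
            es[σ.reg rI].1 ∈ L ∧ es[σ.reg rI].2 ∈ L := by
          simp only [Test.all_cons_holds, Test.not_holds, Test.eq_holds, Expr.eval_read,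
            Expr.eval_reg, Expr.eval_const, Test.all_nil_holds, and_true, h1.1.fst _ hb,
            h1.1.snd _ hb]
          rw [← ne_eq, ← ne_eq, h2, h2]
        by_cases e : i = σ.reg rI
        · subst e
          constructor
          · intro hL
            simp only [markBody, exec_block_cons, exec_block_nil, Cmd.exec]
            rw [if_pos (ht.2 hL)]
            simp
          · intro hL
            simp only [markBody, exec_block_cons, exec_block_nil, Cmd.exec]
            rw [if_neg (mt ht.1 hL)]
            simp
        · suffices (markBody.exec σ).arr aMark i = σ.arr aMark i by
            rw [this]
            exact h4 i hi (by omega)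
          simp only [markBody, exec_block_cons, exec_block_nil, Cmd.exec]
          split_ifs <;> simp [e])
    (by intro σ _; omega)
  refine Total.seq (Q := fun σ => (Reached es G ms s σ ∧ Outer L σ) ∧ σ.reg rI = 0)
    (Cmd.LoopFree.total (c := .assign rI (.const 0)) (by simp [Cmd.LoopFree]) ?_) ?_
  · rintro σ ⟨h1, h2⟩
    exact ⟨⟨h1.frame (by decide) (by decide), h2⟩, by simp⟩
  · rintro σ ⟨h1, h3⟩
    obtain ⟨τ, t, k1, k2, ⟨⟨k3, k4⟩, k5, k6⟩, k7⟩ := key σ ⟨h1, by omega, by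
      intro i hi hi'
      omega⟩
    simp only [Test.lt_holds, Expr.eval_reg, k3.1.edges] at k7
    exact ⟨τ, t, k1, k2, k3, fun i hi => k6 i hi (by omega)⟩

/-- The verdict need not be tested: on a Halin graph it is acceptance, and the register `rZ` then
holds a vertex outside `K`. -/
def decompose : Cmd := .seq recognize (.seq outerLoop (.seq undoLoop markLoop))

theorem RunRecorded.map_selected {ms : List (Move (Fin n))} (h : RunRecorded σ ms) :
    (List.range (σ.reg rLen)).map (σ.arr aSelected) = ms.map fun m => (m.vertex : ℕ) := by
  apply List.ext_getElem
  · simp [h.1]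
  · intro i h1 h2
    simp only [List.length_map] at h2
    have := h.2 i h2
    simp only [List.getElem_map, List.getElem_range]
    cases e : ms[i] with
    | collapse p q r p' q' r' => rw [e] at this; exact this.1
    | shorten p q r x => rw [e] at this; exact this.1
    | discard v => rw [e] at this; exact this.1

theorem decompose_total : ∃ k, ∀ {n : ℕ} {es : List (Fin n × Fin n)} {G : SimpleGraph (Fin n)},
    IsEdgeList G es → IsHalin G → Total (fun σ => σ = input es) decompose
      (fun σ => ∃ (ms : List (Move (Fin n))) (s : State (Fin n)) (z : Fin n),
        CompleteRun G ms s ∧ s.IsK4 ∧ z ∈ s.alive ∧ z ∉ s.K ∧ Reached es G ms s σ ∧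
        ∀ (i : ℕ) (hi : i < es.length),
          (es[i].1 ∈ outerVertices ms s z ∧ es[i].2 ∈ outerVertices ms s z → σ.arr aMark i = 1) ∧
          (¬ (es[i].1 ∈ outerVertices ms s z ∧ es[i].2 ∈ outerVertices ms s z) →
            σ.arr aMark i = 0))
      (k * (n + es.length + 1)) := by
  obtain ⟨k1, h1⟩ := recognize_total
  obtain ⟨k2, h2⟩ := outerLoop_total
  obtain ⟨k3, h3⟩ := undoLoop_total
  obtain ⟨k4, h4⟩ := markLoop_total
  refine ⟨k1 + ((2 + k2) + ((2 + k3 * 3) + (2 + k4))), fun {n es G} hG hH => ?_⟩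
  have hr := h1 hG
  have hbound : k1 * (n + es.length + 1) + ((2 + k2 * (n + 1)) + ((2 + k3 * (3 * n + 1)) +
      (2 + k4 * (es.length + 1)))) ≤
      (k1 + ((2 + k2) + ((2 + k3 * 3) + (2 + k4)))) * (n + es.length + 1) := by
    have e2 : k2 * (n + 1) ≤ k2 * (n + es.length + 1) := Nat.mul_le_mul_left _ (by omega)
    have e3 : k3 * (3 * n + 1) ≤ (k3 * 3) * (n + es.length + 1) := by
      rw [mul_assoc]
      exact Nat.mul_le_mul_left _ (by omega)
    have e4 : k4 * (es.length + 1) ≤ k4 * (n + es.length + 1) := Nat.mul_le_mul_left _ (by omega)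
    simp only [add_mul]
    omega
  refine (Total.seq hr ?_).weaken hbound
  rintro σ ⟨⟨ms, s⟩, ⟨hR, hC⟩, hJ⟩
  have hrun : CompleteRun G ms s := ⟨hR.2.1, hC⟩
  rcases hJ with ⟨-, hk, z, hz, hzA, hzK⟩ | ⟨-, hJ⟩
  · obtain ⟨τ, t, k1, k2, k3, k4⟩ := ((h2 hk).seq (h3.seq h4)) σ ⟨hR, hz⟩
    exact ⟨τ, t, k1, k2, ms, s, z, hrun, hk, hzA, hzK, k3, k4⟩
  · exact absurd (hrun.accepts_iff.2 hH) hJ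

end RAM

open Halin RAM in
theorem mainTheorem1 :
    -- every run ends after linearly many iterations, accepts exactly the Halin graphs, and can be
    -- reversed to give a decomposition
    (∃ c : ℕ, ∀ (V : Type*) [Finite V] (G : SimpleGraph V),
      (∀ ms s, Run (State.init G) ms s →
        ms.length ≤ c * Nat.card V ∧ ∀ v ∈ s.C, ∃ m : Move V, m.vertex = v ∧ m.Allowed s) ∧
      (∀ ms s, CompleteRun G ms s →
        (s.Accepts ↔ IsHalin G) ∧
        (s.IsK4 → ∀ z ∈ s.alive, z ∉ s.K →
          IsDecomposition G (treePart G (outerVertices ms s z))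
            (cyclePart G (outerVertices ms s z))))) ∧
    -- recognition in linear time: the verdict is in register `0`, the sequence of the selected
    -- vertices in array `2`, its length in register `1`
    (∃ (P : Cmd) (c : ℕ), ∀ (n : ℕ) (G : SimpleGraph (Fin n)) (es : List (Fin n × Fin n)),
      IsEdgeList G es → ∃ (σ : Store) (t : ℕ),
        Exec P (input es) σ t ∧ t ≤ c * (n + es.length + 1) ∧
        (IsHalin G → σ.reg 0 = 1) ∧ (¬ IsHalin G → σ.reg 0 = 0) ∧
        ∃ ms s, CompleteRun G ms s ∧ (σ.reg 0 = 1 ↔ s.Accepts) ∧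
          (List.range (σ.reg 1)).map (σ.arr 2) = ms.map fun m => (m.vertex : ℕ)) ∧
    -- decomposition in linear time, by reversing a run: array `3` marks each edge of the list,
    -- by `1` for the cycle and `0` for the tree
    (∃ (Q : Cmd) (c : ℕ), ∀ (n : ℕ) (G : SimpleGraph (Fin n)) (es : List (Fin n × Fin n)),
      IsEdgeList G es → IsHalin G → ∃ (σ : Store) (t : ℕ),
        Exec Q (input es) σ t ∧ t ≤ c * (n + es.length + 1) ∧
        ∃ (ms : List (Move (Fin n))) (s : State (Fin n)) (z : Fin n) (T C : SimpleGraph (Fin n)),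
          CompleteRun G ms s ∧ s.IsK4 ∧ z ∈ s.alive ∧ z ∉ s.K ∧
          (List.range (σ.reg 1)).map (σ.arr 2) = (ms.map fun m => (m.vertex : ℕ)) ∧
          T = treePart G (outerVertices ms s z) ∧ C = cyclePart G (outerVertices ms s z) ∧
          IsDecomposition G T C ∧
          ∀ (i : ℕ) (hi : i < es.length),
            (C.Adj es[i].1 es[i].2 → σ.arr 3 i = 1) ∧ (T.Adj es[i].1 es[i].2 → σ.arr 3 i = 0)) := by
  refine ⟨⟨3, fun V _ G => ⟨fun ms s h => ⟨h.length_le_card, fun v hv => exists_move s hv⟩,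
    fun ms s h => ⟨h.accepts_iff, fun hk z hz hzK => h.1.isDecomposition hk hz hzK⟩⟩⟩, ?_, ?_⟩
  · obtain ⟨k, hk⟩ := recognize_total
    refine ⟨recognize, k, fun n G es hG => ?_⟩
    obtain ⟨σ, t, h1, h2, ⟨ms, s⟩, ⟨h3, h4⟩, h5⟩ := hk hG (input es) rfl
    have hrun : CompleteRun G ms s := ⟨h3.2.1, h4⟩
    have hiff : σ.reg 0 = 1 ↔ s.Accepts := by
      rcases h5 with ⟨k1, k2, z, -, k3, k4⟩ | ⟨k1, k2⟩
      · exact ⟨fun _ => ⟨k2, z, k3, k4⟩, fun _ => k1⟩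
      · exact ⟨fun e => by omega, fun e => absurd e k2⟩
    refine ⟨σ, t, h1, h2, fun h => hiff.2 (hrun.accepts_iff.2 h), fun h => ?_, ms, s, hrun, hiff,
      h3.2.2.2.map_selected⟩
    rcases h5 with ⟨-, k2, z, -, k3, k4⟩ | ⟨k1, -⟩
    · exact absurd (hrun.accepts_iff.1 ⟨k2, z, k3, k4⟩) h
    · exact k1
  · obtain ⟨k, hk⟩ := decompose_total
    refine ⟨decompose, k, fun n G es hG hH => ?_⟩
    obtain ⟨σ, t, h1, h2, ms, s, z, h3, h4, h5, h6, h7, h8⟩ := hk hG hH (input es) rfl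
    refine ⟨σ, t, h1, h2, ms, s, z, _, _, h3, h4, h5, h6, h7.2.2.2.map_selected, rfl, rfl,
      h3.1.isDecomposition h4 h5 h6, fun i hi => ⟨fun h => (h8 i hi).1 h.2, fun h => ?_⟩⟩
    -- The tree part excludes the cycle part, so the ends of a tree edge are not both outer.
    exact (h8 i hi).2 fun e => h.2 ⟨h.1, e⟩
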